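/- **Setting.** Let $L,\tau,\rho^\star>0$, let $V\in C^2((0,\infty))$, $v^\star=V(\rho^\star)>0$, $q^\star=\rho^\star v^\star$, and put $$\lambda_1=v^\star,\qquad \lambda_2=-\rho^\star V'(\rho^\star)-v^\star,\qquad c(x)=-\tfrac1\tau e^{-x/(\tau v^\star)},\qquad r=\frac{\lambda_2}{\lambda_1},$$ and assume $\lambda_2>0$ (congested regime). The nonlinear Aw–Rascle–Zhang (ARZ) system on $[0,L]$ is $$\partial_t\rho+\partial_x(\rho v)=0,\quad \partial_t(v-V(\rho))+v\,\partial_x(v-V(\rho))=\frac{V(\rho)-v}{\tau},\quad \rho(0,t)=\frac{q^\star}{v(0,t)},\quad v(L,t)=v^\star+U(t),$$ and its linearization at $(\rho^\star,v^\star)$, in the coordinates $\tilde w=e^{x/(\tau v^\star)}\big((v-v^\star)-V'(\rho^\star)(\rho-\rho^\star)\big)$, $\tilde v=v-v^\star$, is $$\partial_t\tilde w+\lambda_1\partial_x\tilde w=0,\quad \partial_t\tilde v-\lambda_2\partial_x\tilde v=c(x)\tilde w,\quad \tilde w(0,t)=-r\tilde v(0,t),\quad \tilde v(L,t)=U(t).$$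 On the triangle $\mathcal T=\{0\le\xi\le x\le L\}$ the kernel equations are $$\lambda_2K^w_x-\lambda_1K^w_\xi=c(\xi)K^v,\quad \lambda_2K^v_x+\lambda_2K^v_\xi=0,\quad K^w(x,x)=-\frac{c(x)}{\lambda_1+\lambda_2},\quad K^v(x,0)=-K^w(x,0).$$ A pair $(\hat K^w,\hat K^v)$ of $C^1$ functions on $\mathcal T$ (for instance, the output of a neural operator) is called $\varepsilon$-accurate if, for $i=w,v$, $|\hat K^i-K^i|+|\partial_x(\hat K^i-K^i)|+|\partial_\xi(\hat K^i-K^i)|\le\varepsilon$ on $\mathcal T$. The control law is $$U(t)=\int_0^L\hat K^w(L,\xi)\tilde w(\xi,t)\,d\xi+\int_0^L\hat K^v(L,\xi)\tilde v(\xi,t)\,d\xi .$$ For $w,v\in L^2(0,L)$ put $\hat\beta(x)=v(x)-\int_0^x\hat K^w(x,\xi)w(\xi)\,d\xi-\int_0^x\hat K^v(x,\xi)v(\xi)\,d\xi$ and $$V_k(w,v)=\int_0^L\Big(\frac{e^{-\nu x/\lambda_1}}{\lambda_1}w^2+a\,\frac{e^{-\nu x/\lambda_2}}{\lambda_2}\hat\beta^2\Big)dx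 .$$ **Theorem.** The kernel equations have a $C^1$ solution on $\mathcal T$. Let $(K^w,K^v)$ be a $C^1$ solution, let $\nu>0$ and $a>r^2$. Then there are $m_1,m_2>0$ such that, with $$\eta=\nu-\frac{2a\varepsilon(1+L)(2\lambda_2+\lambda_1)}{m_1\lambda_2},$$ one has $\eta>0$ and $r^2-a+2aL\varepsilon<0$ for all sufficiently small $\varepsilon>0$, and such that for every $\varepsilon>0$ with $\eta>0$ and $r^2-a+2aL\varepsilon<0$ and every $\varepsilon$-accurate pair $(\hat K^w,\hat K^v)$: 1. $m_1\|(w,v)\|_{L^2}^2\le V_k(w,v)\le m_2\|(w,v)\|_{L^2}^2$ for all $w,v\in L^2(0,L)$. 2. For all initial data $\tilde w(\cdot,0),\tilde v(\cdot,0)\in L^2(0,L)$ the linearized closed loop has a weak ($L^2$-)solution in $C([0,\infty);L^2(0,L)^2)$, and every such solution satisfies, for all $t\ge0$, $$\|(\tilde w,\tilde v)(\cdot,t)\|_{L^2}^2\le e^{-\eta t}\,\frac{m_2}{m_1}\,\|(\tilde w,\tilde v)(\cdot,0)\|_{L^2}^2 .$$ 3. The equilibrium $(\rho^\star,v^\star)$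 of the nonlinear ARZ closed loop is locally exponentially stable: there are $\delta,C,\sigma>0$ such that every classical solution ($C^1$ up to the boundary, with $\rho,v>0$) on $[0,L]\times[0,T)$, for any $T>0$, for which each of $|\rho-\rho^\star|,|v-v^\star|,|\rho_x|,|v_x|$ is at most $d\le\delta$ on $[0,L]$ at time $0$, satisfies for all $t\in[0,T)$ that each of these four quantities is at most $Ce^{-\sigma t}d$ on $[0,L]$ at time $t$, and $$\|(\rho-\rho^\star,v-v^\star)(\cdot,t)\|_{L^2}^2\le Ce^{-\sigma t}\|(\rho-\rho^\star,v-v^\star)(\cdot,0)\|_{L^2}^2 .$$ -/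

import Mathlib

open MeasureTheory Set

/-- Data of the Aw-Rascle-Zhang (ARZ) traffic model on the road `[0, L]`: fundamental diagram `V`
(equilibrium velocity as a function of the density), equilibrium density `ρs`, reaction time `τ`
and road length `L`. The last field says that the equilibrium is in the congested regime, where the
second characteristic speed of the linearized system points upstream. -/
structure ARZModel where
  V : ℝ → ℝ
  ρs : ℝ
  τ : ℝ
  L : ℝ
  ρs_pos : 0 < ρs
  τ_pos : 0 < τ
  L_pos : 0 < L
  contDiffOn_V : ContDiffOn ℝ 2 V (Ioi 0)
  velocity_pos : 0 < V ρs
  congested : 0 < -(ρs * deriv V ρs) - V ρs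

namespace ARZModel

/-- Equilibrium velocity `v⋆ = V(ρ⋆)`. -/
noncomputable def vs (p : ARZModel) : ℝ := p.V p.ρs

/-- Equilibrium flow `q⋆ = ρ⋆ V(ρ⋆)`. -/
noncomputable def qs (p : ARZModel) : ℝ := p.ρs * p.V p.ρs

/-- Characteristic speed `λ₁ = v⋆`. -/
noncomputable def lam1 (p : ARZModel) : ℝ := p.vs

/-- Characteristic speed `λ₂ = -ρ⋆ V'(ρ⋆) - v⋆`. -/
noncomputable def lam2 (p : ARZModel) : ℝ := -(p.ρs * deriv p.V p.ρs) - p.vs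

/-- In-domain coupling `c(x) = -(1/τ) exp(-x / (τ v⋆))`. -/
noncomputable def c (p : ARZModel) (x : ℝ) : ℝ := -(1 / p.τ) * Real.exp (-x / (p.τ * p.vs))

/-- Boundary reflection `r = (-ρ⋆ V'(ρ⋆) - v⋆) / v⋆`. -/
noncomputable def r (p : ARZModel) : ℝ := (-(p.ρs * deriv p.V p.ρs) - p.vs) / p.vs

/-! ### Backstepping kernels -/

/-- The closed triangle `0 ≤ ξ ≤ x ≤ L`. -/
def triangle (p : ARZModel) : Set (ℝ × ℝ) := {z | 0 ≤ z.2 ∧ z.2 ≤ z.1 ∧ z.1 ≤ p.L}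

/-- `∂K/∂x` on the triangle (one-sided on its boundary). -/
noncomputable def dX (p : ARZModel) (K : ℝ → ℝ → ℝ) (x ξ : ℝ) : ℝ :=
  fderivWithin ℝ (Function.uncurry K) p.triangle (x, ξ) (1, 0)

/-- `∂K/∂ξ` on the triangle (one-sided on its boundary). -/
noncomputable def dXi (p : ARZModel) (K : ℝ → ℝ → ℝ) (x ξ : ℝ) : ℝ :=
  fderivWithin ℝ (Function.uncurry K) p.triangle (x, ξ) (0, 1)

/-- `(Kw, Kv)` is a `C¹` solution of the backstepping kernel equations on the triangle. -/
structure IsKernelPair (p : ARZModel) (Kw Kv : ℝ → ℝ → ℝ) : Prop where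
  contDiffOn_w : ContDiffOn ℝ 1 (Function.uncurry Kw) p.triangle
  contDiffOn_v : ContDiffOn ℝ 1 (Function.uncurry Kv) p.triangle
  eq_w : ∀ x ξ, (x, ξ) ∈ p.triangle →
    p.lam2 * p.dX Kw x ξ - p.lam1 * p.dXi Kw x ξ = p.c ξ * Kv x ξ
  eq_v : ∀ x ξ, (x, ξ) ∈ p.triangle → p.lam2 * p.dX Kv x ξ + p.lam2 * p.dXi Kv x ξ = 0
  diag : ∀ x ∈ Icc 0 p.L, Kw x x = -(p.c x) / (p.lam1 + p.lam2)
  base : ∀ x ∈ Icc 0 p.L, Kv x 0 = -Kw x 0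

/-- `Kh` is a `C¹` approximation of `K` with accuracy `ε` in value and first derivatives, on the
triangle. -/
structure IsApproxKernel (p : ARZModel) (ε : ℝ) (K Kh : ℝ → ℝ → ℝ) : Prop where
  contDiffOn : ContDiffOn ℝ 1 (Function.uncurry Kh) p.triangle
  close : ∀ x ξ, (x, ξ) ∈ p.triangle →
    |Kh x ξ - K x ξ| + |p.dX (fun y η => Kh y η - K y η) x ξ|
      + |p.dXi (fun y η => Kh y η - K y η) x ξ| ≤ ε

/-- The feedback `∫₀ᴸ Kw(L,ξ) w(ξ) dξ + ∫₀ᴸ Kv(L,ξ) v(ξ) dξ` of a state `(w, v)`. -/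
noncomputable def feedback (p : ARZModel) (Kw Kv : ℝ → ℝ → ℝ) (w v : ℝ → ℝ) : ℝ :=
  (∫ ξ in (0 : ℝ)..p.L, Kw p.L ξ * w ξ) + ∫ ξ in (0 : ℝ)..p.L, Kv p.L ξ * v ξ

/-- The second component `β(x) = v(x) - ∫₀ˣ Kw(x,ξ) w(ξ) dξ - ∫₀ˣ Kv(x,ξ) v(ξ) dξ` of the
backstepping transform of `(w, v)`; the first component is `w` itself. -/
noncomputable def backstep (Kw Kv : ℝ → ℝ → ℝ) (w v : ℝ → ℝ) (x : ℝ) : ℝ :=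
  v x - (∫ ξ in (0 : ℝ)..x, Kw x ξ * w ξ) - ∫ ξ in (0 : ℝ)..x, Kv x ξ * v ξ

/-- The weighted `L²` functional of the backstepping transform of `(w, v)`. -/
noncomputable def lyapunov (p : ARZModel) (ν a : ℝ) (Kw Kv : ℝ → ℝ → ℝ) (w v : ℝ → ℝ) : ℝ :=
  ∫ x in (0 : ℝ)..p.L,
    (Real.exp (-(ν / p.lam1) * x) / p.lam1 * w x ^ 2
      + a * (Real.exp (-(ν / p.lam2) * x) / p.lam2) * backstep Kw Kv w v x ^ 2)

/-- The decay rate `η = ν - 2aε(1+L)(2λ₂+λ₁) / (m₁λ₂)`. -/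
noncomputable def rate (p : ARZModel) (ν a m₁ ε : ℝ) : ℝ :=
  ν - 2 * a * ε * (1 + p.L) * (2 * p.lam2 + p.lam1) / (m₁ * p.lam2)

/-! ### The linearized closed loop -/

/-- The space `L²(0, L)`. -/
abbrev StateL2 (p : ARZModel) : Type := Lp ℝ 2 (volume.restrict (Ioc (0 : ℝ) p.L))

/-- `(w, v) ∈ C([0,∞); L²(0,L)²)` is the `L²`-solution, with initial state `(w₀, v₀)`, of the
linearized closed loop
`w_t + λ₁ w_x = 0`, `v_t - λ₂ v_x = c w`, `w(0,t) = -r v(0,t)`, `v(L,t) = U(t)`,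
where `U` is the feedback with kernels `(Kw, Kv)`. This is the usual transposition definition:
the equations are multiplied by `C¹` functions `φ`, `ψ` of `(x, t)` and integrated by parts, where
the boundary conditions on `φ`, `ψ` remove the traces that the boundary data do not determine. -/
structure IsL2Solution (p : ARZModel) (Kw Kv : ℝ → ℝ → ℝ) (w₀ v₀ : p.StateL2)
    (w v : ℝ → p.StateL2) : Prop where
  continuousOn_w : ContinuousOn w (Ici 0)
  continuousOn_v : ContinuousOn v (Ici 0)
  initial_w : w 0 = w₀
  initial_v : v 0 = v₀
  weak : ∀ T : ℝ, 0 < T → ∀ φ ψ : ℝ → ℝ → ℝ,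
    ContDiff ℝ 1 (Function.uncurry φ) → ContDiff ℝ 1 (Function.uncurry ψ) →
    (∀ t ∈ Icc 0 T, φ p.L t = 0) →
    (∀ t ∈ Icc 0 T, p.lam2 * ψ 0 t = -(p.r * p.lam1 * φ 0 t)) →
    (∫ x in (0 : ℝ)..p.L, (w T x * φ x T + v T x * ψ x T))
        - (∫ x in (0 : ℝ)..p.L, (w₀ x * φ x 0 + v₀ x * ψ x 0))
      = ∫ t in (0 : ℝ)..T,
          ((∫ x in (0 : ℝ)..p.L,
              (w t x * (deriv (fun s => φ x s) t + p.lam1 * deriv (fun y => φ y t) x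
                  + p.c x * ψ x t)
                + v t x * (deriv (fun s => ψ x s) t - p.lam2 * deriv (fun y => ψ y t) x)))
            + p.lam2 * ψ p.L t * p.feedback Kw Kv (w t) (v t))

/-! ### The nonlinear closed loop -/

/-- The (rescaled) first Riemann coordinate of the linearization at the equilibrium,
`w̃ = exp(x / (τ v⋆)) ((v - v⋆) - V'(ρ⋆) (ρ - ρ⋆))`; in the coordinates `(w̃, v - v⋆)` the
linearized ARZ equations take the form used in `IsL2Solution`. -/
noncomputable def wTilde (p : ARZModel) (ρ v : ℝ → ℝ) (x : ℝ) : ℝ :=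
  Real.exp (x / (p.τ * p.vs)) * ((v x - p.vs) - deriv p.V p.ρs * (ρ x - p.ρs))

/-- `(ρ, v)`, functions of `(x, t)`, is a classical (`C¹`, positive) solution on
`[0, L] × [0, T)` of the nonlinear ARZ system
`ρ_t + (ρ v)_x = 0`, `(v - V(ρ))_t + v (v - V(ρ))_x = (V(ρ) - v) / τ`,
`ρ(0,t) = q⋆ / v(0,t)`, `v(L,t) = v⋆ + U(t)`,
where `U` is the feedback with kernels `(Kw, Kv)` of the state `(w̃, v - v⋆)`. -/
structure IsClassicalSolution (p : ARZModel) (Kw Kv : ℝ → ℝ → ℝ) (T : ℝ)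
    (ρ v : ℝ → ℝ → ℝ) : Prop where
  contDiffOn_ρ : ContDiffOn ℝ 1 (Function.uncurry ρ) (Icc 0 p.L ×ˢ Ico 0 T)
  contDiffOn_v : ContDiffOn ℝ 1 (Function.uncurry v) (Icc 0 p.L ×ˢ Ico 0 T)
  ρ_pos : ∀ x ∈ Icc 0 p.L, ∀ t ∈ Ico 0 T, 0 < ρ x t
  v_pos : ∀ x ∈ Icc 0 p.L, ∀ t ∈ Ico 0 T, 0 < v x t
  mass : ∀ x ∈ Icc 0 p.L, ∀ t ∈ Ico 0 T,
    derivWithin (fun s => ρ x s) (Ico 0 T) t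
      + derivWithin (fun y => ρ y t * v y t) (Icc 0 p.L) x = 0
  momentum : ∀ x ∈ Icc 0 p.L, ∀ t ∈ Ico 0 T,
    derivWithin (fun s => v x s - p.V (ρ x s)) (Ico 0 T) t
      + v x t * derivWithin (fun y => v y t - p.V (ρ y t)) (Icc 0 p.L) x
      = (p.V (ρ x t) - v x t) / p.τ
  inlet : ∀ t ∈ Ico 0 T, ρ 0 t = p.qs / v 0 t
  outlet : ∀ t ∈ Ico 0 T, v p.L t = p.vs +
    p.feedback Kw Kv (p.wTilde (fun ξ => ρ ξ t) (fun ξ => v ξ t)) (fun ξ => v ξ t - p.vs)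

/-- The profile `(ρ, v)` deviates from the equilibrium by at most `d` in the `C¹` norm on
`[0, L]`. -/
def C1DeviationLE (p : ARZModel) (ρ v : ℝ → ℝ) (d : ℝ) : Prop :=
  ∀ x ∈ Icc 0 p.L, |ρ x - p.ρs| ≤ d ∧ |v x - p.vs| ≤ d ∧
    |derivWithin ρ (Icc 0 p.L) x| ≤ d ∧ |derivWithin v (Icc 0 p.L) x| ≤ d

/-- The squared `L²` deviation of the profile `(ρ, v)` from the equilibrium. -/
noncomputable def l2DeviationSq (p : ARZModel) (ρ v : ℝ → ℝ) : ℝ :=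
  ∫ x in (0 : ℝ)..p.L, ((ρ x - p.ρs) ^ 2 + (v x - p.vs) ^ 2)

/-- Local exponential stability of the equilibrium of the nonlinear closed loop: every classical
solution, on any time interval `[0, T)`, that starts near the equilibrium in `C¹` decays
exponentially to it, with constants independent of the solution and of `T`, both in the `C¹` and
in the `L²` norm. -/
def LocallyExponentiallyStable (p : ARZModel) (Kw Kv : ℝ → ℝ → ℝ) : Prop :=
  ∃ δ > 0, ∃ C > 0, ∃ σ > 0, ∀ T : ℝ, 0 < T → ∀ ρ v : ℝ → ℝ → ℝ,
    p.IsClassicalSolution Kw Kv T ρ v →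
    ∀ d ≤ δ, p.C1DeviationLE (fun x => ρ x 0) (fun x => v x 0) d →
    ∀ t ∈ Ico 0 T,
      p.C1DeviationLE (fun x => ρ x t) (fun x => v x t) (C * Real.exp (-σ * t) * d) ∧
      p.l2DeviationSq (fun x => ρ x t) (fun x => v x t)
        ≤ C * Real.exp (-σ * t) * p.l2DeviationSq (fun x => ρ x 0) (fun x => v x 0)

end ARZModel

namespace ARZModel

/-! ### Constants -/

/-! Kernels. The kernel equations can be solved by hand. `Kv` is constant along the lines `x - ξ =
const`, and integrating the equation for `Kw` along its characteristics gives a scalar Volterra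
equation for `Kw x 0`; the only solution is `Kv = gain`, `Kw = -gain * exp (-kap * ξ)`
(`exists_isKernelPair`, `IsKernelPair.eq_explicit`). An `ε`-accurate pair therefore gives a feedback
whose gains at `x = L` are within `ε` of explicit ones (`GainsClose`).

Linear system. The exact backstepping transform `β = target w v` turns the closed loop into `w_t +
λ₁ w_x = 0`, `β_t - λ₂ β_x = 0`, `w(0) = -r β(0)`, `β(L) = E`, where `E` is the `discrepancy`
between the applied and the exact feedback, of size `ε` times the norm of the state. Testing the
weak formulation with functions carried along characteristics shows that every weak solution is a
pair of travelling waves (`IsL2Solution.ae_eq_wave`). A weighted energy of these waves decays at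
rate `ν` up to the input `E`, and Gronwall's inequality leaves a rate `ν - j ε²`
(`exists_linear_decay`). For existence, the input is found as the fixed point of a contraction in an
exponentially weighted sup norm (`exists_wave_input`), and a computation with adjoints shows that
the resulting waves satisfy the weak formulation (`weak_of_waves`). The functional `lyapunov` is
compared with the norm directly, uniformly over kernels with a common bound
(`exists_lyapunov_bounds`). A small `m₁` then makes the claimed rate at most `ν - j ε²`, and makes
its positivity force `ε` to be small.

Nonlinear system. The central object is the difference of two classical solutions near the
equilibrium. In the Riemann coordinate `z = v - V(ρ)` and the exact backstepping transform of the
velocity difference, it consists of two damped counter-propagating waves whose source terms carry a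
small factor, because the first-order sources cancel (`gain_mul_deriv`, `LocalBounds.abs_source_le`,
`Flow.dampedPair`). The energies with exponent `2k + 2` decay with constants uniform in `k`
(`energy_slice_le`); `k = 0` gives `L²` decay and `k → ∞` gives decay in the sup norm. Comparison
with the equilibrium controls the values of a solution. Comparison with its own time shift controls
the time derivatives without differentiating the system, and the equations then give the space
derivatives. A continuation argument (`Flow.near_of_deviationLE`) removes the assumption of staying
near the equilibrium. -/

theorem vs_pos (p : ARZModel) : 0 < p.vs := p.velocity_pos

theorem lam1_pos (p : ARZModel) : 0 < p.lam1 := p.velocity_pos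

theorem lam2_pos (p : ARZModel) : 0 < p.lam2 := p.congested

theorem lam_pos (p : ARZModel) : 0 < p.lam1 + p.lam2 := add_pos p.lam1_pos p.lam2_pos

theorem r_mul_lam1 (p : ARZModel) : p.r * p.lam1 = p.lam2 := by
  have := p.vs_pos.ne'
  unfold r lam1 lam2
  field_simp

theorem r_pos (p : ARZModel) : 0 < p.r := div_pos p.lam2_pos p.vs_pos

/-- The spatial decay rate `1 / (τ v⋆)` of the coupling. -/
noncomputable def kap (p : ARZModel) : ℝ := 1 / (p.τ * p.vs)

/-- The constant value `-1 / (τ (λ₁ + λ₂))` of the second backstepping kernel. -/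
noncomputable def gain (p : ARZModel) : ℝ := -(1 / (p.τ * (p.lam1 + p.lam2)))

theorem kap_pos (p : ARZModel) : 0 < p.kap := by
  have := p.vs_pos; have := p.τ_pos; unfold kap; positivity

theorem gain_neg (p : ARZModel) : p.gain < 0 := by
  have := p.lam_pos; have := p.τ_pos
  have : 0 < 1 / (p.τ * (p.lam1 + p.lam2)) := by positivity
  unfold gain; linarith

theorem gain_mul_lam (p : ARZModel) : p.gain * (p.lam1 + p.lam2) = -(1 / p.τ) := by
  have := p.lam_pos.ne'; have := p.τ_pos.ne'
  unfold gain; field_simp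

theorem lam1_mul_kap (p : ARZModel) : p.lam1 * p.kap = -(p.gain * (p.lam1 + p.lam2)) := by
  have := p.vs_pos.ne'; have := p.τ_pos.ne'
  rw [gain_mul_lam]; unfold kap lam1; field_simp

theorem c_eq (p : ARZModel) (x : ℝ) :
    p.c x = p.gain * (p.lam1 + p.lam2) * Real.exp (-(p.kap * x)) := by
  rw [gain_mul_lam]; unfold c kap; congr 2; ring

/-! ### The explicit solution of the kernel equations -/

/-- A convex set with interior points has unique derivatives, so the one-sided partial derivatives
`dX` and `dXi` of explicit functions can be computed, also on the boundary. -/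
theorem uniqueDiffOn_triangle (p : ARZModel) : UniqueDiffOn ℝ p.triangle := by
  have hconv : Convex ℝ p.triangle := by
    rintro ⟨a, b⟩ ⟨h1, h2, h3⟩ ⟨c, d⟩ ⟨h4, h5, h6⟩ s t hs ht hst
    simp only at h1 h2 h3 h4 h5 h6
    refine ⟨?_, ?_, ?_⟩
    · simp; positivity
    · simp; gcongr
    · simp; calc s * a + t * c ≤ s * p.L + t * p.L := by gcongr
        _ = p.L := by rw [← add_mul, hst, one_mul]
  refine uniqueDiffOn_convex hconv ⟨(2 * p.L / 3, p.L / 3), ?_⟩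
  have hL := p.L_pos
  rw [mem_interior]
  refine ⟨{z | 0 < z.2} ∩ ({z | z.2 < z.1} ∩ {z | z.1 < p.L}), ?_, ?_, ?_⟩
  · rintro z ⟨h1, h2, h3⟩; exact ⟨le_of_lt h1, le_of_lt h2, le_of_lt h3⟩
  · exact (isOpen_lt continuous_const continuous_snd).inter
      ((isOpen_lt continuous_snd continuous_fst).inter (isOpen_lt continuous_fst continuous_const))
  · refine ⟨?_, ?_, ?_⟩ <;> simp only [mem_ofPred_eq] <;> linarith

/-- With `Kv` constant and `Kw` a function of `ξ` alone, the first equation becomes `-λ₁ Kw' = c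
Kv`. The diagonal condition prescribes `Kw`, the base condition then prescribes `Kv`, and the
equation holds because `lam1 * kap = -gain * (lam1 + lam2)`. -/
theorem exists_isKernelPair (p : ARZModel) :
    p.IsKernelPair (fun _ ξ => -(p.gain * Real.exp (-(p.kap * ξ)))) (fun _ _ => p.gain) := by
  have hexp : ∀ z : ℝ × ℝ, HasFDerivAt
      (Function.uncurry fun _ ξ : ℝ => -(p.gain * Real.exp (-(p.kap * ξ))))
      ((p.gain * p.kap * Real.exp (-(p.kap * z.2))) • ContinuousLinearMap.snd ℝ ℝ ℝ) z := by
    intro z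
    have h1 : HasDerivAt (fun ξ : ℝ => -(p.gain * Real.exp (-(p.kap * ξ))))
        (p.gain * p.kap * Real.exp (-(p.kap * z.2))) z.2 := by
      refine (((hasDerivAt_id z.2).const_mul p.kap).neg.exp.const_mul p.gain).neg.congr_deriv ?_
      simp; ring
    exact h1.comp_hasFDerivAt z hasFDerivAt_snd
  have hW : ∀ z ∈ p.triangle, fderivWithin ℝ
      (Function.uncurry fun _ ξ : ℝ => -(p.gain * Real.exp (-(p.kap * ξ)))) p.triangle z
      = (p.gain * p.kap * Real.exp (-(p.kap * z.2))) • ContinuousLinearMap.snd ℝ ℝ ℝ :=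
    fun z hz => (hexp z).hasFDerivWithinAt.fderivWithin (p.uniqueDiffOn_triangle z hz)
  have hV : ∀ z ∈ p.triangle, fderivWithin ℝ
      (Function.uncurry fun _ _ : ℝ => p.gain) p.triangle z = 0 :=
    fun z hz => (hasFDerivAt_const (𝕜 := ℝ) p.gain z).hasFDerivWithinAt.fderivWithin
      (p.uniqueDiffOn_triangle z hz)
  refine ⟨?_, ?_, ?_, ?_, ?_, ?_⟩
  · apply ContDiff.contDiffOn
    unfold Function.uncurry
    fun_prop
  · exact contDiffOn_const
  · intro x ξ h
    rw [dX, dXi, hW _ h, c_eq]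
    simp
    linear_combination (-(p.gain * Real.exp (-(p.kap * ξ)))) * p.lam1_mul_kap
  · intro x ξ h
    rw [dX, dXi, hV _ h]
    simp
  · intro x _
    have := p.lam_pos.ne'
    rw [c_eq]
    field_simp
  · intro x _
    simp

theorem hasDerivWithinAt_comp_line (p : ARZModel) {K : ℝ → ℝ → ℝ}
    (hK : ContDiffOn ℝ 1 (Function.uncurry K) p.triangle) {x₀ ξ₀ a b T : ℝ}
    (h : ∀ θ ∈ Icc 0 T, (x₀ + a * θ, ξ₀ + b * θ) ∈ p.triangle) {θ : ℝ} (hθ : θ ∈ Icc 0 T) :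
    HasDerivWithinAt (fun θ => K (x₀ + a * θ) (ξ₀ + b * θ))
      (a * p.dX K (x₀ + a * θ) (ξ₀ + b * θ) + b * p.dXi K (x₀ + a * θ) (ξ₀ + b * θ))
      (Icc 0 T) θ := by
  have h1 := (hK.differentiableOn one_ne_zero _ (h θ hθ)).hasFDerivWithinAt
  have h2 : HasDerivWithinAt (fun θ : ℝ => (x₀ + a * θ, ξ₀ + b * θ)) (a, b) (Icc 0 T) θ := by
    have e1 := ((hasDerivAt_id θ).const_mul a).const_add x₀
    have e2 := ((hasDerivAt_id θ).const_mul b).const_add ξ₀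
    simpa using (e1.prodMk e2).hasDerivWithinAt
  have h3 := h1.comp_hasDerivWithinAt θ h2 h
  refine h3.congr_deriv ?_
  have : ((a, b) : ℝ × ℝ) = a • (1, 0) + b • (0, 1) := by simp
  rw [this, map_add, map_smul, map_smul]
  rfl

theorem eq_of_hasDerivWithinAt_zero {f : ℝ → ℝ} {T : ℝ} (hT : 0 ≤ T)
    (h : ∀ θ ∈ Icc 0 T, HasDerivWithinAt f 0 (Icc 0 T) θ) : f T = f 0 := by
  refine constant_of_has_deriv_right_zero (fun θ hθ => (h θ hθ).continuousWithinAt)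
    (fun θ hθ => ?_) T ⟨hT, le_rfl⟩
  exact (h θ ⟨hθ.1, hθ.2.le⟩).mono_of_mem_nhdsWithin (Icc_mem_nhdsGE_of_mem hθ)

/-- Uniqueness for the kernel equations: every solution is the explicit one. -/
theorem IsKernelPair.eq_explicit {p : ARZModel} {Kw Kv : ℝ → ℝ → ℝ} (h : p.IsKernelPair Kw Kv)
    {x ξ : ℝ} (hx : (x, ξ) ∈ p.triangle) :
    Kw x ξ = -(p.gain * Real.exp (-(p.kap * ξ))) ∧ Kv x ξ = p.gain := by
  have hL := p.L_pos
  have hΛ := p.lam_pos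
  have hl1 := p.lam1_pos
  have hl2 := p.lam2_pos
  set Λ := p.lam1 + p.lam2 with hΛd
  -- The second equation says that the derivative in the direction `(1, 1)` vanishes.
  have hdiag : ∀ x ξ, (x, ξ) ∈ p.triangle → Kv x ξ = Kv (x - ξ) 0 := by
    rintro x ξ ⟨h1, h2, h3⟩
    simp only at h1 h2 h3
    have htri : ∀ θ ∈ Icc 0 ξ, ((x - ξ) + 1 * θ, 0 + 1 * θ) ∈ p.triangle := fun θ hθ =>
      ⟨by simpa using hθ.1, by simpa using h2, by simp; linarith [hθ.2]⟩
    have := eq_of_hasDerivWithinAt_zero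
      (f := fun θ => Kv ((x - ξ) + 1 * θ) (0 + 1 * θ)) h1 (fun θ hθ => by
        refine (p.hasDerivWithinAt_comp_line h.contDiffOn_v htri hθ).congr_deriv ?_
        have := h.eq_v _ _ (htri θ hθ)
        rw [← mul_add] at this
        have := (mul_eq_zero.1 this).resolve_left hl2.ne'
        linarith)
    simpa using this
  -- points on the characteristic of the first equation which ends in `(x, ξ)`
  have hchar : ∀ x ξ, (x, ξ) ∈ p.triangle → ∀ θ ∈ Icc 0 ((x - ξ) / Λ),
      ((p.lam2 * ξ + p.lam1 * x) / Λ + p.lam2 * θ, (p.lam2 * ξ + p.lam1 * x) / Λ + -p.lam1 * θ)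
        ∈ p.triangle := by
    rintro x ξ ⟨h1, h2, h3⟩ θ ⟨h4, h5⟩
    simp only at h1 h2 h3
    rw [le_div_iff₀ hΛ] at h5
    refine ⟨?_, ?_, ?_⟩
    · simp only
      rw [div_add' _ _ _ hΛ.ne']
      apply div_nonneg _ hΛ.le
      nlinarith
    · simp only
      nlinarith
    · simp only
      rw [div_add' _ _ _ hΛ.ne', div_le_iff₀ hΛ]
      nlinarith
  have hbase : ∀ x ∈ Icc 0 p.L, Kw x 0 = -p.gain := by
    -- Clamping the argument gives a continuous function on the whole line, so that the primitive
    -- `F` below is differentiable everywhere.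
    set f : ℝ → ℝ := fun x => Kw (max 0 (min x p.L)) 0 with hf
    have hff : ∀ x ∈ Icc 0 p.L, f x = Kw x 0 := fun x hx => by
      simp only [hf]; rw [min_eq_left hx.2, max_eq_right hx.1]
    have hfc : Continuous f := by
      have : Continuous fun x : ℝ => (max 0 (min x p.L), (0 : ℝ)) := by fun_prop
      refine h.contDiffOn_w.continuousOn.comp_continuous this fun x => ⟨le_rfl, ?_, ?_⟩
      · simp
      · simp [hL.le]
    set F : ℝ → ℝ := fun x => ∫ y in (0 : ℝ)..x, Real.exp (-(p.gain * y)) * f y with hF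
    have hF' : ∀ x, HasDerivAt F (Real.exp (-(p.gain * x)) * f x) x := fun x => by
      have : Continuous fun y => Real.exp (-(p.gain * y)) * f y := by fun_prop
      exact this.integral_hasStrictDerivAt 0 x |>.hasDerivAt
    -- The characteristic that ends in `(x, 0)` starts on the diagonal at `s`. At parameter `θ` its
    -- coordinates differ by `Λ * θ`, so there `Kv = Kv (Λ * θ) 0 = -f (Λ * θ)`: integrating the
    -- first equation along it gives a Volterra equation for `f`.
    have hfF : ∀ x ∈ Icc 0 p.L, f x = -p.gain * Real.exp (p.gain * x) * (1 + F x) := by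
      intro x hx
      have hT : 0 ≤ x / Λ := div_nonneg hx.1 hΛ.le
      have hxt : (x, (0 : ℝ)) ∈ p.triangle := ⟨le_rfl, hx.1, hx.2⟩
      have hc := hchar x 0 hxt
      simp only [mul_zero, zero_add, sub_zero] at hc
      set s := p.lam1 * x / Λ with hs
      have key := eq_of_hasDerivWithinAt_zero (f := fun θ => Kw (s + p.lam2 * θ) (s + -p.lam1 * θ)
          + p.gain * Real.exp (p.gain * x) * F (Λ * θ)) hT (fun θ hθ => by
        have d1 := p.hasDerivWithinAt_comp_line h.contDiffOn_w hc hθ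
        have d2 : HasDerivAt (fun θ => F (Λ * θ)) _ θ :=
          (hF' (Λ * θ)).comp θ ((hasDerivAt_id θ).const_mul Λ)
        refine (d1.add
          (d2.const_mul (p.gain * Real.exp (p.gain * x))).hasDerivWithinAt).congr_deriv ?_
        have e1 := h.eq_w _ _ (hc θ hθ)
        rw [hdiag _ _ (hc θ hθ), h.base _ ?_] at e1
        · have e2 : s + p.lam2 * θ - (s + -p.lam1 * θ) = Λ * θ := by rw [hΛd]; ring
          rw [e2, ← hff, c_eq, ← hΛd] at e1
          · have e3 : Real.exp (-(p.kap * (s + -p.lam1 * θ)))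
                = Real.exp (p.gain * x) * Real.exp (-(p.gain * (Λ * θ))) := by
              rw [← Real.exp_add]
              congr 1
              have : p.kap * s = -(p.gain * x) := by
                rw [hs]
                field_simp
                linear_combination x * p.lam1_mul_kap
              linear_combination -this + θ * p.lam1_mul_kap
            rw [e3] at e1
            simp only [mul_one]
            linear_combination e1
          · have := hc θ hθ
            have h5 := hθ.2
            rw [le_div_iff₀ hΛ] at h5
            exact ⟨mul_nonneg hΛ.le hθ.1, by linarith [hx.2]⟩
        · have := hc θ hθ
          have h5 := hθ.2
          rw [le_div_iff₀ hΛ] at h5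
          have e2 : s + p.lam2 * θ - (s + -p.lam1 * θ) = Λ * θ := by rw [hΛd]; ring
          rw [e2]
          exact ⟨mul_nonneg hΛ.le hθ.1, by linarith [hx.2]⟩)
      have e1 : s + p.lam2 * (x / Λ) = x := by rw [hs]; field_simp; rw [hΛd]
      have e2 : s + -p.lam1 * (x / Λ) = 0 := by rw [hs]; field_simp; ring
      have e3 : Λ * (x / Λ) = x := by field_simp
      have hF0 : F 0 = 0 := by simp [hF]
      have hsI : s ∈ Icc 0 p.L := by
        have := hc 0 ⟨le_rfl, hT⟩
        simp only [mul_zero, add_zero] at this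
        exact ⟨this.1, this.2.2⟩
      simp only [e1, e2, e3, mul_zero, add_zero, hF0] at key
      rw [h.diag s hsI, c_eq, ← hΛd, ← hff x hx] at key
      have e4 : Real.exp (-(p.kap * s)) = Real.exp (p.gain * x) := by
        congr 1
        rw [hs]; field_simp
        linear_combination (-x) * p.lam1_mul_kap
      rw [e4] at key
      have e5 : -(p.gain * Λ * Real.exp (p.gain * x)) / Λ = -(p.gain * Real.exp (p.gain * x)) := by
        field_simp
      rw [e5] at key
      linear_combination key
    intro x hx
    -- By the Volterra equation `1 + F` solves `y' = -gain * y` with `y 0 = 1`.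
    have hone : Real.exp (p.gain * x) * (1 + F x) = 1 := by
      have key := eq_of_hasDerivWithinAt_zero
        (f := fun x => Real.exp (p.gain * x) * (1 + F x)) hx.1 (fun θ hθ => by
        have d1 : HasDerivAt (fun x => Real.exp (p.gain * x)) _ θ :=
          ((hasDerivAt_id θ).const_mul p.gain).exp
        have d2 := d1.mul ((hF' θ).const_add 1)
        refine d2.hasDerivWithinAt.congr_deriv ?_
        rw [hfF θ ⟨hθ.1, hθ.2.trans hx.2⟩]
        simp only [id, mul_one]
        have : Real.exp (p.gain * θ) * Real.exp (-(p.gain * θ)) = 1 := by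
          rw [← Real.exp_add]; simp
        linear_combination -(p.gain * Real.exp (p.gain * θ) * (1 + F θ)) * this)
      simpa [hF] using key
    rw [← hff x hx, hfF x hx, mul_assoc, hone, mul_one]
  have hKv : ∀ x ξ, (x, ξ) ∈ p.triangle → Kv x ξ = p.gain := by
    intro x ξ hx
    have hI : x - ξ ∈ Icc 0 p.L := ⟨sub_nonneg.2 hx.2.1, by
      have := hx.2.2; have := hx.1; simp only at *; linarith⟩
    rw [hdiag x ξ hx, h.base _ hI, hbase _ hI, neg_neg]
  refine ⟨?_, hKv x ξ hx⟩
  have hc := hchar x ξ hx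
  have hT : 0 ≤ (x - ξ) / Λ := div_nonneg (sub_nonneg.2 hx.2.1) hΛ.le
  -- The characteristic through `(x, ξ)` leaves the diagonal at `(s, s)`. Now that `Kv` is known,
  -- `Kw + gain * exp (-kap * ξ)` is constant along it, and it vanishes on the diagonal.
  set s := (p.lam2 * ξ + p.lam1 * x) / Λ with hs
  have key := eq_of_hasDerivWithinAt_zero (f := fun θ => Kw (s + p.lam2 * θ) (s + -p.lam1 * θ)
      + p.gain * Real.exp (-(p.kap * (s + -p.lam1 * θ)))) hT (fun θ hθ => by
    have d1 := p.hasDerivWithinAt_comp_line h.contDiffOn_w hc hθ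
    have d2 : HasDerivAt (fun θ => Real.exp (-(p.kap * (s + -p.lam1 * θ)))) _ θ :=
      ((((hasDerivAt_id θ).const_mul (-p.lam1)).const_add s).const_mul p.kap).neg.exp
    refine (d1.add (d2.const_mul p.gain).hasDerivWithinAt).congr_deriv ?_
    have e1 := h.eq_w _ _ (hc θ hθ)
    rw [hKv _ _ (hc θ hθ), c_eq] at e1
    simp only [id]
    linear_combination e1 + (p.gain * Real.exp (-(p.kap * (s + -p.lam1 * θ)))) * p.lam1_mul_kap)
  have e1 : s + p.lam2 * ((x - ξ) / Λ) = x := by rw [hs]; field_simp; rw [hΛd]; ring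
  have e2 : s + -p.lam1 * ((x - ξ) / Λ) = ξ := by rw [hs]; field_simp; rw [hΛd]; ring
  have hsI : s ∈ Icc 0 p.L := by
    have := hc 0 ⟨le_rfl, hT⟩
    simp only [mul_zero, add_zero] at this
    exact ⟨this.1, this.2.2⟩
  simp only [e1, e2, mul_zero, add_zero] at key
  rw [h.diag s hsI, c_eq, ← hΛd] at key
  have e5 : -(p.gain * Λ * Real.exp (-(p.kap * s))) / Λ
      = -(p.gain * Real.exp (-(p.kap * s))) := by
    field_simp
  rw [e5] at key
  linear_combination key

end ARZModel

/-! ### Square-integrable functions -/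

/-- Cauchy–Schwarz: the quadratic polynomial `t ↦ ∫ (t g + f)²` is nonnegative, so its discriminant
is nonpositive. -/
theorem sq_integral_mul_le {α : Type*} [MeasurableSpace α] {μ : Measure α} {f g : α → ℝ}
    (hf : MemLp f 2 μ) (hg : MemLp g 2 μ) :
    (∫ x, f x * g x ∂μ) ^ 2 ≤ (∫ x, f x ^ 2 ∂μ) * ∫ x, g x ^ 2 ∂μ := by
  have hfi : Integrable (fun x => f x ^ 2) μ := hf.integrable_sq
  have hgi : Integrable (fun x => g x ^ 2) μ := hg.integrable_sq
  have hfg : Integrable (fun x => f x * g x) μ := hf.integrable_mul hg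
  have h := discrim_le_zero (a := ∫ x, g x ^ 2 ∂μ) (b := 2 * ∫ x, f x * g x ∂μ)
    (c := ∫ x, f x ^ 2 ∂μ) (fun t => by
      have : 0 ≤ ∫ x, (t * g x + f x) ^ 2 ∂μ := integral_nonneg fun x => sq_nonneg _
      have e : ∀ x, (t * g x + f x) ^ 2 = t ^ 2 * g x ^ 2 + 2 * t * (f x * g x) + f x ^ 2 :=
        fun x => by ring
      simp_rw [e] at this
      rw [integral_add (f := fun x => t ^ 2 * g x ^ 2 + 2 * t * (f x * g x))
          ((hgi.const_mul _).add (hfg.const_mul _)) hfi,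
        integral_add (hgi.const_mul _) (hfg.const_mul _), integral_const_mul,
        integral_const_mul] at this
      linarith)
  unfold discrim at h
  linarith

theorem sq_integral_abs_le {f : ℝ → ℝ} {a b : ℝ} (hab : a ≤ b)
    (hf : MemLp f 2 (volume.restrict (Ioc a b))) :
    (∫ x in a..b, |f x|) ^ 2 ≤ (b - a) * ∫ x in a..b, f x ^ 2 := by
  rw [intervalIntegral.integral_of_le hab, intervalIntegral.integral_of_le hab]
  have h := sq_integral_mul_le (memLp_const (p := 2) (μ := volume.restrict (Ioc a b)) (1 : ℝ))
    hf.abs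
  simpa [hab] using h

theorem norm_sq_eq_integral {a b : ℝ} (hab : a ≤ b)
    (f : Lp ℝ 2 (volume.restrict (Ioc a b))) : ‖f‖ ^ 2 = ∫ x in a..b, f x ^ 2 := by
  rw [intervalIntegral.integral_of_le hab, ← real_inner_self_eq_norm_sq, L2.inner_def]
  simp [pow_two]

theorem intervalIntegrable_of_memLp {f : ℝ → ℝ} {a b : ℝ} (hab : a ≤ b)
    (hf : MemLp f 2 (volume.restrict (Ioc a b))) : IntervalIntegrable f volume a b := by
  rw [intervalIntegrable_iff_integrableOn_Ioc_of_le hab]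
  exact hf.integrable one_le_two

theorem memLp_Ioc_mono {f : ℝ → ℝ} {a b c d : ℝ} (hf : MemLp f 2 (volume.restrict (Ioc a b)))
    (h : a ≤ c) (h' : d ≤ b) : MemLp f 2 (volume.restrict (Ioc c d)) :=
  hf.mono_measure (Measure.restrict_mono (Ioc_subset_Ioc h h') le_rfl)

theorem intervalIntegrable_sq {f : ℝ → ℝ} {a b : ℝ} (hab : a ≤ b)
    (hf : MemLp f 2 (volume.restrict (Ioc a b))) :
    IntervalIntegrable (fun x => f x ^ 2) volume a b := by
  rw [intervalIntegrable_iff_integrableOn_Ioc_of_le hab]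
  exact hf.integrable_sq

namespace ARZModel

theorem measurableSet_triangle (p : ARZModel) : MeasurableSet p.triangle :=
  ((isClosed_le continuous_const continuous_snd).inter
    ((isClosed_le continuous_snd continuous_fst).inter
      (isClosed_le continuous_fst continuous_const))).measurableSet

/-! ### Volterra operators with bounded kernels -/

section Volterra

variable {p : ARZModel} {K Kw Kv : ℝ → ℝ → ℝ} {M : ℝ} {w v : ℝ → ℝ}

theorem intervalIntegrable_kernel_mul (hK : ContinuousOn (Function.uncurry K) p.triangle)
    {f : ℝ → ℝ} (hf : MemLp f 2 (volume.restrict (Ioc 0 p.L))) {x : ℝ} (hx : x ∈ Icc 0 p.L) :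
    IntervalIntegrable (fun ξ => K x ξ * f ξ) volume 0 x := by
  have h1 := intervalIntegrable_of_memLp hx.1 (memLp_Ioc_mono hf le_rfl hx.2)
  refine h1.continuousOn_mul ?_
  rw [uIcc_of_le hx.1]
  exact hK.comp (by fun_prop : Continuous fun ξ : ℝ => (x, ξ)).continuousOn
    fun ξ hξ => ⟨hξ.1, hξ.2, hx.2⟩

/-- Extending the kernel by zero off the triangle makes the domain of integration independent of
`x`; measurability is then that of a parameter integral on a product space. -/
theorem aestronglyMeasurable_volterra (hK : ContinuousOn (Function.uncurry K) p.triangle)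
    {f : ℝ → ℝ} (hf : MemLp f 2 (volume.restrict (Ioc 0 p.L))) :
    AEStronglyMeasurable (fun x => ∫ ξ in (0 : ℝ)..x, K x ξ * f ξ)
      (volume.restrict (Ioc 0 p.L)) := by
  set μ := volume.restrict (Ioc 0 p.L)
  have h1 : AEStronglyMeasurable (p.triangle.indicator (Function.uncurry K)) (μ.prod μ) :=
    (aestronglyMeasurable_indicator_iff p.measurableSet_triangle).2
      (hK.aestronglyMeasurable p.measurableSet_triangle)
  have h2 : AEStronglyMeasurable
      (fun z : ℝ × ℝ => p.triangle.indicator (Function.uncurry K) z * f z.2) (μ.prod μ) :=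
    h1.mul hf.aestronglyMeasurable.comp_snd
  refine h2.integral_prod_right'.congr ?_
  rw [Filter.EventuallyEq, ae_restrict_iff' measurableSet_Ioc]
  refine Filter.Eventually.of_forall fun x hx => ?_
  simp only
  rw [intervalIntegral.integral_of_le hx.1.le]
  have : ∀ ξ ∈ Ioc 0 p.L, p.triangle.indicator (Function.uncurry K) (x, ξ) * f ξ
      = (Ioc 0 x).indicator (fun ξ => K x ξ * f ξ) ξ := by
    intro ξ hξ
    by_cases h : ξ ≤ x
    · rw [indicator_of_mem (show (x, ξ) ∈ p.triangle from ⟨hξ.1.le, h, hx.2⟩),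
        indicator_of_mem (show ξ ∈ Ioc 0 x from ⟨hξ.1, h⟩)]
      rfl
    · rw [indicator_of_notMem (fun h' => h h'.2.1), indicator_of_notMem (fun h' => h h'.2),
        zero_mul]
  rw [setIntegral_congr_fun measurableSet_Ioc this, setIntegral_indicator measurableSet_Ioc,
    inter_eq_self_of_subset_right (Ioc_subset_Ioc le_rfl hx.2)]

theorem abs_volterra_le (hK : ContinuousOn (Function.uncurry K) p.triangle)
    (hM : ∀ x ξ, (x, ξ) ∈ p.triangle → |K x ξ| ≤ M)
    {f : ℝ → ℝ} (hf : MemLp f 2 (volume.restrict (Ioc 0 p.L))) {x : ℝ} (hx : x ∈ Icc 0 p.L) :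
    |∫ ξ in (0 : ℝ)..x, K x ξ * f ξ| ≤ M * ∫ ξ in (0 : ℝ)..x, |f ξ| := by
  have h1 := intervalIntegrable_of_memLp hx.1 (memLp_Ioc_mono hf le_rfl hx.2)
  refine (intervalIntegral.abs_integral_le_integral_abs hx.1).trans ?_
  rw [← intervalIntegral.integral_const_mul]
  refine intervalIntegral.integral_mono_on hx.1
    (intervalIntegrable_kernel_mul hK hf hx).abs (h1.abs.const_mul M) fun ξ hξ => ?_
  rw [abs_mul]
  exact mul_le_mul_of_nonneg_right (hM x ξ ⟨hξ.1, hξ.2, hx.2⟩) (abs_nonneg _)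

theorem integral_abs_le_full {f : ℝ → ℝ} (hf : MemLp f 2 (volume.restrict (Ioc 0 p.L))) {x : ℝ}
    (hx : x ∈ Icc 0 p.L) : ∫ ξ in (0 : ℝ)..x, |f ξ| ≤ ∫ ξ in (0 : ℝ)..p.L, |f ξ| := by
  apply intervalIntegral.integral_mono_interval le_rfl hx.1 hx.2
  · exact Filter.Eventually.of_forall fun _ => abs_nonneg _
  · exact (intervalIntegrable_of_memLp p.L_pos.le hf).abs

theorem ae_abs_volterra_le (hM0 : 0 ≤ M) (hK : ContinuousOn (Function.uncurry K) p.triangle)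
    (hM : ∀ x ξ, (x, ξ) ∈ p.triangle → |K x ξ| ≤ M)
    {f : ℝ → ℝ} (hf : MemLp f 2 (volume.restrict (Ioc 0 p.L))) :
    ∀ᵐ x ∂volume.restrict (Ioc 0 p.L), ‖∫ ξ in (0 : ℝ)..x, K x ξ * f ξ‖
      ≤ M * ∫ ξ in (0 : ℝ)..p.L, |f ξ| := by
  rw [ae_restrict_iff' measurableSet_Ioc]
  refine Filter.Eventually.of_forall fun x hx => ?_
  have hx' : x ∈ Icc 0 p.L := ⟨hx.1.le, hx.2⟩
  exact (abs_volterra_le hK hM hf hx').trans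
    (mul_le_mul_of_nonneg_left (integral_abs_le_full hf hx') hM0)

theorem memLp_volterra (hM0 : 0 ≤ M) (hK : ContinuousOn (Function.uncurry K) p.triangle)
    (hM : ∀ x ξ, (x, ξ) ∈ p.triangle → |K x ξ| ≤ M)
    {f : ℝ → ℝ} (hf : MemLp f 2 (volume.restrict (Ioc 0 p.L))) :
    MemLp (fun x => ∫ ξ in (0 : ℝ)..x, K x ξ * f ξ) 2 (volume.restrict (Ioc 0 p.L)) :=
  MemLp.of_bound (aestronglyMeasurable_volterra hK hf) _ (ae_abs_volterra_le hM0 hK hM hf)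

/-- Standing assumptions on a pair of kernels: continuity on the triangle and a common bound. -/
structure BoundedKernels (p : ARZModel) (Kw Kv : ℝ → ℝ → ℝ) (M : ℝ) : Prop where
  nonneg : 0 ≤ M
  contW : ContinuousOn (Function.uncurry Kw) p.triangle
  contV : ContinuousOn (Function.uncurry Kv) p.triangle
  boundW : ∀ x ξ, (x, ξ) ∈ p.triangle → |Kw x ξ| ≤ M
  boundV : ∀ x ξ, (x, ξ) ∈ p.triangle → |Kv x ξ| ≤ M

variable (hK : p.BoundedKernels Kw Kv M) (hw : MemLp w 2 (volume.restrict (Ioc 0 p.L)))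
  (hv : MemLp v 2 (volume.restrict (Ioc 0 p.L)))

include hK hw hv

theorem BoundedKernels.memLp_backstep :
    MemLp (backstep Kw Kv w v) 2 (volume.restrict (Ioc 0 p.L)) :=
  (hv.sub (memLp_volterra hK.nonneg hK.contW hK.boundW hw)).sub
    (memLp_volterra hK.nonneg hK.contV hK.boundV hv)

theorem BoundedKernels.integral_backstep_sq_le :
    ∫ x in (0 : ℝ)..p.L, backstep Kw Kv w v x ^ 2 ≤ (3 + 3 * M ^ 2 * p.L ^ 2) *
      ((∫ x in (0 : ℝ)..p.L, w x ^ 2) + ∫ x in (0 : ℝ)..p.L, v x ^ 2) := by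
  have hL := p.L_pos
  set W := ∫ ξ in (0 : ℝ)..p.L, |w ξ|
  set Y := ∫ ξ in (0 : ℝ)..p.L, |v ξ|
  have hW : W ^ 2 ≤ (p.L - 0) * _ := sq_integral_abs_le hL.le hw
  have hY : Y ^ 2 ≤ (p.L - 0) * _ := sq_integral_abs_le hL.le hv
  have hb := intervalIntegrable_sq hL.le (hK.memLp_backstep hw hv)
  have hv2 := intervalIntegrable_sq hL.le hv
  have hw0 : 0 ≤ ∫ x in (0 : ℝ)..p.L, w x ^ 2 :=
    intervalIntegral.integral_nonneg hL.le fun _ _ => sq_nonneg _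
  calc ∫ x in (0 : ℝ)..p.L, backstep Kw Kv w v x ^ 2
      ≤ ∫ x in (0 : ℝ)..p.L, (3 * v x ^ 2 + 3 * M ^ 2 * (W ^ 2 + Y ^ 2)) := by
        refine intervalIntegral.integral_mono_on hL.le hb
          ((hv2.const_mul 3).add intervalIntegrable_const) fun x hx => ?_
        have e1 := (abs_volterra_le hK.contW hK.boundW hw hx).trans
          (mul_le_mul_of_nonneg_left (integral_abs_le_full hw hx) hK.nonneg)
        have e2 := (abs_volterra_le hK.contV hK.boundV hv hx).trans
          (mul_le_mul_of_nonneg_left (integral_abs_le_full hv hx) hK.nonneg)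
        have e3 := sq_le_sq' (abs_le.1 e1).1 (abs_le.1 e1).2
        have e4 := sq_le_sq' (abs_le.1 e2).1 (abs_le.1 e2).2
        unfold backstep
        set q1 := ∫ ξ in (0 : ℝ)..x, Kw x ξ * w ξ
        set q2 := ∫ ξ in (0 : ℝ)..x, Kv x ξ * v ξ
        nlinarith [sq_nonneg (v x + q1), sq_nonneg (v x + q2), sq_nonneg (q1 - q2)]
    _ = 3 * (∫ x in (0 : ℝ)..p.L, v x ^ 2) + p.L * (3 * M ^ 2 * (W ^ 2 + Y ^ 2)) := by
        rw [intervalIntegral.integral_add (hv2.const_mul 3) intervalIntegrable_const,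
          intervalIntegral.integral_const_mul, intervalIntegral.integral_const]
        simp
    _ ≤ _ := by
        have : p.L * (3 * M ^ 2) * (W ^ 2 + Y ^ 2) ≤ p.L * (3 * M ^ 2) * (p.L *
            ((∫ x in (0 : ℝ)..p.L, w x ^ 2) + ∫ x in (0 : ℝ)..p.L, v x ^ 2)) := by
          apply mul_le_mul_of_nonneg_left _ (by positivity)
          linarith
        nlinarith

/-- This is the boundedness of the inverse transform, obtained without an inverse kernel. In the
weighted norm `∫ exp (-g x) v²` the Volterra term in `v` accounts for at most half of the left-hand
side once `g` is large, and is absorbed there. -/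
theorem BoundedKernels.integral_sq_le :
    ∫ x in (0 : ℝ)..p.L, v x ^ 2 ≤
      Real.exp (6 * M ^ 2 * p.L * p.L) * (6 + 6 * M ^ 2 * p.L ^ 2) *
      ((∫ x in (0 : ℝ)..p.L, w x ^ 2) + ∫ x in (0 : ℝ)..p.L, backstep Kw Kv w v x ^ 2) := by
  have hL := p.L_pos
  have hM := hK.nonneg
  -- Chosen so that `3 M² exp (-g x) (∫₀ˣ |v|)² ≤ N / (2 L)`, which integrates to `N / 2`.
  set g := 6 * M ^ 2 * p.L with hg
  have hg0 : 0 ≤ g := by positivity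
  clear_value g
  set W := ∫ ξ in (0 : ℝ)..p.L, |w ξ|
  have hW : W ^ 2 ≤ (p.L - 0) * _ := sq_integral_abs_le hL.le hw
  set N := ∫ x in (0 : ℝ)..p.L, Real.exp (-(g * x)) * v x ^ 2 with hN
  set B := ∫ x in (0 : ℝ)..p.L, backstep Kw Kv w v x ^ 2 with hB
  have hB0 : 0 ≤ B := intervalIntegral.integral_nonneg hL.le fun _ _ => sq_nonneg _
  have hw0 : 0 ≤ ∫ x in (0 : ℝ)..p.L, w x ^ 2 :=
    intervalIntegral.integral_nonneg hL.le fun _ _ => sq_nonneg _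
  have hb := intervalIntegrable_sq hL.le (hK.memLp_backstep hw hv)
  have hv2 := intervalIntegrable_sq hL.le hv
  have hev : IntervalIntegrable (fun x => Real.exp (-(g * x)) * v x ^ 2) volume 0 p.L :=
    hv2.continuousOn_mul (by fun_prop)
  have hN0 : 0 ≤ N := intervalIntegral.integral_nonneg hL.le fun _ _ => by positivity
  -- pointwise weighted bound of the primitive of `|v|`
  have hprim : ∀ x ∈ Icc 0 p.L,
      g * (Real.exp (-(g * x)) * (∫ ξ in (0 : ℝ)..x, |v ξ|) ^ 2) ≤ N := by
    intro x hx
    have hvx := memLp_Ioc_mono hv le_rfl hx.2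
    have hEv : MemLp (fun ξ => Real.exp (-(g / 2 * ξ)) * |v ξ|) 2 (volume.restrict (Ioc 0 x)) := by
      refine MemLp.of_le_mul (c := 1) hvx ?_ ?_
      · exact (by fun_prop : Continuous fun ξ : ℝ => Real.exp (-(g / 2 * ξ))).aestronglyMeasurable.mul
          hvx.abs.aestronglyMeasurable
      · rw [ae_restrict_iff' measurableSet_Ioc]
        refine Filter.Eventually.of_forall fun ξ hξ => ?_
        rw [norm_mul, Real.norm_eq_abs |v ξ|, abs_abs]
        refine mul_le_mul_of_nonneg_right ?_ (abs_nonneg _)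
        rw [Real.norm_eq_abs, Real.abs_exp, Real.exp_le_one_iff]
        have := hξ.1
        have : 0 ≤ g / 2 * ξ := by positivity
        linarith
    have hE : MemLp (fun ξ => Real.exp (g / 2 * ξ)) 2 (volume.restrict (Ioc 0 x)) := by
      refine MemLp.of_bound (C := Real.exp (g / 2 * x))
        (by fun_prop : Continuous fun ξ : ℝ => Real.exp (g / 2 * ξ)).aestronglyMeasurable ?_
      rw [ae_restrict_iff' measurableSet_Ioc]
      refine Filter.Eventually.of_forall fun ξ hξ => ?_
      rw [Real.norm_eq_abs, Real.abs_exp, Real.exp_le_exp]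
      exact mul_le_mul_of_nonneg_left hξ.2 (by positivity)
    -- Cauchy–Schwarz with `|v| = exp (g ξ / 2) * (exp (-g ξ / 2) |v|)`; the first factor
    -- contributes `(exp (g x) - 1) / g`.
    have cs := sq_integral_mul_le hE hEv
    have e1 : ∀ ξ, Real.exp (g / 2 * ξ) * (Real.exp (-(g / 2 * ξ)) * |v ξ|) = |v ξ| := fun ξ => by
      rw [← mul_assoc, ← Real.exp_add]; simp
    have e2 : ∀ ξ, Real.exp (g / 2 * ξ) ^ 2 = Real.exp (g * ξ) := fun ξ => by
      rw [← Real.exp_nat_mul]; congr 1; push_cast; ring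
    have e3 : ∀ ξ, (Real.exp (-(g / 2 * ξ)) * |v ξ|) ^ 2 = Real.exp (-(g * ξ)) * v ξ ^ 2 :=
      fun ξ => by
        rw [mul_pow, sq_abs, ← Real.exp_nat_mul]; congr 2; push_cast; ring
    simp_rw [e1, e2, e3] at cs
    rw [← intervalIntegral.integral_of_le hx.1, ← intervalIntegral.integral_of_le hx.1,
      ← intervalIntegral.integral_of_le hx.1] at cs
    have e4 : g * ∫ ξ in (0 : ℝ)..x, Real.exp (g * ξ) = Real.exp (g * x) - 1 := by
      rw [← intervalIntegral.integral_const_mul]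
      have := intervalIntegral.integral_eq_sub_of_hasDerivAt (a := 0) (b := x)
        (f := fun ξ => Real.exp (g * ξ)) (f' := fun ξ => g * Real.exp (g * ξ)) (fun ξ _ => by
          refine ((hasDerivAt_id ξ).const_mul g).exp.congr_deriv ?_
          simp; ring) (Continuous.intervalIntegrable (by fun_prop) _ _)
      rw [this]; simp
    have e5 : ∫ ξ in (0 : ℝ)..x, Real.exp (-(g * ξ)) * v ξ ^ 2 ≤ N :=
      intervalIntegral.integral_mono_interval le_rfl hx.1 hx.2
        (Filter.Eventually.of_forall fun _ => by simp only [Pi.zero_apply]; positivity) hev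
    have e6 : g * (∫ ξ in (0 : ℝ)..x, |v ξ|) ^ 2 ≤ (Real.exp (g * x) - 1) * N := by
      rw [← e4, mul_assoc]
      refine mul_le_mul_of_nonneg_left (cs.trans ?_) hg0
      refine mul_le_mul_of_nonneg_left e5 ?_
      exact intervalIntegral.integral_nonneg hx.1 fun _ _ => (Real.exp_pos _).le
    have e7 : Real.exp (-(g * x)) * Real.exp (g * x) = 1 := by rw [← Real.exp_add]; simp
    have e8 := Real.exp_pos (-(g * x))
    have := mul_le_mul_of_nonneg_left e6 e8.le
    nlinarith
  have hNle : N ≤ 6 * B + 6 * M ^ 2 * p.L * W ^ 2 := by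
    have hpt : ∀ x ∈ Icc 0 p.L, Real.exp (-(g * x)) * v x ^ 2 ≤
        3 * backstep Kw Kv w v x ^ 2 + (3 * M ^ 2 * W ^ 2 + N / (2 * p.L)) := by
      intro x hx
      have e1 := (abs_volterra_le hK.contW hK.boundW hw hx).trans
        (mul_le_mul_of_nonneg_left (integral_abs_le_full hw hx) hK.nonneg)
      have e2 := abs_volterra_le hK.contV hK.boundV hv hx
      have e3 := sq_le_sq' (abs_le.1 e1).1 (abs_le.1 e1).2
      have e4 := sq_le_sq' (abs_le.1 e2).1 (abs_le.1 e2).2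
      have e5 := hprim x hx
      have hvb : v x = backstep Kw Kv w v x + (∫ ξ in (0 : ℝ)..x, Kw x ξ * w ξ)
          + ∫ ξ in (0 : ℝ)..x, Kv x ξ * v ξ := by unfold backstep; ring
      set q1 := ∫ ξ in (0 : ℝ)..x, Kw x ξ * w ξ
      set q2 := ∫ ξ in (0 : ℝ)..x, Kv x ξ * v ξ
      set h := ∫ ξ in (0 : ℝ)..x, |v ξ|
      set b := backstep Kw Kv w v x
      have e6 : v x ^ 2 ≤ 3 * b ^ 2 + 3 * M ^ 2 * W ^ 2 + 3 * M ^ 2 * h ^ 2 := by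
        rw [hvb]
        nlinarith [sq_nonneg (b - q1), sq_nonneg (b - q2), sq_nonneg (q1 - q2)]
      have e7 : Real.exp (-(g * x)) ≤ 1 := by
        rw [Real.exp_le_one_iff]
        have := mul_nonneg hg0 hx.1
        linarith
      have e8 := Real.exp_pos (-(g * x))
      have e9 : Real.exp (-(g * x)) * (3 * M ^ 2 * h ^ 2) ≤ N / (2 * p.L) := by
        rw [le_div_iff₀ (by positivity)]
        calc _ = g * (Real.exp (-(g * x)) * h ^ 2) := by rw [hg]; ring
          _ ≤ N := e5
      calc Real.exp (-(g * x)) * v x ^ 2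
          ≤ Real.exp (-(g * x)) * (3 * b ^ 2 + 3 * M ^ 2 * W ^ 2 + 3 * M ^ 2 * h ^ 2) :=
            mul_le_mul_of_nonneg_left e6 e8.le
        _ = Real.exp (-(g * x)) * (3 * b ^ 2 + 3 * M ^ 2 * W ^ 2)
            + Real.exp (-(g * x)) * (3 * M ^ 2 * h ^ 2) := by ring
        _ ≤ 1 * (3 * b ^ 2 + 3 * M ^ 2 * W ^ 2) + N / (2 * p.L) :=
            add_le_add (mul_le_mul_of_nonneg_right e7 (by positivity)) e9
        _ = _ := by ring
    have := intervalIntegral.integral_mono_on hL.le hev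
      ((hb.const_mul 3).add intervalIntegrable_const) hpt
    rw [intervalIntegral.integral_add (hb.const_mul 3) intervalIntegrable_const,
      intervalIntegral.integral_const_mul, intervalIntegral.integral_const, ← hN, ← hB] at this
    have e : (p.L - 0) • (3 * M ^ 2 * W ^ 2 + N / (2 * p.L))
        = 3 * M ^ 2 * p.L * W ^ 2 + N / 2 := by
      rw [smul_eq_mul]; field_simp; ring
    rw [e] at this
    linarith
  have hvN : ∫ x in (0 : ℝ)..p.L, v x ^ 2 ≤ Real.exp (g * p.L) * N := by
    rw [hN, ← intervalIntegral.integral_const_mul]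
    refine intervalIntegral.integral_mono_on hL.le hv2 (hev.const_mul _) fun x hx => ?_
    rw [← mul_assoc, ← Real.exp_add]
    refine le_mul_of_one_le_left (sq_nonneg _) (Real.one_le_exp ?_)
    have := mul_le_mul_of_nonneg_left hx.2 hg0
    linarith
  refine hvN.trans ?_
  rw [mul_assoc]
  refine mul_le_mul_of_nonneg_left ?_ (Real.exp_pos _).le
  have : 6 * M ^ 2 * p.L * W ^ 2 ≤ 6 * M ^ 2 * p.L * (p.L * ∫ x in (0 : ℝ)..p.L, w x ^ 2) := by
    apply mul_le_mul_of_nonneg_left _ (by positivity)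
    linarith
  nlinarith [mul_nonneg (by positivity : 0 ≤ 6 * M ^ 2 * p.L ^ 2) hB0]

end Volterra

/-- The functional `lyapunov` is equivalent to the square of the `L²` norm, with constants that
depend on the kernels through their bound only. -/
theorem exists_lyapunov_bounds (p : ARZModel) {ν a M : ℝ} (hν : 0 < ν) (ha : 0 < a) :
    ∃ k > 0, ∃ k' > 0, ∀ Kw Kv, p.BoundedKernels Kw Kv M → ∀ w v : p.StateL2,
      k * (‖w‖ ^ 2 + ‖v‖ ^ 2) ≤ p.lyapunov ν a Kw Kv w v ∧
      p.lyapunov ν a Kw Kv w v ≤ k' * (‖w‖ ^ 2 + ‖v‖ ^ 2) := by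
  have hL := p.L_pos
  have h1 := p.lam1_pos
  have h2 := p.lam2_pos
  set D := 3 + 3 * M ^ 2 * p.L ^ 2 with hD
  set E := Real.exp (6 * M ^ 2 * p.L * p.L) * (6 + 6 * M ^ 2 * p.L ^ 2) with hE
  have hD0 : 0 < D := by positivity
  have hE0 : 0 < E := by positivity
  set m := min (Real.exp (-(ν / p.lam1) * p.L) / p.lam1)
    (a * (Real.exp (-(ν / p.lam2) * p.L) / p.lam2)) with hm
  have hm0 : 0 < m := lt_min (by positivity) (by positivity)
  set m' := max (1 / p.lam1) (a * (1 / p.lam2)) with hm'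
  have hm'0 : 0 < m' := lt_max_of_lt_left (by positivity)
  -- Writing `W`, `Y`, `B` for the squared norms of `w`, `v` and the transform, `Y ≤ E (W + B)`
  -- gives `W + Y ≤ (1 + E) (W + B)`, and `B ≤ D (W + Y)` gives `W + B ≤ (1 + D) (W + Y)`.
  refine ⟨m / (1 + E), by positivity, m' * (1 + D), by positivity, fun Kw Kv hK w v => ?_⟩
  have hw := Lp.memLp w
  have hv := Lp.memLp v
  rw [norm_sq_eq_integral hL.le, norm_sq_eq_integral hL.le]
  have hb := hK.memLp_backstep hw hv
  have i1 := hK.integral_backstep_sq_le hw hv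
  have i2 := hK.integral_sq_le hw hv
  have hw2 := intervalIntegrable_sq hL.le hw
  have hb2 := intervalIntegrable_sq hL.le hb
  rw [← hD] at i1
  rw [← hE] at i2
  set W := ∫ x in (0 : ℝ)..p.L, w x ^ 2
  set Y := ∫ x in (0 : ℝ)..p.L, v x ^ 2
  set B := ∫ x in (0 : ℝ)..p.L, backstep Kw Kv w v x ^ 2 with hB
  have hW0 : 0 ≤ W := intervalIntegral.integral_nonneg hL.le fun _ _ => sq_nonneg _
  have hY0 : 0 ≤ Y := intervalIntegral.integral_nonneg hL.le fun _ _ => sq_nonneg _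
  have hB0 : 0 ≤ B := intervalIntegral.integral_nonneg hL.le fun _ _ => sq_nonneg _
  have hint : IntervalIntegrable (fun x => Real.exp (-(ν / p.lam1) * x) / p.lam1 * w x ^ 2
      + a * (Real.exp (-(ν / p.lam2) * x) / p.lam2) * backstep Kw Kv w v x ^ 2) volume 0 p.L :=
    (hw2.continuousOn_mul (by fun_prop)).add (hb2.continuousOn_mul (by fun_prop))
  have exp_le : ∀ {l x : ℝ}, 0 < l → x ∈ Icc 0 p.L →
      Real.exp (-(ν / l) * p.L) ≤ Real.exp (-(ν / l) * x) ∧ Real.exp (-(ν / l) * x) ≤ 1 := by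
    intro l x hl hx
    have : 0 < ν / l := by positivity
    rw [Real.exp_le_exp, Real.exp_le_one_iff]
    exact ⟨by nlinarith [hx.2], by nlinarith [hx.1]⟩
  have lo : m * (W + B) ≤ p.lyapunov ν a Kw Kv w v := by
    rw [mul_add, ← intervalIntegral.integral_const_mul, hB, ← intervalIntegral.integral_const_mul,
      ← intervalIntegral.integral_add (hw2.const_mul _) (hb2.const_mul _)]
    refine intervalIntegral.integral_mono_on hL.le
      ((hw2.const_mul _).add (hb2.const_mul _)) hint fun x hx => ?_
    refine add_le_add (mul_le_mul_of_nonneg_right ((min_le_left _ _).trans ?_) (sq_nonneg _))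
      (mul_le_mul_of_nonneg_right ((min_le_right _ _).trans ?_) (sq_nonneg _))
    · have := (exp_le h1 hx).1
      gcongr
    · have := (exp_le h2 hx).1
      gcongr
  have up : p.lyapunov ν a Kw Kv w v ≤ m' * (W + B) := by
    rw [mul_add, ← intervalIntegral.integral_const_mul, hB, ← intervalIntegral.integral_const_mul,
      ← intervalIntegral.integral_add (hw2.const_mul _) (hb2.const_mul _)]
    refine intervalIntegral.integral_mono_on hL.le hint
      ((hw2.const_mul _).add (hb2.const_mul _)) fun x hx => ?_
    refine add_le_add (mul_le_mul_of_nonneg_right (le_trans ?_ (le_max_left _ _)) (sq_nonneg _))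
      (mul_le_mul_of_nonneg_right (le_trans ?_ (le_max_right _ _)) (sq_nonneg _))
    · have := (exp_le h1 hx).2
      gcongr
    · have := (exp_le h2 hx).2
      gcongr
  constructor
  · refine le_trans ?_ lo
    rw [div_mul_eq_mul_div, div_le_iff₀ (by positivity), mul_assoc]
    refine mul_le_mul_of_nonneg_left ?_ hm0.le
    nlinarith
  · refine up.trans ?_
    rw [mul_assoc]
    refine mul_le_mul_of_nonneg_left ?_ hm'0.le
    nlinarith

end ARZModel

/-- Exchange of the order of integration on a triangle. -/
theorem integral_primitive_mul {f h : ℝ → ℝ} {L : ℝ} (hL : 0 ≤ L)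
    (hf : IntervalIntegrable f volume 0 L) (hh : IntervalIntegrable h volume 0 L) :
    ∫ x in (0 : ℝ)..L, (∫ ξ in (0 : ℝ)..x, f ξ) * h x
      = ∫ ξ in (0 : ℝ)..L, f ξ * ∫ x in ξ..L, h x := by
  rw [intervalIntegrable_iff_integrableOn_Ioc_of_le hL] at hf hh
  set μ := volume.restrict (Ioc 0 L)
  set F : ℝ → ℝ → ℝ := fun x ξ => {z : ℝ × ℝ | z.2 ≤ z.1}.indicator (fun z => h z.1 * f z.2) (x, ξ)
  have hm : MeasurableSet {z : ℝ × ℝ | z.2 ≤ z.1} := measurableSet_le measurable_snd measurable_fst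
  have hF : Integrable (Function.uncurry F) (μ.prod μ) := (hh.mul_prod hf).indicator hm
  have key := integral_integral_swap hF
  rw [intervalIntegral.integral_of_le hL, intervalIntegral.integral_of_le hL]
  calc _ = ∫ x, ∫ ξ, F x ξ ∂μ ∂μ := by
        refine setIntegral_congr_fun measurableSet_Ioc fun x hx => ?_
        have : ∀ ξ ∈ Ioc 0 L, F x ξ = (Iic x).indicator (fun ξ => h x * f ξ) ξ := fun ξ _ => rfl
        rw [setIntegral_congr_fun measurableSet_Ioc this, setIntegral_indicator measurableSet_Iic,
          intervalIntegral.integral_of_le hx.1.le, mul_comm, ← integral_const_mul,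
          show Ioc 0 L ∩ Iic x = Ioc 0 x from
            Subset.antisymm (fun ξ h => ⟨h.1.1, h.2⟩) fun ξ h => ⟨⟨h.1, h.2.trans hx.2⟩, h.2⟩]
    _ = _ := key
    _ = _ := by
        refine setIntegral_congr_fun measurableSet_Ioc fun ξ hξ => ?_
        have : ∀ x ∈ Ioc 0 L, F x ξ = (Ici ξ).indicator (fun x => h x * f ξ) x := fun x _ => rfl
        rw [setIntegral_congr_fun measurableSet_Ioc this, setIntegral_indicator measurableSet_Ici,
          intervalIntegral.integral_of_le hξ.2, mul_comm, ← integral_mul_const,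
          ← integral_Icc_eq_integral_Ioc,
          show Ioc 0 L ∩ Ici ξ = Icc ξ L from
            Subset.antisymm (fun x h => ⟨h.2, h.1.2⟩) fun x h => ⟨⟨hξ.1.trans_le h.1, h.2⟩, h.1⟩]

theorem memLp_of_continuousOn {k : ℝ → ℝ} {a b : ℝ} (hk : ContinuousOn k (Icc a b)) :
    MemLp k 2 (volume.restrict (Ioc a b)) := by
  obtain ⟨C, hC⟩ := isCompact_Icc.exists_bound_of_continuousOn hk
  refine MemLp.of_bound ((hk.mono Ioc_subset_Icc_self).aestronglyMeasurable measurableSet_Ioc) C ?_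
  rw [ae_restrict_iff' measurableSet_Ioc]
  exact Filter.Eventually.of_forall fun x hx => hC x ⟨hx.1.le, hx.2⟩

theorem continuous_integral_mul {k : ℝ → ℝ} {a b : ℝ} (hab : a ≤ b)
    (hk : ContinuousOn k (Icc a b)) :
    Continuous fun f : Lp ℝ 2 (volume.restrict (Ioc a b)) => ∫ x in a..b, k x * f x := by
  have h := memLp_of_continuousOn hk
  have : ∀ f : Lp ℝ 2 (volume.restrict (Ioc a b)),
      ∫ x in a..b, k x * f x = inner ℝ (h.toLp k) f := by
    intro f
    rw [L2.inner_def, intervalIntegral.integral_of_le hab]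
    refine integral_congr_ae ?_
    filter_upwards [h.coeFn_toLp] with x hx
    simp [hx, mul_comm]
  simp_rw [this]
  fun_prop

/-! ### Exact kernels, discrepancy of the feedback, and the exact transform -/

namespace ARZModel

/-- The first exact backstepping kernel. -/
noncomputable def exactW (p : ARZModel) (_ ξ : ℝ) : ℝ := -(p.gain * Real.exp (-(p.kap * ξ)))

/-- The second exact backstepping kernel. -/
noncomputable def exactV (p : ARZModel) (_ _ : ℝ) : ℝ := p.gain

theorem boundedKernels_exact (p : ARZModel) :
    p.BoundedKernels p.exactW p.exactV |p.gain| := by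
  have := p.exists_isKernelPair
  refine ⟨abs_nonneg _, this.contDiffOn_w.continuousOn, this.contDiffOn_v.continuousOn,
    fun x ξ h => ?_, fun _ _ _ => le_rfl⟩
  rw [exactW, abs_neg, abs_mul, Real.abs_exp]
  refine mul_le_of_le_one_right (abs_nonneg _) (Real.exp_le_one_iff.2 ?_)
  have := mul_nonneg p.kap_pos.le h.1
  simpa using this

/-- The difference between a feedback law and the exact one. -/
noncomputable def discrepancy (p : ARZModel) (Kw Kv : ℝ → ℝ → ℝ) (w v : ℝ → ℝ) : ℝ :=
  p.feedback Kw Kv w v - p.feedback p.exactW p.exactV w v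

theorem mem_triangle_L (p : ARZModel) {ξ : ℝ} (hξ : ξ ∈ Icc 0 p.L) : (p.L, ξ) ∈ p.triangle :=
  ⟨hξ.1, hξ.2, le_rfl⟩

theorem continuousOn_kernel_L {p : ARZModel} {K : ℝ → ℝ → ℝ}
    (hK : ContinuousOn (Function.uncurry K) p.triangle) : ContinuousOn (K p.L) (Icc 0 p.L) :=
  hK.comp (by fun_prop : Continuous fun ξ : ℝ => (p.L, ξ)).continuousOn
    fun _ hξ => p.mem_triangle_L hξ

theorem BoundedKernels.continuousOn_feedback {p : ARZModel} {Kw Kv : ℝ → ℝ → ℝ} {M : ℝ}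
    (hK : p.BoundedKernels Kw Kv M) {w v : ℝ → p.StateL2} {s : Set ℝ} (hw : ContinuousOn w s)
    (hv : ContinuousOn v s) : ContinuousOn (fun t => p.feedback Kw Kv (w t) (v t)) s :=
  ((continuous_integral_mul p.L_pos.le (continuousOn_kernel_L hK.contW)).comp_continuousOn hw).add
    ((continuous_integral_mul p.L_pos.le (continuousOn_kernel_L hK.contV)).comp_continuousOn hv)

/-- The feedback gains of the two kernels deviate by at most `ε` from the exact ones. -/
def GainsClose (p : ARZModel) (ε : ℝ) (Kw Kv : ℝ → ℝ → ℝ) : Prop :=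
  ∀ ξ ∈ Icc 0 p.L, |Kw p.L ξ - p.exactW p.L ξ| ≤ ε ∧ |Kv p.L ξ - p.exactV p.L ξ| ≤ ε

theorem discrepancy_eq {p : ARZModel} {Kw Kv : ℝ → ℝ → ℝ} {M : ℝ}
    (hK : p.BoundedKernels Kw Kv M) {w v : ℝ → ℝ} (hw : IntervalIntegrable w volume 0 p.L)
    (hv : IntervalIntegrable v volume 0 p.L) :
    p.discrepancy Kw Kv w v = (∫ ξ in (0 : ℝ)..p.L, (Kw p.L ξ - p.exactW p.L ξ) * w ξ)
      + ∫ ξ in (0 : ℝ)..p.L, (Kv p.L ξ - p.exactV p.L ξ) * v ξ := by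
  have hu := uIcc_of_le p.L_pos.le
  have hE := p.boundedKernels_exact
  have i : ∀ {K f}, ContinuousOn (Function.uncurry K) p.triangle →
      IntervalIntegrable f volume 0 p.L → IntervalIntegrable (fun ξ => K p.L ξ * f ξ) volume 0 p.L :=
    fun h1 h2 => h2.continuousOn_mul (by rw [hu]; exact continuousOn_kernel_L h1)
  simp only [sub_mul]
  rw [intervalIntegral.integral_sub (i hK.contW hw) (i hE.contW hw),
    intervalIntegral.integral_sub (i hK.contV hv) (i hE.contV hv), discrepancy, feedback, feedback]
  ring

theorem abs_discrepancy_le {p : ARZModel} {Kw Kv : ℝ → ℝ → ℝ} {M ε : ℝ}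
    (hK : p.BoundedKernels Kw Kv M) (hε : p.GainsClose ε Kw Kv) {w v : ℝ → ℝ}
    (hw : IntervalIntegrable w volume 0 p.L) (hv : IntervalIntegrable v volume 0 p.L) :
    |p.discrepancy Kw Kv w v| ≤
      ε * ((∫ ξ in (0 : ℝ)..p.L, |w ξ|) + ∫ ξ in (0 : ℝ)..p.L, |v ξ|) := by
  have hL := p.L_pos.le
  have hu := uIcc_of_le hL
  have hE := p.boundedKernels_exact
  have key : ∀ {k f : ℝ → ℝ}, ContinuousOn k (Icc 0 p.L) → (∀ ξ ∈ Icc 0 p.L, |k ξ| ≤ ε) →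
      IntervalIntegrable f volume 0 p.L →
      |∫ ξ in (0 : ℝ)..p.L, k ξ * f ξ| ≤ ε * ∫ ξ in (0 : ℝ)..p.L, |f ξ| := by
    intro k f h1 h2 h3
    refine (intervalIntegral.abs_integral_le_integral_abs hL).trans ?_
    rw [← intervalIntegral.integral_const_mul]
    refine intervalIntegral.integral_mono_on hL (h3.continuousOn_mul (by rwa [hu])).abs
      (h3.abs.const_mul ε) fun ξ hξ => ?_
    rw [abs_mul]
    exact mul_le_mul_of_nonneg_right (h2 ξ hξ) (abs_nonneg _)
  rw [discrepancy_eq hK hw hv, mul_add]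
  refine (abs_add_le _ _).trans (add_le_add ?_ ?_)
  · exact key ((continuousOn_kernel_L hK.contW).sub (continuousOn_kernel_L hE.contW))
      (fun ξ hξ => (hε ξ hξ).1) hw
  · exact key ((continuousOn_kernel_L hK.contV).sub (continuousOn_kernel_L hE.contV))
      (fun ξ hξ => (hε ξ hξ).2) hv

theorem discrepancy_sq_le {p : ARZModel} {Kw Kv : ℝ → ℝ → ℝ} {M ε : ℝ}
    (hK : p.BoundedKernels Kw Kv M) (hε : p.GainsClose ε Kw Kv) {w v : ℝ → ℝ}
    (hw : MemLp w 2 (volume.restrict (Ioc 0 p.L)))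
    (hv : MemLp v 2 (volume.restrict (Ioc 0 p.L))) :
    p.discrepancy Kw Kv w v ^ 2 ≤ 2 * ε ^ 2 * p.L *
      ((∫ ξ in (0 : ℝ)..p.L, w ξ ^ 2) + ∫ ξ in (0 : ℝ)..p.L, v ξ ^ 2) := by
  have hL := p.L_pos.le
  have h := abs_discrepancy_le hK hε (intervalIntegrable_of_memLp hL hw)
    (intervalIntegrable_of_memLp hL hv)
  have h1 := sq_integral_abs_le hL hw
  have h2 := sq_integral_abs_le hL hv
  have h3 := sq_le_sq' (abs_le.1 h).1 (abs_le.1 h).2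
  rw [sub_zero] at h1 h2
  set W := ∫ ξ in (0 : ℝ)..p.L, |w ξ|
  set Y := ∫ ξ in (0 : ℝ)..p.L, |v ξ|
  calc _ ≤ _ := h3
    _ ≤ 2 * ε ^ 2 * (W ^ 2 + Y ^ 2) := by nlinarith [mul_nonneg (sq_nonneg ε) (sq_nonneg (W - Y))]
    _ ≤ 2 * ε ^ 2 * (p.L * (∫ ξ in (0 : ℝ)..p.L, w ξ ^ 2)
          + p.L * ∫ ξ in (0 : ℝ)..p.L, v ξ ^ 2) := by gcongr
    _ = _ := by ring

/-- The exact backstepping transform of `(w, v)`. -/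
noncomputable def target (p : ARZModel) (w v : ℝ → ℝ) : ℝ → ℝ := backstep p.exactW p.exactV w v

/-- Neither exact kernel depends on `x`, so the two Volterra integrals merge into the primitive of
one function. -/
theorem target_eq {p : ARZModel} {w v : ℝ → ℝ} (hw : IntervalIntegrable w volume 0 p.L)
    (hv : IntervalIntegrable v volume 0 p.L) {x : ℝ} (hx : x ∈ Icc 0 p.L) :
    p.target w v x
      = v x - p.gain * ∫ ξ in (0 : ℝ)..x, (v ξ - Real.exp (-(p.kap * ξ)) * w ξ) := by
  have hs : uIcc 0 x ⊆ uIcc 0 p.L := by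
    rw [uIcc_of_le hx.1, uIcc_of_le p.L_pos.le]; exact Icc_subset_Icc le_rfl hx.2
  have hw' := hw.mono_set hs
  have hv' := hv.mono_set hs
  rw [target, backstep, intervalIntegral.integral_sub hv'
    (hw'.continuousOn_mul (Continuous.continuousOn (by fun_prop)))]
  simp only [exactW, exactV, neg_mul, mul_assoc]
  rw [intervalIntegral.integral_neg, intervalIntegral.integral_const_mul,
    intervalIntegral.integral_const_mul]
  ring

/-- The adjoint of the exact transform, by exchanging the order of integration. It converts test
functions in the transformed coordinates into test functions in the original ones. -/
theorem integral_target_mul {p : ARZModel} {w v h : ℝ → ℝ}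
    (hw : IntervalIntegrable w volume 0 p.L) (hv : IntervalIntegrable v volume 0 p.L)
    (hh : Continuous h) :
    ∫ x in (0 : ℝ)..p.L, p.target w v x * h x = (∫ x in (0 : ℝ)..p.L, v x * h x)
      - ∫ x in (0 : ℝ)..p.L,
          (v x - Real.exp (-(p.kap * x)) * w x) * (p.gain * ∫ y in x..p.L, h y) := by
  have hL := p.L_pos.le
  set u : ℝ → ℝ := fun ξ => v ξ - Real.exp (-(p.kap * ξ)) * w ξ with hu
  have hui : IntervalIntegrable u volume 0 p.L :=
    hv.sub (hw.continuousOn_mul (Continuous.continuousOn (by fun_prop)))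
  have hprim : ContinuousOn (fun x => ∫ ξ in (0 : ℝ)..x, u ξ) (uIcc 0 p.L) :=
    intervalIntegral.continuousOn_primitive_interval' hui left_mem_uIcc
  have e1 : ∫ x in (0 : ℝ)..p.L, p.target w v x * h x
      = ∫ x in (0 : ℝ)..p.L, (v x * h x - p.gain * ((∫ ξ in (0 : ℝ)..x, u ξ) * h x)) := by
    refine intervalIntegral.integral_congr fun x hx => ?_
    rw [uIcc_of_le hL] at hx
    rw [target_eq hw hv hx]; ring
  have hq : IntervalIntegrable (fun x => (∫ ξ in (0 : ℝ)..x, u ξ) * h x) volume 0 p.L :=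
    (hprim.mul hh.continuousOn).intervalIntegrable
  rw [e1, intervalIntegral.integral_sub (hv.mul_continuousOn hh.continuousOn) (hq.const_mul _),
    intervalIntegral.integral_const_mul,
    integral_primitive_mul hL hui (hh.intervalIntegrable _ _), ← intervalIntegral.integral_const_mul]
  congr 1
  refine intervalIntegral.integral_congr fun x _ => ?_
  ring

/-! ### Weak solutions tested along characteristics -/

/-- The weak formulation of the closed loop, tested with functions that are transported along the
characteristics in the coordinates `(w, target w v)`. -/
theorem IsL2Solution.transport_identity {p : ARZModel} {Kw Kv : ℝ → ℝ → ℝ}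
    {w₀ v₀ : p.StateL2} {w v : ℝ → p.StateL2} (hs : p.IsL2Solution Kw Kv w₀ v₀ w v)
    {T : ℝ} (hT : 0 < T) {g : ℝ → ℝ} (hg : ContDiff ℝ 1 g)
    (hgT : ∀ y ∈ Icc (p.L - p.lam1 * T) p.L, g y = 0) :
    (∫ x in (0 : ℝ)..p.L, w T x * g (x - p.lam1 * T))
        - (∫ x in (0 : ℝ)..p.L, p.target (w T) (v T) x * g (-((x + p.lam2 * T) / p.r)))
      = (∫ x in (0 : ℝ)..p.L, w₀ x * g x) - (∫ x in (0 : ℝ)..p.L, p.target w₀ v₀ x * g (-(x / p.r)))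
        - p.lam2 * ∫ t in (0 : ℝ)..T,
            g (-((p.L + p.lam2 * t) / p.r)) * p.discrepancy Kw Kv (w t) (v t) := by
  have hL := p.L_pos
  have hr := p.r_pos
  have hrl := p.r_mul_lam1
  have hr0 := hr.ne'
  set G : ℝ → ℝ := fun x => ∫ y in (0 : ℝ)..x, g y with hG
  have hG' : ∀ x, HasDerivAt G (g x) x := fun x =>
    (hg.continuous.integral_hasStrictDerivAt 0 x).hasDerivAt
  have hGc : ContDiff ℝ 1 G := by
    rw [contDiff_one_iff_deriv]
    refine ⟨fun x => (hG' x).differentiableAt, ?_⟩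
    rw [show deriv G = g from funext fun x => (hG' x).deriv]
    exact hg.continuous
  -- Minus the tail integral, from `x` to `L`, of `gain` times the left-moving test function,
  -- written with the primitive `G` so that it is visibly `C¹`.
  set Ψ : ℝ → ℝ → ℝ := fun x t =>
    p.gain * p.r * (G (-((p.L + p.lam2 * t) / p.r)) - G (-((x + p.lam2 * t) / p.r))) with hΨ
  -- The pair `(φ, ψ)` is the image, under the adjoint of the exact transform, of the pair `g (x -
  -- λ₁ t)`, `-g (-(x + λ₂ t) / r)`. Both components of the latter are constant along their
  -- characteristics.
  set φ : ℝ → ℝ → ℝ := fun x t => g (x - p.lam1 * t) + Real.exp (-(p.kap * x)) * Ψ x t with hφ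
  set ψ : ℝ → ℝ → ℝ := fun x t => -g (-((x + p.lam2 * t) / p.r)) - Ψ x t with hψ
  have hφc : ContDiff ℝ 1 (Function.uncurry φ) := by
    simp only [hφ, hΨ]; unfold Function.uncurry; fun_prop
  have hψc : ContDiff ℝ 1 (Function.uncurry ψ) := by
    simp only [hψ, hΨ]; unfold Function.uncurry; fun_prop
  have hΨL : ∀ t, Ψ p.L t = 0 := fun t => by simp [hΨ]
  -- the integral of the second transported test function
  have hΨint : ∀ t x, p.gain * ∫ y in x..p.L, g (-((y + p.lam2 * t) / p.r)) = -Ψ x t := by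
    intro t x
    have := intervalIntegral.integral_eq_sub_of_hasDerivAt (a := x) (b := p.L)
      (f := fun y => -p.r * G (-((y + p.lam2 * t) / p.r)))
      (f' := fun y => g (-((y + p.lam2 * t) / p.r))) (fun y _ => by
        have := ((hG' _).comp y
          (((hasDerivAt_id y).add_const (p.lam2 * t)).div_const p.r).neg).const_mul (-p.r)
        refine this.congr_deriv ?_
        simp only [id, Pi.neg_apply]; field_simp) (Continuous.intervalIntegrable (by
          have := hg.continuous; fun_prop) _ _)
    rw [this]; simp only [hΨ]; ring
  have hpair : ∀ (w v : p.StateL2) (t : ℝ),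
      ∫ x in (0 : ℝ)..p.L, (w x * φ x t + v x * ψ x t)
        = (∫ x in (0 : ℝ)..p.L, w x * g (x - p.lam1 * t))
          - ∫ x in (0 : ℝ)..p.L, p.target w v x * g (-((x + p.lam2 * t) / p.r)) := by
    intro w v t
    have hw := intervalIntegrable_of_memLp hL.le (Lp.memLp w)
    have hv := intervalIntegrable_of_memLp hL.le (Lp.memLp v)
    have hgc := hg.continuous
    have hGc' := hGc.continuous
    rw [integral_target_mul hw hv (by fun_prop)]
    simp_rw [hΨint t]
    have i1 : IntervalIntegrable (fun x => w x * g (x - p.lam1 * t)) volume 0 p.L :=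
      hw.mul_continuousOn (Continuous.continuousOn (by fun_prop))
    have i2 : IntervalIntegrable (fun x => v x * g (-((x + p.lam2 * t) / p.r))) volume 0 p.L :=
      hv.mul_continuousOn (Continuous.continuousOn (by fun_prop))
    have i3 : IntervalIntegrable (fun x => (v x - Real.exp (-(p.kap * x)) * w x) * -Ψ x t)
        volume 0 p.L :=
      (hv.sub (hw.continuousOn_mul (Continuous.continuousOn (by fun_prop)))).mul_continuousOn
        (Continuous.continuousOn (by simp only [hΨ]; fun_prop))
    rw [← intervalIntegral.integral_sub i2 i3, ← intervalIntegral.integral_sub i1 (i2.sub i3)]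
    refine intervalIntegral.integral_congr fun x _ => ?_
    simp only [hφ, hψ]
    ring
  have hweak := hs.weak T hT φ ψ hφc hψc (fun t ht => by
      simp only [hφ]
      rw [hΨL, hgT _ ⟨?_, ?_⟩]
      · simp
      · have := mul_le_mul_of_nonneg_left ht.2 p.lam1_pos.le; linarith
      · have := mul_nonneg p.lam1_pos.le ht.1; linarith) (fun t _ => by
      -- The scaling by `r` makes the two transported functions agree up to sign at `x = 0`, which
      -- is the boundary condition required of `(φ, ψ)`. The one at `x = L` comes from the vanishing
      -- of `g`.
      have e1 : -((0 + p.lam2 * t) / p.r) = 0 - p.lam1 * t := by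
        rw [← hrl]; field_simp; ring
      simp only [hφ, hψ]
      rw [e1, hrl]
      simp
      ring)
  rw [hpair, hpair] at hweak
  have e0 : ∀ x : ℝ, -((x + p.lam2 * 0) / p.r) = -(x / p.r) := fun x => by simp
  simp_rw [e0, mul_zero, sub_zero] at hweak
  have hgd : ∀ x, HasDerivAt g (deriv g x) x := fun x =>
    (hg.differentiable one_ne_zero x).hasDerivAt
  have hlin : ∀ x t, HasDerivAt (fun s => -((x + p.lam2 * s) / p.r)) (-p.lam1) t := by
    intro x t
    refine (((((hasDerivAt_id t).const_mul p.lam2).const_add x).div_const p.r).neg).congr_deriv ?_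
    rw [← hrl]; field_simp
  have hlin' : ∀ x t, HasDerivAt (fun y => -((y + p.lam2 * t) / p.r)) (-(1 / p.r)) x := fun x t =>
    ((((hasDerivAt_id x).add_const (p.lam2 * t)).div_const p.r).neg)
  have hΨt : ∀ x t, HasDerivAt (fun s => Ψ x s) (p.gain * p.lam2 *
      (g (-((x + p.lam2 * t) / p.r)) - g (-((p.L + p.lam2 * t) / p.r)))) t := by
    intro x t
    have := (((hG' _).comp t (hlin p.L t)).sub ((hG' _).comp t (hlin x t))).const_mul
      (p.gain * p.r)
    refine this.congr_deriv ?_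
    rw [← hrl]; ring
  have hΨx : ∀ x t, HasDerivAt (fun y => Ψ y t) (p.gain * g (-((x + p.lam2 * t) / p.r))) x := by
    intro x t
    have := (((hG' _).comp x (hlin' x t)).const_sub (G (-((p.L + p.lam2 * t) / p.r)))).const_mul
      (p.gain * p.r)
    refine this.congr_deriv ?_
    field_simp
  have hφt : ∀ x t, deriv (fun s => φ x s) t = -p.lam1 * deriv g (x - p.lam1 * t)
      + Real.exp (-(p.kap * x)) * (p.gain * p.lam2 *
      (g (-((x + p.lam2 * t) / p.r)) - g (-((p.L + p.lam2 * t) / p.r)))) := by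
    intro x t
    refine HasDerivAt.deriv ?_
    refine (((hgd _).comp t (((hasDerivAt_id t).const_mul p.lam1).const_sub x)).add
      ((hΨt x t).const_mul (Real.exp (-(p.kap * x))))).congr_deriv ?_
    simp; ring
  have hφx : ∀ x t, deriv (fun y => φ y t) x = deriv g (x - p.lam1 * t)
      + (-p.kap * Real.exp (-(p.kap * x)) * Ψ x t
        + Real.exp (-(p.kap * x)) * (p.gain * g (-((x + p.lam2 * t) / p.r)))) := by
    intro x t
    refine HasDerivAt.deriv ?_
    refine (((hgd _).comp x ((hasDerivAt_id x).sub_const (p.lam1 * t))).add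
      ((((hasDerivAt_id x).const_mul p.kap).neg.exp).mul (hΨx x t))).congr_deriv ?_
    simp only [id, mul_one, Pi.neg_apply]; ring
  have hψt : ∀ x t, deriv (fun s => ψ x s) t = p.lam1 * deriv g (-((x + p.lam2 * t) / p.r))
      - (p.gain * p.lam2 *
      (g (-((x + p.lam2 * t) / p.r)) - g (-((p.L + p.lam2 * t) / p.r)))) := by
    intro x t
    refine HasDerivAt.deriv ?_
    refine ((((hgd _).comp t (hlin x t)).neg).sub (hΨt x t)).congr_deriv ?_
    ring
  have hψx : ∀ x t, deriv (fun y => ψ y t) x = 1 / p.r * deriv g (-((x + p.lam2 * t) / p.r))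
      - p.gain * g (-((x + p.lam2 * t) / p.r)) := by
    intro x t
    refine HasDerivAt.deriv ?_
    refine ((((hgd _).comp x (hlin' x t)).neg).sub (hΨx x t)).congr_deriv ?_
    ring
  -- All interior terms cancel except a multiple of `gL`, which is the exact feedback; it combines
  -- with the applied feedback into the discrepancy.
  have hrhs : ∀ t, (∫ x in (0 : ℝ)..p.L,
        (w t x * (deriv (fun s => φ x s) t + p.lam1 * deriv (fun y => φ y t) x + p.c x * ψ x t)
          + v t x * (deriv (fun s => ψ x s) t - p.lam2 * deriv (fun y => ψ y t) x)))
        + p.lam2 * ψ p.L t * p.feedback Kw Kv (w t) (v t)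
      = -p.lam2 * (g (-((p.L + p.lam2 * t) / p.r)) * p.discrepancy Kw Kv (w t) (v t)) := by
    intro t
    have hw := intervalIntegrable_of_memLp hL.le (Lp.memLp (w t))
    have hv := intervalIntegrable_of_memLp hL.le (Lp.memLp (v t))
    set gL := g (-((p.L + p.lam2 * t) / p.r)) with hgL
    have e1 : ∀ x, w t x * (deriv (fun s => φ x s) t + p.lam1 * deriv (fun y => φ y t) x
          + p.c x * ψ x t)
          + v t x * (deriv (fun s => ψ x s) t - p.lam2 * deriv (fun y => ψ y t) x)
        = p.lam2 * gL * (p.exactW p.L x * w t x + p.exactV p.L x * v t x) := by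
      intro x
      rw [hφt, hφx, hψt, hψx, c_eq, exactW, exactV, ← hgL]
      have e2 : ψ x t = -g (-((x + p.lam2 * t) / p.r)) - Ψ x t := rfl
      have e3 : p.lam2 * (1 / p.r) = p.lam1 := by rw [← hrl]; field_simp
      rw [e2]
      linear_combination (-(w t x * Real.exp (-(p.kap * x)) * Ψ x t)) * p.lam1_mul_kap
        - v t x * deriv g (-((x + p.lam2 * t) / p.r)) * e3
    simp_rw [e1]
    have i1 : IntervalIntegrable (fun x => p.exactW p.L x * w t x) volume 0 p.L :=
      hw.continuousOn_mul (Continuous.continuousOn (by unfold exactW; fun_prop))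
    have i2 : IntervalIntegrable (fun x => p.exactV p.L x * v t x) volume 0 p.L :=
      hv.const_mul p.gain
    rw [intervalIntegral.integral_const_mul, intervalIntegral.integral_add i1 i2]
    have e4 : ψ p.L t = -gL := by simp only [hψ]; rw [hΨL, sub_zero]
    rw [e4, discrepancy]
    have e5 : p.feedback p.exactW p.exactV (w t) (v t) =
      (∫ x in (0 : ℝ)..p.L, p.exactW p.L x * w t x) + ∫ x in (0 : ℝ)..p.L, p.exactV p.L x * v t x :=
      rfl
    rw [e5]
    ring
  simp_rw [hrhs] at hweak
  rw [intervalIntegral.integral_const_mul] at hweak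
  linarith

end ARZModel

/-- The fundamental lemma of the calculus of variations on a bounded interval. -/
theorem ae_eq_zero_of_integral_test_eq_zero {f : ℝ → ℝ} {a b : ℝ} (hab : a ≤ b)
    (hf : IntervalIntegrable f volume a b)
    (h : ∀ γ : ℝ → ℝ, ContDiff ℝ 1 γ → (∀ x, x ∉ Ioo a b → γ x = 0) →
      ∫ x in a..b, f x * γ x = 0) :
    ∀ᵐ x ∂volume.restrict (Ioc a b), f x = 0 := by
  rw [intervalIntegrable_iff_integrableOn_Ioo_of_le hab] at hf
  have key := isOpen_Ioo.ae_eq_zero_of_integral_contDiff_smul_eq_zero (μ := volume)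
    hf.locallyIntegrableOn (fun γ h1 _ h3 => by
      have h4 : ∀ x, x ∉ Ioo a b → γ x = 0 := fun x hx =>
        Function.notMem_support.1 fun hx' => hx (h3 (subset_tsupport _ hx'))
      have := h γ (h1.of_le (by simp)) h4
      rw [intervalIntegral.integral_of_le hab, integral_Ioc_eq_integral_Ioo] at this
      rw [← this, ← setIntegral_eq_integral_of_forall_compl_eq_zero (s := Ioo a b)
        (fun x hx => by simp [h4 x hx])]
      exact integral_congr_ae (Filter.Eventually.of_forall fun x => by simp [mul_comm]))
  rw [← restrict_Ioo_eq_restrict_Ioc, ae_restrict_iff' measurableSet_Ioo]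
  exact key

/-! ### Travelling waves with reflection at the inlet -/

namespace ARZModel

/-- The left-moving wave with initial profile `b₀` and boundary input `E`, at time `0`. -/
noncomputable def waveB (p : ARZModel) (b₀ E : ℝ → ℝ) (s : ℝ) : ℝ :=
  if s ≤ p.L then b₀ s else E ((s - p.L) / p.lam2)

/-- The right-moving wave with initial profile `w₀` which is produced at the boundary `x = 0` by
reflection of the left-moving wave, at time `0`. -/
noncomputable def waveW (p : ARZModel) (w₀ b₀ E : ℝ → ℝ) (s : ℝ) : ℝ :=
  -- A value labelled `s < 0` leaves `x = 0` at time `-s / λ₁`. The left-moving wave that arrives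
  -- there at this time has label `λ₂ (-s / λ₁) = -r s`.
  if 0 < s then w₀ s else -p.r * p.waveB b₀ E (-(p.r * s))

theorem uIoc_congr_integrable {f g : ℝ → ℝ} {a b : ℝ} (hab : a ≤ b) (h : ∀ x ∈ Ioo a b, f x = g x)
    (hf : IntervalIntegrable f volume a b) : IntervalIntegrable g volume a b := by
  rw [intervalIntegrable_iff_integrableOn_Ioo_of_le hab] at hf ⊢
  exact hf.congr_fun h measurableSet_Ioo

theorem integral_congr_Ioo {f g : ℝ → ℝ} {a b : ℝ} (hab : a ≤ b) (h : ∀ x ∈ Ioo a b, f x = g x) :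
    ∫ x in a..b, f x = ∫ x in a..b, g x := by
  rw [intervalIntegral.integral_of_le hab, intervalIntegral.integral_of_le hab,
    integral_Ioc_eq_integral_Ioo, integral_Ioc_eq_integral_Ioo]
  exact setIntegral_congr_fun measurableSet_Ioo h

/-- Unfolding of two transported quantities which are linked by reflection at `x = 0`. -/
theorem integral_reflection (p : ARZModel) {fW fB : ℝ → ℝ} {k T : ℝ} (hT : 0 ≤ T)
    (hW : IntervalIntegrable fW volume 0 p.L)
    (hB : IntervalIntegrable fB volume 0 (p.L + p.lam2 * T))
    (hWB : ∀ s < 0, fW s = k * fB (-(p.r * s))) :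
    IntervalIntegrable fW volume (-(p.lam1 * T)) p.L ∧
    (∫ x in (0 : ℝ)..p.L, fW (x - p.lam1 * T)) + k / p.r * ∫ x in (0 : ℝ)..p.L, fB (x + p.lam2 * T)
      = (∫ x in (0 : ℝ)..p.L, fW x) + k / p.r * ((∫ x in (0 : ℝ)..p.L, fB x)
        + p.lam2 * ∫ t in (0 : ℝ)..T, fB (p.L + p.lam2 * t))
        - ∫ x in (p.L - p.lam1 * T)..p.L, fW x := by
  have hL := p.L_pos
  have h1 := p.lam1_pos
  have h2 := p.lam2_pos
  have hr := p.r_pos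
  have hrl := p.r_mul_lam1
  have hT1 : 0 ≤ p.lam1 * T := by positivity
  have hT2 : 0 ≤ p.lam2 * T := by positivity
  have sub : ∀ {a b : ℝ}, 0 ≤ a → 0 ≤ b → a ≤ p.L + p.lam2 * T → b ≤ p.L + p.lam2 * T →
      IntervalIntegrable fB volume a b := fun ha hb ha' hb' => by
    refine hB.mono_set ?_
    rw [uIcc_of_le (by linarith : 0 ≤ p.L + p.lam2 * T)]
    exact uIcc_subset_Icc ⟨ha, ha'⟩ ⟨hb, hb'⟩
  have hneg : IntervalIntegrable (fun s => k * fB (-p.r * s)) volume (-(p.lam1 * T)) 0 := by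
    have := (sub (a := 0) (b := p.lam2 * T) le_rfl hT2 (by linarith) (by linarith)).symm
    have := (this.comp_mul_left (c := -p.r)).const_mul k
    convert this using 1
    · rw [← hrl]; field_simp
    · simp
  have hWneg : IntervalIntegrable fW volume (-(p.lam1 * T)) 0 :=
    uIoc_congr_integrable (by linarith) (fun s hs => by rw [hWB s hs.2]; congr 2; ring) hneg
  have hWfull := hWneg.trans hW
  refine ⟨hWfull, ?_⟩
  have e1 : ∫ x in (0 : ℝ)..p.L, fW (x - p.lam1 * T)
      = ∫ x in (-(p.lam1 * T))..(p.L - p.lam1 * T), fW x := by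
    rw [intervalIntegral.integral_comp_sub_right]; simp
  have e2 : ∫ x in (0 : ℝ)..p.L, fB (x + p.lam2 * T)
      = ∫ x in (p.lam2 * T)..(p.L + p.lam2 * T), fB x := by
    rw [intervalIntegral.integral_comp_add_right]; simp
  -- The substitution `s ↦ -r s` matches what has entered through `x = 0` by reflection with what
  -- has left there up to time `T`; its Jacobian is the reason for the factor `k / r`.
  have e3 : ∫ x in (-(p.lam1 * T))..0, fW x = k / p.r * ∫ x in (0 : ℝ)..(p.lam2 * T), fB x := by
    rw [integral_congr_Ioo (g := fun s => k * fB (-p.r * s)) (by linarith)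
      (fun s hs => by rw [hWB s hs.2]; congr 2; ring), intervalIntegral.integral_const_mul,
      intervalIntegral.integral_comp_mul_left _ (neg_ne_zero.2 hr.ne')]
    rw [mul_zero, show -p.r * -(p.lam1 * T) = p.lam2 * T by rw [← hrl]; ring,
      intervalIntegral.integral_symm, inv_neg, smul_eq_mul]
    ring
  have e4 : p.lam2 * ∫ t in (0 : ℝ)..T, fB (p.L + p.lam2 * t)
      = ∫ x in p.L..(p.L + p.lam2 * T), fB x := by
    rw [intervalIntegral.integral_comp_add_mul _ h2.ne', smul_eq_mul, ← mul_assoc,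
      mul_inv_cancel₀ h2.ne', one_mul]
    simp
  have s1 := intervalIntegral.integral_add_adjacent_intervals hWneg hW
  have hu : uIcc (-(p.lam1 * T)) p.L = Icc (-(p.lam1 * T)) p.L := uIcc_of_le (by linarith)
  have s2 := intervalIntegral.integral_add_adjacent_intervals
    (hWfull.mono_set (c := -(p.lam1 * T)) (d := p.L - p.lam1 * T) (by
      rw [hu]; exact uIcc_subset_Icc ⟨le_rfl, by linarith⟩ ⟨by linarith, by linarith⟩))
    (hWfull.mono_set (c := p.L - p.lam1 * T) (d := p.L) (by
      rw [hu]; exact uIcc_subset_Icc ⟨by linarith, by linarith⟩ ⟨by linarith, by linarith⟩))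
  have s3 := intervalIntegral.integral_add_adjacent_intervals
    (sub (a := 0) (b := p.lam2 * T) le_rfl hT2 (by linarith) (by linarith))
    (sub (a := p.lam2 * T) (b := p.L + p.lam2 * T) hT2 (by linarith) (by linarith) le_rfl)
  have s4 := intervalIntegral.integral_add_adjacent_intervals
    (sub (a := 0) (b := p.L) le_rfl hL.le (by linarith) (by linarith))
    (sub (a := p.L) (b := p.L + p.lam2 * T) hL.le (by linarith) (by linarith) le_rfl)
  rw [e1, e2, e4, s4, ← s3]
  linear_combination s1 + s2 + e3 - s1 * 2

section Waves

variable {p : ARZModel} {w₀ b₀ E : ℝ → ℝ} {T : ℝ}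

theorem waveB_of_le {s : ℝ} (hs : s ≤ p.L) : p.waveB b₀ E s = b₀ s := if_pos hs

theorem waveB_input {t : ℝ} (ht : 0 < t) : p.waveB b₀ E (p.L + p.lam2 * t) = E t := by
  have := p.lam2_pos
  have h : ¬ p.L + p.lam2 * t ≤ p.L := by
    have := mul_pos this ht
    linarith
  rw [waveB, if_neg h]
  congr 1
  field_simp
  ring

theorem waveW_of_pos {s : ℝ} (hs : 0 < s) : p.waveW w₀ b₀ E s = w₀ s := if_pos hs

theorem waveW_of_neg {s : ℝ} (hs : s < 0) :
    p.waveW w₀ b₀ E s = -p.r * p.waveB b₀ E (-(p.r * s)) := if_neg hs.not_gt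

theorem integrable_comp_waveB (F : ℝ → ℝ → ℝ)
    (hF : IntervalIntegrable (fun s => F s (b₀ s)) volume 0 p.L)
    (hT : 0 ≤ T) (hE : ContinuousOn (fun s => F s (E ((s - p.L) / p.lam2)))
      (Icc p.L (p.L + p.lam2 * T))) :
    IntervalIntegrable (fun s => F s (p.waveB b₀ E s)) volume 0 (p.L + p.lam2 * T) := by
  have h2 := p.lam2_pos
  have h3 : p.L ≤ p.L + p.lam2 * T := by have := mul_nonneg h2.le hT; linarith
  refine (uIoc_congr_integrable p.L_pos.le (fun s hs => ?_) hF).trans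
    (uIoc_congr_integrable h3 (fun s hs => ?_) (hE.intervalIntegrable_of_Icc h3))
  · rw [waveB, if_pos hs.2.le]
  · rw [waveB, if_neg (not_le.2 hs.1)]

theorem continuousOn_input (hE : ContinuousOn E (Ici 0)) :
    ContinuousOn (fun s => E ((s - p.L) / p.lam2)) (Icc p.L (p.L + p.lam2 * T)) :=
  hE.comp (Continuous.continuousOn (by fun_prop)) fun s hs =>
    div_nonneg (sub_nonneg.2 hs.1) p.lam2_pos.le

/-- The waves satisfy the transported form of the weak formulation. -/
theorem wave_transport_identity (hw : IntervalIntegrable w₀ volume 0 p.L)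
    (hb : IntervalIntegrable b₀ volume 0 p.L) (hE : ContinuousOn E (Ici 0)) (hT : 0 ≤ T)
    {g : ℝ → ℝ} (hg : Continuous g) (hgT : ∀ y ∈ Icc (p.L - p.lam1 * T) p.L, g y = 0) :
    (∫ x in (0 : ℝ)..p.L, p.waveW w₀ b₀ E (x - p.lam1 * T) * g (x - p.lam1 * T))
        - (∫ x in (0 : ℝ)..p.L, p.waveB b₀ E (x + p.lam2 * T) * g (-((x + p.lam2 * T) / p.r)))
      = (∫ x in (0 : ℝ)..p.L, w₀ x * g x) - (∫ x in (0 : ℝ)..p.L, b₀ x * g (-(x / p.r)))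
        - p.lam2 * ∫ t in (0 : ℝ)..T, g (-((p.L + p.lam2 * t) / p.r)) * E t := by
  have hr := p.r_pos
  have hL := p.L_pos
  have hlT := mul_nonneg p.lam1_pos.le hT
  have key := (p.integral_reflection (fW := fun s => p.waveW w₀ b₀ E s * g s)
    (fB := fun s => p.waveB b₀ E s * g (-(s / p.r))) (k := -p.r) hT
    (uIoc_congr_integrable hL.le (fun s hs => by rw [waveW_of_pos hs.1])
      (hw.mul_continuousOn hg.continuousOn))
    (integrable_comp_waveB (fun s y => y * g (-(s / p.r)))
      (hb.mul_continuousOn (Continuous.continuousOn (by fun_prop))) hT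
      ((continuousOn_input hE).mul (Continuous.continuousOn (by fun_prop))))
    (fun s hs => by
      rw [waveW_of_neg hs]
      have : -(-(p.r * s) / p.r) = s := by field_simp
      rw [this]; ring)).2
  have z : ∫ x in (p.L - p.lam1 * T)..p.L, p.waveW w₀ b₀ E x * g x = 0 := by
    rw [integral_congr_Ioo (g := fun _ => 0) (by linarith)
      (fun s hs => by rw [hgT s ⟨hs.1.le, hs.2.le⟩, mul_zero])]
    simp
  have e1 : ∫ x in (0 : ℝ)..p.L, p.waveW w₀ b₀ E x * g x = ∫ x in (0 : ℝ)..p.L, w₀ x * g x :=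
    integral_congr_Ioo hL.le fun s hs => by rw [waveW_of_pos hs.1]
  have e2 : ∫ x in (0 : ℝ)..p.L, p.waveB b₀ E x * g (-(x / p.r))
      = ∫ x in (0 : ℝ)..p.L, b₀ x * g (-(x / p.r)) :=
    integral_congr_Ioo hL.le fun s hs => by rw [waveB_of_le hs.2.le]
  have e3 : ∫ t in (0 : ℝ)..T, p.waveB b₀ E (p.L + p.lam2 * t) * g (-((p.L + p.lam2 * t) / p.r))
      = ∫ t in (0 : ℝ)..T, g (-((p.L + p.lam2 * t) / p.r)) * E t :=
    integral_congr_Ioo hT fun s hs => by rw [waveB_input hs.1, mul_comm]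
  have e4 : -p.r / p.r = -1 := by field_simp
  rw [z, e1, e2, e3, e4] at key
  linarith

/-! ### Weighted energy and exponential decay of weak solutions -/

/-- The weighted energy of a pair `(w, β)`. -/
noncomputable def energy (p : ARZModel) (ν : ℝ) (w b : ℝ → ℝ) : ℝ :=
  (∫ x in (0 : ℝ)..p.L, Real.exp (-(ν / p.lam1 * x)) * w x ^ 2)
    + p.r * ∫ x in (0 : ℝ)..p.L, Real.exp (ν / p.lam2 * x) * b x ^ 2

/-- Along characteristics the weights change exactly by the factor `exp (-ν t)`. The factor `r` in
the energy makes the reflection `w = -r β` at `x = 0` neutral, since `λ₁ r² = λ₂ r`. The outflow of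
`w` at `x = L` only helps, and the last term is the energy injected by `E`. -/
theorem energy_wave_le {ν : ℝ} (hw : MemLp w₀ 2 (volume.restrict (Ioc 0 p.L)))
    (hb : MemLp b₀ 2 (volume.restrict (Ioc 0 p.L))) (hE : ContinuousOn E (Ici 0)) (hT : 0 ≤ T) :
    Real.exp (ν * T) * p.energy ν (fun x => p.waveW w₀ b₀ E (x - p.lam1 * T))
        (fun x => p.waveB b₀ E (x + p.lam2 * T))
      ≤ p.energy ν w₀ b₀ + p.r * p.lam2 * Real.exp (ν / p.lam2 * p.L) *
        ∫ t in (0 : ℝ)..T, Real.exp (ν * t) * E t ^ 2 := by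
  have hr := p.r_pos
  have hL := p.L_pos
  have hl1 := p.lam1_pos
  have hl2 := p.lam2_pos
  have hrl := p.r_mul_lam1
  have hlT := mul_nonneg p.lam1_pos.le hT
  obtain ⟨hint, key⟩ := p.integral_reflection
    (fW := fun s => Real.exp (-(ν / p.lam1 * s)) * p.waveW w₀ b₀ E s ^ 2)
    (fB := fun s => Real.exp (ν / p.lam2 * s) * p.waveB b₀ E s ^ 2) (k := p.r ^ 2) hT
    (uIoc_congr_integrable hL.le (fun s hs => by rw [waveW_of_pos hs.1])
      ((intervalIntegrable_sq hL.le hw).continuousOn_mul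
        (g := fun s => Real.exp (-(ν / p.lam1 * s))) (Continuous.continuousOn (by fun_prop))))
    (integrable_comp_waveB (fun s y => Real.exp (ν / p.lam2 * s) * y ^ 2)
      ((intervalIntegrable_sq hL.le hb).continuousOn_mul (Continuous.continuousOn (by fun_prop))) hT
      (ContinuousOn.mul (Continuous.continuousOn (by fun_prop)) ((continuousOn_input hE).pow 2)))
    (fun s hs => by
      rw [waveW_of_neg hs]
      have : ν / p.lam2 * -(p.r * s) = -(ν / p.lam1 * s) := by rw [← hrl]; field_simp
      rw [this]; ring)
  have z : 0 ≤ ∫ x in (p.L - p.lam1 * T)..p.L,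
      Real.exp (-(ν / p.lam1 * x)) * p.waveW w₀ b₀ E x ^ 2 :=
    intervalIntegral.integral_nonneg (by linarith) fun x _ => by positivity
  have e1 : ∫ x in (0 : ℝ)..p.L, Real.exp (-(ν / p.lam1 * x)) * p.waveW w₀ b₀ E x ^ 2
      = ∫ x in (0 : ℝ)..p.L, Real.exp (-(ν / p.lam1 * x)) * w₀ x ^ 2 :=
    integral_congr_Ioo hL.le fun s hs => by rw [waveW_of_pos hs.1]
  have e2 : ∫ x in (0 : ℝ)..p.L, Real.exp (ν / p.lam2 * x) * p.waveB b₀ E x ^ 2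
      = ∫ x in (0 : ℝ)..p.L, Real.exp (ν / p.lam2 * x) * b₀ x ^ 2 :=
    integral_congr_Ioo hL.le fun s hs => by rw [waveB_of_le hs.2.le]
  have e3 : ∫ t in (0 : ℝ)..T, Real.exp (ν / p.lam2 * (p.L + p.lam2 * t))
        * p.waveB b₀ E (p.L + p.lam2 * t) ^ 2
      = Real.exp (ν / p.lam2 * p.L) * ∫ t in (0 : ℝ)..T, Real.exp (ν * t) * E t ^ 2 := by
    rw [← intervalIntegral.integral_const_mul]
    refine integral_congr_Ioo hT fun s hs => ?_
    rw [waveB_input hs.1, ← mul_assoc, ← Real.exp_add]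
    congr 2
    field_simp
  have e4 : p.r ^ 2 / p.r = p.r := by field_simp
  have e5 : ∫ x in (0 : ℝ)..p.L, Real.exp (-(ν / p.lam1 * (x - p.lam1 * T)))
        * p.waveW w₀ b₀ E (x - p.lam1 * T) ^ 2
      = Real.exp (ν * T) * ∫ x in (0 : ℝ)..p.L, Real.exp (-(ν / p.lam1 * x))
        * p.waveW w₀ b₀ E (x - p.lam1 * T) ^ 2 := by
    rw [← intervalIntegral.integral_const_mul]
    refine intervalIntegral.integral_congr fun x _ => ?_
    rw [← mul_assoc, ← Real.exp_add]
    congr 2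
    field_simp
    ring
  have e6 : ∫ x in (0 : ℝ)..p.L, Real.exp (ν / p.lam2 * (x + p.lam2 * T))
        * p.waveB b₀ E (x + p.lam2 * T) ^ 2
      = Real.exp (ν * T) * ∫ x in (0 : ℝ)..p.L, Real.exp (ν / p.lam2 * x)
        * p.waveB b₀ E (x + p.lam2 * T) ^ 2 := by
    rw [← intervalIntegral.integral_const_mul]
    refine intervalIntegral.integral_congr fun x _ => ?_
    rw [← mul_assoc, ← Real.exp_add]
    congr 2
    field_simp
    ring
  rw [e1, e2, e3, e4, e5, e6] at key
  unfold energy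
  linarith

end Waves

/-- Every weak solution is a superposition of the two waves. -/
theorem IsL2Solution.ae_eq_wave {p : ARZModel} {Kw Kv : ℝ → ℝ → ℝ} {M : ℝ}
    (hK : p.BoundedKernels Kw Kv M) {w₀ v₀ : p.StateL2} {w v : ℝ → p.StateL2}
    (hs : p.IsL2Solution Kw Kv w₀ v₀ w v) {T : ℝ} (hT : 0 < T) :
    (∀ᵐ x ∂volume.restrict (Ioc 0 p.L), w T x
      = p.waveW w₀ (p.target w₀ v₀) (fun t => p.discrepancy Kw Kv (w t) (v t)) (x - p.lam1 * T)) ∧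
    ∀ᵐ x ∂volume.restrict (Ioc 0 p.L), p.target (w T) (v T) x
      = p.waveB (p.target w₀ v₀) (fun t => p.discrepancy Kw Kv (w t) (v t)) (x + p.lam2 * T) := by
  have hL := p.L_pos
  have hr := p.r_pos
  have hrl := p.r_mul_lam1
  have hl1 := p.lam1_pos
  have hl2 := p.lam2_pos
  have hX := p.boundedKernels_exact
  set E : ℝ → ℝ := fun t => p.discrepancy Kw Kv (w t) (v t) with hEd
  set b₀ := p.target w₀ v₀ with hb₀
  have hE : ContinuousOn E (Ici 0) :=
    (hK.continuousOn_feedback hs.continuousOn_w hs.continuousOn_v).sub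
      (hX.continuousOn_feedback hs.continuousOn_w hs.continuousOn_v)
  have hw0 := intervalIntegrable_of_memLp hL.le (Lp.memLp w₀)
  have hb0 : IntervalIntegrable b₀ volume 0 p.L := intervalIntegrable_of_memLp hL.le
    (hX.memLp_backstep (Lp.memLp w₀) (Lp.memLp v₀))
  have hwT := intervalIntegrable_of_memLp hL.le (Lp.memLp (w T))
  have hbT : IntervalIntegrable (p.target (w T) (v T)) volume 0 p.L :=
    intervalIntegrable_of_memLp hL.le (hX.memLp_backstep (Lp.memLp (w T)) (Lp.memLp (v T)))
  have hBi : IntervalIntegrable (p.waveB b₀ E) volume 0 (p.L + p.lam2 * T) :=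
    integrable_comp_waveB (fun _ y => y) hb0 hT.le (continuousOn_input hE)
  have hWi : IntervalIntegrable (p.waveW w₀ b₀ E) volume (-(p.lam1 * T)) p.L :=
    (p.integral_reflection (k := -p.r) hT.le
      (uIoc_congr_integrable hL.le (fun s hs => by rw [waveW_of_pos hs.1]) hw0) hBi
      (fun s hs => waveW_of_neg hs)).1
  have hT1 := mul_pos hl1 hT
  have hT2 := mul_pos hl2 hT
  have hBT : IntervalIntegrable (fun x => p.waveB b₀ E (x + p.lam2 * T)) volume 0 p.L := by
    have := (hBi.mono_set (c := p.lam2 * T) (d := p.L + p.lam2 * T) (by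
      rw [uIcc_of_le (by linarith : 0 ≤ p.L + p.lam2 * T)]
      exact uIcc_subset_Icc ⟨by linarith, by linarith⟩ ⟨by linarith, by linarith⟩)).comp_add_right
        (p.lam2 * T)
    simpa using this
  have hWT : IntervalIntegrable (fun x => p.waveW w₀ b₀ E (x - p.lam1 * T)) volume 0 p.L := by
    have := (hWi.mono_set (c := -(p.lam1 * T)) (d := p.L - p.lam1 * T) (by
      rw [uIcc_of_le (by linarith : -(p.lam1 * T) ≤ p.L)]
      exact uIcc_subset_Icc ⟨by linarith, by linarith⟩ ⟨by linarith, by linarith⟩)).comp_sub_right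
        (p.lam1 * T)
    simpa using this
  have key : ∀ g : ℝ → ℝ, ContDiff ℝ 1 g → (∀ y ∈ Icc (p.L - p.lam1 * T) p.L, g y = 0) →
      (∫ x in (0 : ℝ)..p.L, (w T x - p.waveW w₀ b₀ E (x - p.lam1 * T)) * g (x - p.lam1 * T))
      = ∫ x in (0 : ℝ)..p.L, (p.target (w T) (v T) x - p.waveB b₀ E (x + p.lam2 * T))
          * g (-((x + p.lam2 * T) / p.r)) := by
    intro g hg hgT
    have h1 := hs.transport_identity hT hg hgT
    have h2 := wave_transport_identity (E := E) hw0 hb0 hE hT.le hg.continuous hgT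
    have hgc := hg.continuous
    have c1 : ContinuousOn (fun x => g (x - p.lam1 * T)) (uIcc 0 p.L) :=
      Continuous.continuousOn (by fun_prop)
    have c2 : ContinuousOn (fun x => g (-((x + p.lam2 * T) / p.r))) (uIcc 0 p.L) :=
      Continuous.continuousOn (by fun_prop)
    simp_rw [sub_mul]
    rw [intervalIntegral.integral_sub (hwT.mul_continuousOn c1) (hWT.mul_continuousOn c1),
      intervalIntegral.integral_sub (hbT.mul_continuousOn c2) (hBT.mul_continuousOn c2)]
    linarith
  have earg : ∀ x : ℝ, -((x + p.lam2 * T) / p.r) = -(x / p.r) - p.lam1 * T := fun x => by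
    rw [← hrl]; field_simp; ring
  constructor
  -- With `g = γ (· + λ₁ T)` the second integral evaluates `γ` only at the nonpositive points `-(x /
  -- r)`, where it vanishes; this isolates the first component.
  · have := ae_eq_zero_of_integral_test_eq_zero hL.le (hwT.sub hWT) (fun γ hγ h0 => by
      have h := key (fun y => γ (y + p.lam1 * T)) (hγ.comp (by fun_prop)) (fun y hy =>
        h0 _ fun h => by have := h.2; linarith [hy.1])
      simp only [sub_add_cancel] at h
      refine h.trans ?_
      rw [integral_congr_Ioo (g := fun _ => 0) hL.le (fun x hx => ?_)]
      · simp
      · rw [earg, sub_add_cancel, h0 _ fun h => ?_, mul_zero]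
        have := div_pos hx.1 hr
        linarith [h.1])
    filter_upwards [this] with x hx
    exact sub_eq_zero.1 hx
  -- Here `g` is supported in `y < -λ₁ T`, where the first integral does not look; the factor `-r`
  -- turns the argument in the second integral into `x`.
  · have := ae_eq_zero_of_integral_test_eq_zero hL.le (hbT.sub hBT) (fun γ hγ h0 => by
      have h := key (fun y => γ (-p.r * (y + p.lam1 * T))) (hγ.comp (by fun_prop)) (fun y hy =>
        h0 _ fun h => by
          have h1 := h.1
          have : 0 < y + p.lam1 * T := by linarith [hy.1]
          have := mul_pos hr this
          linarith)
      have e : ∀ x, -p.r * (-((x + p.lam2 * T) / p.r) + p.lam1 * T) = x := fun x => by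
        rw [earg]; field_simp; ring
      simp only [e, sub_add_cancel] at h
      refine h.symm.trans ?_
      rw [integral_congr_Ioo (g := fun _ => 0) hL.le (fun x hx => ?_)]
      · simp
      · rw [h0 _ fun h => ?_, mul_zero]
        have := mul_pos hr hx.1
        linarith [h.1])
    filter_upwards [this] with x hx
    exact sub_eq_zero.1 hx

theorem energy_congr {p : ARZModel} {ν : ℝ} {w b w' b' : ℝ → ℝ}
    (hw : ∀ᵐ x ∂volume.restrict (Ioc 0 p.L), w x = w' x)
    (hb : ∀ᵐ x ∂volume.restrict (Ioc 0 p.L), b x = b' x) : p.energy ν w b = p.energy ν w' b' := by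
  unfold energy
  rw [intervalIntegral.integral_of_le p.L_pos.le, intervalIntegral.integral_of_le p.L_pos.le,
    intervalIntegral.integral_of_le p.L_pos.le, intervalIntegral.integral_of_le p.L_pos.le]
  congr 1
  · refine integral_congr_ae ?_
    filter_upwards [hw] with x hx
    rw [hx]
  · congr 1
    refine integral_congr_ae ?_
    filter_upwards [hb] with x hx
    rw [hx]

theorem integral_sq_le_energy {p : ARZModel} {ν : ℝ} (hν : 0 ≤ ν) {w b : ℝ → ℝ}
    (hw : MemLp w 2 (volume.restrict (Ioc 0 p.L)))
    (hb : MemLp b 2 (volume.restrict (Ioc 0 p.L))) :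
    (∫ x in (0 : ℝ)..p.L, w x ^ 2) + ∫ x in (0 : ℝ)..p.L, b x ^ 2
      ≤ (Real.exp (ν / p.lam1 * p.L) + 1 / p.r) * p.energy ν w b := by
  have hL := p.L_pos
  have h1 := p.lam1_pos
  have h2 := p.lam2_pos
  have hr := p.r_pos
  set e := Real.exp (ν / p.lam1 * p.L) with he
  have hw2 := intervalIntegrable_sq hL.le hw
  have hb2 := intervalIntegrable_sq hL.le hb
  have b1 : ∫ x in (0 : ℝ)..p.L, w x ^ 2
      ≤ e * ∫ x in (0 : ℝ)..p.L, Real.exp (-(ν / p.lam1 * x)) * w x ^ 2 := by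
    rw [← intervalIntegral.integral_const_mul]
    refine intervalIntegral.integral_mono_on hL.le hw2 ((hw2.continuousOn_mul
      (Continuous.continuousOn (by fun_prop))).const_mul _) fun x hx => ?_
    rw [← mul_assoc, ← Real.exp_add]
    refine le_mul_of_one_le_left (sq_nonneg _) (Real.one_le_exp ?_)
    have := mul_le_mul_of_nonneg_left hx.2 (by positivity : 0 ≤ ν / p.lam1)
    linarith
  have b3 : ∫ x in (0 : ℝ)..p.L, b x ^ 2 ≤
      ∫ x in (0 : ℝ)..p.L, Real.exp (ν / p.lam2 * x) * b x ^ 2 := by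
    refine intervalIntegral.integral_mono_on hL.le hb2 (hb2.continuousOn_mul
      (Continuous.continuousOn (by fun_prop))) fun x hx => ?_
    refine le_mul_of_one_le_left (sq_nonneg _) (Real.one_le_exp ?_)
    exact mul_nonneg (by positivity) hx.1
  unfold energy
  have hWe0 : 0 ≤ ∫ x in (0 : ℝ)..p.L, Real.exp (-(ν / p.lam1 * x)) * w x ^ 2 :=
    intervalIntegral.integral_nonneg hL.le fun _ _ => by positivity
  have hBe0 : 0 ≤ ∫ x in (0 : ℝ)..p.L, Real.exp (ν / p.lam2 * x) * b x ^ 2 :=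
    intervalIntegral.integral_nonneg hL.le fun _ _ => by positivity
  set We := ∫ x in (0 : ℝ)..p.L, Real.exp (-(ν / p.lam1 * x)) * w x ^ 2
  set Be := ∫ x in (0 : ℝ)..p.L, Real.exp (ν / p.lam2 * x) * b x ^ 2
  have he0 : 0 < e := Real.exp_pos _
  have h3 : (1 / p.r) * (p.r * Be) = Be := by field_simp
  have h4 : 0 ≤ 1 / p.r * We := by positivity
  have h5 : 0 ≤ e * (p.r * Be) := by positivity
  nlinarith

/-- The energy of `(w, target w v)` is equivalent to the square of the `L²` norm of `(w, v)`. -/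
theorem exists_energy_bounds (p : ARZModel) {ν : ℝ} (hν : 0 < ν) :
    ∃ k > 0, ∃ k' > 0, ∀ w v : p.StateL2,
      ‖w‖ ^ 2 + ‖v‖ ^ 2 ≤ k * p.energy ν w (p.target w v) ∧
      p.energy ν w (p.target w v) ≤ k' * (‖w‖ ^ 2 + ‖v‖ ^ 2) := by
  have hL := p.L_pos
  have h1 := p.lam1_pos
  have h2 := p.lam2_pos
  have hr := p.r_pos
  have hX := p.boundedKernels_exact
  set D := 3 + 3 * |p.gain| ^ 2 * p.L ^ 2 with hD
  set F := Real.exp (6 * |p.gain| ^ 2 * p.L * p.L) * (6 + 6 * |p.gain| ^ 2 * p.L ^ 2) with hF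
  have hD0 : 0 < D := by positivity
  have hF0 : 0 < F := by positivity
  set e := Real.exp (ν / p.lam1 * p.L) with he
  set e' := Real.exp (ν / p.lam2 * p.L) with he'
  refine ⟨(1 + F) * (e + 1 / p.r), by positivity, 1 + p.r * e' * D, by positivity,
    fun w v => ?_⟩
  have hw := Lp.memLp w
  have hv := Lp.memLp v
  have hb := hX.memLp_backstep hw hv
  have i1 := hX.integral_backstep_sq_le hw hv
  have i2 := hX.integral_sq_le hw hv
  rw [norm_sq_eq_integral hL.le, norm_sq_eq_integral hL.le]
  rw [← hD] at i1
  rw [← hF] at i2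
  have hw2 := intervalIntegrable_sq hL.le hw
  have hb2 := intervalIntegrable_sq hL.le hb
  have hew : IntervalIntegrable (fun x => Real.exp (-(ν / p.lam1 * x)) * w x ^ 2) volume 0 p.L :=
    hw2.continuousOn_mul (Continuous.continuousOn (by fun_prop))
  have heb : IntervalIntegrable (fun x => Real.exp (ν / p.lam2 * x) *
      backstep p.exactW p.exactV w v x ^ 2) volume 0 p.L :=
    hb2.continuousOn_mul (Continuous.continuousOn (by fun_prop))
  unfold target
  have b1 := integral_sq_le_energy hν.le hw hb
  unfold energy at b1 ⊢
  have b2 : ∫ x in (0 : ℝ)..p.L, Real.exp (-(ν / p.lam1 * x)) * w x ^ 2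
      ≤ ∫ x in (0 : ℝ)..p.L, w x ^ 2 := by
    refine intervalIntegral.integral_mono_on hL.le hew hw2 fun x hx => ?_
    refine mul_le_of_le_one_left (sq_nonneg _) (Real.exp_le_one_iff.2 ?_)
    have := mul_nonneg (by positivity : 0 ≤ ν / p.lam1) hx.1
    linarith
  have b4 : ∫ x in (0 : ℝ)..p.L, Real.exp (ν / p.lam2 * x) *
      backstep p.exactW p.exactV w v x ^ 2
      ≤ e' * ∫ x in (0 : ℝ)..p.L, backstep p.exactW p.exactV w v x ^ 2 := by
    rw [← intervalIntegral.integral_const_mul]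
    refine intervalIntegral.integral_mono_on hL.le heb (hb2.const_mul _) fun x hx => ?_
    refine mul_le_mul_of_nonneg_right (Real.exp_le_exp.2 ?_) (sq_nonneg _)
    exact mul_le_mul_of_nonneg_left hx.2 (by positivity)
  set W := ∫ x in (0 : ℝ)..p.L, w x ^ 2
  set Y := ∫ x in (0 : ℝ)..p.L, v x ^ 2
  set B := ∫ x in (0 : ℝ)..p.L, backstep p.exactW p.exactV w v x ^ 2
  set We := ∫ x in (0 : ℝ)..p.L, Real.exp (-(ν / p.lam1 * x)) * w x ^ 2
  set Be := ∫ x in (0 : ℝ)..p.L, Real.exp (ν / p.lam2 * x) * backstep p.exactW p.exactV w v x ^ 2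
  have hW0 : 0 ≤ W := intervalIntegral.integral_nonneg hL.le fun _ _ => sq_nonneg _
  have hY0 : 0 ≤ Y := intervalIntegral.integral_nonneg hL.le fun _ _ => sq_nonneg _
  have hB0 : 0 ≤ B := intervalIntegral.integral_nonneg hL.le fun _ _ => sq_nonneg _
  have he0 : 0 < e := Real.exp_pos _
  have he'0 : 0 < e' := Real.exp_pos _
  constructor
  · calc W + Y ≤ (1 + F) * (W + B) := by nlinarith
      _ ≤ (1 + F) * ((e + 1 / p.r) * (We + p.r * Be)) := by gcongr
      _ = _ := by ring
  · calc We + p.r * Be ≤ W + p.r * (e' * (D * (W + Y))) := by gcongr; exact b4.trans (by gcongr)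
      _ ≤ _ := by nlinarith

/-- Gronwall's inequality in the form used for the energy. -/
theorem exp_mul_le_of_integral_le {ν c k N₀ T : ℝ} (hc : 0 ≤ c) (hk : 0 ≤ k) {N E : ℝ → ℝ}
    (hE : ContinuousOn E (Ici 0)) (hEN : ∀ t, 0 ≤ t → E t ^ 2 ≤ c * N t)
    (hN : ∀ t, 0 ≤ t → Real.exp (ν * t) * N t
      ≤ N₀ + k * ∫ s in (0 : ℝ)..t, Real.exp (ν * s) * E s ^ 2) (hT : 0 ≤ T) :
    N T ≤ Real.exp (-(ν - k * c) * T) * N₀ := by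
  -- Freezing `E` for negative times makes the primitive differentiable on the whole line. The
  -- majorant `X` of `exp (ν t) N t` satisfies `X' ≤ k c X`, so `exp (-k c t) X` is nonincreasing.
  set f : ℝ → ℝ := fun t => Real.exp (ν * t) * E (max 0 t) ^ 2 with hf
  have hfc : Continuous f := by
    have : Continuous fun t => E (max 0 t) :=
      hE.comp_continuous (by fun_prop) fun t => mem_Ici.2 (le_max_left _ _)
    exact (by fun_prop : Continuous fun t => Real.exp (ν * t)).mul (this.pow 2)
  have hint : ∀ t, 0 ≤ t → ∫ s in (0 : ℝ)..t, Real.exp (ν * s) * E s ^ 2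
      = ∫ s in (0 : ℝ)..t, f s := fun t ht =>
    intervalIntegral.integral_congr fun s hs => by
      rw [uIcc_of_le ht] at hs
      simp only [hf, max_eq_right hs.1]
  set X : ℝ → ℝ := fun t => N₀ + k * ∫ s in (0 : ℝ)..t, f s with hX
  have hX' : ∀ t, HasDerivAt X (k * f t) t := fun t =>
    ((hfc.integral_hasStrictDerivAt 0 t).hasDerivAt.const_mul k).const_add N₀
  have hEX : ∀ t, 0 ≤ t → f t ≤ c * X t := by
    intro t ht
    have h1 := hN t ht
    rw [hint t ht] at h1
    simp only [hf, max_eq_right ht]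
    have h2 := mul_le_mul_of_nonneg_left (hEN t ht) (Real.exp_pos (ν * t)).le
    have h3 := mul_le_mul_of_nonneg_left h1 hc
    simp only [hX]
    linarith
  have hY' : ∀ t, HasDerivAt (fun t => Real.exp (-(k * c) * t) * X t)
      (Real.exp (-(k * c) * t) * (k * f t - k * c * X t)) t := fun t => by
    refine ((((hasDerivAt_id t).const_mul (-(k * c))).exp).mul (hX' t)).congr_deriv ?_
    simp only [id]
    ring
  have hanti : AntitoneOn (fun t => Real.exp (-(k * c) * t) * X t) (Ici 0) := by
    refine antitoneOn_of_deriv_nonpos (convex_Ici 0)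
      (fun t _ => (hY' t).continuousAt.continuousWithinAt)
      (fun t _ => (hY' t).differentiableAt.differentiableWithinAt) fun t ht => ?_
    rw [interior_Ici] at ht
    rw [(hY' t).deriv]
    refine mul_nonpos_of_nonneg_of_nonpos (Real.exp_pos _).le ?_
    have := mul_le_mul_of_nonneg_left (hEX t (le_of_lt ht)) hk
    linarith
  have h1 := hanti self_mem_Ici hT hT
  have h2 := hN T hT
  rw [hint T hT] at h2
  simp only [hX, intervalIntegral.integral_same, mul_zero, add_zero, Real.exp_zero, one_mul] at h1
  have e1 : Real.exp (-(ν - k * c) * T) * (Real.exp (ν * T) * Real.exp (-(k * c) * T)) = 1 := by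
    rw [← Real.exp_add, ← Real.exp_add, ← Real.exp_zero]
    congr 1; ring
  have h3 := Real.exp_pos (-(ν - k * c) * T)
  have h4 := Real.exp_pos (-(k * c) * T)
  calc N T = Real.exp (-(ν - k * c) * T) * (Real.exp (-(k * c) * T) * (Real.exp (ν * T) * N T)) := by
        linear_combination (-(N T)) * e1
    _ ≤ Real.exp (-(ν - k * c) * T) * N₀ := by
        refine mul_le_mul_of_nonneg_left ?_ h3.le
        exact (mul_le_mul_of_nonneg_left h2 h4.le).trans h1

/-- Exponential decay of the weak solutions, at a rate which is close to `ν` if the gains are close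
to the exact ones. -/
theorem exists_linear_decay (p : ARZModel) {ν : ℝ} (hν : 0 < ν) :
    ∃ C > 0, ∃ k > 0, ∀ ε M Kw Kv, p.BoundedKernels Kw Kv M → p.GainsClose ε Kw Kv →
      ∀ (w₀ v₀ : p.StateL2) (w v : ℝ → p.StateL2), p.IsL2Solution Kw Kv w₀ v₀ w v →
      ∀ t, 0 ≤ t → ‖w t‖ ^ 2 + ‖v t‖ ^ 2
        ≤ C * (Real.exp (-(ν - k * ε ^ 2) * t) * (‖w₀‖ ^ 2 + ‖v₀‖ ^ 2)) := by
  obtain ⟨c, hc, c', hc', hcc⟩ := p.exists_energy_bounds hν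
  have hL := p.L_pos
  have hr := p.r_pos
  have hl2 := p.lam2_pos
  have hX := p.boundedKernels_exact
  set k := p.r * p.lam2 * Real.exp (ν / p.lam2 * p.L) with hk
  have hk0 : 0 < k := by positivity
  -- The discrepancy enters Gronwall's inequality squared, with `discrepancy² ≤ 2 ε² L c * energy`;
  -- the loss in the rate is therefore quadratic in `ε`.
  refine ⟨c * c', by positivity, k * (2 * p.L * c), by positivity,
    fun ε M Kw Kv hK hε w₀ v₀ w v hs t ht => ?_⟩
  set E : ℝ → ℝ := fun t => p.discrepancy Kw Kv (w t) (v t) with hEd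
  have hE : ContinuousOn E (Ici 0) :=
    (hK.continuousOn_feedback hs.continuousOn_w hs.continuousOn_v).sub
      (hX.continuousOn_feedback hs.continuousOn_w hs.continuousOn_v)
  have hdecay := exp_mul_le_of_integral_le (ν := ν) (c := 2 * ε ^ 2 * p.L * c) (k := k)
    (N₀ := p.energy ν w₀ (p.target w₀ v₀)) (N := fun t => p.energy ν (w t) (p.target (w t) (v t)))
    (by positivity) hk0.le hE (fun t ht => by
      have h1 := discrepancy_sq_le hK hε (Lp.memLp (w t)) (Lp.memLp (v t))
      rw [← norm_sq_eq_integral hL.le, ← norm_sq_eq_integral hL.le] at h1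
      refine h1.trans ?_
      rw [mul_assoc (2 * ε ^ 2 * p.L)]
      exact mul_le_mul_of_nonneg_left (hcc (w t) (v t)).1 (by positivity))
    (fun t ht => by
      rcases ht.eq_or_lt with rfl | ht
      · simp [hs.initial_w, hs.initial_v]
      · obtain ⟨h1, h2⟩ := hs.ae_eq_wave hK ht
        rw [energy_congr h1 h2]
        exact energy_wave_le (Lp.memLp w₀) (hX.memLp_backstep (Lp.memLp w₀) (Lp.memLp v₀)) hE
          ht.le) ht
  calc ‖w t‖ ^ 2 + ‖v t‖ ^ 2 ≤ c * p.energy ν (w t) (p.target (w t) (v t)) := (hcc _ _).1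
    _ ≤ c * (Real.exp (-(ν - k * (2 * ε ^ 2 * p.L * c)) * t) * (c' * (‖w₀‖ ^ 2 + ‖v₀‖ ^ 2))) := by
        refine mul_le_mul_of_nonneg_left (hdecay.trans ?_) hc.le
        exact mul_le_mul_of_nonneg_left (hcc w₀ v₀).2 (Real.exp_pos _).le
    _ = _ := by
        rw [show k * (2 * ε ^ 2 * p.L * c) = k * (2 * p.L * c) * ε ^ 2 by ring]
        ring

end ARZModel

/-! ### Weak form of the transport equations for rough waves -/

/-- Derivative along a line of a function with continuous partial derivatives. -/
theorem hasDerivAt_line_of_partials {F Fx Ft : ℝ → ℝ → ℝ}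
    (hx : ∀ x t, HasDerivAt (fun y => F y t) (Fx x t) x)
    (ht : ∀ x t, HasDerivAt (fun s => F x s) (Ft x t) t)
    (hFx : Continuous (Function.uncurry Fx)) (hFt : Continuous (Function.uncurry Ft))
    (x a t : ℝ) :
    HasDerivAt (fun s => F (x + a * s) s) (Ft (x + a * t) t + a * Fx (x + a * t) t) t := by
  have hc : ∀ {G : ℝ → ℝ → ℝ}, Continuous (Function.uncurry G) → ∀ u : ℝ × ℝ,
      ContinuousAt (↿fun x t => ContinuousLinearMap.toSpanSingleton ℝ (G x t)) u := fun hG u =>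
    (((ContinuousLinearMap.toSpanSingletonCLE (𝕜 := ℝ) (E := ℝ)).continuous).comp hG).continuousAt
  have h := (hasStrictFDerivAt_uncurry_coprod (u := (x + a * t, t)) (f := F)
    (f₁ := fun x t => ContinuousLinearMap.toSpanSingleton ℝ (Fx x t))
    (f₂ := fun x t => ContinuousLinearMap.toSpanSingleton ℝ (Ft x t))
    (Filter.Eventually.of_forall fun v => (hx v.1 v.2).hasFDerivAt)
    (Filter.Eventually.of_forall fun v => (ht v.1 v.2).hasFDerivAt)
    (hc hFx _) (hc hFt _)).hasFDerivAt
  have h2 : HasDerivAt (fun s : ℝ => (x + a * s, s)) (a, 1) t := by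
    have e1 := ((hasDerivAt_id t).const_mul a).const_add x
    simpa using e1.prodMk (hasDerivAt_id t)
  refine (HasFDerivAt.comp_hasDerivAt (f := fun s : ℝ => (x + a * s, s)) t h h2).congr_deriv ?_
  simp [Function.HasUncurry.uncurry]
  ring

/-- Differentiation under the integral sign on a compact interval. -/
theorem hasDerivAt_integral_param {F F' : ℝ → ℝ → ℝ} {a b c d t : ℝ} (hab : a ≤ b)
    (hF : ContinuousOn (Function.uncurry F) (Icc a b ×ˢ Ioo c d))
    (hF' : ContinuousOn (Function.uncurry F') (Icc a b ×ˢ Ioo c d))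
    (h : ∀ x ∈ Ioo a b, ∀ t ∈ Ioo c d, HasDerivAt (fun s => F x s) (F' x t) t)
    (ht : t ∈ Ioo c d) :
    HasDerivAt (fun s => ∫ x in a..b, F x s) (∫ x in a..b, F' x t) t := by
  have hsec : ∀ {G : ℝ → ℝ → ℝ}, ContinuousOn (Function.uncurry G) (Icc a b ×ˢ Ioo c d) →
      ∀ s ∈ Ioo c d, ContinuousOn (fun x => G x s) (Icc a b) := fun hG s hs =>
    hG.comp (f := fun x : ℝ => (x, s)) (Continuous.continuousOn (by fun_prop))
      fun x hx => ⟨hx, hs⟩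
  obtain ⟨r, hr, hball⟩ := Metric.isOpen_iff.1 isOpen_Ioo t ht
  have hcb : Metric.closedBall t (r / 2) ⊆ Ioo c d :=
    (Metric.closedBall_subset_ball (by linarith)).trans hball
  obtain ⟨C, hC⟩ := (isCompact_Icc.prod (isCompact_closedBall t (r / 2))).exists_bound_of_continuousOn
    (hF'.mono (prod_mono le_rfl hcb))
  refine (intervalIntegral.hasDerivAt_integral_of_dominated_loc_of_deriv_le (𝕜 := ℝ)
    (F := fun s x => F x s) (F' := fun s x => F' x s)
    (bound := fun _ => C) (Metric.ball_mem_nhds t (by linarith : 0 < r / 2)) ?_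
    ((hsec hF t ht).intervalIntegrable_of_Icc hab) ?_ ?_ intervalIntegrable_const ?_).2
  · filter_upwards [isOpen_Ioo.mem_nhds ht] with s hs
    rw [uIoc_of_le hab]
    exact ((hsec hF s hs).mono Ioc_subset_Icc_self).aestronglyMeasurable measurableSet_Ioc
  · rw [uIoc_of_le hab]
    exact ((hsec hF' t ht).mono Ioc_subset_Icc_self).aestronglyMeasurable measurableSet_Ioc
  · refine Filter.Eventually.of_forall fun x hx s hs => ?_
    rw [uIoc_of_le hab] at hx
    exact hC (x, s) ⟨⟨hx.1.le, hx.2⟩, Metric.ball_subset_closedBall hs⟩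
  · have hne : ∀ᵐ x : ℝ, x ≠ b := by simp [ae_iff, measure_singleton]
    filter_upwards [hne] with x hxb hx s hs
    rw [uIoc_of_le hab] at hx
    exact h x ⟨hx.1, lt_of_le_of_ne hx.2 hxb⟩ s (hcb (Metric.ball_subset_closedBall hs))

/-- Weak form of the transport equation for a wave moving to the right. -/
theorem integral_transport {H : ℝ → ℝ} {P Px Pt : ℝ → ℝ → ℝ} {L l T : ℝ} (hL : 0 ≤ L) (hl : 0 < l)
    (hT : 0 ≤ T) (hH : IntervalIntegrable H volume (-(l * T)) L)
    (hx : ∀ x t, HasDerivAt (fun y => P y t) (Px x t) x)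
    (ht : ∀ x t, HasDerivAt (fun s => P x s) (Pt x t) t)
    (hP : Continuous (Function.uncurry P))
    (hPx : Continuous (Function.uncurry Px)) (hPt : Continuous (Function.uncurry Pt)) :
    IntervalIntegrable (fun t => ∫ x in (0 : ℝ)..L, H (x - l * t) * (Pt x t + l * Px x t))
      volume 0 T ∧
    (∫ x in (0 : ℝ)..L, H (x - l * T) * P x T) - (∫ x in (0 : ℝ)..L, H x * P x 0)
      = (∫ t in (0 : ℝ)..T, ∫ x in (0 : ℝ)..L, H (x - l * t) * (Pt x t + l * Px x t))
        + l * (∫ t in (0 : ℝ)..T, H (-(l * t)) * P 0 t)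
        - l * ∫ t in (0 : ℝ)..T, H (L - l * t) * P L t := by
  have hlT : 0 ≤ l * T := by positivity
  set d : ℝ → ℝ → ℝ := fun s t => Pt (s + l * t) t + l * Px (s + l * t) t with hd
  have hdc : Continuous (Function.uncurry d) := by
    have e1 : Continuous fun z : ℝ × ℝ => Pt (z.1 + l * z.2) z.2 :=
      hPt.comp (by fun_prop : Continuous fun z : ℝ × ℝ => (z.1 + l * z.2, z.2))
    have e2 : Continuous fun z : ℝ × ℝ => Px (z.1 + l * z.2) z.2 :=
      hPx.comp (by fun_prop : Continuous fun z : ℝ × ℝ => (z.1 + l * z.2, z.2))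
    exact e1.add (continuous_const.mul e2)
  have hline : ∀ s t, HasDerivAt (fun t => P (s + l * t) t) (d s t) t := fun s t =>
    hasDerivAt_line_of_partials hx ht hPx hPt s l t
  -- The profile `H` is merely integrable, so no derivative may fall on it. In the coordinate `s = x
  -- - l t` the rectangle becomes the strip `S`, `H s` is constant in time, and `d s t` is the time
  -- derivative of `P` along the characteristic labelled `s`.
  set S : Set (ℝ × ℝ) := {z | 0 < z.1 + l * z.2 ∧ z.1 + l * z.2 < L} with hS
  have hsc : Continuous fun z : ℝ × ℝ => z.1 + l * z.2 := by fun_prop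
  have hSm : MeasurableSet S :=
    ((isOpen_lt continuous_const hsc).inter (isOpen_lt hsc continuous_const)).measurableSet
  set a := -(l * T) with ha
  have haL : a ≤ L := by linarith
  set μ := volume.restrict (Ioc a L) with hμ
  set η := volume.restrict (Ioc 0 T) with hη
  have hHi : IntegrableOn H (Ioc a L) := by
    rwa [intervalIntegrable_iff_integrableOn_Ioc_of_le haL] at hH
  have hFint : Integrable (fun z : ℝ × ℝ => S.indicator (fun z => H z.1 * d z.1 z.2) z)
      (μ.prod η) := by
    refine Integrable.indicator ?_ hSm
    have h1 : Integrable (fun z : ℝ × ℝ => H z.1) (μ.prod η) := Integrable.comp_fst hHi η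
    rw [hμ, hη, Measure.prod_restrict] at h1 ⊢
    exact IntegrableOn.mul_continuousOn_of_subset (K := Icc a L ×ˢ Icc 0 T) h1 hdc.continuousOn
      (measurableSet_Ioc.prod measurableSet_Ioc) (isCompact_Icc.prod isCompact_Icc)
      (prod_mono Ioc_subset_Icc_self Ioc_subset_Icc_self)
  -- the inner integrals
  have hin_t : ∀ t ∈ Ioc 0 T, ∫ s, S.indicator (fun z => H z.1 * d z.1 z.2) (s, t) ∂μ
      = ∫ x in (0 : ℝ)..L, H (x - l * t) * (Pt x t + l * Px x t) := by
    intro t ht'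
    have h1 : ∀ s, S.indicator (fun z => H z.1 * d z.1 z.2) (s, t)
        = (Ioo (-(l * t)) (L - l * t)).indicator (fun s => H s * d s t) s := by
      intro s
      by_cases h : (s, t) ∈ S
      · rw [indicator_of_mem h, indicator_of_mem]
        exact ⟨by linarith [h.1], by linarith [h.2]⟩
      · rw [indicator_of_notMem h, indicator_of_notMem]
        exact fun h' => h ⟨by linarith [h'.1], by linarith [h'.2]⟩
    have hlt : l * t ≤ l * T := mul_le_mul_of_nonneg_left ht'.2 hl.le
    have hlt0 : 0 < l * t := mul_pos hl ht'.1
    simp_rw [h1]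
    rw [integral_indicator measurableSet_Ioo, Measure.restrict_restrict measurableSet_Ioo,
      inter_eq_self_of_subset_left, ← integral_Ioc_eq_integral_Ioo,
      ← intervalIntegral.integral_of_le (by linarith)]
    · have := intervalIntegral.integral_comp_sub_right (a := 0) (b := L)
        (fun s => H s * d s t) (l * t)
      rw [zero_sub] at this
      rw [← this]
      simp [hd]
    · exact fun s hs => ⟨by linarith [hs.1], by linarith [hs.2]⟩
  -- The characteristic labelled `s` enters the rectangle at time `max 0 (-s / l)` and leaves it at
  -- `min T ((L - s) / l)`. Sorting these cases later produces the four boundary integrals.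
  have hin_s : ∀ s ∈ Ioc a L, ∫ t, S.indicator (fun z => H z.1 * d z.1 z.2) (s, t) ∂η
      = H s * (P (s + l * min T ((L - s) / l)) (min T ((L - s) / l))
        - P (s + l * max 0 (-s / l)) (max 0 (-s / l))) := by
    intro s hs
    have h0 : max 0 (-s / l) ≤ min T ((L - s) / l) := by
      refine max_le (le_min hT (div_nonneg (by linarith [hs.2]) hl.le)) (le_min ?_ ?_)
      · rw [div_le_iff₀ hl]; linarith [hs.1]
      · gcongr; linarith
    have h1 : ∀ t ∈ Ioc 0 T, S.indicator (fun z => H z.1 * d z.1 z.2) (s, t)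
        = (Ioo (-s / l) ((L - s) / l)).indicator (fun t => H s * d s t) t := by
      intro t _
      have : (s, t) ∈ S ↔ t ∈ Ioo (-s / l) ((L - s) / l) := by
        simp only [hS, mem_Ioo, div_lt_iff₀ hl, lt_div_iff₀ hl, mem_ofPred_eq]
        constructor <;> rintro ⟨h2, h3⟩ <;> constructor <;> linarith
      by_cases h : (s, t) ∈ S
      · rw [indicator_of_mem h, indicator_of_mem (this.1 h)]
      · rw [indicator_of_notMem h, indicator_of_notMem fun h' => h (this.2 h')]
    rw [hη, setIntegral_congr_fun measurableSet_Ioc h1, setIntegral_indicator measurableSet_Ioo,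
      integral_const_mul]
    congr 1
    have h2 : ∫ t in Ioc 0 T ∩ Ioo (-s / l) ((L - s) / l), d s t
        = ∫ t in Ioo 0 T ∩ Ioo (-s / l) ((L - s) / l), d s t :=
      setIntegral_congr_set ((Ioo_ae_eq_Ioc (μ := volume)).symm.inter (Filter.EventuallyEq.refl _ _))
    rw [h2, Ioo_inter_Ioo, ← integral_Ioc_eq_integral_Ioo, ← intervalIntegral.integral_of_le h0]
    exact intervalIntegral.integral_eq_sub_of_hasDerivAt (fun t _ => hline s t)
      (Continuous.intervalIntegrable (hdc.comp (by fun_prop : Continuous fun t : ℝ => (s, t))) _ _)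
  have hswap := integral_integral_swap
    (f := fun s t => S.indicator (fun z => H z.1 * d z.1 z.2) (s, t)) hFint
  have hlhs : ∫ t, ∫ s, S.indicator (fun z => H z.1 * d z.1 z.2) (s, t) ∂μ ∂η
      = ∫ t in (0 : ℝ)..T, ∫ x in (0 : ℝ)..L, H (x - l * t) * (Pt x t + l * Px x t) := by
    rw [intervalIntegral.integral_of_le hT]
    exact setIntegral_congr_fun measurableSet_Ioc hin_t
  refine ⟨?_, ?_⟩
  · rw [intervalIntegrable_iff_integrableOn_Ioc_of_le hT]
    exact IntegrableOn.congr_fun hFint.integral_prod_right hin_t measurableSet_Ioc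
  rw [← hlhs, ← hswap]
  have hrhs : ∫ s, ∫ t, S.indicator (fun z => H z.1 * d z.1 z.2) (s, t) ∂η ∂μ
      = ∫ s in a..L, (H s * P (s + l * min T ((L - s) / l)) (min T ((L - s) / l))
        - H s * P (s + l * max 0 (-s / l)) (max 0 (-s / l))) := by
    rw [intervalIntegral.integral_of_le haL]
    refine setIntegral_congr_fun measurableSet_Ioc fun s hs => ?_
    rw [← mul_sub]
    exact hin_s s hs
  have c1 : Continuous fun s => P (s + l * min T ((L - s) / l)) (min T ((L - s) / l)) :=
    hP.comp (by fun_prop : Continuous fun s =>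
      (s + l * min T ((L - s) / l), min T ((L - s) / l)))
  have c2 : Continuous fun s => P (s + l * max 0 (-s / l)) (max 0 (-s / l)) :=
    hP.comp (by fun_prop : Continuous fun s => (s + l * max 0 (-s / l), max 0 (-s / l)))
  have i1 := hH.mul_continuousOn c1.continuousOn
  have i2 := hH.mul_continuousOn c2.continuousOn
  have hu : uIcc a L = Icc a L := uIcc_of_le haL
  have hsub : ∀ {f : ℝ → ℝ} {u v : ℝ}, IntervalIntegrable f volume a L → u ∈ Icc a L →
      v ∈ Icc a L → IntervalIntegrable f volume u v := fun hf h h' =>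
    hf.mono_set (by rw [hu]; exact uIcc_subset_Icc h h')
  have m0 : a ∈ Icc a L := ⟨le_rfl, haL⟩
  have m1 : (0 : ℝ) ∈ Icc a L := ⟨by linarith, hL⟩
  have m2 : L - l * T ∈ Icc a L := ⟨by linarith, by linarith⟩
  have m3 : L ∈ Icc a L := ⟨haL, le_rfl⟩
  rw [hrhs, intervalIntegral.integral_sub i1 i2,
    ← intervalIntegral.integral_add_adjacent_intervals (hsub i1 m0 m2) (hsub i1 m2 m3),
    ← intervalIntegral.integral_add_adjacent_intervals (hsub i2 m0 m1) (hsub i2 m1 m3)]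
  have e1 : ∫ s in a..(L - l * T), H s * P (s + l * min T ((L - s) / l)) (min T ((L - s) / l))
      = ∫ x in (0 : ℝ)..L, H (x - l * T) * P x T := by
    have := intervalIntegral.integral_comp_sub_right (a := 0) (b := L)
        (fun s => H s * P (s + l * T) T) (l * T)
    simp only [sub_add_cancel, zero_sub] at this
    rw [this]
    refine ARZModel.integral_congr_Ioo m2.1 fun s hs => ?_
    rw [min_eq_left]
    rw [le_div_iff₀ hl]; linarith [hs.2]
  have e2 : ∫ s in (L - l * T)..L, H s * P (s + l * min T ((L - s) / l)) (min T ((L - s) / l))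
      = l * ∫ t in (0 : ℝ)..T, H (L - l * t) * P L t := by
    have := intervalIntegral.integral_comp_sub_mul (a := 0) (b := T)
        (fun s => H s * P L ((L - s) / l)) hl.ne' L
    have e : ∀ t, (L - (L - l * t)) / l = t := fun t => by field_simp; ring
    simp only [e, mul_zero, sub_zero] at this
    rw [this, smul_eq_mul, ← mul_assoc, mul_inv_cancel₀ hl.ne', one_mul]
    refine ARZModel.integral_congr_Ioo m2.2 fun s hs => ?_
    rw [min_eq_right]
    · congr 2; field_simp; ring
    · rw [div_le_iff₀ hl]; linarith [hs.1]
  have e3 : ∫ s in a..0, H s * P (s + l * max 0 (-s / l)) (max 0 (-s / l))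
      = l * ∫ t in (0 : ℝ)..T, H (-(l * t)) * P 0 t := by
    have := intervalIntegral.integral_comp_sub_mul (a := 0) (b := T)
        (fun s => H s * P 0 (-s / l)) hl.ne' 0
    have e : ∀ t, -(-(l * t)) / l = t := fun t => by field_simp
    simp only [zero_sub, e, mul_zero, neg_zero] at this
    rw [this, smul_eq_mul, ← mul_assoc, mul_inv_cancel₀ hl.ne', one_mul]
    refine ARZModel.integral_congr_Ioo m1.1 fun s hs => ?_
    rw [max_eq_right]
    · congr 2; field_simp; ring
    · exact div_nonneg (by linarith [hs.2]) hl.le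
  have e4 : ∫ s in (0 : ℝ)..L, H s * P (s + l * max 0 (-s / l)) (max 0 (-s / l))
      = ∫ x in (0 : ℝ)..L, H x * P x 0 := by
    refine ARZModel.integral_congr_Ioo hL fun s hs => ?_
    rw [max_eq_left]
    · simp
    · exact div_nonpos_of_nonpos_of_nonneg (by linarith [hs.1]) hl.le
  rw [e1, e2, e3, e4]
  ring

/-- Weak form of the transport equation for a wave moving to the left. -/
theorem integral_transport_left {F : ℝ → ℝ} {P Px Pt : ℝ → ℝ → ℝ} {L l T : ℝ} (hL : 0 ≤ L)
    (hl : 0 < l) (hT : 0 ≤ T) (hF : IntervalIntegrable F volume 0 (L + l * T))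
    (hx : ∀ x t, HasDerivAt (fun y => P y t) (Px x t) x)
    (ht : ∀ x t, HasDerivAt (fun s => P x s) (Pt x t) t)
    (hP : Continuous (Function.uncurry P))
    (hPx : Continuous (Function.uncurry Px)) (hPt : Continuous (Function.uncurry Pt)) :
    IntervalIntegrable (fun t => ∫ x in (0 : ℝ)..L, F (x + l * t) * (Pt x t - l * Px x t))
      volume 0 T ∧
    (∫ x in (0 : ℝ)..L, F (x + l * T) * P x T) - (∫ x in (0 : ℝ)..L, F x * P x 0)
      = (∫ t in (0 : ℝ)..T, ∫ x in (0 : ℝ)..L, F (x + l * t) * (Pt x t - l * Px x t))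
        + l * (∫ t in (0 : ℝ)..T, F (L + l * t) * P L t)
        - l * ∫ t in (0 : ℝ)..T, F (l * t) * P 0 t := by
  -- The reflection `x ↦ L - x` reduces the claim to the wave moving to the right.
  have hH : IntervalIntegrable (fun x => F (L - x)) volume (-(l * T)) L := by
    have := hF.comp_sub_left L
    have e : L - (L + l * T) = -(l * T) := by ring
    rw [e, sub_zero] at this
    exact this.symm
  have refl : ∀ f : ℝ → ℝ, ∫ x in (0 : ℝ)..L, f (L - x) = ∫ x in (0 : ℝ)..L, f x := fun f => by
    rw [intervalIntegral.integral_comp_sub_left]; simp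
  have hcont : ∀ {G : ℝ → ℝ → ℝ}, Continuous (Function.uncurry G) →
      Continuous (Function.uncurry fun x t => G (L - x) t) := fun hG =>
    hG.comp (by fun_prop : Continuous fun z : ℝ × ℝ => (L - z.1, z.2))
  have key := integral_transport (H := fun x => F (L - x)) (P := fun x t => P (L - x) t)
    (Px := fun x t => -Px (L - x) t) (Pt := fun x t => Pt (L - x) t) hL hl hT hH
    (fun x t => by
      refine ((hx (L - x) t).comp x ((hasDerivAt_id x).const_sub L)).congr_deriv ?_
      ring) (fun x t => ht _ t) (hcont hP) (hcont hPx).neg (hcont hPt)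
  have e1 : ∀ t, ∫ x in (0 : ℝ)..L, F (L - (x - l * t)) * (Pt (L - x) t + l * -Px (L - x) t)
      = ∫ x in (0 : ℝ)..L, F (x + l * t) * (Pt x t - l * Px x t) := fun t => by
    rw [← refl]
    refine intervalIntegral.integral_congr fun x _ => ?_
    rw [show L - (L - x - l * t) = x + l * t by ring, show L - (L - x) = x by ring]
    ring
  have e2 : ∫ x in (0 : ℝ)..L, F (L - (x - l * T)) * P (L - x) T
      = ∫ x in (0 : ℝ)..L, F (x + l * T) * P x T := by
    rw [← refl]
    refine intervalIntegral.integral_congr fun x _ => ?_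
    rw [show L - (L - x - l * T) = x + l * T by ring, show L - (L - x) = x by ring]
  have e3 : ∫ x in (0 : ℝ)..L, F (L - x) * P (L - x) 0 = ∫ x in (0 : ℝ)..L, F x * P x 0 :=
    refl fun x => F x * P x 0
  have e4 : ∀ t, L - -(l * t) = L + l * t := fun t => by ring
  have e5 : ∀ t, L - (L - l * t) = l * t := fun t => by ring
  simp only [e1, e2, e3, e4, e5, sub_zero, sub_self] at key
  exact key

/-! ### Windows of a function on the line as elements of `L²` -/

/-- The restriction of `x ↦ F (x + a)` to `(0, L)`, as an element of `L²`. -/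
noncomputable def window (L : ℝ) (F : ℝ → ℝ) (a : ℝ) : Lp ℝ 2 (volume.restrict (Ioc (0 : ℝ) L)) :=
  open Classical in
  if h : MemLp (fun x => F (x + a)) 2 (volume.restrict (Ioc (0 : ℝ) L)) then h.toLp else 0

theorem coeFn_window {L : ℝ} {F : ℝ → ℝ} {a : ℝ}
    (h : MemLp (fun x => F (x + a)) 2 (volume.restrict (Ioc (0 : ℝ) L))) :
    window L F a =ᵐ[volume.restrict (Ioc 0 L)] fun x => F (x + a) := by
  rw [window, dif_pos h]
  exact h.coeFn_toLp

theorem memLp_window {L c d a : ℝ} {F : ℝ → ℝ} (hF : MemLp F 2 (volume.restrict (Ioc c d)))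
    (ha : a ∈ Icc c (d - L)) : MemLp (fun x => F (x + a)) 2 (volume.restrict (Ioc (0 : ℝ) L)) := by
  rw [← memLp_indicator_iff_restrict measurableSet_Ioc] at hF
  have h1 := (hF.comp_measurePreserving (measurePreserving_add_right volume a)).restrict (Ioc 0 L)
  refine (memLp_congr_ae ?_).1 h1
  rw [Filter.EventuallyEq, ae_restrict_iff' measurableSet_Ioc]
  refine Filter.Eventually.of_forall fun x hx => ?_
  exact indicator_of_mem (show x + a ∈ Ioc c d from
    ⟨by linarith [hx.1, ha.1], by linarith [hx.2, ha.2]⟩) F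

/-- Strong continuity of translations in `L²`: `F`, cut off outside `(c, d]`, is translated on the
whole line and then restricted to `(0, L]`. For windows inside `(c, d]` the cut-off is not seen. -/
theorem continuousOn_window {L c d : ℝ} {F : ℝ → ℝ} (hF : MemLp F 2 (volume.restrict (Ioc c d))) :
    ContinuousOn (window L F) (Icc c (d - L)) := by
  have hG := (memLp_indicator_iff_restrict measurableSet_Ioc).2 hF
  set g := hG.toLp
  let τ : C(ℝ, C(ℝ, ℝ)) := (ContinuousMap.mk (fun z : ℝ × ℝ => z.2 + z.1) (by fun_prop)).curry
  have hmp : ∀ a, MeasurePreserving (τ a) volume volume := fun a =>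
    measurePreserving_add_right volume a
  have hc : Continuous fun a => Lp.compMeasurePreserving (τ a) (hmp a) g :=
    continuous_const.compMeasurePreservingLp τ.continuous hmp (by norm_num)
  have hc' := (LpToLpRestrictCLM ℝ ℝ ℝ volume 2 (Ioc 0 L)).continuous.comp hc
  refine hc'.continuousOn.congr fun a ha => ?_
  apply Lp.ext
  have h1 : LpToLpRestrictCLM ℝ ℝ ℝ volume 2 (Ioc 0 L) (Lp.compMeasurePreserving (τ a) (hmp a) g)
      =ᵐ[volume.restrict (Ioc 0 L)] Lp.compMeasurePreserving (τ a) (hmp a) g :=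
    LpToLpRestrictCLM_coeFn ℝ (Ioc 0 L) _
  have h2 := ae_restrict_of_ae (s := Ioc 0 L) (Lp.coeFn_compMeasurePreserving g (hmp a))
  have h3 := ae_restrict_of_ae (s := Ioc 0 L)
    ((hmp a).quasiMeasurePreserving.ae_eq_comp hG.coeFn_toLp)
  filter_upwards [coeFn_window (memLp_window hF ha), h1, h2, h3,
    ae_restrict_mem measurableSet_Ioc] with x e1 e2 e3 e4 hx
  rw [e1]
  refine Eq.symm (e2.trans (e3.trans (e4.trans ?_)))
  exact indicator_of_mem (show x + a ∈ Ioc c d from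
    ⟨by linarith [hx.1, ha.1], by linarith [hx.2, ha.2]⟩) F

theorem exists_clm_integral_mul {k : ℝ → ℝ} {a b : ℝ} (hab : a ≤ b)
    (hk : ContinuousOn k (Icc a b)) :
    ∃ l : Lp ℝ 2 (volume.restrict (Ioc a b)) →L[ℝ] ℝ, ∀ f, l f = ∫ x in a..b, k x * f x := by
  have h := memLp_of_continuousOn hk
  refine ⟨innerSL ℝ (h.toLp k), fun f => ?_⟩
  rw [innerSL_apply_apply, L2.inner_def, intervalIntegral.integral_of_le hab]
  refine integral_congr_ae ?_
  filter_upwards [h.coeFn_toLp] with x hx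
  simp [hx, mul_comm]

/-! ### Volterra operators on `L²` and the inverse of the exact transform -/

namespace ARZModel

/-- Linearity and boundedness at the level of `L²` classes are needed to read the feedback as one
continuous linear functional of the two waves. The bound `M * L` comes from Cauchy–Schwarz. -/
theorem exists_volterra_clm {p : ARZModel} {K : ℝ → ℝ → ℝ} {M : ℝ} (hM0 : 0 ≤ M)
    (hK : ContinuousOn (Function.uncurry K) p.triangle)
    (hM : ∀ x ξ, (x, ξ) ∈ p.triangle → |K x ξ| ≤ M) :
    ∃ S : p.StateL2 →L[ℝ] p.StateL2, ∀ f : p.StateL2, S f =ᵐ[volume.restrict (Ioc 0 p.L)]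
      fun x => ∫ ξ in (0 : ℝ)..x, K x ξ * f ξ := by
  have hL := p.L_pos
  have hmem := fun f : p.StateL2 => memLp_volterra hM0 hK hM (Lp.memLp f)
  have hae : ∀ {f g : ℝ → ℝ} {x : ℝ}, x ∈ Ioc 0 p.L → f =ᵐ[volume.restrict (Ioc 0 p.L)] g →
      ∫ ξ in (0 : ℝ)..x, K x ξ * f ξ = ∫ ξ in (0 : ℝ)..x, K x ξ * g ξ := by
    intro f g x hx h
    rw [intervalIntegral.integral_of_le hx.1.le, intervalIntegral.integral_of_le hx.1.le]
    refine integral_congr_ae ?_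
    filter_upwards [ae_restrict_of_ae_restrict_of_subset (Ioc_subset_Ioc le_rfl hx.2) h] with ξ hξ
    rw [hξ]
  let S : p.StateL2 →ₗ[ℝ] p.StateL2 :=
    { toFun := fun f => (hmem f).toLp
      map_add' := fun f g => by
        apply Lp.ext
        filter_upwards [(hmem (f + g)).coeFn_toLp, (hmem f).coeFn_toLp, (hmem g).coeFn_toLp,
          Lp.coeFn_add ((hmem f).toLp) ((hmem g).toLp), ae_restrict_mem measurableSet_Ioc]
          with x e1 e2 e3 e4 hx
        rw [e1, e4, Pi.add_apply, e2, e3, hae hx (Lp.coeFn_add f g)]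
        have hx' : x ∈ Icc 0 p.L := ⟨hx.1.le, hx.2⟩
        rw [← intervalIntegral.integral_add (intervalIntegrable_kernel_mul hK (Lp.memLp f) hx')
          (intervalIntegrable_kernel_mul hK (Lp.memLp g) hx')]
        simp [mul_add]
      map_smul' := fun c f => by
        apply Lp.ext
        filter_upwards [(hmem (c • f)).coeFn_toLp, (hmem f).coeFn_toLp,
          Lp.coeFn_smul c ((hmem f).toLp), ae_restrict_mem measurableSet_Ioc] with x e1 e2 e3 hx
        rw [e1, RingHom.id_apply, e3, Pi.smul_apply, e2, hae hx (Lp.coeFn_smul c f),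
          smul_eq_mul, ← intervalIntegral.integral_const_mul]
        refine intervalIntegral.integral_congr fun ξ _ => ?_
        simp only [Pi.smul_apply, smul_eq_mul]
        ring }
  refine ⟨S.mkContinuous (M * p.L) fun f => ?_, fun f => (hmem f).coeFn_toLp⟩
  refine abs_le_of_sq_le_sq' ?_ (by positivity) |>.2
  rw [norm_sq_eq_integral hL.le]
  have h1 := sq_integral_abs_le hL.le (Lp.memLp f)
  rw [← norm_sq_eq_integral hL.le, sub_zero] at h1
  have h2 : ∫ x in (0 : ℝ)..p.L, S f x ^ 2
      ≤ ∫ x in (0 : ℝ)..p.L, (M * ∫ ξ in (0 : ℝ)..p.L, |f ξ|) ^ 2 := by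
    refine intervalIntegral.integral_mono_ae_restrict hL.le
      (intervalIntegrable_sq hL.le (Lp.memLp _)) intervalIntegrable_const ?_
    rw [← restrict_Ioc_eq_restrict_Icc]
    filter_upwards [(hmem f).coeFn_toLp, ae_abs_volterra_le hM0 hK hM (Lp.memLp f)] with x e1 e2
    have : S f x = ∫ ξ in (0 : ℝ)..x, K x ξ * f ξ := e1
    rw [this]
    exact sq_le_sq' (abs_le.1 e2).1 (abs_le.1 e2).2
  refine h2.trans ?_
  rw [intervalIntegral.integral_const, sub_zero, smul_eq_mul]
  calc p.L * (M * ∫ ξ in (0 : ℝ)..p.L, |f ξ|) ^ 2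
      = p.L * M ^ 2 * (∫ ξ in (0 : ℝ)..p.L, |f ξ|) ^ 2 := by ring
    _ ≤ p.L * M ^ 2 * (p.L * ‖f‖ ^ 2) := by gcongr
    _ = _ := by ring

/-- The inverse of the exact backstepping transform. -/
theorem exists_inverse_clm (p : ARZModel) : ∃ S : p.StateL2 × p.StateL2 →L[ℝ] p.StateL2,
    ∀ w b : p.StateL2, S (w, b) =ᵐ[volume.restrict (Ioc 0 p.L)] fun x =>
      b x + ∫ ξ in (0 : ℝ)..x, p.gain * Real.exp (p.gain * (x - ξ)) *
        (b ξ - Real.exp (-(p.kap * ξ)) * w ξ) := by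
  have c1 : Continuous (Function.uncurry fun x ξ : ℝ => p.gain * Real.exp (p.gain * (x - ξ))) := by
    unfold Function.uncurry; fun_prop
  have c2 : Continuous (Function.uncurry fun x ξ : ℝ =>
      p.gain * Real.exp (p.gain * (x - ξ)) * Real.exp (-(p.kap * ξ))) := by
    unfold Function.uncurry; fun_prop
  -- `gain` is negative, so the exponential in the resolvent kernel is at most one on the triangle.
  have hb : ∀ x ξ, (x, ξ) ∈ p.triangle → |p.gain * Real.exp (p.gain * (x - ξ))| ≤ |p.gain| := by
    intro x ξ h
    rw [abs_mul, Real.abs_exp]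
    refine mul_le_of_le_one_right (abs_nonneg _) (Real.exp_le_one_iff.2 ?_)
    exact mul_nonpos_of_nonpos_of_nonneg p.gain_neg.le (sub_nonneg.2 h.2.1)
  obtain ⟨S1, h1⟩ := exists_volterra_clm (abs_nonneg p.gain) c1.continuousOn hb
  obtain ⟨S2, h2⟩ := exists_volterra_clm (abs_nonneg p.gain) c2.continuousOn (fun x ξ h => by
    rw [abs_mul, Real.abs_exp]
    refine (mul_le_of_le_one_right (abs_nonneg _) (Real.exp_le_one_iff.2 ?_)).trans (hb x ξ h)
    have := mul_nonneg p.kap_pos.le h.1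
    simpa using this)
  refine ⟨ContinuousLinearMap.snd ℝ p.StateL2 p.StateL2
    + S1.comp (ContinuousLinearMap.snd ℝ p.StateL2 p.StateL2)
    - S2.comp (ContinuousLinearMap.fst ℝ p.StateL2 p.StateL2), fun w b => ?_⟩
  have e0 : (ContinuousLinearMap.snd ℝ p.StateL2 p.StateL2
      + S1.comp (ContinuousLinearMap.snd ℝ p.StateL2 p.StateL2)
      - S2.comp (ContinuousLinearMap.fst ℝ p.StateL2 p.StateL2)) (w, b) = b + S1 b - S2 w := rfl
  rw [e0]
  filter_upwards [h1 b, h2 w, Lp.coeFn_sub (b + S1 b) (S2 w), Lp.coeFn_add b (S1 b),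
    ae_restrict_mem measurableSet_Ioc] with x e1 e2 e3 e4 hx
  have hx' : x ∈ Icc 0 p.L := ⟨hx.1.le, hx.2⟩
  rw [e3, Pi.sub_apply, e4, Pi.add_apply, e1, e2, add_sub_assoc,
    ← intervalIntegral.integral_sub (intervalIntegrable_kernel_mul c1.continuousOn (Lp.memLp b) hx')
      (intervalIntegrable_kernel_mul c2.continuousOn (Lp.memLp w) hx')]
  congr 1
  refine intervalIntegral.integral_congr fun ξ _ => ?_
  ring

/-- The inverse transform undoes the exact backstepping transform. -/
theorem inverse_target {p : ARZModel} {w v : ℝ → ℝ} (hw : IntervalIntegrable w volume 0 p.L)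
    (hv : IntervalIntegrable v volume 0 p.L) {x : ℝ} (hx : x ∈ Icc 0 p.L) :
    p.target w v x + ∫ ξ in (0 : ℝ)..x, p.gain * Real.exp (p.gain * (x - ξ)) *
        (p.target w v ξ - Real.exp (-(p.kap * ξ)) * w ξ) = v x := by
  set u : ℝ → ℝ := fun ξ => v ξ - Real.exp (-(p.kap * ξ)) * w ξ with hu
  have hs : uIcc 0 x ⊆ uIcc 0 p.L := by
    rw [uIcc_of_le hx.1, uIcc_of_le p.L_pos.le]; exact Icc_subset_Icc le_rfl hx.2
  have hui : IntervalIntegrable u volume 0 x :=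
    (hv.sub (hw.continuousOn_mul (Continuous.continuousOn (by fun_prop)))).mono_set hs
  have hprim : ContinuousOn (fun y => ∫ ξ in (0 : ℝ)..y, u ξ) (uIcc 0 x) :=
    intervalIntegral.continuousOn_primitive_interval' hui left_mem_uIcc
  set h : ℝ → ℝ := fun ξ => p.gain * Real.exp (p.gain * (x - ξ)) with hh
  have hhc : Continuous h := by fun_prop
  -- After exchanging the order of integration, `gain` times the double integral equals the integral
  -- of `h * u` minus `gain * ∫ u`. The first part cancels the single integral of `h * u`, the
  -- second one the Volterra term of `target`.
  have hH : ∀ ξ, ∫ y in ξ..x, h y = Real.exp (p.gain * (x - ξ)) - 1 := by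
    intro ξ
    rw [intervalIntegral.integral_eq_sub_of_hasDerivAt (f := fun y => -Real.exp (p.gain * (x - y)))
      (fun y _ => by
        refine (((hasDerivAt_id y).const_sub x).const_mul p.gain).exp.neg.congr_deriv ?_
        simp only [hh, id]; ring) (hhc.intervalIntegrable _ _)]
    simp only [sub_self, mul_zero, Real.exp_zero]
    ring
  have hq : IntervalIntegrable (fun y => (∫ ξ in (0 : ℝ)..y, u ξ) * h y) volume 0 x :=
    (hprim.mul hhc.continuousOn).intervalIntegrable
  have e1 : ∫ ξ in (0 : ℝ)..x, h ξ * (p.target w v ξ - Real.exp (-(p.kap * ξ)) * w ξ)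
      = ∫ ξ in (0 : ℝ)..x, (h ξ * u ξ - p.gain * ((∫ y in (0 : ℝ)..ξ, u y) * h ξ)) := by
    refine intervalIntegral.integral_congr fun ξ hξ => ?_
    rw [uIcc_of_le hx.1] at hξ
    rw [target_eq hw hv ⟨hξ.1, hξ.2.trans hx.2⟩]
    simp only [hu]
    ring
  rw [target_eq hw hv hx, e1, intervalIntegral.integral_sub (hui.continuousOn_mul hhc.continuousOn)
    (hq.const_mul _), intervalIntegral.integral_const_mul,
    integral_primitive_mul hx.1 hui (hhc.intervalIntegrable _ _)]
  simp_rw [hH, mul_sub, mul_one]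
  rw [intervalIntegral.integral_sub (hui.mul_continuousOn (Continuous.continuousOn (by fun_prop)))
    hui, mul_sub, ← intervalIntegral.integral_const_mul, ← intervalIntegral.integral_const_mul]
  have e2 : ∫ ξ in (0 : ℝ)..x, h ξ * u ξ
      = ∫ ξ in (0 : ℝ)..x, p.gain * (u ξ * Real.exp (p.gain * (x - ξ))) :=
    intervalIntegral.integral_congr fun ξ _ => by simp only [hh]; ring
  rw [e2, intervalIntegral.integral_const_mul]
  ring_nf

end ARZModel

theorem window_sub {L a : ℝ} {F G : ℝ → ℝ}
    (hF : MemLp (fun x => F (x + a)) 2 (volume.restrict (Ioc (0 : ℝ) L)))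
    (hG : MemLp (fun x => G (x + a)) 2 (volume.restrict (Ioc (0 : ℝ) L))) :
    window L F a - window L G a = window L (fun x => F x - G x) a := by
  apply Lp.ext
  filter_upwards [coeFn_window hF, coeFn_window hG,
    coeFn_window (F := fun x => F x - G x) (hF.sub hG),
    Lp.coeFn_sub (window L F a) (window L G a)] with x e1 e2 e3 e4
  rw [e3, e4, Pi.sub_apply, e1, e2]

/-- The factor `1 / (2 γ)` is the gain of the exponentially weighted sup norm; a large `γ` makes the
map on boundary inputs a contraction. -/
theorem integral_sq_le_of_le_exp {E : ℝ → ℝ} {γ m s : ℝ} (hγ : 0 < γ) (hs : 0 ≤ s)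
    (hE : ContinuousOn E (Ici 0)) (h : ∀ t, 0 ≤ t → |E t| ≤ Real.exp (γ * t) * m) :
    ∫ t in (0 : ℝ)..s, E t ^ 2 ≤ m ^ 2 * Real.exp (2 * γ * s) / (2 * γ) := by
  have h1 : ∫ t in (0 : ℝ)..s, m ^ 2 * Real.exp (2 * γ * t)
      = m ^ 2 * Real.exp (2 * γ * s) / (2 * γ) - m ^ 2 / (2 * γ) := by
    rw [intervalIntegral.integral_eq_sub_of_hasDerivAt
      (f := fun t => m ^ 2 * Real.exp (2 * γ * t) / (2 * γ))
      (fun t _ => by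
        refine ((((hasDerivAt_id t).const_mul (2 * γ)).exp.const_mul (m ^ 2)).div_const
          (2 * γ)).congr_deriv ?_
        simp only [id]
        field_simp) (Continuous.intervalIntegrable (by fun_prop) _ _)]
    simp
  have h2 : ∫ t in (0 : ℝ)..s, E t ^ 2 ≤ ∫ t in (0 : ℝ)..s, m ^ 2 * Real.exp (2 * γ * t) := by
    refine intervalIntegral.integral_mono_on hs
      ((hE.mono (by rw [uIcc_of_le hs]; exact Icc_subset_Ici_self)).pow 2).intervalIntegrable
      (Continuous.intervalIntegrable (by fun_prop) _ _) fun t ht => ?_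
    have h3 := pow_le_pow_left₀ (abs_nonneg _) (h t ht.1) 2
    rw [sq_abs, mul_pow, ← Real.exp_nat_mul] at h3
    refine h3.trans_eq ?_
    rw [mul_comm]
    congr 2
    push_cast
    ring
  have h4 : 0 ≤ m ^ 2 / (2 * γ) := by positivity
  linarith

/-! ### Closing the loop by a fixed point for the boundary input -/

namespace ARZModel

variable {p : ARZModel} {w₀ b₀ E : ℝ → ℝ} {T : ℝ}

theorem memLp_waveB (hb : MemLp b₀ 2 (volume.restrict (Ioc 0 p.L))) (hE : ContinuousOn E (Ici 0))
    (hT : 0 ≤ T) : MemLp (p.waveB b₀ E) 2 (volume.restrict (Ioc 0 (p.L + p.lam2 * T))) := by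
  have h0 : 0 ≤ p.L + p.lam2 * T := by
    have := mul_nonneg p.lam2_pos.le hT
    linarith [p.L_pos]
  have i1 := integrable_comp_waveB (p := p) (b₀ := b₀) (fun _ y => y)
    (intervalIntegrable_of_memLp p.L_pos.le hb) hT (continuousOn_input hE)
  have i2 := integrable_comp_waveB (p := p) (b₀ := b₀) (fun _ y => y ^ 2)
    (intervalIntegrable_sq p.L_pos.le hb) hT ((continuousOn_input hE).pow 2)
  rw [intervalIntegrable_iff_integrableOn_Ioc_of_le h0] at i1 i2
  exact (memLp_two_iff_integrable_sq i1.aestronglyMeasurable).2 i2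

/-- The reflection identity is used for the wave, to get measurability, and for its square, to get
square integrability. -/
theorem memLp_waveW (hw : MemLp w₀ 2 (volume.restrict (Ioc 0 p.L)))
    (hb : MemLp b₀ 2 (volume.restrict (Ioc 0 p.L))) (hE : ContinuousOn E (Ici 0))
    (hT : 0 ≤ T) : MemLp (p.waveW w₀ b₀ E) 2 (volume.restrict (Ioc (-(p.lam1 * T)) p.L)) := by
  have hL := p.L_pos.le
  have h0 : -(p.lam1 * T) ≤ p.L := by
    have := mul_nonneg p.lam1_pos.le hT
    linarith
  have h1 : 0 ≤ p.L + p.lam2 * T := by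
    have := mul_nonneg p.lam2_pos.le hT
    linarith [p.L_pos]
  have hB := memLp_waveB hb hE hT
  have i1 := (p.integral_reflection (fW := p.waveW w₀ b₀ E) (fB := p.waveB b₀ E) (k := -p.r) hT
    (uIoc_congr_integrable hL (fun s hs => (waveW_of_pos hs.1).symm)
      (intervalIntegrable_of_memLp hL hw)) (intervalIntegrable_of_memLp h1 hB)
    fun s hs => waveW_of_neg hs).1
  have i2 := (p.integral_reflection (fW := fun s => p.waveW w₀ b₀ E s ^ 2)
    (fB := fun s => p.waveB b₀ E s ^ 2) (k := p.r ^ 2) hT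
    (uIoc_congr_integrable hL (fun s hs => by rw [waveW_of_pos hs.1])
      (intervalIntegrable_sq hL hw)) (intervalIntegrable_sq h1 hB)
    fun s hs => by rw [waveW_of_neg hs]; ring).1
  rw [intervalIntegrable_iff_integrableOn_Ioc_of_le h0] at i1 i2
  exact (memLp_two_iff_integrable_sq i1.aestronglyMeasurable).2 i2

theorem memLp_waveB_shift (hb : MemLp b₀ 2 (volume.restrict (Ioc 0 p.L)))
    (hE : ContinuousOn E (Ici 0)) (hT : 0 ≤ T) :
    MemLp (fun x => p.waveB b₀ E (x + p.lam2 * T)) 2 (volume.restrict (Ioc 0 p.L)) :=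
  memLp_window (memLp_waveB hb hE hT) ⟨mul_nonneg p.lam2_pos.le hT, by linarith⟩

theorem memLp_waveW_shift (hw : MemLp w₀ 2 (volume.restrict (Ioc 0 p.L)))
    (hb : MemLp b₀ 2 (volume.restrict (Ioc 0 p.L))) (hE : ContinuousOn E (Ici 0)) (hT : 0 ≤ T) :
    MemLp (fun x => p.waveW w₀ b₀ E (x + -(p.lam1 * T))) 2 (volume.restrict (Ioc 0 p.L)) :=
  memLp_window (memLp_waveW hw hb hE hT)
    ⟨le_rfl, by have := mul_nonneg p.lam1_pos.le hT; linarith⟩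

/-- The state, at time `t`, which is formed by the two waves. -/
noncomputable def waveState (p : ARZModel) (w₀ b₀ E : ℝ → ℝ) (t : ℝ) : p.StateL2 × p.StateL2 :=
  (window p.L (p.waveW w₀ b₀ E) (-(p.lam1 * t)), window p.L (p.waveB b₀ E) (p.lam2 * t))

theorem continuousOn_waveState (hw : MemLp w₀ 2 (volume.restrict (Ioc 0 p.L)))
    (hb : MemLp b₀ 2 (volume.restrict (Ioc 0 p.L))) (hE : ContinuousOn E (Ici 0)) :
    ContinuousOn (p.waveState w₀ b₀ E) (Ici 0) := by
  have h1 := p.lam1_pos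
  have h2 := p.lam2_pos
  intro t ht
  have ht0 : (0 : ℝ) ≤ t := ht
  have hT : 0 ≤ t + 1 := by linarith
  have hc1 : ContinuousOn (fun s => window p.L (p.waveW w₀ b₀ E) (-(p.lam1 * s)))
      (Icc 0 (t + 1)) :=
    (continuousOn_window (memLp_waveW hw hb hE hT)).comp
      (Continuous.continuousOn (by fun_prop)) fun s hs =>
        ⟨by have := mul_le_mul_of_nonneg_left hs.2 h1.le; linarith,
          by have := mul_nonneg h1.le hs.1; linarith⟩
  have hc2 : ContinuousOn (fun s => window p.L (p.waveB b₀ E) (p.lam2 * s)) (Icc 0 (t + 1)) :=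
    (continuousOn_window (memLp_waveB hb hE hT)).comp
      (Continuous.continuousOn (by fun_prop)) fun s hs =>
        ⟨mul_nonneg h2.le hs.1,
          by have := mul_le_mul_of_nonneg_left hs.2 h2.le; linarith⟩
  refine ((hc1.prodMk hc2) t ⟨ht0, by linarith⟩).mono_of_mem_nhdsWithin ?_
  rw [← Ici_inter_Iic]
  exact inter_mem_nhdsWithin _ (Iic_mem_nhds (by linarith))

/-- The energy inequality with `ν = 0`, where the weights in `x` disappear; the maximum norm of the
product is bounded by the sum of squares. -/
theorem norm_waveState_sq_le (hw : MemLp w₀ 2 (volume.restrict (Ioc 0 p.L)))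
    (hb : MemLp b₀ 2 (volume.restrict (Ioc 0 p.L))) (hE : ContinuousOn E (Ici 0)) (hT : 0 ≤ T) :
    ‖p.waveState w₀ b₀ E T‖ ^ 2 ≤ (1 + 1 / p.r) *
      (p.energy 0 w₀ b₀ + p.r * p.lam2 * ∫ t in (0 : ℝ)..T, E t ^ 2) := by
  have hr := p.r_pos
  have hL := p.L_pos.le
  have hW := memLp_waveW_shift hw hb hE hT
  have hB := memLp_waveB_shift hb hE hT
  have e1 : ‖window p.L (p.waveW w₀ b₀ E) (-(p.lam1 * T))‖ ^ 2
      = ∫ x in (0 : ℝ)..p.L, p.waveW w₀ b₀ E (x + -(p.lam1 * T)) ^ 2 := by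
    rw [norm_sq_eq_integral hL, intervalIntegral.integral_of_le hL,
      intervalIntegral.integral_of_le hL]
    refine integral_congr_ae ?_
    filter_upwards [coeFn_window hW] with x hx
    rw [hx]
  have e2 : ‖window p.L (p.waveB b₀ E) (p.lam2 * T)‖ ^ 2
      = ∫ x in (0 : ℝ)..p.L, p.waveB b₀ E (x + p.lam2 * T) ^ 2 := by
    rw [norm_sq_eq_integral hL, intervalIntegral.integral_of_le hL,
      intervalIntegral.integral_of_le hL]
    refine integral_congr_ae ?_
    filter_upwards [coeFn_window hB] with x hx
    rw [hx]
  have h1 := integral_sq_le_energy (p := p) le_rfl hW hB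
  have h2 := energy_wave_le (ν := 0) hw hb hE hT
  simp only [zero_mul, zero_div, Real.exp_zero, one_mul, mul_one] at h1 h2
  rw [← e1, ← e2] at h1
  have h3 : ‖p.waveState w₀ b₀ E T‖ ^ 2 ≤ ‖window p.L (p.waveW w₀ b₀ E) (-(p.lam1 * T))‖ ^ 2
      + ‖window p.L (p.waveB b₀ E) (p.lam2 * T)‖ ^ 2 := by
    rw [waveState, Prod.norm_mk]
    rcases max_choice ‖window p.L (p.waveW w₀ b₀ E) (-(p.lam1 * T))‖
      ‖window p.L (p.waveB b₀ E) (p.lam2 * T)‖ with h | h <;> rw [h]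
    · exact le_add_of_nonneg_right (sq_nonneg _)
    · exact le_add_of_nonneg_left (sq_nonneg _)
  exact h3.trans (h1.trans (mul_le_mul_of_nonneg_left h2 (by positivity)))

/-- The waves depend linearly on their data. With equal initial profiles only the difference of the
inputs remains, and the contraction estimate is then the a priori bound with zero initial data. -/
theorem waveState_sub {E' : ℝ → ℝ} (hw : MemLp w₀ 2 (volume.restrict (Ioc 0 p.L)))
    (hb : MemLp b₀ 2 (volume.restrict (Ioc 0 p.L))) (hE : ContinuousOn E (Ici 0))
    (hE' : ContinuousOn E' (Ici 0)) (hT : 0 ≤ T) :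
    p.waveState w₀ b₀ E T - p.waveState w₀ b₀ E' T
      = p.waveState (fun _ => 0) (fun _ => 0) (fun t => E t - E' t) T := by
  have hB : ∀ s, p.waveB b₀ E s - p.waveB b₀ E' s
      = p.waveB (fun _ => 0) (fun t => E t - E' t) s := by
    intro s
    unfold waveB
    split_ifs <;> ring
  have hW : ∀ s, p.waveW w₀ b₀ E s - p.waveW w₀ b₀ E' s
      = p.waveW (fun _ => 0) (fun _ => 0) (fun t => E t - E' t) s := by
    intro s
    unfold waveW
    rw [← hB]
    split_ifs <;> ring
  unfold waveState
  rw [Prod.mk_sub_mk, window_sub (memLp_waveW_shift hw hb hE hT) (memLp_waveW_shift hw hb hE' hT),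
    window_sub (memLp_waveB_shift hb hE hT) (memLp_waveB_shift hb hE' hT)]
  simp_rw [hB, hW]

open BoundedContinuousFunction in
/-- Any bounded linear feedback closes the loop of the two waves. -/
theorem exists_wave_input (p : ARZModel) {w₀ b₀ : ℝ → ℝ}
    (D : p.StateL2 × p.StateL2 →L[ℝ] ℝ) (hw : MemLp w₀ 2 (volume.restrict (Ioc 0 p.L)))
    (hb : MemLp b₀ 2 (volume.restrict (Ioc 0 p.L))) :
    ∃ E : ℝ → ℝ, Continuous E ∧ ∀ t, 0 ≤ t → D (p.waveState w₀ b₀ E t) = E t := by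
  have hr := p.r_pos
  have hl2 := p.lam2_pos
  have hz : MemLp (fun _ : ℝ => (0 : ℝ)) 2 (volume.restrict (Ioc 0 p.L)) := MemLp.zero'
  set K := ‖D‖ ^ 2 * (1 + 1 / p.r) with hK
  set k := p.r * p.lam2 with hk
  have hK0 : 0 ≤ K := by positivity
  have hk0 : 0 < k := by positivity
  -- Large enough for `K k / (2 γ) ≤ 1 / 4`; after taking a square root the contraction factor is `1
  -- / 2`.
  set γ := 2 * (K * k) + 1 with hγ
  have hγ0 : 0 < γ := by positivity
  have hγ1 : K * k / (2 * γ) ≤ 1 / 4 := by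
    rw [div_le_iff₀ (by positivity)]
    have := mul_nonneg hK0 hk0.le
    linarith
  let N₀ := |p.energy 0 w₀ b₀|
  have bound : ∀ {w b E : ℝ → ℝ} {m t : ℝ}, MemLp w 2 (volume.restrict (Ioc 0 p.L)) →
      MemLp b 2 (volume.restrict (Ioc 0 p.L)) → Continuous E →
      (∀ s, 0 ≤ s → |E s| ≤ Real.exp (γ * s) * m) → 0 ≤ t →
      (Real.exp (-(γ * t)) * D (p.waveState w b E t)) ^ 2
        ≤ K * |p.energy 0 w b| + (m / 2) ^ 2 := by
    intro w b E m t hw hb hE hm ht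
    have h1 := norm_waveState_sq_le hw hb hE.continuousOn ht
    have h2 := integral_sq_le_of_le_exp hγ0 ht hE.continuousOn hm
    have h3 : D (p.waveState w b E t) ^ 2 ≤ ‖D‖ ^ 2 * ‖p.waveState w b E t‖ ^ 2 := by
      rw [← mul_pow, ← sq_abs]
      exact pow_le_pow_left₀ (abs_nonneg _) (D.le_opNorm _) 2
    have h4 : D (p.waveState w b E t) ^ 2
        ≤ K * (|p.energy 0 w b| + k * (m ^ 2 * Real.exp (2 * γ * t) / (2 * γ))) := by
      refine h3.trans ((mul_le_mul_of_nonneg_left h1 (sq_nonneg _)).trans ?_)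
      rw [← mul_assoc]
      refine mul_le_mul_of_nonneg_left ?_ hK0
      exact add_le_add (le_abs_self _) (mul_le_mul_of_nonneg_left h2 hk0.le)
    have he : Real.exp (-(γ * t)) ^ 2 * Real.exp (2 * γ * t) = 1 := by
      rw [← Real.exp_nat_mul, ← Real.exp_add, Real.exp_eq_one_iff]
      push_cast
      ring
    have he1 : Real.exp (-(γ * t)) ^ 2 ≤ 1 := by
      refine pow_le_one₀ (Real.exp_pos _).le (Real.exp_le_one_iff.2 ?_)
      have := mul_nonneg hγ0.le ht
      linarith
    calc (Real.exp (-(γ * t)) * D (p.waveState w b E t)) ^ 2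
        = Real.exp (-(γ * t)) ^ 2 * D (p.waveState w b E t) ^ 2 := by ring
      _ ≤ Real.exp (-(γ * t)) ^ 2 *
          (K * (|p.energy 0 w b| + k * (m ^ 2 * Real.exp (2 * γ * t) / (2 * γ)))) := by gcongr
      _ = Real.exp (-(γ * t)) ^ 2 * (K * |p.energy 0 w b|) + (Real.exp (-(γ * t)) ^ 2
          * Real.exp (2 * γ * t)) * (m ^ 2 * (K * k / (2 * γ))) := by ring
      _ ≤ 1 * (K * |p.energy 0 w b|) + 1 * (m ^ 2 * (1 / 4)) := by
          rw [he]
          gcongr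
      _ = _ := by ring
  -- Inputs are written as `exp (γ t)` times a bounded continuous function, which turns the weighted
  -- sup norm into the norm of a complete space.
  let inp : (ℝ →ᵇ ℝ) → ℝ → ℝ := fun u t => Real.exp (γ * t) * u t
  have hinp : ∀ u, Continuous (inp u) := fun u =>
    (by fun_prop : Continuous fun t => Real.exp (γ * t)).mul u.continuous
  have hcont : ∀ u, Continuous fun t : ℝ =>
      Real.exp (-(γ * max 0 t)) * D (p.waveState w₀ b₀ (inp u) (max 0 t)) := fun u =>
    (by fun_prop : Continuous fun t : ℝ => Real.exp (-(γ * max 0 t))).mul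
      (D.continuous.comp ((continuousOn_waveState hw hb (hinp u).continuousOn).comp_continuous
        (by fun_prop) fun t => mem_Ici.2 (le_max_left _ _)))
  have hle : ∀ u : ℝ →ᵇ ℝ, ∀ s, 0 ≤ s → |inp u s| ≤ Real.exp (γ * s) * ‖u‖ := by
    intro u s _
    simp only [inp]
    rw [abs_mul, Real.abs_exp]
    exact mul_le_mul_of_nonneg_left (u.norm_coe_le_norm s) (Real.exp_pos _).le
  -- The clamp `max 0 t` extends the output to negative times, which carry no information. The a
  -- priori bound provides the boundedness required of an element of `ℝ →ᵇ ℝ`.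
  let Φ : (ℝ →ᵇ ℝ) → (ℝ →ᵇ ℝ) := fun u =>
    BoundedContinuousFunction.ofNormedAddCommGroup _ (hcont u)
      (Real.sqrt (K * |p.energy 0 w₀ b₀| + (‖u‖ / 2) ^ 2)) fun t =>
        Real.abs_le_sqrt (bound hw hb (hinp u) (hle u) (le_max_left _ _))
  have hΦ : ∀ u t, Φ u t
      = Real.exp (-(γ * max 0 t)) * D (p.waveState w₀ b₀ (inp u) (max 0 t)) := fun _ _ => rfl
  have hcontr : ContractingWith (1 / 2) Φ := by
    refine ⟨by rw [← NNReal.coe_lt_coe]; norm_num, LipschitzWith.of_dist_le_mul fun u u' => ?_⟩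
    refine (BoundedContinuousFunction.dist_le (by positivity)).2 fun t => ?_
    have hs : (0 : ℝ) ≤ max 0 t := le_max_left _ _
    have e : (fun t => inp u t - inp u' t) = inp (u - u') := by
      funext t
      simp only [inp, BoundedContinuousFunction.coe_sub, Pi.sub_apply]
      ring
    rw [Real.dist_eq, hΦ, hΦ, ← mul_sub, ← map_sub,
      waveState_sub hw hb (hinp u).continuousOn (hinp u').continuousOn hs, e, dist_eq_norm]
    have h := bound hz hz (hinp (u - u')) (hle (u - u')) hs
    have h0 : p.energy 0 (fun _ => 0) (fun _ => 0) = 0 := by simp [energy]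
    rw [h0, abs_zero, mul_zero, zero_add] at h
    refine (abs_le_of_sq_le_sq h (by positivity)).trans_eq ?_
    push_cast
    ring
  obtain ⟨u, hu⟩ : ∃ u, Φ u = u := ⟨_, hcontr.fixedPoint_isFixedPt⟩
  refine ⟨inp u, hinp u, fun t ht => ?_⟩
  have h := DFunLike.congr_fun hu t
  rw [hΦ, max_eq_right ht] at h
  simp only [inp] at h ⊢
  rw [← h, ← mul_assoc, ← Real.exp_add]
  simp

end ARZModel

theorem hasDerivAt_partials_of_contDiff {φ : ℝ → ℝ → ℝ} (h : ContDiff ℝ 1 (Function.uncurry φ)) :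
    (∀ x t, HasDerivAt (fun y => φ y t) (deriv (fun y => φ y t) x) x) ∧
    (∀ x t, HasDerivAt (fun s => φ x s) (deriv (fun s => φ x s) t) t) ∧
    Continuous (Function.uncurry fun x t => deriv (fun y => φ y t) x) ∧
    Continuous (Function.uncurry fun x t => deriv (fun s => φ x s) t) := by
  have hd : ∀ z, HasFDerivAt (Function.uncurry φ) (fderiv ℝ (Function.uncurry φ) z) z := fun z =>
    (h.differentiable one_ne_zero z).hasFDerivAt
  have hx : ∀ x t, HasDerivAt (fun y => φ y t) (fderiv ℝ (Function.uncurry φ) (x, t) (1, 0)) x :=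
    fun x t => (hd (x, t)).comp_hasDerivAt (f := fun y => (y, t)) x
      ((hasDerivAt_id x).prodMk (hasDerivAt_const x t))
  have ht : ∀ x t, HasDerivAt (fun s => φ x s) (fderiv ℝ (Function.uncurry φ) (x, t) (0, 1)) t :=
    fun x t => (hd (x, t)).comp_hasDerivAt (f := fun s => (x, s)) t
      ((hasDerivAt_const t x).prodMk (hasDerivAt_id t))
  have hc : Continuous (fderiv ℝ (Function.uncurry φ)) := h.continuous_fderiv one_ne_zero
  refine ⟨fun x t => (hx x t).differentiableAt.hasDerivAt,
    fun x t => (ht x t).differentiableAt.hasDerivAt, ?_, ?_⟩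
  · have e : (Function.uncurry fun x t => deriv (fun y => φ y t) x)
        = fun z => fderiv ℝ (Function.uncurry φ) z (1, 0) := funext fun z => (hx z.1 z.2).deriv
    rw [e]
    exact hc.clm_apply continuous_const
  · have e : (Function.uncurry fun x t => deriv (fun s => φ x s) t)
        = fun z => fderiv ℝ (Function.uncurry φ) z (0, 1) := funext fun z => (ht z.1 z.2).deriv
    rw [e]
    exact hc.clm_apply continuous_const

/-! ### The adjoint of the inverse transform and existence of weak solutions -/

namespace ARZModel

/-- The adjoint of the Volterra operator in the inverse backstepping transform. -/
noncomputable def tail (p : ARZModel) (h : ℝ → ℝ) (ξ : ℝ) : ℝ :=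
  p.gain * (Real.exp (-(p.gain * ξ)) * ∫ y in ξ..p.L, Real.exp (p.gain * y) * h y)

variable {p : ARZModel}

theorem tail_L (h : ℝ → ℝ) : p.tail h p.L = 0 := by simp [tail]

theorem hasDerivAt_tail {h : ℝ → ℝ} (hh : Continuous h) (x : ℝ) :
    HasDerivAt (p.tail h) (-(p.gain * p.tail h x) - p.gain * h x) x := by
  have hc : Continuous fun y => Real.exp (p.gain * y) * h y := by fun_prop
  have h1 := intervalIntegral.integral_hasDerivAt_left (hc.intervalIntegrable x p.L)
    (hc.stronglyMeasurableAtFilter _ _) hc.continuousAt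
  refine ((((hasDerivAt_id x).const_mul p.gain).neg.exp.mul h1).const_mul p.gain).congr_deriv ?_
  simp only [id, tail, mul_one]
  have : Real.exp (-(p.gain * x)) * Real.exp (p.gain * x) = 1 := by
    rw [← Real.exp_add, neg_add_cancel, Real.exp_zero]
  linear_combination (-(p.gain * h x)) * this

theorem continuous_tail {ψ : ℝ → ℝ → ℝ} (hψ : Continuous (Function.uncurry ψ)) :
    Continuous (Function.uncurry fun x t => p.tail (fun y => ψ y t) x) := by
  have hc : Continuous (Function.uncurry fun (z : ℝ × ℝ) y => Real.exp (p.gain * y) * ψ y z.2) :=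
    (by unfold Function.uncurry; fun_prop :
      Continuous (Function.uncurry fun (z : ℝ × ℝ) (y : ℝ) => Real.exp (p.gain * y))).mul
      (hψ.comp (by fun_prop : Continuous fun q : (ℝ × ℝ) × ℝ => (q.2, q.1.2)))
  have h1 := intervalIntegral.continuous_parametric_intervalIntegral_of_continuous (μ := volume)
    (a₀ := p.L) hc continuous_fst
  have h2 : (Function.uncurry fun x t => p.tail (fun y => ψ y t) x) = fun z : ℝ × ℝ =>
      -(p.gain * (Real.exp (-(p.gain * z.1)) *
        ∫ y in p.L..z.1, Real.exp (p.gain * y) * ψ y z.2)) := by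
    funext z
    simp only [Function.uncurry, tail]
    rw [intervalIntegral.integral_symm p.L z.1]
    ring
  rw [h2]
  exact (continuous_const.mul
    ((by fun_prop : Continuous fun z : ℝ × ℝ => Real.exp (-(p.gain * z.1))).mul h1)).neg

theorem hasDerivAt_tail_param {ψ ψ' : ℝ → ℝ → ℝ} (hψ : Continuous (Function.uncurry ψ))
    (hψ' : Continuous (Function.uncurry ψ')) (hd : ∀ x t, HasDerivAt (fun s => ψ x s) (ψ' x t) t)
    (x t : ℝ) :
    HasDerivAt (fun s => p.tail (fun y => ψ y s) x) (p.tail (fun y => ψ' y t) x) t := by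
  have hc : ∀ {f : ℝ → ℝ → ℝ}, Continuous (Function.uncurry f) →
      Continuous (Function.uncurry fun y s => Real.exp (p.gain * y) * f y s) := fun hf =>
    (by unfold Function.uncurry; fun_prop :
      Continuous (Function.uncurry fun (y _ : ℝ) => Real.exp (p.gain * y))).mul hf
  have hi : ∀ {a b : ℝ}, a ≤ b →
      HasDerivAt (fun s => ∫ y in a..b, Real.exp (p.gain * y) * ψ y s)
        (∫ y in a..b, Real.exp (p.gain * y) * ψ' y t) t := fun hab =>
    hasDerivAt_integral_param (c := t - 1) (d := t + 1) hab (hc hψ).continuousOn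
      (hc hψ').continuousOn (fun x _ s _ => (hd x s).const_mul _) ⟨by linarith, by linarith⟩
  refine HasDerivAt.const_mul _ (HasDerivAt.const_mul _ ?_)
  rcases le_total x p.L with h | h
  · exact hi h
  · simp_rw [intervalIntegral.integral_symm p.L x]
    exact (hi h).neg

/-- Integration by parts. The boundary term at `L` is the one that the exact feedback will cancel in
`weak_integrand_eq`. -/
theorem tail_deriv {h h' : ℝ → ℝ} (hh' : Continuous h') (hd : ∀ x, HasDerivAt h (h' x) x) (x : ℝ) :
    p.tail h' x = p.gain * Real.exp (p.gain * (p.L - x)) * h p.L - p.gain * h x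
      - p.gain * p.tail h x := by
  have hh : Continuous h := continuous_iff_continuousAt.2 fun x => (hd x).continuousAt
  have hi := intervalIntegral.integral_mul_deriv_eq_deriv_mul
    (a := x) (b := p.L) (u := fun y => Real.exp (p.gain * y)) (v := h)
    (u' := fun y => p.gain * Real.exp (p.gain * y)) (v' := h')
    (fun y _ => ((hasDerivAt_id y).const_mul p.gain).exp.congr_deriv
      (by simp only [id, mul_one]; ring)) (fun y _ => hd y)
    (Continuous.intervalIntegrable (by fun_prop) _ _) (hh'.intervalIntegrable _ _)
  have e1 : ∫ y in x..p.L, p.gain * Real.exp (p.gain * y) * h y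
      = p.gain * ∫ y in x..p.L, Real.exp (p.gain * y) * h y := by
    rw [← intervalIntegral.integral_const_mul]
    exact intervalIntegral.integral_congr fun y _ => by ring
  have e2 : Real.exp (-(p.gain * x)) * Real.exp (p.gain * x) = 1 := by
    rw [← Real.exp_add, neg_add_cancel, Real.exp_zero]
  have e3 : Real.exp (p.gain * (p.L - x)) = Real.exp (-(p.gain * x)) * Real.exp (p.gain * p.L) := by
    rw [← Real.exp_add]
    ring_nf
  rw [tail, hi, e1, e3, tail]
  linear_combination (-(p.gain * h x)) * e2

/-- The resolvent kernel factors as `exp (gain x) * exp (-gain ξ)`, so exchanging the order of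
integration moves the inverse transform onto the test function as `h + tail h`, together with a term
in `w`. -/
theorem integral_inverse_mul {w b v h : ℝ → ℝ} (hw : IntervalIntegrable w volume 0 p.L)
    (hb : IntervalIntegrable b volume 0 p.L) (hh : Continuous h)
    (hv : v =ᵐ[volume.restrict (Ioc 0 p.L)] fun x => b x + ∫ ξ in (0 : ℝ)..x,
      p.gain * Real.exp (p.gain * (x - ξ)) * (b ξ - Real.exp (-(p.kap * ξ)) * w ξ)) :
    ∫ x in (0 : ℝ)..p.L, v x * h x = (∫ x in (0 : ℝ)..p.L, b x * (h x + p.tail h x))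
      - ∫ x in (0 : ℝ)..p.L, w x * (Real.exp (-(p.kap * x)) * p.tail h x) := by
  have hL := p.L_pos.le
  have hG : Continuous (p.tail h) :=
    continuous_iff_continuousAt.2 fun x => (hasDerivAt_tail hh x).continuousAt
  set f : ℝ → ℝ := fun ξ => p.gain * Real.exp (-(p.gain * ξ))
    * (b ξ - Real.exp (-(p.kap * ξ)) * w ξ) with hf
  have hfi : IntervalIntegrable f volume 0 p.L :=
    (hb.sub (hw.continuousOn_mul (Continuous.continuousOn (by fun_prop)))).continuousOn_mul
      (Continuous.continuousOn (by fun_prop))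
  have hec : Continuous fun x => Real.exp (p.gain * x) * h x := by fun_prop
  have e1 : ∫ x in (0 : ℝ)..p.L, v x * h x = ∫ x in (0 : ℝ)..p.L,
      (b x * h x + (∫ ξ in (0 : ℝ)..x, f ξ) * (Real.exp (p.gain * x) * h x)) := by
    rw [intervalIntegral.integral_of_le hL, intervalIntegral.integral_of_le hL]
    refine integral_congr_ae ?_
    filter_upwards [hv] with x hx
    have e2 : ∫ ξ in (0 : ℝ)..x, p.gain * Real.exp (p.gain * (x - ξ))
        * (b ξ - Real.exp (-(p.kap * ξ)) * w ξ)
        = Real.exp (p.gain * x) * ∫ ξ in (0 : ℝ)..x, f ξ := by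
      rw [← intervalIntegral.integral_const_mul]
      refine intervalIntegral.integral_congr fun ξ _ => ?_
      simp only [hf]
      rw [mul_sub p.gain x ξ, sub_eq_add_neg (p.gain * x), Real.exp_add]
      ring
    rw [hx, e2]
    ring
  have hbh : IntervalIntegrable (fun x => b x * h x) volume 0 p.L :=
    hb.mul_continuousOn hh.continuousOn
  have hprim : ContinuousOn (fun y => ∫ ξ in (0 : ℝ)..y, f ξ) (uIcc 0 p.L) :=
    intervalIntegral.continuousOn_primitive_interval' hfi left_mem_uIcc
  have hq : IntervalIntegrable (fun x => (∫ ξ in (0 : ℝ)..x, f ξ) * (Real.exp (p.gain * x) * h x))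
      volume 0 p.L := (hprim.mul hec.continuousOn).intervalIntegrable
  rw [e1, intervalIntegral.integral_add hbh hq,
    integral_primitive_mul hL hfi (hec.intervalIntegrable _ _)]
  have e3 : ∫ ξ in (0 : ℝ)..p.L, f ξ * ∫ x in ξ..p.L, Real.exp (p.gain * x) * h x
      = ∫ x in (0 : ℝ)..p.L, (b x * p.tail h x - w x * (Real.exp (-(p.kap * x)) * p.tail h x)) :=
    intervalIntegral.integral_congr fun x _ => by
      simp only [hf, tail]
      ring
  have i1 : IntervalIntegrable (fun x => b x * p.tail h x) volume 0 p.L :=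
    hb.mul_continuousOn hG.continuousOn
  have i2 : IntervalIntegrable (fun x => w x * (Real.exp (-(p.kap * x)) * p.tail h x)) volume 0 p.L :=
    hw.mul_continuousOn (Continuous.continuousOn (by fun_prop))
  rw [e3, intervalIntegral.integral_sub i1 i2, ← add_sub_assoc,
    ← intervalIntegral.integral_add hbh i1]
  congr 1
  exact intervalIntegral.integral_congr fun x _ => by ring

/-- At `x = L` the exact gain on `v` is the constant `gain`. Its contribution is the adjoint
identity tested with a constant, whose `tail` follows from `tail_deriv` for the function `1`; the
remaining `w` terms cancel against the gain on `w`. -/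
theorem feedback_exact_eq {w b v : ℝ → ℝ} (hw : IntervalIntegrable w volume 0 p.L)
    (hb : IntervalIntegrable b volume 0 p.L)
    (hv : v =ᵐ[volume.restrict (Ioc 0 p.L)] fun x => b x + ∫ ξ in (0 : ℝ)..x,
      p.gain * Real.exp (p.gain * (x - ξ)) * (b ξ - Real.exp (-(p.kap * ξ)) * w ξ)) :
    p.feedback p.exactW p.exactV w v
      = (∫ x in (0 : ℝ)..p.L, b x * (p.gain * Real.exp (p.gain * (p.L - x))))
        - ∫ x in (0 : ℝ)..p.L,
          w x * (Real.exp (-(p.kap * x)) * (p.gain * Real.exp (p.gain * (p.L - x)))) := by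
  have h1 := integral_inverse_mul hw hb (continuous_const (y := p.gain)) hv
  have h2 : ∀ x, p.tail (fun _ => p.gain) x = p.gain * Real.exp (p.gain * (p.L - x)) - p.gain := by
    intro x
    have h3 := tail_deriv (p := p) (h := fun _ => 1) (h' := fun _ => 0) continuous_const
      (fun x => hasDerivAt_const x 1) x
    have h4 : p.tail (fun _ => p.gain) x = p.gain * p.tail (fun _ => 1) x := by
      unfold tail
      simp only [mul_one]
      rw [intervalIntegral.integral_mul_const]
      ring
    have h5 : p.tail (fun _ => 0) x = 0 := by simp [tail]
    rw [h4]
    linarith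
  simp_rw [h2] at h1
  have i1 : IntervalIntegrable (fun x => w x * (Real.exp (-(p.kap * x))
      * (p.gain * Real.exp (p.gain * (p.L - x))))) volume 0 p.L :=
    hw.mul_continuousOn (Continuous.continuousOn (by fun_prop))
  have i2 : IntervalIntegrable (fun x => w x * (Real.exp (-(p.kap * x)) * p.gain)) volume 0 p.L :=
    hw.mul_continuousOn (Continuous.continuousOn (by fun_prop))
  have e1 : ∫ x in (0 : ℝ)..p.L, w x * (Real.exp (-(p.kap * x))
      * (p.gain * Real.exp (p.gain * (p.L - x)) - p.gain))
      = (∫ x in (0 : ℝ)..p.L, w x * (Real.exp (-(p.kap * x))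
      * (p.gain * Real.exp (p.gain * (p.L - x)))))
        - ∫ x in (0 : ℝ)..p.L, w x * (Real.exp (-(p.kap * x)) * p.gain) := by
    rw [← intervalIntegral.integral_sub i1 i2]
    exact intervalIntegral.integral_congr fun x _ => by ring
  have e2 : ∫ x in (0 : ℝ)..p.L, p.exactW p.L x * w x
      = -∫ x in (0 : ℝ)..p.L, w x * (Real.exp (-(p.kap * x)) * p.gain) := by
    rw [← intervalIntegral.integral_neg]
    exact intervalIntegral.integral_congr fun x _ => by simp only [exactW]; ring
  have e3 : ∫ x in (0 : ℝ)..p.L, p.exactV p.L x * v x = ∫ x in (0 : ℝ)..p.L, v x * p.gain :=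
    intervalIntegral.integral_congr fun x _ => by simp only [exactV]; ring
  rw [feedback, e2, e3, h1, e1]
  simp only [add_sub_cancel]
  ring

/-- The coupling `c w` and the exact feedback disappear together. What remains are the two free
transport operators, acting on the test functions `φ - exp (-kap x) * tail ψ` for `w` and `ψ + tail
ψ` for `b`. -/
theorem weak_integrand_eq {w b v f ψ ψ' ψt : ℝ → ℝ} (hw : IntervalIntegrable w volume 0 p.L)
    (hb : IntervalIntegrable b volume 0 p.L) (hvi : IntervalIntegrable v volume 0 p.L)
    (hv : v =ᵐ[volume.restrict (Ioc 0 p.L)] fun x => b x + ∫ ξ in (0 : ℝ)..x,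
      p.gain * Real.exp (p.gain * (x - ξ)) * (b ξ - Real.exp (-(p.kap * ξ)) * w ξ))
    (hf : Continuous f) (hψ' : Continuous ψ') (hψt : Continuous ψt)
    (hd : ∀ x, HasDerivAt ψ (ψ' x) x) :
    (∫ x in (0 : ℝ)..p.L, (w x * (f x + p.c x * ψ x) + v x * (ψt x - p.lam2 * ψ' x)))
        + p.lam2 * ψ p.L * p.feedback p.exactW p.exactV w v
      = (∫ x in (0 : ℝ)..p.L, w x * (f x - Real.exp (-(p.kap * x)) * p.tail ψt x
          + p.lam1 * (p.kap * Real.exp (-(p.kap * x)) * p.tail ψ x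
            + Real.exp (-(p.kap * x)) * (p.gain * p.tail ψ x + p.gain * ψ x))))
        + ∫ x in (0 : ℝ)..p.L, b x * (ψt x + p.tail ψt x
          - p.lam2 * (ψ' x + (-(p.gain * p.tail ψ x) - p.gain * ψ x))) := by
  have hψ : Continuous ψ := continuous_iff_continuousAt.2 fun x => (hd x).continuousAt
  have ct : ∀ {h}, Continuous h → Continuous (p.tail h) := fun hh =>
    continuous_iff_continuousAt.2 fun x => (hasDerivAt_tail hh x).continuousAt
  have t1 := ct hψ
  have t2 := ct hψt
  have hχ : Continuous fun x => ψt x - p.lam2 * ψ' x := by fun_prop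
  have t3 := ct hχ
  have hc : Continuous p.c := by unfold c; fun_prop
  have htail : ∀ x, p.tail (fun x => ψt x - p.lam2 * ψ' x) x = p.tail ψt x - p.lam2 *
      (p.gain * Real.exp (p.gain * (p.L - x)) * ψ p.L - p.gain * ψ x - p.gain * p.tail ψ x) := by
    intro x
    rw [← tail_deriv hψ' hd x]
    unfold tail
    rw [show (fun y => Real.exp (p.gain * y) * (ψt y - p.lam2 * ψ' y)) = fun y =>
      Real.exp (p.gain * y) * ψt y - p.lam2 * (Real.exp (p.gain * y) * ψ' y) from
        funext fun y => by ring,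
      intervalIntegral.integral_sub (Continuous.intervalIntegrable (by fun_prop) _ _)
        (Continuous.intervalIntegrable (by fun_prop) _ _), intervalIntegral.integral_const_mul]
    ring
  have i1 : IntervalIntegrable (fun x => w x * (f x + p.c x * ψ x)) volume 0 p.L :=
    hw.mul_continuousOn (Continuous.continuousOn (by fun_prop))
  have i2 : IntervalIntegrable (fun x => v x * (ψt x - p.lam2 * ψ' x)) volume 0 p.L :=
    hvi.mul_continuousOn (Continuous.continuousOn (by fun_prop))
  have iw : ∀ {h}, Continuous h → IntervalIntegrable (fun x => w x * h x) volume 0 p.L := fun hh =>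
    hw.mul_continuousOn hh.continuousOn
  have ib : ∀ {h}, Continuous h → IntervalIntegrable (fun x => b x * h x) volume 0 p.L := fun hh =>
    hb.mul_continuousOn hh.continuousOn
  rw [intervalIntegral.integral_add i1 i2, integral_inverse_mul hw hb hχ hv,
    feedback_exact_eq hw hb hv, mul_sub, ← intervalIntegral.integral_const_mul,
    ← intervalIntegral.integral_const_mul]
  have j1 : IntervalIntegrable (fun x => w x * (Real.exp (-(p.kap * x))
      * p.tail (fun x => ψt x - p.lam2 * ψ' x) x)) volume 0 p.L :=
    iw (h := fun x => Real.exp (-(p.kap * x)) * p.tail (fun x => ψt x - p.lam2 * ψ' x) x)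
      (by fun_prop)
  have j2 : IntervalIntegrable (fun x => p.lam2 * ψ p.L * (w x * (Real.exp (-(p.kap * x))
      * (p.gain * Real.exp (p.gain * (p.L - x)))))) volume 0 p.L :=
    (iw (h := fun x => Real.exp (-(p.kap * x)) * (p.gain * Real.exp (p.gain * (p.L - x))))
      (by fun_prop)).const_mul _
  have j3 : IntervalIntegrable (fun x => b x * (ψt x - p.lam2 * ψ' x
      + p.tail (fun x => ψt x - p.lam2 * ψ' x) x)) volume 0 p.L :=
    ib (h := fun x => ψt x - p.lam2 * ψ' x + p.tail (fun x => ψt x - p.lam2 * ψ' x) x)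
      (by fun_prop)
  have j4 : IntervalIntegrable (fun x => p.lam2 * ψ p.L *
      (b x * (p.gain * Real.exp (p.gain * (p.L - x))))) volume 0 p.L :=
    (ib (h := fun x => p.gain * Real.exp (p.gain * (p.L - x))) (by fun_prop)).const_mul _
  rw [show ∀ a b c d e : ℝ, a + (b - c) + (d - e) = (a - c - e) + (b + d) by intros; ring,
    ← intervalIntegral.integral_sub i1 j1, ← intervalIntegral.integral_sub (i1.sub j1) j2,
    ← intervalIntegral.integral_add j3 j4]
  congr 1
  · refine intervalIntegral.integral_congr fun x _ => ?_
    have h1 := p.lam1_mul_kap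
    simp only [htail]
    rw [c_eq]
    have : p.lam1 * (p.kap * Real.exp (-(p.kap * x)) * p.tail ψ x) = (p.lam1 * p.kap)
      * (Real.exp (-(p.kap * x)) * p.tail ψ x) := by ring
    rw [mul_add p.lam1, this, h1]
    ring
  · refine intervalIntegral.integral_congr fun x _ => ?_
    simp only [htail]
    ring

end ARZModel

namespace ARZModel

variable {p : ARZModel}

/-- The weak formulation for the two waves, in terms of the state in the original coordinates. -/
theorem weak_of_waves {w₀ b₀ E : ℝ → ℝ} (hw₀ : MemLp w₀ 2 (volume.restrict (Ioc 0 p.L)))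
    (hb₀ : MemLp b₀ 2 (volume.restrict (Ioc 0 p.L))) (hE : Continuous E)
    {w b v : ℝ → p.StateL2} {U : ℝ → ℝ}
    (hw : ∀ t, 0 ≤ t → w t =ᵐ[volume.restrict (Ioc 0 p.L)]
      fun x => p.waveW w₀ b₀ E (x + -(p.lam1 * t)))
    (hb : ∀ t, 0 ≤ t → b t =ᵐ[volume.restrict (Ioc 0 p.L)]
      fun x => p.waveB b₀ E (x + p.lam2 * t))
    (hv : ∀ t, 0 ≤ t → v t =ᵐ[volume.restrict (Ioc 0 p.L)] fun x => b t x + ∫ ξ in (0 : ℝ)..x,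
      p.gain * Real.exp (p.gain * (x - ξ)) * (b t ξ - Real.exp (-(p.kap * ξ)) * w t ξ))
    (hU : ∀ t, 0 ≤ t → U t = p.feedback p.exactW p.exactV (w t) (v t) + E t)
    {T : ℝ} (hT : 0 < T) {φ ψ : ℝ → ℝ → ℝ}
    (hφ : ContDiff ℝ 1 (Function.uncurry φ)) (hψ : ContDiff ℝ 1 (Function.uncurry ψ))
    (hφL : ∀ t ∈ Icc 0 T, φ p.L t = 0)
    (hφψ : ∀ t ∈ Icc 0 T, p.lam2 * ψ 0 t = -(p.r * p.lam1 * φ 0 t)) :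
    (∫ x in (0 : ℝ)..p.L, (w T x * φ x T + v T x * ψ x T))
        - (∫ x in (0 : ℝ)..p.L, (w 0 x * φ x 0 + v 0 x * ψ x 0))
      = ∫ t in (0 : ℝ)..T,
          ((∫ x in (0 : ℝ)..p.L,
              (w t x * (deriv (fun s => φ x s) t + p.lam1 * deriv (fun y => φ y t) x
                  + p.c x * ψ x t)
                + v t x * (deriv (fun s => ψ x s) t - p.lam2 * deriv (fun y => ψ y t) x)))
            + p.lam2 * ψ p.L t * U t) := by
  have hL := p.L_pos.le
  have hl1 := p.lam1_pos
  have hl2 := p.lam2_pos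
  have hrl := p.r_mul_lam1
  obtain ⟨dφx, dφt, cφx, cφt⟩ := hasDerivAt_partials_of_contDiff hφ
  obtain ⟨dψx, dψt, cψx, cψt⟩ := hasDerivAt_partials_of_contDiff hψ
  set φx : ℝ → ℝ → ℝ := fun x t => deriv (fun y => φ y t) x
  set φt : ℝ → ℝ → ℝ := fun x t => deriv (fun s => φ x s) t
  set ψx : ℝ → ℝ → ℝ := fun x t => deriv (fun y => ψ y t) x
  set ψt : ℝ → ℝ → ℝ := fun x t => deriv (fun s => ψ x s) t
  have sl : ∀ {f : ℝ → ℝ → ℝ}, Continuous (Function.uncurry f) → ∀ t, Continuous fun x => f x t :=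
    fun hf t => hf.comp (by fun_prop : Continuous fun x : ℝ => (x, t))
  have cφ := hφ.continuous
  have cψ := hψ.continuous
  have cΨ := continuous_tail (p := p) cψ
  have cΨt := continuous_tail (p := p) cψt
  have cexp : Continuous (Function.uncurry fun x _ : ℝ => Real.exp (-(p.kap * x))) := by
    unfold Function.uncurry; fun_prop
  set Ψ : ℝ → ℝ → ℝ := fun x t => p.tail (fun y => ψ y t) x
  set Ψt : ℝ → ℝ → ℝ := fun x t => p.tail (fun y => ψt y t) x
  have dΨx : ∀ x t, HasDerivAt (fun y => Ψ y t) (-(p.gain * Ψ x t) - p.gain * ψ x t) x :=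
    fun x t => hasDerivAt_tail (sl cψ t) x
  have dΨt : ∀ x t, HasDerivAt (fun s => Ψ x s) (Ψt x t) t :=
    hasDerivAt_tail_param cψ cψt dψt
  have dex : ∀ x, HasDerivAt (fun y => Real.exp (-(p.kap * y)))
      (-(p.kap * Real.exp (-(p.kap * x)))) x := fun x => by
    refine ((hasDerivAt_id x).const_mul p.kap).neg.exp.congr_deriv ?_
    simp only [id, Pi.neg_apply]; ring
  have hTW : 0 ≤ p.lam1 * T := by positivity
  have hTB : 0 ≤ p.lam2 * T := by positivity
  have hHi : IntervalIntegrable (p.waveW w₀ b₀ E) volume (-(p.lam1 * T)) p.L :=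
    intervalIntegrable_of_memLp (by linarith) (memLp_waveW hw₀ hb₀ hE.continuousOn hT.le)
  have hFi : IntervalIntegrable (p.waveB b₀ E) volume 0 (p.L + p.lam2 * T) :=
    intervalIntegrable_of_memLp (by linarith) (memLp_waveB hb₀ hE.continuousOn hT.le)
  set H := p.waveW w₀ b₀ E with hH
  set F := p.waveB b₀ E with hF
  -- Each wave is tested with its own pulled-back function; only the boundary integrals at `x = 0`
  -- and `x = L` need further attention.
  obtain ⟨I1, T1⟩ := integral_transport (P := fun x t => φ x t - Real.exp (-(p.kap * x)) * Ψ x t)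
    (Px := fun x t => φx x t + (p.kap * Real.exp (-(p.kap * x)) * Ψ x t
      + Real.exp (-(p.kap * x)) * (p.gain * Ψ x t + p.gain * ψ x t)))
    (Pt := fun x t => φt x t - Real.exp (-(p.kap * x)) * Ψt x t) hL hl1 hT.le hHi
    (fun x t => ((dφx x t).sub ((dex x).mul (dΨx x t))).congr_deriv (by ring))
    (fun x t => (dφt x t).sub ((dΨt x t).const_mul _))
    (cφ.sub (cexp.mul cΨ))
    (cφx.add (((continuous_const.mul cexp).mul cΨ).add
      (cexp.mul ((continuous_const.mul cΨ).add (continuous_const.mul cψ)))))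
    (cφt.sub (cexp.mul cΨt))
  obtain ⟨I2, T2⟩ := integral_transport_left (P := fun x t => ψ x t + Ψ x t)
    (Px := fun x t => ψx x t + (-(p.gain * Ψ x t) - p.gain * ψ x t))
    (Pt := fun x t => ψt x t + Ψt x t) hL hl2 hT.le hFi
    (fun x t => (dψx x t).add (dΨx x t)) (fun x t => (dψt x t).add (dΨt x t))
    (cψ.add cΨ) (cψx.add ((continuous_const.mul cΨ).neg.sub (continuous_const.mul cψ)))
    (cψt.add cΨt)
  have ii : ∀ f : p.StateL2, IntervalIntegrable f volume 0 p.L := fun f =>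
    intervalIntegrable_of_memLp hL (Lp.memLp f)
  have slice : ∀ t, 0 ≤ t → (∫ x in (0 : ℝ)..p.L, (w t x * φ x t + v t x * ψ x t))
      = (∫ x in (0 : ℝ)..p.L, H (x - p.lam1 * t) * (φ x t - Real.exp (-(p.kap * x)) * Ψ x t))
        + ∫ x in (0 : ℝ)..p.L, F (x + p.lam2 * t) * (ψ x t + Ψ x t) := by
    intro t ht
    have i1 : IntervalIntegrable (fun x => w t x * φ x t) volume 0 p.L :=
      (ii (w t)).mul_continuousOn (sl cφ t).continuousOn
    have i2 : IntervalIntegrable (fun x => v t x * ψ x t) volume 0 p.L :=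
      (ii (v t)).mul_continuousOn (sl cψ t).continuousOn
    have i3 : IntervalIntegrable (fun x => w t x * (Real.exp (-(p.kap * x)) * Ψ x t)) volume 0 p.L :=
      (ii (w t)).mul_continuousOn (sl (f := fun x t => Real.exp (-(p.kap * x)) * Ψ x t) (cexp.mul cΨ) t).continuousOn
    rw [intervalIntegral.integral_add i1 i2,
      integral_inverse_mul (ii (w t)) (ii (b t)) (sl cψ t) (hv t ht), ← add_sub_assoc,
      add_sub_right_comm, ← intervalIntegral.integral_sub i1 i3]
    simp only [intervalIntegral.integral_of_le hL]
    congr 1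
    · refine integral_congr_ae ?_
      filter_upwards [hw t ht] with x hx
      rw [hx, sub_eq_add_neg x]
      ring
    · refine integral_congr_ae ?_
      filter_upwards [hb t ht] with x hx
      rw [hx]
  have inner : ∀ t ∈ Icc 0 T, ((∫ x in (0 : ℝ)..p.L,
      (w t x * (φt x t + p.lam1 * φx x t + p.c x * ψ x t)
        + v t x * (ψt x t - p.lam2 * ψx x t))) + p.lam2 * ψ p.L t * U t)
      = ((∫ x in (0 : ℝ)..p.L, H (x - p.lam1 * t) * (φt x t - Real.exp (-(p.kap * x)) * Ψt x t
          + p.lam1 * (φx x t + (p.kap * Real.exp (-(p.kap * x)) * Ψ x t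
            + Real.exp (-(p.kap * x)) * (p.gain * Ψ x t + p.gain * ψ x t)))))
        + ∫ x in (0 : ℝ)..p.L, F (x + p.lam2 * t) * (ψt x t + Ψt x t
          - p.lam2 * (ψx x t + (-(p.gain * Ψ x t) - p.gain * ψ x t))))
        + p.lam2 * (ψ p.L t * E t) := by
    intro t ht
    have h1 := weak_integrand_eq (ii (w t)) (ii (b t)) (ii (v t)) (hv t ht.1)
      (f := fun x => φt x t + p.lam1 * φx x t)
      ((sl cφt t).add ((sl cφx t).const_mul _)) (sl cψx t) (sl cψt t) (fun x => dψx x t)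
    rw [hU t ht.1, mul_add, ← add_assoc, h1, mul_assoc p.lam2]
    congr 2
    · simp only [intervalIntegral.integral_of_le hL]
      refine integral_congr_ae ?_
      filter_upwards [hw t ht.1] with x hx
      rw [hx, sub_eq_add_neg x]
      ring
    · simp only [intervalIntegral.integral_of_le hL]
      refine integral_congr_ae ?_
      filter_upwards [hb t ht.1] with x hx
      rw [hx]
  have hE1 : IntervalIntegrable (fun t => p.lam2 * (ψ p.L t * E t)) volume 0 T :=
    (continuous_const.mul ((cψ.comp (by fun_prop : Continuous fun t : ℝ => (p.L, t))).mul
      hE)).intervalIntegrable _ _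
  rw [slice T hT.le, slice 0 le_rfl,
    intervalIntegral.integral_congr (fun t ht => inner t (by rwa [uIcc_of_le hT.le] at ht)),
    intervalIntegral.integral_add (I1.add I2) hE1, intervalIntegral.integral_add I1 I2,
    intervalIntegral.integral_const_mul]
  simp only [mul_zero, sub_zero, add_zero]
  have hΨL : ∀ t, Ψ p.L t = 0 := fun t => tail_L _
  have B1 : ∫ t in (0 : ℝ)..T, H (p.L - p.lam1 * t) * (φ p.L t - Real.exp (-(p.kap * p.L)) * Ψ p.L t)
      = 0 := by
    rw [intervalIntegral.integral_congr (g := fun _ => (0 : ℝ)) fun t ht => ?_]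
    · simp
    · rw [uIcc_of_le hT.le] at ht
      simp [hφL t ht, hΨL]
  have B2 : ∫ t in (0 : ℝ)..T, F (p.L + p.lam2 * t) * (ψ p.L t + Ψ p.L t)
      = ∫ t in (0 : ℝ)..T, ψ p.L t * E t :=
    integral_congr_Ioo hT.le fun t ht => by
      rw [hF, waveB_input ht.1, hΨL]
      ring
  -- At the inlet the two boundary integrals cancel by the reflection law of the waves, the boundary
  -- condition linking `φ` and `ψ`, and `r λ₁ = λ₂`.
  have B3 : p.lam1 * (∫ t in (0 : ℝ)..T, H (-(p.lam1 * t))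
        * (φ 0 t - Real.exp (-(p.kap * 0)) * Ψ 0 t))
      = p.lam2 * ∫ t in (0 : ℝ)..T, F (p.lam2 * t) * (ψ 0 t + Ψ 0 t) := by
    rw [← intervalIntegral.integral_const_mul, ← intervalIntegral.integral_const_mul]
    refine integral_congr_Ioo hT.le fun t ht => ?_
    have hneg : -(p.lam1 * t) < 0 := by have := mul_pos hl1 ht.1; linarith
    have h1 := hφψ t ⟨ht.1.le, ht.2.le⟩
    have h2 : -(p.r * -(p.lam1 * t)) = p.lam2 * t := by rw [← hrl]; ring
    rw [hH, waveW_of_neg hneg, ← hF, h2]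
    simp only [mul_zero, neg_zero, Real.exp_zero, one_mul]
    linear_combination (-(F (p.lam2 * t))) * h1 - F (p.lam2 * t) * Ψ 0 t * (-hrl)
      + 0 * h2
  rw [B1, B3] at T1
  rw [B2] at T2
  simp only [mul_zero, sub_zero] at T1 T2
  linarith

/-- The input `E` is the fixed point for the functional that sends a pair of waves to the
discrepancy of the recovered state. With it the applied feedback equals the exact feedback plus `E`,
which is what `weak_of_waves` asks for. -/
theorem exists_isL2Solution {Kw Kv : ℝ → ℝ → ℝ} {M : ℝ} (hK : p.BoundedKernels Kw Kv M)
    (w₀ v₀ : p.StateL2) : ∃ w v : ℝ → p.StateL2, p.IsL2Solution Kw Kv w₀ v₀ w v := by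
  have hL := p.L_pos.le
  have hX := p.boundedKernels_exact
  obtain ⟨S, hS⟩ := p.exists_inverse_clm
  obtain ⟨l₁, hl₁⟩ := exists_clm_integral_mul hL
    ((continuousOn_kernel_L hK.contW).sub (continuousOn_kernel_L hX.contW))
  obtain ⟨l₂, hl₂⟩ := exists_clm_integral_mul hL
    ((continuousOn_kernel_L hK.contV).sub (continuousOn_kernel_L hX.contV))
  have ii : ∀ f : p.StateL2, IntervalIntegrable f volume 0 p.L := fun f =>
    intervalIntegrable_of_memLp hL (Lp.memLp f)
  have hb₀ : MemLp (p.target w₀ v₀) 2 (volume.restrict (Ioc 0 p.L)) :=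
    hX.memLp_backstep (Lp.memLp w₀) (Lp.memLp v₀)
  obtain ⟨E, hE, hfix⟩ := p.exists_wave_input
    (l₁.comp (ContinuousLinearMap.fst ℝ p.StateL2 p.StateL2) + l₂.comp S) (Lp.memLp w₀) hb₀
  set st := p.waveState w₀ (p.target w₀ v₀) E with hst
  have hstc : ContinuousOn st (Ici 0) :=
    continuousOn_waveState (Lp.memLp w₀) hb₀ hE.continuousOn
  have hfix' : ∀ t, 0 ≤ t → p.discrepancy Kw Kv (st t).1 (S (st t)) = E t := by
    intro t ht
    rw [discrepancy_eq hK (ii _) (ii _), ← hfix t ht]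
    exact congrArg₂ (· + ·) (hl₁ _).symm (hl₂ _).symm
  have hw : ∀ t, 0 ≤ t → (st t).1 =ᵐ[volume.restrict (Ioc 0 p.L)]
      fun x => p.waveW w₀ (p.target w₀ v₀) E (x + -(p.lam1 * t)) := fun t ht =>
    coeFn_window (memLp_waveW_shift (Lp.memLp w₀) hb₀ hE.continuousOn ht)
  have hb : ∀ t, 0 ≤ t → (st t).2 =ᵐ[volume.restrict (Ioc 0 p.L)]
      fun x => p.waveB (p.target w₀ v₀) E (x + p.lam2 * t) := fun t ht =>
    coeFn_window (memLp_waveB_shift hb₀ hE.continuousOn ht)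
  have hv : ∀ t, S (st t) =ᵐ[volume.restrict (Ioc 0 p.L)] fun x => (st t).2 x +
      ∫ ξ in (0 : ℝ)..x, p.gain * Real.exp (p.gain * (x - ξ)) *
        ((st t).2 ξ - Real.exp (-(p.kap * ξ)) * (st t).1 ξ) := fun t => hS (st t).1 (st t).2
  have w0 : (st 0).1 = w₀ := by
    apply Lp.ext
    filter_upwards [hw 0 le_rfl, ae_restrict_mem measurableSet_Ioc] with x hx hm
    rw [hx, mul_zero, neg_zero, add_zero, waveW_of_pos hm.1]
  have b0 : (st 0).2 =ᵐ[volume.restrict (Ioc 0 p.L)] p.target w₀ v₀ := by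
    filter_upwards [hb 0 le_rfl, ae_restrict_mem measurableSet_Ioc] with x hx hm
    rw [hx, mul_zero, add_zero, waveB_of_le hm.2]
  have v0 : S (st 0) = v₀ := by
    apply Lp.ext
    filter_upwards [hv 0, b0, ae_restrict_mem measurableSet_Ioc] with x hx hbx hm
    rw [hx, w0, hbx, ← inverse_target (ii w₀) (ii v₀) ⟨hm.1.le, hm.2⟩]
    congr 1
    rw [intervalIntegral.integral_of_le hm.1.le, intervalIntegral.integral_of_le hm.1.le]
    refine integral_congr_ae ?_
    filter_upwards [ae_restrict_of_ae_restrict_of_subset (Ioc_subset_Ioc le_rfl hm.2) b0] with ξ hξ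
    rw [hξ]
  refine ⟨fun t => (st t).1, fun t => S (st t), ⟨continuous_fst.comp_continuousOn hstc,
    S.continuous.comp_continuousOn hstc, w0, v0, fun T hT φ ψ hφ hψ hφL hφψ => ?_⟩⟩
  have h := weak_of_waves (w := fun t => (st t).1) (b := fun t => (st t).2)
    (v := fun t => S (st t)) (U := fun t => p.feedback Kw Kv (st t).1 (S (st t)))
    (Lp.memLp w₀) hb₀ hE hw hb (fun t _ => hv t) (fun t ht => by
      rw [← hfix' t ht, discrepancy]
      ring) hT hφ hψ hφL hφψ
  simpa only [w0, v0] using h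

end ARZModel

/-! ### Power energies of damped counter-propagating waves -/

/-- The graph of `x ↦ x ^ (n + 1)` lies above its tangent at `y`. The induction step only uses `(n +
1) * y ^ n * (x - y) ^ 2 ≥ 0`. -/
theorem young_pow {x y : ℝ} (hx : 0 ≤ x) (hy : 0 ≤ y) (n : ℕ) :
    (n + 1) * (y ^ n * x) ≤ x ^ (n + 1) + n * y ^ (n + 1) := by
  induction n with
  | zero => simp
  | succ n ih =>
    have h1 := mul_le_mul_of_nonneg_left ih hx
    have h2 : 0 ≤ (n + 1) * (y ^ n * (x - y) ^ 2) := by positivity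
    push_cast
    have e1 : x ^ (n + 1 + 1) = x * x ^ (n + 1) := by ring
    have e2 : y ^ (n + 1 + 1) = y ^ n * y ^ 2 := by ring
    have e3 : y ^ (n + 1) = y ^ n * y := by ring
    rw [e3] at h1
    rw [e1, e2, e3]
    nlinarith

theorem pow_mul_le_add_pow {x y : ℝ} (hx : 0 ≤ x) (hy : 0 ≤ y) (n : ℕ) :
    y ^ n * x ≤ x ^ (n + 1) + y ^ (n + 1) := by
  rcases le_total x y with h | h
  · have : y ^ n * x ≤ y ^ n * y := by gcongr
    have h2 : 0 ≤ x ^ (n + 1) := by positivity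
    rw [pow_succ y]
    linarith
  · have : y ^ n * x ≤ x ^ n * x := by gcongr
    have h2 : 0 ≤ y ^ (n + 1) := by positivity
    rw [pow_succ x]
    linarith

/-- Jensen's inequality for powers. -/
theorem pow_average_le {L : ℝ} (hL : 0 < L) {P Q : ℝ → ℝ} (hP : ContinuousOn P (Icc 0 L))
    (hQ : ContinuousOn Q (Icc 0 L)) (n : ℕ) :
    2 * L * ((∫ x in (0 : ℝ)..L, (|P x| + |Q x|)) / (2 * L)) ^ (n + 1)
      ≤ ∫ x in (0 : ℝ)..L, (|P x| ^ (n + 1) + |Q x| ^ (n + 1)) := by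
  set I := ∫ x in (0 : ℝ)..L, (|P x| + |Q x|) with hI
  set J := I / (2 * L) with hJ
  have hI0 : 0 ≤ I := intervalIntegral.integral_nonneg hL.le fun x _ => by positivity
  have hJ0 : 0 ≤ J := by positivity
  have h1 : ∫ x in (0 : ℝ)..L, ((n + 1) * J ^ n * (|P x| + |Q x|) - 2 * (n * J ^ (n + 1)))
      ≤ ∫ x in (0 : ℝ)..L, (|P x| ^ (n + 1) + |Q x| ^ (n + 1)) := by
    refine intervalIntegral.integral_mono_on hL.le
      (ContinuousOn.intervalIntegrable_of_Icc hL.le (by fun_prop))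
      (ContinuousOn.intervalIntegrable_of_Icc hL.le (by fun_prop)) fun x _ => ?_
    have := young_pow (abs_nonneg (P x)) hJ0 n
    have := young_pow (abs_nonneg (Q x)) hJ0 n
    linarith
  rw [intervalIntegral.integral_sub
    (ContinuousOn.intervalIntegrable_of_Icc hL.le (by fun_prop)) intervalIntegrable_const,
    intervalIntegral.integral_const_mul, ← hI, intervalIntegral.integral_const, sub_zero,
    smul_eq_mul] at h1
  have h2 : I = 2 * L * J := by rw [hJ]; field_simp
  rw [h2] at h1
  refine le_trans (le_of_eq ?_) h1
  ring

/-- The pointwise bound of the perturbation terms in the energy estimate. -/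
theorem perturbation_le {x y J L : ℝ} (hx : 0 ≤ x) (hy : 0 ≤ y) (hJ : 0 ≤ J) (hL : 0 ≤ L) (n : ℕ) :
    (x ^ n + y ^ n) * (x + y + 2 * L * J)
      ≤ (3 + 2 * L) * (x ^ (n + 1) + y ^ (n + 1)) + 4 * L * J ^ (n + 1) := by
  have h1 := pow_mul_le_add_pow hx hy n
  have h2 := pow_mul_le_add_pow hy hx n
  have h3 := mul_le_mul_of_nonneg_left (pow_mul_le_add_pow hJ hx n) (by positivity : 0 ≤ 2 * L)
  have h4 := mul_le_mul_of_nonneg_left (pow_mul_le_add_pow hJ hy n) (by positivity : 0 ≤ 2 * L)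
  have e : (x ^ n + y ^ n) * (x + y + 2 * L * J) = x ^ (n + 1) + y ^ (n + 1) + y ^ n * x + x ^ n * y
      + 2 * L * (x ^ n * J) + 2 * L * (y ^ n * J) := by ring
  rw [e]
  linarith

/-- Energy estimate for a pair of counter-propagating damped waves at a fixed time. -/
theorem energy_slice_le {L s η θ B : ℝ} (hL : 0 < L) (hη : 0 ≤ η) (hθ : 0 ≤ θ) (hB : 0 ≤ B)
    (hθL : 2 * L * θ ≤ 1) (hs : η * (4 + 4 * L) + B * θ ≤ s / 2)
    {P Q Px Qx Pt Qt a b ax bx p q : ℝ → ℝ}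
    (cP : ContinuousOn P (Icc 0 L)) (cQ : ContinuousOn Q (Icc 0 L))
    (cPx : ContinuousOn Px (Icc 0 L)) (cQx : ContinuousOn Qx (Icc 0 L))
    (cPt : ContinuousOn Pt (Icc 0 L)) (cQt : ContinuousOn Qt (Icc 0 L))
    (ca : ContinuousOn a (Icc 0 L)) (cb : ContinuousOn b (Icc 0 L))
    (cax : ContinuousOn ax (Icc 0 L)) (cbx : ContinuousOn bx (Icc 0 L))
    (dP : ∀ x ∈ Ioo 0 L, HasDerivAt P (Px x) x) (dQ : ∀ x ∈ Ioo 0 L, HasDerivAt Q (Qx x) x)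
    (da : ∀ x ∈ Ioo 0 L, HasDerivAt a (ax x) x) (db : ∀ x ∈ Ioo 0 L, HasDerivAt b (bx x) x)
    (hp : ∀ x ∈ Icc 0 L, s ≤ p x) (hq : ∀ x ∈ Icc 0 L, s ≤ q x)
    (hax : ∀ x ∈ Icc 0 L, |ax x| ≤ η) (hbx : ∀ x ∈ Icc 0 L, |bx x| ≤ η)
    (eP : ∀ x ∈ Icc 0 L, |Pt x + a x * Px x + p x * P x|
      ≤ η * (|P x| + |Q x| + ∫ y in (0 : ℝ)..L, (|P y| + |Q y|)))
    (eQ : ∀ x ∈ Icc 0 L, |Qt x - b x * Qx x + q x * Q x|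
      ≤ η * (|P x| + |Q x| + ∫ y in (0 : ℝ)..L, (|P y| + |Q y|)))
    (h0 : |P 0| ≤ |Q 0|) (h0' : a 0 * |P 0| ≤ b 0 * |Q 0|) (hb0 : 0 ≤ b 0)
    (haL : 0 ≤ a L) (hbL : b L ≤ B)
    (hQL : |Q L| ≤ θ * ∫ y in (0 : ℝ)..L, (|P y| + |Q y|)) (k : ℕ) :
    ∫ x in (0 : ℝ)..L, ((2 * k + 2) * P x ^ (2 * k + 1) * Pt x
        + (2 * k + 2) * Q x ^ (2 * k + 1) * Qt x)
      ≤ -((2 * k + 2) * (s / 2)) * ∫ x in (0 : ℝ)..L, (P x ^ (2 * k + 2) + Q x ^ (2 * k + 2)) := by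
  set I := ∫ y in (0 : ℝ)..L, (|P y| + |Q y|) with hI
  set W := ∫ x in (0 : ℝ)..L, (P x ^ (2 * k + 2) + Q x ^ (2 * k + 2)) with hW
  set J := I / (2 * L) with hJ
  have hI0 : 0 ≤ I := intervalIntegral.integral_nonneg hL.le fun x _ => by positivity
  have hJ0 : 0 ≤ J := by positivity
  have hIJ : I = 2 * L * J := by rw [hJ]; field_simp
  have hev : Even (2 * k + 2) := ⟨k + 1, by ring⟩
  have habs : ∀ y : ℝ, |y| ^ (2 * k + 2) = y ^ (2 * k + 2) := hev.pow_abs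
  have hW0 : 0 ≤ W := intervalIntegral.integral_nonneg hL.le fun x _ =>
    add_nonneg (hev.pow_nonneg _) (hev.pow_nonneg _)
  have hJW : 2 * L * J ^ (2 * k + 2) ≤ W := by
    have h := pow_average_le hL cP cQ (2 * k + 1)
    simp only [show 2 * k + 1 + 1 = 2 * k + 2 from rfl, habs] at h
    exact h
  -- The `x`-derivative of `b Q ^ (2k+2) - a P ^ (2k+2)`: the transport terms of both waves
  -- integrate to boundary values, up to the terms with `ax` and `bx`.
  set Φx : ℝ → ℝ := fun x => (bx x * Q x ^ (2 * k + 2)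
      + b x * ((2 * k + 2) * Q x ^ (2 * k + 1) * Qx x))
    - (ax x * P x ^ (2 * k + 2) + a x * ((2 * k + 2) * P x ^ (2 * k + 1) * Px x)) with hΦx
  have hΦ : ∫ x in (0 : ℝ)..L, Φx x = (b L * Q L ^ (2 * k + 2) - a L * P L ^ (2 * k + 2))
      - (b 0 * Q 0 ^ (2 * k + 2) - a 0 * P 0 ^ (2 * k + 2)) := by
    refine intervalIntegral.integral_eq_sub_of_hasDerivAt_of_le hL.le
      (f := fun x => b x * Q x ^ (2 * k + 2) - a x * P x ^ (2 * k + 2))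
      (by fun_prop) (fun x hx => ?_)
      (ContinuousOn.intervalIntegrable_of_Icc hL.le (by fun_prop))
    refine (((db x hx).mul ((dQ x hx).pow (2 * k + 2))).sub
      ((da x hx).mul ((dP x hx).pow (2 * k + 2)))).congr_deriv ?_
    simp only [hΦx, Pi.pow_apply, show 2 * k + 2 - 1 = 2 * k + 1 from rfl]
    push_cast
    ring
  -- One factor is estimated together with the speeds, the other `2k + 1` factors by `|P 0| ≤ |Q
  -- 0|`. This is why two inlet conditions are required, and it works for every `k`.
  have hbd0 : a 0 * P 0 ^ (2 * k + 2) ≤ b 0 * Q 0 ^ (2 * k + 2) := by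
    have e : ∀ y : ℝ, |y| ^ (2 * k + 2) = |y| * |y| ^ (2 * k + 1) := fun y => pow_succ' _ _
    rw [← habs, ← habs (Q 0), e, e, ← mul_assoc, ← mul_assoc]
    refine (mul_le_mul_of_nonneg_right h0' (by positivity)).trans ?_
    exact mul_le_mul_of_nonneg_left (pow_le_pow_left₀ (abs_nonneg _) h0 _) (by positivity)
  -- `(θ I)^(2k+2) = (2Lθ)^(2k+1) * θ * 2L * J^(2k+2)`, so `2Lθ ≤ 1` and Jensen's inequality give
  -- the bound `θ W` with a constant that does not grow with `k`.
  have hbdL : b L * Q L ^ (2 * k + 2) ≤ B * θ * W := by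
    have h1 : Q L ^ (2 * k + 2) ≤ θ * W := by
      rw [← habs]
      calc |Q L| ^ (2 * k + 2) ≤ (θ * I) ^ (2 * k + 2) := pow_le_pow_left₀ (abs_nonneg _) hQL _
        _ = (2 * L * θ) ^ (2 * k + 1) * (θ * (2 * L * J ^ (2 * k + 2))) := by rw [hIJ]; ring_nf
        _ ≤ 1 * (θ * W) := by
            gcongr
            exact pow_le_one₀ (by positivity) hθL
        _ = θ * W := one_mul _
    calc b L * Q L ^ (2 * k + 2) ≤ B * Q L ^ (2 * k + 2) :=
          mul_le_mul_of_nonneg_right hbL (hev.pow_nonneg _)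
      _ ≤ B * (θ * W) := mul_le_mul_of_nonneg_left h1 hB
      _ = _ := by ring
  have haPL : 0 ≤ a L * P L ^ (2 * k + 2) := mul_nonneg haL (hev.pow_nonneg _)
  have hpt : ∀ x ∈ Icc 0 L, (2 * k + 2) * P x ^ (2 * k + 1) * Pt x
        + (2 * k + 2) * Q x ^ (2 * k + 1) * Qt x
      ≤ Φx x + (((2 * k + 2) * (η * (4 + 2 * L) - s)) * (P x ^ (2 * k + 2) + Q x ^ (2 * k + 2))
        + (2 * k + 2) * η * (4 * L * J ^ (2 * k + 2))) := by
    intro x hx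
    have one : ∀ {X Xt y c d : ℝ}, |Xt + y + c * X| ≤ d → s ≤ c →
        X ^ (2 * k + 1) * Xt ≤ |X| ^ (2 * k + 1) * d - s * X ^ (2 * k + 2)
          - X ^ (2 * k + 1) * y := by
      intro X Xt y c d h1 h2
      have h3 : X ^ (2 * k + 1) * (Xt + y + c * X) ≤ |X| ^ (2 * k + 1) * d := by
        refine (le_abs_self _).trans ?_
        rw [abs_mul, abs_pow]
        exact mul_le_mul_of_nonneg_left h1 (by positivity)
      have h4 := mul_le_mul_of_nonneg_right h2 (hev.pow_nonneg X)
      have h5 : X ^ (2 * k + 1) * (Xt + y + c * X)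
        = X ^ (2 * k + 1) * Xt + X ^ (2 * k + 1) * y + c * X ^ (2 * k + 2) := by ring
      linarith
    have h1 := one (eP x hx) (hp x hx)
    have h2 := one (X := Q x) (Xt := Qt x) (y := -(b x * Qx x)) (d := η * (|P x| + |Q x| + I))
      (by rw [← sub_eq_add_neg]; exact eQ x hx) (hq x hx)
    have h3 := perturbation_le (abs_nonneg (P x)) (abs_nonneg (Q x)) hJ0 hL.le (2 * k + 1)
    simp only [show 2 * k + 1 + 1 = 2 * k + 2 from rfl, habs] at h3
    rw [← hIJ] at h3
    have h4 : ax x * P x ^ (2 * k + 2) ≤ η * P x ^ (2 * k + 2) :=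
      mul_le_mul_of_nonneg_right (abs_le.1 (hax x hx)).2 (hev.pow_nonneg _)
    have h5 : -bx x * Q x ^ (2 * k + 2) ≤ η * Q x ^ (2 * k + 2) :=
      mul_le_mul_of_nonneg_right (neg_le.1 (abs_le.1 (hbx x hx)).1) (hev.pow_nonneg _)
    have h6 := mul_le_mul_of_nonneg_left h3 hη
    have hn : (0 : ℝ) ≤ 2 * k + 2 := by positivity
    have h7 := mul_le_mul_of_nonneg_left (add_le_add (add_le_add h1 h2) h6) hn
    -- The terms from `ax` and `bx` come without the factor `2k + 2`; inserting it raises the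
    -- coefficient `3 + 2L` of `perturbation_le` to `4 + 2L`. The nonlocal term adds another `2L`,
    -- which explains `4 + 4L` in the hypothesis.
    have h8 : η * (P x ^ (2 * k + 2) + Q x ^ (2 * k + 2))
        ≤ (2 * k + 2) * η * (P x ^ (2 * k + 2) + Q x ^ (2 * k + 2)) := by
      have h9 : 0 ≤ η * (P x ^ (2 * k + 2) + Q x ^ (2 * k + 2)) :=
        mul_nonneg hη (add_nonneg (hev.pow_nonneg _) (hev.pow_nonneg _))
      have h10 : (0 : ℝ) ≤ k := Nat.cast_nonneg k
      rw [mul_assoc]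
      exact le_mul_of_one_le_left h9 (by linarith)
    simp only [hΦx]
    linarith
  have hmono := intervalIntegral.integral_mono_on (μ := volume) hL.le
    (ContinuousOn.intervalIntegrable_of_Icc hL.le (by fun_prop))
    (ContinuousOn.intervalIntegrable_of_Icc hL.le (by fun_prop)) hpt
  have iΦ : IntervalIntegrable Φx volume 0 L :=
    ContinuousOn.intervalIntegrable_of_Icc hL.le (by fun_prop)
  have iW : IntervalIntegrable (fun x => ((2 * k + 2) * (η * (4 + 2 * L) - s))
      * (P x ^ (2 * k + 2) + Q x ^ (2 * k + 2))) volume 0 L :=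
    ContinuousOn.intervalIntegrable_of_Icc hL.le (by fun_prop)
  rw [intervalIntegral.integral_add iΦ (iW.add intervalIntegrable_const),
    intervalIntegral.integral_add iW intervalIntegrable_const, intervalIntegral.integral_const_mul,
    ← hW, intervalIntegral.integral_const, smul_eq_mul, sub_zero, hΦ] at hmono
  have hk : (0 : ℝ) ≤ k := Nat.cast_nonneg k
  have hn : (0 : ℝ) ≤ 2 * k + 2 := by positivity
  have f1 : L * ((2 * k + 2) * η * (4 * L * J ^ (2 * k + 2)))
      ≤ (2 * k + 2) * (η * (2 * L)) * W := by
    calc L * ((2 * k + 2) * η * (4 * L * J ^ (2 * k + 2)))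
        = (2 * k + 2) * (η * (2 * L)) * (2 * L * J ^ (2 * k + 2)) := by ring
      _ ≤ _ := mul_le_mul_of_nonneg_left hJW (by positivity)
  have f2 : B * θ * W ≤ (2 * k + 2) * (B * θ) * W := by
    have h9 : 0 ≤ B * θ * W := by positivity
    have := le_mul_of_one_le_left h9 (by linarith : (1 : ℝ) ≤ 2 * k + 2)
    linarith
  have f3 : (2 * k + 2) * (η * (4 + 4 * L) + B * θ) * W ≤ (2 * k + 2) * (s / 2) * W := by gcongr
  linarith

/-- Two counter-propagating damped waves `P_t + a P_x + p P = O(η)`, `Q_t - b Q_x + q Q = O(η)` on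
`[0, L] × [0, T)` with dissipative boundary conditions. -/
structure DampedPair (L T s η θ B : ℝ) (P Q Px Qx Pt Qt a b ax bx p q : ℝ → ℝ → ℝ) : Prop where
  contP : ContinuousOn (Function.uncurry P) (Icc 0 L ×ˢ Ico 0 T)
  contQ : ContinuousOn (Function.uncurry Q) (Icc 0 L ×ˢ Ico 0 T)
  contPx : ContinuousOn (Function.uncurry Px) (Icc 0 L ×ˢ Ico 0 T)
  contQx : ContinuousOn (Function.uncurry Qx) (Icc 0 L ×ˢ Ico 0 T)
  contPt : ContinuousOn (Function.uncurry Pt) (Icc 0 L ×ˢ Ico 0 T)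
  contQt : ContinuousOn (Function.uncurry Qt) (Icc 0 L ×ˢ Ico 0 T)
  conta : ContinuousOn (Function.uncurry a) (Icc 0 L ×ˢ Ico 0 T)
  contb : ContinuousOn (Function.uncurry b) (Icc 0 L ×ˢ Ico 0 T)
  contax : ContinuousOn (Function.uncurry ax) (Icc 0 L ×ˢ Ico 0 T)
  contbx : ContinuousOn (Function.uncurry bx) (Icc 0 L ×ˢ Ico 0 T)
  derivPx : ∀ x ∈ Ioo 0 L, ∀ t ∈ Ioo 0 T, HasDerivAt (fun y => P y t) (Px x t) x
  derivQx : ∀ x ∈ Ioo 0 L, ∀ t ∈ Ioo 0 T, HasDerivAt (fun y => Q y t) (Qx x t) x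
  derivPt : ∀ x ∈ Ioo 0 L, ∀ t ∈ Ioo 0 T, HasDerivAt (fun τ => P x τ) (Pt x t) t
  derivQt : ∀ x ∈ Ioo 0 L, ∀ t ∈ Ioo 0 T, HasDerivAt (fun τ => Q x τ) (Qt x t) t
  derivax : ∀ x ∈ Ioo 0 L, ∀ t ∈ Ioo 0 T, HasDerivAt (fun y => a y t) (ax x t) x
  derivbx : ∀ x ∈ Ioo 0 L, ∀ t ∈ Ioo 0 T, HasDerivAt (fun y => b y t) (bx x t) x
  le_p : ∀ x ∈ Icc 0 L, ∀ t ∈ Ioo 0 T, s ≤ p x t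
  le_q : ∀ x ∈ Icc 0 L, ∀ t ∈ Ioo 0 T, s ≤ q x t
  ax_le : ∀ x ∈ Icc 0 L, ∀ t ∈ Ioo 0 T, |ax x t| ≤ η
  bx_le : ∀ x ∈ Icc 0 L, ∀ t ∈ Ioo 0 T, |bx x t| ≤ η
  eqP : ∀ x ∈ Icc 0 L, ∀ t ∈ Ioo 0 T, |Pt x t + a x t * Px x t + p x t * P x t|
    ≤ η * (|P x t| + |Q x t| + ∫ y in (0 : ℝ)..L, (|P y t| + |Q y t|))
  eqQ : ∀ x ∈ Icc 0 L, ∀ t ∈ Ioo 0 T, |Qt x t - b x t * Qx x t + q x t * Q x t|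
    ≤ η * (|P x t| + |Q x t| + ∫ y in (0 : ℝ)..L, (|P y t| + |Q y t|))
  left : ∀ t ∈ Ioo 0 T, |P 0 t| ≤ |Q 0 t|
  left' : ∀ t ∈ Ioo 0 T, a 0 t * |P 0 t| ≤ b 0 t * |Q 0 t|
  b_nonneg : ∀ t ∈ Ioo 0 T, 0 ≤ b 0 t
  a_nonneg : ∀ t ∈ Ioo 0 T, 0 ≤ a L t
  b_le : ∀ t ∈ Ioo 0 T, b L t ≤ B
  right : ∀ t ∈ Ioo 0 T, |Q L t| ≤ θ * ∫ y in (0 : ℝ)..L, (|P y t| + |Q y t|)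

theorem continuousOn_slice {f : ℝ → ℝ → ℝ} {A I : Set ℝ}
    (hf : ContinuousOn (Function.uncurry f) (A ×ˢ I)) {t : ℝ} (ht : t ∈ I) :
    ContinuousOn (fun x => f x t) A :=
  hf.comp (f := fun x : ℝ => (x, t)) (Continuous.continuousOn (by fun_prop)) fun _ hx => ⟨hx, ht⟩

/-- Continuity, up to the initial time, of an integral over `[0, L]`. -/
theorem continuousOn_integral_Ico {F : ℝ → ℝ → ℝ} {L T : ℝ} (hL : 0 ≤ L)
    (hF : ContinuousOn (Function.uncurry F) (Icc 0 L ×ˢ Ico 0 T)) :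
    ContinuousOn (fun t => ∫ x in (0 : ℝ)..L, F x t) (Ico 0 T) := by
  rw [continuousOn_iff_continuous_domRestrict]
  let G : Ico (0 : ℝ) T → ℝ → ℝ := fun t x => F (projIcc 0 L hL x) t
  have hG : Continuous (Function.uncurry G) :=
    hF.comp_continuous (f := fun z : Ico (0 : ℝ) T × ℝ => ((projIcc 0 L hL z.2 : ℝ), (z.1 : ℝ)))
      (by fun_prop) fun z => ⟨(projIcc 0 L hL z.2).2, z.1.2⟩
  have h := intervalIntegral.continuous_parametric_intervalIntegral_of_continuous' (μ := volume)
    hG 0 L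
  refine h.congr fun t => ?_
  refine intervalIntegral.integral_congr fun x hx => ?_
  rw [uIcc_of_le hL] at hx
  simp only [G, projIcc_of_mem hL hx]

theorem le_exp_mul_of_hasDerivAt_le {W W' : ℝ → ℝ} {c T : ℝ} (hW : ContinuousOn W (Ico 0 T))
    (hd : ∀ t ∈ Ioo 0 T, HasDerivAt W (W' t) t) (hle : ∀ t ∈ Ioo 0 T, W' t ≤ -c * W t)
    {t : ℝ} (ht : t ∈ Ico 0 T) : W t ≤ Real.exp (-c * t) * W 0 := by
  have hd' : ∀ t ∈ Ioo 0 T, HasDerivAt (fun t => Real.exp (c * t) * W t)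
      (Real.exp (c * t) * (c * W t + W' t)) t := fun t ht => by
    refine (((hasDerivAt_id t).const_mul c).exp.mul (hd t ht)).congr_deriv ?_
    simp only [id]
    ring
  have hanti : AntitoneOn (fun t => Real.exp (c * t) * W t) (Ico 0 T) := by
    refine antitoneOn_of_deriv_nonpos (convex_Ico 0 T)
      ((Continuous.continuousOn (by fun_prop)).mul hW) ?_ ?_ <;> rw [interior_Ico]
    · exact fun t ht => (hd' t ht).differentiableAt.differentiableWithinAt
    · intro t ht
      rw [(hd' t ht).deriv]
      have := hle t ht
      exact mul_nonpos_of_nonneg_of_nonpos (Real.exp_pos _).le (by linarith)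
  have h := hanti ⟨le_rfl, ht.1.trans_lt ht.2⟩ ht ht.1
  simp only [mul_zero, Real.exp_zero, one_mul] at h
  calc W t = Real.exp (-c * t) * (Real.exp (c * t) * W t) := by
        rw [← mul_assoc, ← Real.exp_add]; simp
    _ ≤ _ := mul_le_mul_of_nonneg_left h (Real.exp_pos _).le

/-- Decay of all the power energies. -/
theorem DampedPair.integral_pow_le {L T s η θ B : ℝ} {P Q Px Qx Pt Qt a b ax bx p q : ℝ → ℝ → ℝ}
    (h : DampedPair L T s η θ B P Q Px Qx Pt Qt a b ax bx p q) (hL : 0 < L) (hη : 0 ≤ η)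
    (hθ : 0 ≤ θ) (hB : 0 ≤ B) (hθL : 2 * L * θ ≤ 1) (hs : η * (4 + 4 * L) + B * θ ≤ s / 2)
    (k : ℕ) {t : ℝ} (ht : t ∈ Ico 0 T) :
    ∫ x in (0 : ℝ)..L, (P x t ^ (2 * k + 2) + Q x t ^ (2 * k + 2))
      ≤ Real.exp (-((2 * k + 2) * (s / 2)) * t)
        * ∫ x in (0 : ℝ)..L, (P x 0 ^ (2 * k + 2) + Q x 0 ^ (2 * k + 2)) := by
  have hsub : Icc 0 L ×ˢ Ioo 0 T ⊆ Icc 0 L ×ˢ Ico 0 T := prod_mono le_rfl Ioo_subset_Ico_self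
  have hPQ : ContinuousOn (Function.uncurry fun x t => P x t ^ (2 * k + 2) + Q x t ^ (2 * k + 2))
      (Icc 0 L ×ˢ Ico 0 T) := (h.contP.pow _).add (h.contQ.pow _)
  refine le_exp_mul_of_hasDerivAt_le (continuousOn_integral_Ico hL.le hPQ)
    (W' := fun t => ∫ x in (0 : ℝ)..L, ((2 * k + 2) * P x t ^ (2 * k + 1) * Pt x t
        + (2 * k + 2) * Q x t ^ (2 * k + 1) * Qt x t)) (fun t ht => ?_) (fun t ht => ?_) ht
  · refine hasDerivAt_integral_param (F' := fun x t => (2 * k + 2) * P x t ^ (2 * k + 1) * Pt x t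
        + (2 * k + 2) * Q x t ^ (2 * k + 1) * Qt x t) hL.le (hPQ.mono hsub) ?_ ?_ ht
    · exact (((((continuousOn_const.mul (h.contP.pow _)).mul h.contPt).add
        ((continuousOn_const.mul (h.contQ.pow _)).mul h.contQt))).mono hsub)
    · intro x hx t ht
      refine (((h.derivPt x hx t ht).pow (2 * k + 2)).add
        ((h.derivQt x hx t ht).pow (2 * k + 2))).congr_deriv ?_
      simp only [show 2 * k + 2 - 1 = 2 * k + 1 from rfl]
      push_cast
      ring
  · have ht' : t ∈ Ico 0 T := ⟨ht.1.le, ht.2⟩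
    exact energy_slice_le hL hη hθ hB hθL hs (continuousOn_slice h.contP ht')
      (continuousOn_slice h.contQ ht') (continuousOn_slice h.contPx ht')
      (continuousOn_slice h.contQx ht') (continuousOn_slice h.contPt ht')
      (continuousOn_slice h.contQt ht') (continuousOn_slice h.conta ht')
      (continuousOn_slice h.contb ht') (continuousOn_slice h.contax ht')
      (continuousOn_slice h.contbx ht') (fun x hx => h.derivPx x hx t ht)
      (fun x hx => h.derivQx x hx t ht) (fun x hx => h.derivax x hx t ht)
      (fun x hx => h.derivbx x hx t ht) (p := fun x => p x t) (q := fun x => q x t)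
      (fun x hx => h.le_p x hx t ht) (fun x hx => h.le_q x hx t ht)
      (fun x hx => h.ax_le x hx t ht) (fun x hx => h.bx_le x hx t ht)
      (fun x hx => h.eqP x hx t ht) (fun x hx => h.eqQ x hx t ht) (h.left t ht) (h.left' t ht)
      (h.b_nonneg t ht) (h.a_nonneg t ht) (h.b_le t ht) (h.right t ht) k

/-- The sup norm as a limit of power norms. If `|f x| > N`, then `|f| ≥ N' > N` on an interval of
positive length, and this length is at most `2 L (N / N')^(2k+2)`, which tends to zero. -/
theorem abs_le_of_integral_pow_le {L N : ℝ} (hL : 0 < L) (hN : 0 ≤ N) {f g : ℝ → ℝ}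
    (hf : ContinuousOn f (Icc 0 L)) (hg : ContinuousOn g (Icc 0 L))
    (h : ∀ k : ℕ, ∫ x in (0 : ℝ)..L, (f x ^ (2 * k + 2) + g x ^ (2 * k + 2))
      ≤ 2 * L * N ^ (2 * k + 2)) {x : ℝ} (hx : x ∈ Icc 0 L) : |f x| ≤ N := by
  by_contra! hlt
  obtain ⟨N', h1, h2⟩ := exists_between hlt
  have hN' : 0 < N' := hN.trans_lt h1
  obtain ⟨δ, hδ, hball⟩ := Metric.continuousWithinAt_iff.1 (hf.abs x hx) (|f x| - N') (by linarith)
  set α := max 0 (x - δ / 2)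
  set β := min L (x + δ / 2)
  have hαβ : α < β := by
    refine max_lt (lt_min hL (by linarith [hx.1])) (lt_min (by linarith [hx.2]) (by linarith))
  have hα : 0 ≤ α := le_max_left _ _
  have hβ : β ≤ L := min_le_left _ _
  have hlow : ∀ y ∈ Icc α β, N' ≤ |f y| := by
    intro y hy
    have h3 : |y - x| < δ := by
      have := (le_max_right 0 (x - δ / 2)).trans hy.1
      have := hy.2.trans (min_le_right L (x + δ / 2))
      rw [abs_lt]
      constructor <;> linarith
    have h4 := hball ⟨hα.trans hy.1, hy.2.trans hβ⟩ h3
    rw [Real.dist_eq] at h4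
    linarith [(abs_lt.1 h4).1]
  have key : ∀ k : ℕ, β - α ≤ 2 * L * (N / N') ^ (2 * k + 2) := by
    intro k
    have hev : Even (2 * k + 2) := ⟨k + 1, by ring⟩
    have i1 : IntervalIntegrable (fun x => f x ^ (2 * k + 2) + g x ^ (2 * k + 2)) volume 0 L :=
      ContinuousOn.intervalIntegrable_of_Icc hL.le (by fun_prop)
    have h5 : ∫ _ in α..β, N' ^ (2 * k + 2)
        ≤ ∫ x in α..β, (f x ^ (2 * k + 2) + g x ^ (2 * k + 2)) := by
      refine intervalIntegral.integral_mono_on hαβ.le intervalIntegrable_const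
        (i1.mono_set ?_) fun y hy => ?_
      · rw [uIcc_of_le hαβ.le, uIcc_of_le hL.le]
        exact Icc_subset_Icc hα hβ
      · have h6 := pow_le_pow_left₀ hN'.le (hlow y hy) (2 * k + 2)
        rw [hev.pow_abs] at h6
        linarith [hev.pow_nonneg (g y)]
    have h7 : ∫ x in α..β, (f x ^ (2 * k + 2) + g x ^ (2 * k + 2))
        ≤ ∫ x in (0 : ℝ)..L, (f x ^ (2 * k + 2) + g x ^ (2 * k + 2)) :=
      intervalIntegral.integral_mono_interval hα hαβ.le hβ
        (Filter.Eventually.of_forall fun x => add_nonneg (hev.pow_nonneg _) (hev.pow_nonneg _)) i1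
    rw [intervalIntegral.integral_const, smul_eq_mul] at h5
    have h8 := h5.trans (h7.trans (h k))
    rw [div_pow, ← mul_div_assoc, le_div_iff₀ (by positivity)]
    exact h8
  have hq : N / N' < 1 := (div_lt_one hN').2 h1
  have hq0 : 0 ≤ N / N' := by positivity
  have hlim : Filter.Tendsto (fun k : ℕ => 2 * L * (N / N') ^ (2 * k + 2)) Filter.atTop
      (nhds (2 * L * 0)) := by
    refine (Filter.Tendsto.const_mul _ ?_)
    exact (tendsto_pow_atTop_nhds_zero_of_lt_one hq0 hq).comp
      (Filter.tendsto_atTop_mono (fun k => by simp only [id]; omega) Filter.tendsto_id)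
  have := ge_of_tendsto' hlim key
  linarith

/-- Decay in the supremum norm. -/
theorem DampedPair.abs_le {L T s η θ B : ℝ} {P Q Px Qx Pt Qt a b ax bx p q : ℝ → ℝ → ℝ}
    (h : DampedPair L T s η θ B P Q Px Qx Pt Qt a b ax bx p q) (hL : 0 < L) (hη : 0 ≤ η)
    (hθ : 0 ≤ θ) (hB : 0 ≤ B) (hθL : 2 * L * θ ≤ 1) (hs : η * (4 + 4 * L) + B * θ ≤ s / 2)
    {N : ℝ} (hP : ∀ x ∈ Icc 0 L, |P x 0| ≤ N) (hQ : ∀ x ∈ Icc 0 L, |Q x 0| ≤ N)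
    {t : ℝ} (ht : t ∈ Ico 0 T) {x : ℝ} (hx : x ∈ Icc 0 L) :
    |P x t| ≤ Real.exp (-(s / 2) * t) * N ∧ |Q x t| ≤ Real.exp (-(s / 2) * t) * N := by
  have hN : 0 ≤ N := (abs_nonneg _).trans (hP 0 ⟨le_rfl, hL.le⟩)
  have h0 : (0 : ℝ) ∈ Ico 0 T := ⟨le_rfl, ht.1.trans_lt ht.2⟩
  have cP := continuousOn_slice h.contP ht
  have cQ := continuousOn_slice h.contQ ht
  have key : ∀ k : ℕ, ∫ x in (0 : ℝ)..L, (P x t ^ (2 * k + 2) + Q x t ^ (2 * k + 2))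
      ≤ 2 * L * (Real.exp (-(s / 2) * t) * N) ^ (2 * k + 2) := by
    intro k
    have hev : Even (2 * k + 2) := ⟨k + 1, by ring⟩
    have h1 : ∫ x in (0 : ℝ)..L, (P x 0 ^ (2 * k + 2) + Q x 0 ^ (2 * k + 2))
        ≤ ∫ _ in (0 : ℝ)..L, 2 * N ^ (2 * k + 2) := by
      have c1 := continuousOn_slice h.contP h0
      have c2 := continuousOn_slice h.contQ h0
      refine intervalIntegral.integral_mono_on hL.le
        (ContinuousOn.intervalIntegrable_of_Icc hL.le (by fun_prop)) intervalIntegrable_const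
        fun x hx => ?_
      have h2 := pow_le_pow_left₀ (abs_nonneg _) (hP x hx) (2 * k + 2)
      have h3 := pow_le_pow_left₀ (abs_nonneg _) (hQ x hx) (2 * k + 2)
      rw [hev.pow_abs] at h2 h3
      linarith
    rw [intervalIntegral.integral_const, sub_zero, smul_eq_mul] at h1
    refine (h.integral_pow_le hL hη hθ hB hθL hs k ht).trans
      ((mul_le_mul_of_nonneg_left h1 (Real.exp_pos _).le).trans_eq ?_)
    have e : Real.exp (-((2 * k + 2) * (s / 2)) * t) = Real.exp (-(s / 2) * t) ^ (2 * k + 2) := by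
      rw [← Real.exp_nat_mul]
      congr 1
      push_cast
      ring
    rw [e, mul_pow]
    ring
  have hN' : 0 ≤ Real.exp (-(s / 2) * t) * N := by positivity
  refine ⟨abs_le_of_integral_pow_le hL hN' cP cQ key hx,
    abs_le_of_integral_pow_le hL hN' cQ cP (fun k => ?_) hx⟩
  simp_rw [add_comm (Q _ t ^ _)]
  exact key k

/-- Joint continuity of a primitive in the space variable. -/
theorem continuousOn_primitive_Icc {F : ℝ → ℝ → ℝ} {L T : ℝ} (hL : 0 ≤ L)
    (hF : ContinuousOn (Function.uncurry F) (Icc 0 L ×ˢ Ico 0 T)) :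
    ContinuousOn (Function.uncurry fun x t => ∫ y in (0 : ℝ)..x, F y t)
      (Icc 0 L ×ˢ Ico 0 T) := by
  rw [continuousOn_iff_continuous_domRestrict]
  let G : (Icc (0 : ℝ) L ×ˢ Ico (0 : ℝ) T : Set (ℝ × ℝ)) → ℝ → ℝ :=
    fun z x => F (projIcc 0 L hL x) z.1.2
  have hG : Continuous (Function.uncurry G) :=
    hF.comp_continuous (f := fun z : (Icc (0 : ℝ) L ×ˢ Ico (0 : ℝ) T : Set (ℝ × ℝ)) × ℝ =>
      ((projIcc 0 L hL z.2 : ℝ), z.1.1.2)) (by fun_prop) fun z => ⟨(projIcc 0 L hL z.2).2, z.1.2.2⟩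
  have h := intervalIntegral.continuous_parametric_intervalIntegral_of_continuous (μ := volume)
    (a₀ := 0) hG (by fun_prop : Continuous fun z : (Icc (0 : ℝ) L ×ˢ Ico (0 : ℝ) T : Set (ℝ × ℝ)) =>
      z.1.1)
  refine h.congr fun z => ?_
  refine intervalIntegral.integral_congr fun x hx => ?_
  have hz := z.2.1
  rw [uIcc_of_le hz.1] at hx
  simp only [G, projIcc_of_mem hL ⟨hx.1, hx.2.trans hz.2⟩]

theorem hasDerivAt_primitive_Ioo {f : ℝ → ℝ} {L x : ℝ} (hf : ContinuousOn f (Icc 0 L))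
    (hx : x ∈ Ioo 0 L) : HasDerivAt (fun x => ∫ y in (0 : ℝ)..x, f y) (f x) x :=
  intervalIntegral.integral_hasDerivAt_right
    ((hf.mono (Icc_subset_Icc le_rfl hx.2.le)).intervalIntegrable_of_Icc hx.1.le)
    ((hf.mono Ioo_subset_Icc_self).stronglyMeasurableAtFilter isOpen_Ioo x hx)
    (hf.continuousAt (Icc_mem_nhds hx.1 hx.2))

/-! ### Classical solutions and bounds for the model near the equilibrium -/

namespace ARZModel

/-- A classical solution of the nonlinear closed loop, together with its partial derivatives. -/
structure Flow (p : ARZModel) (Kw Kv : ℝ → ℝ → ℝ) (T : ℝ) where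
  ρ : ℝ → ℝ → ℝ
  v : ℝ → ℝ → ℝ
  ρx : ℝ → ℝ → ℝ
  ρt : ℝ → ℝ → ℝ
  vx : ℝ → ℝ → ℝ
  vt : ℝ → ℝ → ℝ
  contρ : ContinuousOn (Function.uncurry ρ) (Icc 0 p.L ×ˢ Ico 0 T)
  contv : ContinuousOn (Function.uncurry v) (Icc 0 p.L ×ˢ Ico 0 T)
  contρx : ContinuousOn (Function.uncurry ρx) (Icc 0 p.L ×ˢ Ico 0 T)
  contρt : ContinuousOn (Function.uncurry ρt) (Icc 0 p.L ×ˢ Ico 0 T)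
  contvx : ContinuousOn (Function.uncurry vx) (Icc 0 p.L ×ˢ Ico 0 T)
  contvt : ContinuousOn (Function.uncurry vt) (Icc 0 p.L ×ˢ Ico 0 T)
  derivρx : ∀ x ∈ Icc 0 p.L, ∀ t ∈ Ico 0 T,
    HasDerivWithinAt (fun y => ρ y t) (ρx x t) (Icc 0 p.L) x
  derivρt : ∀ x ∈ Icc 0 p.L, ∀ t ∈ Ico 0 T, HasDerivWithinAt (fun s => ρ x s) (ρt x t) (Ico 0 T) t
  derivvx : ∀ x ∈ Icc 0 p.L, ∀ t ∈ Ico 0 T,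
    HasDerivWithinAt (fun y => v y t) (vx x t) (Icc 0 p.L) x
  derivvt : ∀ x ∈ Icc 0 p.L, ∀ t ∈ Ico 0 T, HasDerivWithinAt (fun s => v x s) (vt x t) (Ico 0 T) t
  ρ_pos : ∀ x ∈ Icc 0 p.L, ∀ t ∈ Ico 0 T, 0 < ρ x t
  mass : ∀ x ∈ Icc 0 p.L, ∀ t ∈ Ico 0 T, ρt x t + (ρx x t * v x t + ρ x t * vx x t) = 0
  momentum : ∀ x ∈ Icc 0 p.L, ∀ t ∈ Ico 0 T, vt x t - deriv p.V (ρ x t) * ρt x t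
    + v x t * (vx x t - deriv p.V (ρ x t) * ρx x t) = (p.V (ρ x t) - v x t) / p.τ
  inlet : ∀ t ∈ Ico 0 T, ρ 0 t * v 0 t = p.qs
  outlet : ∀ t ∈ Ico 0 T, v p.L t = p.vs +
    p.feedback Kw Kv (p.wTilde (fun ξ => ρ ξ t) (fun ξ => v ξ t)) (fun ξ => v ξ t - p.vs)

theorem hasDerivAt_V (p : ARZModel) {y : ℝ} (hy : 0 < y) : HasDerivAt p.V (deriv p.V y) y :=
  ((p.contDiffOn_V.contDiffAt (Ioi_mem_nhds hy)).differentiableAt two_ne_zero).hasDerivAt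

theorem contDiffOn_deriv_V (p : ARZModel) : ContDiffOn ℝ 1 (deriv p.V) (Ioi 0) :=
  ((contDiffOn_succ_iff_deriv_of_isOpen (n := 1) isOpen_Ioi).1
    (by simpa [one_add_one_eq_two] using p.contDiffOn_V)).2.2

theorem hasDerivAt_deriv_V (p : ARZModel) {y : ℝ} (hy : 0 < y) :
    HasDerivAt (deriv p.V) (deriv (deriv p.V) y) y :=
  ((p.contDiffOn_deriv_V.contDiffAt (Ioi_mem_nhds hy)).differentiableAt one_ne_zero).hasDerivAt

theorem continuousOn_deriv_deriv_V (p : ARZModel) : ContinuousOn (deriv (deriv p.V)) (Ioi 0) :=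
  p.contDiffOn_deriv_V.continuousOn_deriv_of_isOpen isOpen_Ioi le_rfl

variable {p : ARZModel} {Kw Kv : ℝ → ℝ → ℝ} {T : ℝ}

/-- The constant equilibrium solution. -/
noncomputable def equilibriumFlow (p : ARZModel) (Kw Kv : ℝ → ℝ → ℝ) (T : ℝ) : p.Flow Kw Kv T where
  ρ := fun _ _ => p.ρs
  v := fun _ _ => p.vs
  ρx := fun _ _ => 0
  ρt := fun _ _ => 0
  vx := fun _ _ => 0
  vt := fun _ _ => 0
  contρ := continuousOn_const
  contv := continuousOn_const
  contρx := continuousOn_const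
  contρt := continuousOn_const
  contvx := continuousOn_const
  contvt := continuousOn_const
  derivρx := fun _ _ _ _ => hasDerivWithinAt_const _ _ _
  derivρt := fun _ _ _ _ => hasDerivWithinAt_const _ _ _
  derivvx := fun _ _ _ _ => hasDerivWithinAt_const _ _ _
  derivvt := fun _ _ _ _ => hasDerivWithinAt_const _ _ _
  ρ_pos := fun _ _ _ _ => p.ρs_pos
  mass := fun _ _ _ _ => by simp
  momentum := fun _ _ _ _ => by simp [vs]
  inlet := fun _ _ => rfl
  outlet := fun _ _ => by
    have : p.wTilde (fun _ => p.ρs) (fun _ => p.vs) = fun _ => 0 := by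
      funext x
      simp [wTilde]
    rw [this]
    simp [feedback]

/-- Time shift of a solution. -/
def Flow.shift (f : p.Flow Kw Kv T) {h : ℝ} (hh : 0 ≤ h) : p.Flow Kw Kv (T - h) :=
  have hm : ∀ {t}, t ∈ Ico 0 (T - h) → t + h ∈ Ico 0 T := fun ht =>
    ⟨by linarith [ht.1], by linarith [ht.2]⟩
  have hc : ∀ {g : ℝ → ℝ → ℝ}, ContinuousOn (Function.uncurry g) (Icc 0 p.L ×ˢ Ico 0 T) →
      ContinuousOn (Function.uncurry fun x t => g x (t + h)) (Icc 0 p.L ×ˢ Ico 0 (T - h)) :=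
    fun hg => hg.comp (f := fun z : ℝ × ℝ => (z.1, z.2 + h))
      (Continuous.continuousOn (by fun_prop)) fun _ hz => ⟨hz.1, hm hz.2⟩
  have hd : ∀ {g : ℝ → ℝ} {g' t : ℝ}, t ∈ Ico 0 (T - h) → HasDerivWithinAt g g' (Ico 0 T) (t + h) →
      HasDerivWithinAt (fun s => g (s + h)) g' (Ico 0 (T - h)) t := fun {g g' t} _ hg => by
    have h1 : HasDerivWithinAt (fun s => s + h) 1 (Ico 0 (T - h)) t :=
      ((hasDerivAt_id t).add_const h).hasDerivWithinAt
    exact (hg.comp t h1 fun s hs => hm hs).congr_deriv (mul_one _)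
  { ρ := fun x t => f.ρ x (t + h)
    v := fun x t => f.v x (t + h)
    ρx := fun x t => f.ρx x (t + h)
    ρt := fun x t => f.ρt x (t + h)
    vx := fun x t => f.vx x (t + h)
    vt := fun x t => f.vt x (t + h)
    contρ := hc f.contρ
    contv := hc f.contv
    contρx := hc f.contρx
    contρt := hc f.contρt
    contvx := hc f.contvx
    contvt := hc f.contvt
    derivρx := fun x hx _ ht => f.derivρx x hx _ (hm ht)
    derivρt := fun x hx _ ht => hd ht (f.derivρt x hx _ (hm ht))
    derivvx := fun x hx _ ht => f.derivvx x hx _ (hm ht)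
    derivvt := fun x hx _ ht => hd ht (f.derivvt x hx _ (hm ht))
    ρ_pos := fun x hx _ ht => f.ρ_pos x hx _ (hm ht)
    mass := fun x hx _ ht => f.mass x hx _ (hm ht)
    momentum := fun x hx _ ht => f.momentum x hx _ (hm ht)
    inlet := fun _ ht => f.inlet _ (hm ht)
    outlet := fun _ ht => f.outlet _ (hm ht) }

/-- Restriction of a solution to a shorter time interval. -/
def Flow.restrict (f : p.Flow Kw Kv T) {T' : ℝ} (hT : T' ≤ T) : p.Flow Kw Kv T' :=
  have hm : ∀ {t}, t ∈ Ico 0 T' → t ∈ Ico 0 T := fun ht => ⟨ht.1, ht.2.trans_le hT⟩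
  have hs : Icc 0 p.L ×ˢ Ico 0 T' ⊆ Icc 0 p.L ×ˢ Ico 0 T := prod_mono le_rfl fun _ ht => hm ht
  { ρ := f.ρ
    v := f.v
    ρx := f.ρx
    ρt := f.ρt
    vx := f.vx
    vt := f.vt
    contρ := f.contρ.mono hs
    contv := f.contv.mono hs
    contρx := f.contρx.mono hs
    contρt := f.contρt.mono hs
    contvx := f.contvx.mono hs
    contvt := f.contvt.mono hs
    derivρx := fun x hx _ ht => f.derivρx x hx _ (hm ht)
    derivρt := fun x hx _ ht => (f.derivρt x hx _ (hm ht)).mono fun _ ht => hm ht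
    derivvx := fun x hx _ ht => f.derivvx x hx _ (hm ht)
    derivvt := fun x hx _ ht => (f.derivvt x hx _ (hm ht)).mono fun _ ht => hm ht
    ρ_pos := fun x hx _ ht => f.ρ_pos x hx _ (hm ht)
    mass := fun x hx _ ht => f.mass x hx _ (hm ht)
    momentum := fun x hx _ ht => f.momentum x hx _ (hm ht)
    inlet := fun _ ht => f.inlet _ (hm ht)
    outlet := fun _ ht => f.outlet _ (hm ht) }

/-- With named, jointly continuous partial derivatives, solutions can be shifted in time, restricted
and subtracted. The inlet condition becomes `ρ v = q⋆`, which is what differences of solutions use.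
-/
theorem IsClassicalSolution.exists_flow {ρ v : ℝ → ℝ → ℝ}
    (h : p.IsClassicalSolution Kw Kv T ρ v) : ∃ f : p.Flow Kw Kv T, f.ρ = ρ ∧ f.v = v := by
  have hL := p.L_pos
  set S : Set (ℝ × ℝ) := Icc 0 p.L ×ˢ Ico 0 T with hS
  have hI : UniqueDiffOn ℝ (Icc 0 p.L) := uniqueDiffOn_Icc hL
  have hJ : UniqueDiffOn ℝ (Ico 0 T) := uniqueDiffOn_Ico 0 T
  have hSu : UniqueDiffOn ℝ S := hI.prod hJ
  have cx : ∀ {g : ℝ → ℝ → ℝ} (_ : ContDiffOn ℝ 1 (Function.uncurry g) S) (w : ℝ × ℝ),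
      ContinuousOn (Function.uncurry fun x t => fderivWithin ℝ (Function.uncurry g) S (x, t) w) S :=
    fun hg w => (hg.continuousOn_fderivWithin hSu le_rfl).clm_apply continuousOn_const
  have dx : ∀ {g : ℝ → ℝ → ℝ} (_ : ContDiffOn ℝ 1 (Function.uncurry g) S), ∀ x ∈ Icc 0 p.L,
      ∀ t ∈ Ico 0 T, HasDerivWithinAt (fun y => g y t)
        (fderivWithin ℝ (Function.uncurry g) S (x, t) (1, 0)) (Icc 0 p.L) x := fun hg x hx t ht =>
    ((hg.differentiableOn one_ne_zero (x, t) ⟨hx, ht⟩).hasFDerivWithinAt).comp_hasDerivWithinAt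
      (f := fun y => (y, t)) x ((hasDerivAt_id x).prodMk (hasDerivAt_const x t)).hasDerivWithinAt
      fun y hy => ⟨hy, ht⟩
  have dt : ∀ {g : ℝ → ℝ → ℝ} (_ : ContDiffOn ℝ 1 (Function.uncurry g) S), ∀ x ∈ Icc 0 p.L,
      ∀ t ∈ Ico 0 T, HasDerivWithinAt (fun s => g x s)
        (fderivWithin ℝ (Function.uncurry g) S (x, t) (0, 1)) (Ico 0 T) t := fun hg x hx t ht =>
    ((hg.differentiableOn one_ne_zero (x, t) ⟨hx, ht⟩).hasFDerivWithinAt).comp_hasDerivWithinAt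
      (f := fun s => (x, s)) t ((hasDerivAt_const t x).prodMk (hasDerivAt_id t)).hasDerivWithinAt
      fun s hs => ⟨hx, hs⟩
  have hρ := h.contDiffOn_ρ
  have hv := h.contDiffOn_v
  refine ⟨⟨ρ, v, fun x t => fderivWithin ℝ (Function.uncurry ρ) S (x, t) (1, 0),
    fun x t => fderivWithin ℝ (Function.uncurry ρ) S (x, t) (0, 1),
    fun x t => fderivWithin ℝ (Function.uncurry v) S (x, t) (1, 0),
    fun x t => fderivWithin ℝ (Function.uncurry v) S (x, t) (0, 1),
    hρ.continuousOn, hv.continuousOn, cx hρ _, cx hρ _, cx hv _, cx hv _, dx hρ, dt hρ, dx hv, dt hv,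
    h.ρ_pos, fun x hx t ht => ?_, fun x hx t ht => ?_, fun t ht => ?_, h.outlet⟩, rfl, rfl⟩
  · have e := h.mass x hx t ht
    have e2 : derivWithin (fun y => ρ y t * v y t) (Icc 0 p.L) x = _ :=
      ((dx hρ x hx t ht).mul (dx hv x hx t ht)).derivWithin (hI x hx)
    rwa [(dt hρ x hx t ht).derivWithin (hJ t ht), e2] at e
  · have hV := p.hasDerivAt_V (h.ρ_pos x hx t ht)
    have e := h.momentum x hx t ht
    have e1 : derivWithin (fun s => v x s - p.V (ρ x s)) (Ico 0 T) t = _ :=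
      ((dt hv x hx t ht).sub (hV.comp_hasDerivWithinAt t (dt hρ x hx t ht))).derivWithin (hJ t ht)
    have e2 : derivWithin (fun y => v y t - p.V (ρ y t)) (Icc 0 p.L) x = _ :=
      ((dx hv x hx t ht).sub (hV.comp_hasDerivWithinAt x (dx hρ x hx t ht))).derivWithin (hI x hx)
    rwa [e1, e2] at e
  · have e := h.inlet t ht
    have hv0 := h.v_pos 0 ⟨le_rfl, hL.le⟩ t ht
    rw [e]
    field_simp

/-- The second characteristic speed `-(v + ρ V'(ρ))`. -/
noncomputable def speed (p : ARZModel) (y u : ℝ) : ℝ := -(u + y * deriv p.V y)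

/-- Bounds for the data of the model near the equilibrium. -/
structure LocalBounds (p : ARZModel) (δ G : ℝ) : Prop where
  one_le : 1 ≤ G
  pos : ∀ y, |y - p.ρs| ≤ δ → 0 < y
  le : ∀ y, |y - p.ρs| ≤ δ → y ≤ G
  deriv_le : ∀ y, |y - p.ρs| ≤ δ → |deriv p.V y| ≤ G
  deriv_le' : ∀ y, |y - p.ρs| ≤ δ → deriv p.V y ≤ -G⁻¹
  deriv2_le : ∀ y, |y - p.ρs| ≤ δ → |deriv (deriv p.V) y| ≤ G
  inv_le : ∀ u, |u - p.vs| ≤ δ → G⁻¹ ≤ u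
  le_v : ∀ u, |u - p.vs| ≤ δ → u ≤ G
  le_speed : ∀ y u, |y - p.ρs| ≤ δ → |u - p.vs| ≤ δ → p.lam2 / 2 ≤ p.speed y u
  speed_le : ∀ y u, |y - p.ρs| ≤ δ → |u - p.vs| ≤ δ → p.speed y u ≤ G

/-- Continuity of `V'` and `V''` on a compact interval around `ρ⋆`, and of the characteristic speed
at the equilibrium. A single large `G` serves as upper bound and, through `G⁻¹`, as lower bound. -/
theorem exists_localBounds (p : ARZModel) : ∃ δ > 0, ∃ G, p.LocalBounds δ G := by
  have hρ := p.ρs_pos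
  have hv := p.vs_pos
  have hl := p.lam2_pos
  -- Congestion means `-ρ⋆ V'(ρ⋆) > v⋆ > 0`, so `V` is strictly decreasing near `ρ⋆` and `ρ` can be
  -- recovered from `V(ρ)`.
  have hVneg : deriv p.V p.ρs < 0 := by
    have := p.congested
    have := p.velocity_pos
    by_contra! h
    have := mul_nonneg hρ.le h
    linarith
  have c1 : ContinuousOn (deriv p.V) (Ioi 0) := p.contDiffOn_deriv_V.continuousOn
  have c1' : ContinuousAt (deriv p.V) p.ρs := c1.continuousAt (Ioi_mem_nhds hρ)
  have cs : ContinuousAt (Function.uncurry p.speed) (p.ρs, p.vs) := by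
    unfold speed Function.uncurry
    exact (continuousAt_snd.add (continuousAt_fst.mul
      (ContinuousAt.comp (f := Prod.fst) (x := (p.ρs, p.vs)) c1' continuousAt_fst))).neg
  have es : Function.uncurry p.speed (p.ρs, p.vs) = p.lam2 := by
    simp only [Function.uncurry, speed, lam2]
    ring
  have ev1 : ∀ᶠ z in nhds (p.ρs, p.vs), p.lam2 / 2 < Function.uncurry p.speed z ∧
      Function.uncurry p.speed z < p.lam2 + 1 :=
    cs.eventually (Ioo_mem_nhds (by rw [es]; linarith) (by rw [es]; linarith))
  have ev2 : ∀ᶠ y in nhds p.ρs, deriv p.V y < deriv p.V p.ρs / 2 :=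
    c1'.eventually (Iio_mem_nhds (by linarith))
  obtain ⟨δ₁, hδ₁, h1⟩ := Metric.nhds_basis_closedBall.eventually_iff.1 ev1
  obtain ⟨δ₂, hδ₂, h2⟩ := Metric.nhds_basis_closedBall.eventually_iff.1 ev2
  set δ := min (min δ₁ δ₂) (min (p.ρs / 2) (p.vs / 2)) with hδ
  have hδ0 : 0 < δ := by positivity
  have d1 : δ ≤ δ₁ := (min_le_left _ _).trans (min_le_left _ _)
  have d2 : δ ≤ δ₂ := (min_le_left _ _).trans (min_le_right _ _)
  have d3 : δ ≤ p.ρs / 2 := (min_le_right _ _).trans (min_le_left _ _)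
  have d4 : δ ≤ p.vs / 2 := (min_le_right _ _).trans (min_le_right _ _)
  have hpos : ∀ y, |y - p.ρs| ≤ δ → 0 < y := fun y hy => by linarith [(abs_le.1 hy).1]
  have hsub : Icc (p.ρs - δ) (p.ρs + δ) ⊆ Ioi 0 := fun y hy => by
    have := hy.1
    exact mem_Ioi.2 (by linarith)
  have hmem : ∀ y, |y - p.ρs| ≤ δ → y ∈ Icc (p.ρs - δ) (p.ρs + δ) := fun y hy =>
    ⟨by linarith [(abs_le.1 hy).1], by linarith [(abs_le.1 hy).2]⟩
  obtain ⟨C₁, hC₁⟩ := isCompact_Icc.exists_bound_of_continuousOn (c1.mono hsub)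
  obtain ⟨C₂, hC₂⟩ := isCompact_Icc.exists_bound_of_continuousOn
    (p.continuousOn_deriv_deriv_V.mono hsub)
  set g := -(deriv p.V p.ρs / 2) with hg
  have hg0 : 0 < g := by linarith
  set G := 1 + |C₁| + |C₂| + 2 * p.ρs + 2 * p.vs + g⁻¹ + (p.vs / 2)⁻¹ + p.lam2 with hG
  have a1 := abs_nonneg C₁
  have a2 := abs_nonneg C₂
  have a3 : 0 < g⁻¹ := inv_pos.2 hg0
  have a4 : 0 < (p.vs / 2)⁻¹ := by positivity
  refine ⟨δ, hδ0, G, ⟨by linarith, hpos, fun y hy => ?_, fun y hy => ?_, fun y hy => ?_,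
    fun y hy => ?_, fun u hu => ?_, fun u hu => ?_, fun y u hy hu => ?_, fun y u hy hu => ?_⟩⟩
  · linarith [(abs_le.1 hy).2]
  · have h3 := hC₁ y (hmem y hy)
    rw [Real.norm_eq_abs] at h3
    linarith [le_abs_self C₁]
  · have h3 := h2 (show y ∈ Metric.closedBall p.ρs δ₂ by
      rw [Metric.mem_closedBall, Real.dist_eq]; exact hy.trans d2)
    have h4 : G⁻¹ ≤ g := inv_le_of_inv_le₀ hg0 (by linarith)
    linarith
  · have h3 := hC₂ y (hmem y hy)
    rw [Real.norm_eq_abs] at h3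
    linarith [le_abs_self C₂]
  · have h4 : G⁻¹ ≤ p.vs / 2 := inv_le_of_inv_le₀ (by positivity) (by linarith)
    linarith [(abs_le.1 hu).1]
  · linarith [(abs_le.1 hu).2]
  · refine (h1 (x := (y, u)) ?_).1.le
    rw [Metric.mem_closedBall, Prod.dist_eq, Real.dist_eq, Real.dist_eq]
    exact max_le (hy.trans d1) (hu.trans d1)
  · have := (h1 (x := (y, u)) (by
      rw [Metric.mem_closedBall, Prod.dist_eq, Real.dist_eq, Real.dist_eq]
      exact max_le (hy.trans d1) (hu.trans d1))).2
    simp only [Function.uncurry] at this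
    linarith

namespace LocalBounds

variable {δ G : ℝ}

theorem abs_V_sub_le (hb : p.LocalBounds δ G) {y₁ y₂ : ℝ} (h₁ : |y₁ - p.ρs| ≤ δ) (h₂ : |y₂ - p.ρs| ≤ δ) :
    |p.V y₁ - p.V y₂| ≤ G * |y₁ - y₂| :=
  (convex_closedBall p.ρs δ).norm_image_sub_le_of_norm_hasDerivWithin_le
    (fun y hy => (p.hasDerivAt_V (hb.pos y hy)).hasDerivWithinAt)
    (fun y hy => hb.deriv_le y hy) h₂ h₁

theorem abs_deriv_sub_le (hb : p.LocalBounds δ G) {y₁ y₂ : ℝ} (h₁ : |y₁ - p.ρs| ≤ δ) (h₂ : |y₂ - p.ρs| ≤ δ) :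
    |deriv p.V y₁ - deriv p.V y₂| ≤ G * |y₁ - y₂| :=
  (convex_closedBall p.ρs δ).norm_image_sub_le_of_norm_hasDerivWithin_le
    (fun y hy => (p.hasDerivAt_deriv_V (hb.pos y hy)).hasDerivWithinAt)
    (fun y hy => hb.deriv2_le y hy) h₂ h₁

/-- The mean value inequality for `V - V'(ρ⋆) · id`, whose derivative is at most `G κ` within
distance `κ` of `ρ⋆`; the small factor `κ` drives the estimate of the sources. -/
theorem abs_V_sub_linear_le (hb : p.LocalBounds δ G) {κ y₁ y₂ : ℝ} (hκ : κ ≤ δ) (h₁ : |y₁ - p.ρs| ≤ κ)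
    (h₂ : |y₂ - p.ρs| ≤ κ) :
    |p.V y₁ - p.V y₂ - deriv p.V p.ρs * (y₁ - y₂)| ≤ G * κ * |y₁ - y₂| := by
  have hG := hb.one_le
  have h := (convex_closedBall p.ρs κ).norm_image_sub_le_of_norm_hasDerivWithin_le
    (f := fun y => p.V y - deriv p.V p.ρs * y) (f' := fun y => deriv p.V y - deriv p.V p.ρs)
    (C := G * κ) (fun y hy => ((p.hasDerivAt_V (hb.pos y (le_trans hy hκ))).sub
      (((hasDerivAt_id y).const_mul (deriv p.V p.ρs)).congr_deriv (mul_one _))).hasDerivWithinAt)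
    (fun y hy => (hb.abs_deriv_sub_le (le_trans hy hκ) (by
      rw [sub_self, abs_zero]; exact (abs_nonneg _).trans (le_trans hy hκ))).trans
        (mul_le_mul_of_nonneg_left hy (by linarith))) h₂ h₁
  rw [Real.norm_eq_abs, Real.norm_eq_abs] at h
  convert h using 2
  ring

/-- The slope of `V` is at most `-G⁻¹`, so its inverse is `G`-Lipschitz. -/
theorem abs_sub_le_V (hb : p.LocalBounds δ G) {y₁ y₂ : ℝ} (h₁ : |y₁ - p.ρs| ≤ δ) (h₂ : |y₂ - p.ρs| ≤ δ) :
    |y₁ - y₂| ≤ G * |p.V y₁ - p.V y₂| := by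
  have hG : 0 < G := by linarith [hb.one_le]
  have key : ∀ {x y : ℝ}, |x - p.ρs| ≤ δ → |y - p.ρs| ≤ δ → x ≤ y →
      y - x ≤ G * |p.V x - p.V y| := by
    intro x y hx hy hxy
    have h := (convex_closedBall p.ρs δ).image_sub_le_mul_sub_of_deriv_le (f := p.V) (C := -G⁻¹)
      (fun z hz => (p.hasDerivAt_V (hb.pos z hz)).continuousAt.continuousWithinAt)
      (fun z hz => (p.hasDerivAt_V (hb.pos z (show z ∈ Metric.closedBall p.ρs δ from interior_subset hz))).differentiableAt
        |>.differentiableWithinAt)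
      (fun z hz => hb.deriv_le' z (show z ∈ Metric.closedBall p.ρs δ from interior_subset hz)) x hx y hy hxy
    have h3 : G⁻¹ * (y - x) ≤ |p.V x - p.V y| := by
      have := le_abs_self (p.V x - p.V y)
      linarith
    calc y - x = G * (G⁻¹ * (y - x)) := by field_simp
      _ ≤ _ := mul_le_mul_of_nonneg_left h3 hG.le
  rcases le_total y₁ y₂ with h | h
  · rw [abs_sub_comm, abs_of_nonneg (sub_nonneg.2 h)]
    exact key h₁ h₂ h
  · rw [abs_of_nonneg (sub_nonneg.2 h), abs_sub_comm (p.V y₁)]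
    exact key h₂ h₁ h

theorem abs_speed_sub_le (hb : p.LocalBounds δ G) {y₁ y₂ u₁ u₂ : ℝ} (h₁ : |y₁ - p.ρs| ≤ δ) (h₂ : |y₂ - p.ρs| ≤ δ) :
    |p.speed y₁ u₁ - p.speed y₂ u₂| ≤ |u₁ - u₂| + (G + G * G) * |y₁ - y₂| := by
  have e : p.speed y₁ u₁ - p.speed y₂ u₂ = -((u₁ - u₂) + (y₁ - y₂) * deriv p.V y₁
      + y₂ * (deriv p.V y₁ - deriv p.V y₂)) := by
    unfold speed
    ring
  have hG := hb.one_le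
  rw [e, abs_neg]
  have b1 : |(y₁ - y₂) * deriv p.V y₁| ≤ G * |y₁ - y₂| := by
    rw [abs_mul, mul_comm]
    exact mul_le_mul_of_nonneg_right (hb.deriv_le _ h₁) (abs_nonneg _)
  have b2 : |y₂ * (deriv p.V y₁ - deriv p.V y₂)| ≤ G * (G * |y₁ - y₂|) := by
    rw [abs_mul, abs_of_pos (hb.pos _ h₂)]
    exact mul_le_mul (hb.le _ h₂) (hb.abs_deriv_sub_le h₁ h₂) (abs_nonneg _) (by linarith)
  have := abs_add_three (u₁ - u₂) ((y₁ - y₂) * deriv p.V y₁) (y₂ * (deriv p.V y₁ - deriv p.V y₂))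
  linarith

end LocalBounds

end ARZModel

/-! ### Recovering a state from its transformed coordinates -/

/-- Gronwall's inequality for the primitive of `u`, with integrating factor `exp (-c x)`. -/
theorem integral_le_of_le_add_integral {L c : ℝ} (hL : 0 ≤ L) (hc : 0 ≤ c) {u h : ℝ → ℝ}
    (cu : ContinuousOn u (Icc 0 L)) (ch : ContinuousOn h (Icc 0 L))
    (hh : ∀ x ∈ Icc 0 L, 0 ≤ h x) (hu : ∀ x ∈ Icc 0 L, u x ≤ h x + c * ∫ y in (0 : ℝ)..x, u y) :
    ∫ x in (0 : ℝ)..L, u x ≤ Real.exp (c * L) * ∫ x in (0 : ℝ)..L, h x := by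
  have cg : ContinuousOn (fun x => ∫ y in (0 : ℝ)..x, u y) (Icc 0 L) := by
    have := intervalIntegral.continuousOn_primitive_interval'
      (cu.intervalIntegrable_of_Icc (μ := volume) hL) left_mem_uIcc
    rwa [uIcc_of_le hL] at this
  have h1 := intervalIntegral.integral_eq_sub_of_hasDerivAt_of_le hL
    (f := fun x => Real.exp (-(c * x)) * ∫ y in (0 : ℝ)..x, u y)
    (f' := fun x => Real.exp (-(c * x)) * (u x - c * ∫ y in (0 : ℝ)..x, u y)) (by fun_prop)
    (fun x hx => by
      refine ((((hasDerivAt_id x).const_mul c).neg.exp).mul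
        (hasDerivAt_primitive_Ioo cu hx)).congr_deriv ?_
      simp only [id, Pi.neg_apply]
      ring) (ContinuousOn.intervalIntegrable_of_Icc hL (by fun_prop))
  have h2 : ∫ x in (0 : ℝ)..L, Real.exp (-(c * x)) * (u x - c * ∫ y in (0 : ℝ)..x, u y)
      ≤ ∫ x in (0 : ℝ)..L, h x := by
    refine intervalIntegral.integral_mono_on hL
      (ContinuousOn.intervalIntegrable_of_Icc hL (by fun_prop))
      (ch.intervalIntegrable_of_Icc hL) fun x hx => ?_
    have h3 : Real.exp (-(c * x)) ≤ 1 :=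
      Real.exp_le_one_iff.2 (neg_nonpos.2 (mul_nonneg hc hx.1))
    calc Real.exp (-(c * x)) * (u x - c * ∫ y in (0 : ℝ)..x, u y)
        ≤ Real.exp (-(c * x)) * h x :=
          mul_le_mul_of_nonneg_left (by linarith [hu x hx]) (Real.exp_pos _).le
      _ ≤ 1 * h x := mul_le_mul_of_nonneg_right h3 (hh x hx)
      _ = h x := one_mul _
  rw [h1, intervalIntegral.integral_same, mul_zero, sub_zero] at h2
  calc ∫ x in (0 : ℝ)..L, u x
      = Real.exp (c * L) * (Real.exp (-(c * L)) * ∫ x in (0 : ℝ)..L, u x) := by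
        rw [← mul_assoc, ← Real.exp_add]; simp
    _ ≤ _ := mul_le_mul_of_nonneg_left h2 (Real.exp_pos _).le

/-- Recovery of a state from its transformed coordinates. -/
theorem recover_le {L G c : ℝ} (hL : 0 ≤ L) (hG : 1 ≤ G) (hc : 0 ≤ c) {R Y Z b : ℝ → ℝ}
    (cR : ContinuousOn R (Icc 0 L)) (cY : ContinuousOn Y (Icc 0 L)) (cZ : ContinuousOn Z (Icc 0 L))
    (cb : ContinuousOn b (Icc 0 L)) (hR : ∀ x ∈ Icc 0 L, |R x| ≤ G * (|Z x| + |Y x|))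
    (hY : ∀ x ∈ Icc 0 L, |Y x| ≤ |b x| + c * ∫ y in (0 : ℝ)..x, |R y|) {x : ℝ}
    (hx : x ∈ Icc 0 L) :
    |R x| + |Y x| ≤ (G + 1) * (1 + c * G * (1 + Real.exp (c * G * L) * (1 + c * G * L))) *
      (|Z x| + |b x| + ∫ y in (0 : ℝ)..L, (|Z y| + |b y|)) := by
  set k := c * G with hk
  have hk0 : 0 ≤ k := by positivity
  have ii : ∀ {f : ℝ → ℝ}, ContinuousOn f (Icc 0 L) → IntervalIntegrable f volume 0 L := fun hf =>
    hf.intervalIntegrable_of_Icc hL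
  have iix : ∀ {f : ℝ → ℝ} {y : ℝ}, y ∈ Icc 0 L → ContinuousOn f (Icc 0 L) →
      IntervalIntegrable f volume 0 y := fun hy hf =>
    (hf.mono (Icc_subset_Icc le_rfl hy.2)).intervalIntegrable_of_Icc hy.1
  set IZ := ∫ y in (0 : ℝ)..L, |Z y| with hIZ
  set Ib := ∫ y in (0 : ℝ)..L, |b y| with hIb
  set IY := ∫ y in (0 : ℝ)..L, |Y y| with hIY
  have hIZ0 : 0 ≤ IZ := intervalIntegral.integral_nonneg hL fun y _ => abs_nonneg _
  have hIb0 : 0 ≤ Ib := intervalIntegral.integral_nonneg hL fun y _ => abs_nonneg _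
  have hmono : ∀ {f : ℝ → ℝ} {y : ℝ}, y ∈ Icc 0 L → ContinuousOn f (Icc 0 L) →
      ∫ s in (0 : ℝ)..y, |f s| ≤ ∫ s in (0 : ℝ)..L, |f s| := fun hy hf =>
    intervalIntegral.integral_mono_interval le_rfl hy.1 hy.2
      (Filter.Eventually.of_forall fun _ => abs_nonneg _) (ii hf.abs)
  -- Inserting the bound on `R` into the one on `Y` leaves a scalar Volterra inequality for `|Y|`.
  have hY' : ∀ y ∈ Icc 0 L, |Y y| ≤ (|b y| + k * IZ) + k * ∫ s in (0 : ℝ)..y, |Y s| := by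
    intro y hy
    have h1 : ∫ s in (0 : ℝ)..y, |R s| ≤ ∫ s in (0 : ℝ)..y, G * (|Z s| + |Y s|) :=
      intervalIntegral.integral_mono_on hy.1 (iix hy cR.abs)
        (iix hy (continuousOn_const.mul (cZ.abs.add cY.abs)))
        fun s hs => hR s ⟨hs.1, hs.2.trans hy.2⟩
    rw [intervalIntegral.integral_const_mul,
      intervalIntegral.integral_add (iix hy cZ.abs) (iix hy cY.abs)] at h1
    have h2 := mul_le_mul_of_nonneg_left h1 hc
    have h3 := mul_le_mul_of_nonneg_left (hmono hy cZ) hk0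
    have h4 := hY y hy
    calc |Y y| ≤ |b y| + (k * (∫ s in (0 : ℝ)..y, |Z s|) + k * ∫ s in (0 : ℝ)..y, |Y s|) := by
          rw [hk]; linarith
      _ ≤ _ := by linarith
  have hIYle := integral_le_of_le_add_integral (h := fun y => |b y| + k * IZ) hL hk0 cY.abs
    (cb.abs.add continuousOn_const) (fun y _ => add_nonneg (abs_nonneg _) (by positivity)) hY'
  rw [intervalIntegral.integral_add (ii cb.abs) intervalIntegrable_const,
    intervalIntegral.integral_const, sub_zero, smul_eq_mul, ← hIY, ← hIb] at hIYle
  set e := Real.exp (k * L) with he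
  have he0 : 0 < e := Real.exp_pos _
  have h5 : IY ≤ e * (1 + k * L) * (IZ + Ib) := by
    refine hIYle.trans ?_
    rw [mul_assoc e]
    refine mul_le_mul_of_nonneg_left ?_ he0.le
    have : 0 ≤ k * L * Ib := by positivity
    linarith
  have h6 : |Y x| ≤ |b x| + k * (1 + e * (1 + k * L)) * (IZ + Ib) := by
    have h7 := mul_le_mul_of_nonneg_left ((hmono hx cY).trans h5) hk0
    have h8 := hY' x hx
    have : 0 ≤ k * Ib := by positivity
    linarith
  have h9 := hR x hx
  rw [intervalIntegral.integral_add (ii cZ.abs) (ii cb.abs), ← hIZ, ← hIb]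
  have hK1 : 0 ≤ k * (1 + e * (1 + k * L)) := by positivity
  set K := k * (1 + e * (1 + k * L)) with hK
  have z0 := abs_nonneg (Z x)
  have b0 := abs_nonneg (b x)
  calc |R x| + |Y x| ≤ G * |Z x| + (G + 1) * |Y x| := by linarith
    _ ≤ (G + 1) * |Z x| + (G + 1) * (|b x| + K * (IZ + Ib)) := by gcongr; linarith
    _ ≤ (G + 1) * ((1 + K) * (|Z x| + |b x| + (IZ + Ib))) := by
        rw [← mul_add]
        refine mul_le_mul_of_nonneg_left ?_ (by linarith)
        have p1 : 0 ≤ K * |Z x| := by positivity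
        have p2 : 0 ≤ K * |b x| := by positivity
        linarith
    _ = _ := by ring

/-! ### Differences of two classical solutions as damped waves -/

namespace ARZModel

variable {p : ARZModel} {Kw Kv : ℝ → ℝ → ℝ} {T : ℝ}

/-- Since `λ₁ + λ₂ = -ρ⋆ V'(ρ⋆)`, this is `gain_mul_lam` rewritten. It is the identity by which the
relaxation term and the backstepping term cancel to first order. -/
theorem gain_mul_deriv (p : ARZModel) : p.gain * deriv p.V p.ρs * p.ρs = 1 / p.τ := by
  have h := p.gain_mul_lam
  have h2 : p.lam1 + p.lam2 = -(p.ρs * deriv p.V p.ρs) := by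
    unfold lam1 lam2
    ring
  rw [h2] at h
  linarith

/-- The source terms in the equation for the transformed velocity cancel to first order. -/
theorem LocalBounds.abs_source_le {δ G κ : ℝ} (hb : p.LocalBounds δ G) (hκδ : κ ≤ δ)
    {y₁ y₂ u₁ u₂ w : ℝ} (hy₁ : |y₁ - p.ρs| ≤ κ) (hy₂ : |y₂ - p.ρs| ≤ κ) (hu₁ : |u₁ - p.vs| ≤ κ)
    (hu₂ : |u₂ - p.vs| ≤ κ) (hw : |w| ≤ κ) :
    |-((u₁ - p.V y₁) - (u₂ - p.V y₂)) / p.τ + (p.speed y₁ u₁ - p.speed y₂ u₂) * w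
        + p.gain * deriv p.V p.ρs * ((y₁ * u₁ - y₂ * u₂) + p.speed y₁ u₁ * (y₁ - y₂))|
      ≤ κ * (G / p.τ + (1 + G + G * G) + |p.gain| * G * (3 + G + G * G))
        * (|y₁ - y₂| + |u₁ - u₂|) := by
  have hκ : 0 ≤ κ := (abs_nonneg _).trans hw
  have hδ : 0 ≤ δ := hκ.trans hκδ
  have hG := hb.one_le
  have hτ := p.τ_pos
  have hs0 : |p.ρs - p.ρs| ≤ δ := by simpa using hδ
  -- The first-order parts cancel by `gain_mul_deriv`. Every remaining term is a difference of the
  -- two states times a factor of order `κ`.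
  have e : -((u₁ - p.V y₁) - (u₂ - p.V y₂)) / p.τ + (p.speed y₁ u₁ - p.speed y₂ u₂) * w
        + p.gain * deriv p.V p.ρs * ((y₁ * u₁ - y₂ * u₂) + p.speed y₁ u₁ * (y₁ - y₂))
      = 1 / p.τ * (p.V y₁ - p.V y₂ - deriv p.V p.ρs * (y₁ - y₂))
        + (p.speed y₁ u₁ - p.speed y₂ u₂) * w
        + p.gain * deriv p.V p.ρs * ((y₁ - p.ρs) * (u₁ - u₂) + (u₂ - p.vs) * (y₁ - y₂)
          + (p.speed y₁ u₁ - p.speed p.ρs p.vs) * (y₁ - y₂)) := by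
    have h := p.gain_mul_deriv
    have hsp : p.speed p.ρs p.vs = -(p.vs + p.ρs * deriv p.V p.ρs) := rfl
    rw [hsp]
    linear_combination (u₁ - u₂ - deriv p.V p.ρs * (y₁ - y₂)) * h
  rw [e]
  set R := |y₁ - y₂| with hR
  set Y := |u₁ - u₂| with hY
  have hR0 : 0 ≤ R := abs_nonneg _
  have hY0 : 0 ≤ Y := abs_nonneg _
  have b1 : |1 / p.τ * (p.V y₁ - p.V y₂ - deriv p.V p.ρs * (y₁ - y₂))|
      ≤ κ * (G / p.τ) * (R + Y) := by
    rw [abs_mul, abs_of_pos (by positivity : 0 < 1 / p.τ)]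
    calc 1 / p.τ * |p.V y₁ - p.V y₂ - deriv p.V p.ρs * (y₁ - y₂)|
        ≤ 1 / p.τ * (G * κ * R) := mul_le_mul_of_nonneg_left
          (hb.abs_V_sub_linear_le hκδ hy₁ hy₂) (by positivity)
      _ = κ * (G / p.τ) * R := by ring
      _ ≤ _ := mul_le_mul_of_nonneg_left (by linarith) (by positivity)
  have b2 : |(p.speed y₁ u₁ - p.speed y₂ u₂) * w| ≤ κ * (1 + G + G * G) * (R + Y) := by
    rw [abs_mul]
    have h1 := hb.abs_speed_sub_le (u₁ := u₁) (u₂ := u₂) (hy₁.trans hκδ) (hy₂.trans hκδ)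
    have h2 : |p.speed y₁ u₁ - p.speed y₂ u₂| ≤ (1 + G + G * G) * (R + Y) := by
      have : 0 ≤ (G + G * G) * Y := by positivity
      linarith
    calc _ ≤ ((1 + G + G * G) * (R + Y)) * κ := mul_le_mul h2 hw (abs_nonneg _) (by positivity)
      _ = _ := by ring
  have b3 : |(y₁ - p.ρs) * (u₁ - u₂)| ≤ κ * Y := by
    rw [abs_mul]; exact mul_le_mul_of_nonneg_right hy₁ hY0
  have b4 : |(u₂ - p.vs) * (y₁ - y₂)| ≤ κ * R := by
    rw [abs_mul]; exact mul_le_mul_of_nonneg_right hu₂ hR0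
  have b5 : |(p.speed y₁ u₁ - p.speed p.ρs p.vs) * (y₁ - y₂)| ≤ κ * (1 + G + G * G) * R := by
    rw [abs_mul]
    refine mul_le_mul_of_nonneg_right ?_ hR0
    have h1 := hb.abs_speed_sub_le (u₁ := u₁) (u₂ := p.vs) (hy₁.trans hκδ) hs0
    have h2 := mul_le_mul_of_nonneg_left hy₁ (by positivity : 0 ≤ G + G * G)
    linarith
  have b6 : |p.gain * deriv p.V p.ρs * ((y₁ - p.ρs) * (u₁ - u₂) + (u₂ - p.vs) * (y₁ - y₂)
          + (p.speed y₁ u₁ - p.speed p.ρs p.vs) * (y₁ - y₂))|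
      ≤ κ * (|p.gain| * G * (3 + G + G * G)) * (R + Y) := by
    rw [abs_mul, abs_mul]
    have h1 := abs_add_three ((y₁ - p.ρs) * (u₁ - u₂)) ((u₂ - p.vs) * (y₁ - y₂))
      ((p.speed y₁ u₁ - p.speed p.ρs p.vs) * (y₁ - y₂))
    have h2 : |(y₁ - p.ρs) * (u₁ - u₂) + (u₂ - p.vs) * (y₁ - y₂)
          + (p.speed y₁ u₁ - p.speed p.ρs p.vs) * (y₁ - y₂)|
        ≤ κ * (3 + G + G * G) * (R + Y) := by
      have q1 : 0 ≤ κ * (2 + G + G * G) * Y := by positivity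
      have q2 : 0 ≤ κ * R := by positivity
      linarith
    have h3 : |p.gain| * |deriv p.V p.ρs| ≤ |p.gain| * G :=
      mul_le_mul_of_nonneg_left (hb.deriv_le _ hs0) (abs_nonneg _)
    calc _ ≤ |p.gain| * G * (κ * (3 + G + G * G) * (R + Y)) :=
          mul_le_mul h3 h2 (abs_nonneg _) (by positivity)
      _ = _ := by ring
  refine (abs_add_three _ _ _).trans ?_
  linarith

namespace Flow

/-- The difference of the densities. -/
def dρ (f g : p.Flow Kw Kv T) (x t : ℝ) : ℝ := f.ρ x t - g.ρ x t

/-- The difference of the velocities. -/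
def dv (f g : p.Flow Kw Kv T) (x t : ℝ) : ℝ := f.v x t - g.v x t

/-- The Riemann coordinate `v - V(ρ)`. -/
def z (f : p.Flow Kw Kv T) (x t : ℝ) : ℝ := f.v x t - p.V (f.ρ x t)

/-- The difference of the Riemann coordinates. -/
def dz (f g : p.Flow Kw Kv T) (x t : ℝ) : ℝ := f.z x t - g.z x t

/-- The backstepping transform of the difference of the velocities. -/
noncomputable def dβ (f g : p.Flow Kw Kv T) (x t : ℝ) : ℝ :=
  f.dv g x t - p.gain * deriv p.V p.ρs * ∫ y in (0 : ℝ)..x, f.dρ g y t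

/-- The solution stays `κ`-close to the equilibrium in the `C¹` norm. -/
def Near (f : p.Flow Kw Kv T) (κ : ℝ) : Prop :=
  ∀ x ∈ Icc 0 p.L, ∀ t ∈ Ico 0 T,
    |f.ρ x t - p.ρs| ≤ κ ∧ |f.v x t - p.vs| ≤ κ ∧ |f.ρx x t| ≤ κ ∧ |f.vx x t| ≤ κ

variable (f g : p.Flow Kw Kv T)

theorem contdρ : ContinuousOn (Function.uncurry (f.dρ g)) (Icc 0 p.L ×ˢ Ico 0 T) :=
  f.contρ.sub g.contρ

theorem contdv : ContinuousOn (Function.uncurry (f.dv g)) (Icc 0 p.L ×ˢ Ico 0 T) :=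
  f.contv.sub g.contv

theorem cont_comp_ρ {F : ℝ → ℝ} (hF : ContinuousOn F (Ioi 0)) :
    ContinuousOn (Function.uncurry fun x t => F (f.ρ x t)) (Icc 0 p.L ×ˢ Ico 0 T) :=
  hF.comp f.contρ fun z hz => f.ρ_pos z.1 hz.1 z.2 hz.2

theorem contz : ContinuousOn (Function.uncurry f.z) (Icc 0 p.L ×ˢ Ico 0 T) :=
  f.contv.sub (f.cont_comp_ρ p.contDiffOn_V.continuousOn)

theorem contdz : ContinuousOn (Function.uncurry (f.dz g)) (Icc 0 p.L ×ˢ Ico 0 T) :=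
  f.contz.sub g.contz

theorem contdβ : ContinuousOn (Function.uncurry (f.dβ g)) (Icc 0 p.L ×ˢ Ico 0 T) :=
  (f.contdv g).sub (continuousOn_const.mul (continuousOn_primitive_Icc p.L_pos.le (f.contdρ g)))

theorem dβ_zero (t : ℝ) : f.dβ g 0 t = f.dv g 0 t := by simp [dβ]

/-- At the outlet the transformed velocity only sees the error of the gains. -/
theorem dβ_outlet {M : ℝ} (hK : p.BoundedKernels Kw Kv M) {t : ℝ} (ht : t ∈ Ico 0 T) :
    f.dβ g p.L t = p.discrepancy Kw Kv (fun x => Real.exp (p.kap * x)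
      * (f.dv g x t - deriv p.V p.ρs * f.dρ g x t)) (fun x => f.dv g x t) := by
  have hL := p.L_pos.le
  have hX := p.boundedKernels_exact
  have sρ := fun f : p.Flow Kw Kv T => continuousOn_slice f.contρ ht
  have sv := fun f : p.Flow Kw Kv T => continuousOn_slice f.contv ht
  have kw := continuousOn_kernel_L hK.contW
  have kv := continuousOn_kernel_L hK.contV
  have hkap : ∀ x, x / (p.τ * p.vs) = p.kap * x := fun x => by unfold kap; ring
  have cw : ∀ f : p.Flow Kw Kv T, ContinuousOn
      (fun x => Kw p.L x * p.wTilde (fun ξ => f.ρ ξ t) (fun ξ => f.v ξ t) x) (Icc 0 p.L) := by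
    intro f
    have h1 := sρ f
    have h2 := sv f
    unfold wTilde
    fun_prop
  have cv : ∀ f : p.Flow Kw Kv T, ContinuousOn
      (fun x => Kv p.L x * (f.v x t - p.vs)) (Icc 0 p.L) := by
    intro f
    have h2 := sv f
    fun_prop
  have e1 : f.dv g p.L t = p.feedback Kw Kv (fun x => Real.exp (p.kap * x)
      * (f.dv g x t - deriv p.V p.ρs * f.dρ g x t)) (fun x => f.dv g x t) := by
    rw [dv, f.outlet t ht, g.outlet t ht, feedback, feedback, feedback, add_sub_add_left_eq_sub,
      add_sub_add_comm, ← intervalIntegral.integral_sub ((cw f).intervalIntegrable_of_Icc hL)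
        ((cw g).intervalIntegrable_of_Icc hL),
      ← intervalIntegral.integral_sub ((cv f).intervalIntegrable_of_Icc hL)
        ((cv g).intervalIntegrable_of_Icc hL)]
    congr 1
    · refine intervalIntegral.integral_congr fun x _ => ?_
      simp only [wTilde, hkap, dv, dρ]
      ring
    · refine intervalIntegral.integral_congr fun x _ => ?_
      simp only [dv]
      ring
  -- With `w̃ = exp (kap x) (v - V'(ρ⋆) ρ)` for differences, the velocity parts of the two exact
  -- feedback integrals cancel. What is left is exactly the integral subtracted in the definition of
  -- `dβ`.
  have e2 : p.feedback p.exactW p.exactV (fun x => Real.exp (p.kap * x)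
      * (f.dv g x t - deriv p.V p.ρs * f.dρ g x t)) (fun x => f.dv g x t)
      = p.gain * deriv p.V p.ρs * ∫ y in (0 : ℝ)..p.L, f.dρ g y t := by
    have c1 := continuousOn_slice (f.contdρ g) ht
    have c2 := continuousOn_slice (f.contdv g) ht
    rw [feedback, ← intervalIntegral.integral_const_mul, ← intervalIntegral.integral_add
      (ContinuousOn.intervalIntegrable_of_Icc hL (by unfold exactW; fun_prop))
      (ContinuousOn.intervalIntegrable_of_Icc hL (by unfold exactV; fun_prop))]
    refine intervalIntegral.integral_congr fun x _ => ?_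
    have : Real.exp (-(p.kap * x)) * Real.exp (p.kap * x) = 1 := by
      rw [← Real.exp_add, neg_add_cancel, Real.exp_zero]
    simp only [exactW, exactV]
    linear_combination (-(p.gain * (f.dv g x t - deriv p.V p.ρs * f.dρ g x t))) * this
  rw [discrepancy, e2, ← e1, dβ]

end Flow

end ARZModel

namespace ARZModel

variable {p : ARZModel} {Kw Kv : ℝ → ℝ → ℝ} {T : ℝ}

namespace Flow

variable (f g : p.Flow Kw Kv T)

/-- The space derivative of the Riemann coordinate. -/
noncomputable def zx (f : p.Flow Kw Kv T) (x t : ℝ) : ℝ :=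
  f.vx x t - deriv p.V (f.ρ x t) * f.ρx x t

/-- The time derivative of the Riemann coordinate. -/
noncomputable def zt (f : p.Flow Kw Kv T) (x t : ℝ) : ℝ :=
  f.vt x t - deriv p.V (f.ρ x t) * f.ρt x t

/-- The second characteristic speed along the solution. -/
noncomputable def sp (f : p.Flow Kw Kv T) (x t : ℝ) : ℝ := p.speed (f.ρ x t) (f.v x t)

/-- The space derivative of the second characteristic speed along the solution. -/
noncomputable def spx (f : p.Flow Kw Kv T) (x t : ℝ) : ℝ :=
  -(f.vx x t + (f.ρx x t * deriv p.V (f.ρ x t)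
    + f.ρ x t * (deriv (deriv p.V) (f.ρ x t) * f.ρx x t)))

/-- The difference of the flows of vehicles. -/
def dJ (f g : p.Flow Kw Kv T) (x t : ℝ) : ℝ := f.ρ x t * f.v x t - g.ρ x t * g.v x t

theorem contzx : ContinuousOn (Function.uncurry f.zx) (Icc 0 p.L ×ˢ Ico 0 T) :=
  f.contvx.sub ((f.cont_comp_ρ p.contDiffOn_deriv_V.continuousOn).mul f.contρx)

theorem contzt : ContinuousOn (Function.uncurry f.zt) (Icc 0 p.L ×ˢ Ico 0 T) :=
  f.contvt.sub ((f.cont_comp_ρ p.contDiffOn_deriv_V.continuousOn).mul f.contρt)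

theorem contsp : ContinuousOn (Function.uncurry f.sp) (Icc 0 p.L ×ˢ Ico 0 T) :=
  (f.contv.add (f.contρ.mul (f.cont_comp_ρ p.contDiffOn_deriv_V.continuousOn))).neg

theorem contspx : ContinuousOn (Function.uncurry f.spx) (Icc 0 p.L ×ˢ Ico 0 T) :=
  (f.contvx.add ((f.contρx.mul (f.cont_comp_ρ p.contDiffOn_deriv_V.continuousOn)).add
    (f.contρ.mul ((f.cont_comp_ρ p.continuousOn_deriv_deriv_V).mul f.contρx)))).neg

theorem contdJ : ContinuousOn (Function.uncurry (f.dJ g)) (Icc 0 p.L ×ˢ Ico 0 T) :=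
  (f.contρ.mul f.contv).sub (g.contρ.mul g.contv)

variable {x t : ℝ}

theorem hasDerivAt_ρx (hx : x ∈ Ioo 0 p.L) (ht : t ∈ Ico 0 T) :
    HasDerivAt (fun y => f.ρ y t) (f.ρx x t) x :=
  (f.derivρx x (Ioo_subset_Icc_self hx) t ht).hasDerivAt (Icc_mem_nhds hx.1 hx.2)

theorem hasDerivAt_vx (hx : x ∈ Ioo 0 p.L) (ht : t ∈ Ico 0 T) :
    HasDerivAt (fun y => f.v y t) (f.vx x t) x :=
  (f.derivvx x (Ioo_subset_Icc_self hx) t ht).hasDerivAt (Icc_mem_nhds hx.1 hx.2)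

theorem hasDerivAt_ρt (hx : x ∈ Icc 0 p.L) (ht : t ∈ Ioo 0 T) :
    HasDerivAt (fun s => f.ρ x s) (f.ρt x t) t :=
  (f.derivρt x hx t (Ioo_subset_Ico_self ht)).hasDerivAt (Ico_mem_nhds ht.1 ht.2)

theorem hasDerivAt_vt (hx : x ∈ Icc 0 p.L) (ht : t ∈ Ioo 0 T) :
    HasDerivAt (fun s => f.v x s) (f.vt x t) t :=
  (f.derivvt x hx t (Ioo_subset_Ico_self ht)).hasDerivAt (Ico_mem_nhds ht.1 ht.2)

theorem hasDerivAt_zx (hx : x ∈ Ioo 0 p.L) (ht : t ∈ Ico 0 T) :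
    HasDerivAt (fun y => f.z y t) (f.zx x t) x :=
  (f.hasDerivAt_vx hx ht).sub ((p.hasDerivAt_V (f.ρ_pos x (Ioo_subset_Icc_self hx) t ht)).comp x
    (f.hasDerivAt_ρx hx ht))

theorem hasDerivAt_zt (hx : x ∈ Icc 0 p.L) (ht : t ∈ Ioo 0 T) :
    HasDerivAt (fun s => f.z x s) (f.zt x t) t :=
  (f.hasDerivAt_vt hx ht).sub ((p.hasDerivAt_V (f.ρ_pos x hx t (Ioo_subset_Ico_self ht))).comp t
    (f.hasDerivAt_ρt hx ht))

theorem hasDerivAt_spx (hx : x ∈ Ioo 0 p.L) (ht : t ∈ Ico 0 T) :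
    HasDerivAt (fun y => f.sp y t) (f.spx x t) x := by
  have h := (p.hasDerivAt_deriv_V (f.ρ_pos x (Ioo_subset_Icc_self hx) t ht)).comp
    (h₂ := deriv p.V) (h := fun y => f.ρ y t) x (f.hasDerivAt_ρx hx ht)
  exact ((f.hasDerivAt_vx hx ht).add ((f.hasDerivAt_ρx hx ht).mul h)).neg

theorem z_equation (hx : x ∈ Icc 0 p.L) (ht : t ∈ Ico 0 T) :
    f.zt x t + f.v x t * f.zx x t = -(f.z x t) / p.τ := by
  have := f.momentum x hx t ht
  unfold zt zx z
  rw [this]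
  ring

theorem v_equation (hx : x ∈ Icc 0 p.L) (ht : t ∈ Ico 0 T) :
    f.vt x t = -(f.z x t) / p.τ + f.sp x t * f.vx x t := by
  have h1 := f.momentum x hx t ht
  have h2 := f.mass x hx t ht
  unfold z sp speed
  linear_combination h1 + deriv p.V (f.ρ x t) * h2

theorem hasDerivAt_dβx (hx : x ∈ Ioo 0 p.L) (ht : t ∈ Ico 0 T) :
    HasDerivAt (fun y => f.dβ g y t)
      (f.vx x t - g.vx x t - p.gain * deriv p.V p.ρs * f.dρ g x t) x :=
  ((f.hasDerivAt_vx hx ht).sub (g.hasDerivAt_vx hx ht)).sub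
    ((hasDerivAt_primitive_Ioo (continuousOn_slice (f.contdρ g) ht) hx).const_mul _)

/-- Conservation of mass turns the time derivative of `∫₀ˣ dρ` into minus the difference of flows at
`x`; the contribution of `x = 0` vanishes because both solutions have inflow `q⋆`. -/
theorem hasDerivAt_dβt (hx : x ∈ Ioo 0 p.L) (ht : t ∈ Ioo 0 T) :
    HasDerivAt (fun s => f.dβ g x s)
      (f.vt x t - g.vt x t + p.gain * deriv p.V p.ρs * f.dJ g x t) t := by
  have hxI := Ioo_subset_Icc_self hx
  have ht' := Ioo_subset_Ico_self ht
  have hsub : Icc 0 x ×ˢ Ioo 0 T ⊆ Icc 0 p.L ×ˢ Ico 0 T :=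
    prod_mono (Icc_subset_Icc le_rfl hxI.2) Ioo_subset_Ico_self
  have hm := hasDerivAt_integral_param (F := f.dρ g) (F' := fun x t => f.ρt x t - g.ρt x t) hxI.1
    ((f.contdρ g).mono hsub) ((f.contρt.sub g.contρt).mono hsub)
    (fun y hy s hs => (f.hasDerivAt_ρt ⟨hy.1.le, hy.2.le.trans hxI.2⟩ hs).sub
      (g.hasDerivAt_ρt ⟨hy.1.le, hy.2.le.trans hxI.2⟩ hs)) ht
  have hJ0 : f.dJ g 0 t = 0 := by
    rw [dJ, f.inlet t ht', g.inlet t ht', sub_self]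
  have hint : ∫ y in (0 : ℝ)..x, (f.ρt y t - g.ρt y t) = -(f.dJ g x t) := by
    have h1 := intervalIntegral.integral_eq_sub_of_hasDerivAt_of_le hxI.1
      (f := fun y => -(f.dJ g y t)) (f' := fun y => f.ρt y t - g.ρt y t)
      ((continuousOn_slice (f.contdJ g) ht').mono (Icc_subset_Icc le_rfl hxI.2)).neg
      (fun y hy => by
        have hy' : y ∈ Ioo 0 p.L := ⟨hy.1, hy.2.trans_le hxI.2⟩
        refine (((f.hasDerivAt_ρx hy' ht').mul (f.hasDerivAt_vx hy' ht')).sub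
          ((g.hasDerivAt_ρx hy' ht').mul (g.hasDerivAt_vx hy' ht'))).neg.congr_deriv ?_
        have e1 := f.mass y (Ioo_subset_Icc_self hy') t ht'
        have e2 := g.mass y (Ioo_subset_Icc_self hy') t ht'
        linear_combination e2 - e1)
      (((continuousOn_slice (f := fun x t => f.ρt x t - g.ρt x t)
        (f.contρt.sub g.contρt) ht').mono
        (Icc_subset_Icc le_rfl hxI.2)).intervalIntegrable_of_Icc hxI.1)
    rw [h1, hJ0]
    ring
  rw [hint] at hm
  refine (((f.hasDerivAt_vt hxI ht).sub (g.hasDerivAt_vt hxI ht)).sub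
    (hm.const_mul (p.gain * deriv p.V p.ρs))).congr_deriv ?_
  ring

variable {f g} {δ G κ : ℝ}

/-- The constant in the recovery of a state from its transformed coordinates. -/
noncomputable def recoverConst (p : ARZModel) (G : ℝ) : ℝ :=
  (G + 1) * (1 + |p.gain| * G * G * (1 + Real.exp (|p.gain| * G * G * p.L)
    * (1 + |p.gain| * G * G * p.L)))

theorem abs_dρ_le (hb : p.LocalBounds δ G) (hκδ : κ ≤ δ) (hf : f.Near κ) (hg : g.Near κ)
    (hx : x ∈ Icc 0 p.L) (ht : t ∈ Ico 0 T) :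
    |f.dρ g x t| ≤ G * (|f.dz g x t| + |f.dv g x t|) := by
  have h1 := hb.abs_sub_le_V ((hf x hx t ht).1.trans hκδ) ((hg x hx t ht).1.trans hκδ)
  refine h1.trans (mul_le_mul_of_nonneg_left ?_ (by linarith [hb.one_le]))
  have e : p.V (f.ρ x t) - p.V (g.ρ x t) = f.dv g x t - f.dz g x t := by
    unfold dv dz z
    ring
  rw [e, add_comm]
  exact abs_sub _ _

theorem abs_dz_le (hb : p.LocalBounds δ G) (hκδ : κ ≤ δ) (hf : f.Near κ) (hg : g.Near κ)
    (hx : x ∈ Icc 0 p.L) (ht : t ∈ Ico 0 T) :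
    |f.dz g x t| ≤ |f.dv g x t| + G * |f.dρ g x t| := by
  have h1 := hb.abs_V_sub_le ((hf x hx t ht).1.trans hκδ) ((hg x hx t ht).1.trans hκδ)
  have e : f.dz g x t = f.dv g x t - (p.V (f.ρ x t) - p.V (g.ρ x t)) := by
    unfold dv dz z
    ring
  rw [e]
  exact (abs_sub _ _).trans (add_le_add le_rfl h1)

theorem abs_gain_deriv_le (hb : p.LocalBounds δ G) (hδ : 0 ≤ δ) :
    |p.gain * deriv p.V p.ρs| ≤ |p.gain| * G := by
  rw [abs_mul]
  exact mul_le_mul_of_nonneg_left (hb.deriv_le _ (by simpa using hδ)) (abs_nonneg _)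

theorem abs_dβ_sub_le (hb : p.LocalBounds δ G) (hδ : 0 ≤ δ) (f g : p.Flow Kw Kv T)
    (hx : x ∈ Icc 0 p.L) (t : ℝ) :
    |f.dβ g x t - f.dv g x t| ≤ |p.gain| * G * ∫ y in (0 : ℝ)..x, |f.dρ g y t| := by
  have h1 : |∫ y in (0 : ℝ)..x, f.dρ g y t| ≤ ∫ y in (0 : ℝ)..x, |f.dρ g y t| :=
    intervalIntegral.abs_integral_le_integral_abs hx.1
  have e : f.dβ g x t - f.dv g x t
      = -(p.gain * deriv p.V p.ρs * ∫ y in (0 : ℝ)..x, f.dρ g y t) := by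
    unfold dβ
    ring
  rw [e, abs_neg, abs_mul]
  exact mul_le_mul (abs_gain_deriv_le hb hδ) h1 (abs_nonneg _)
    (mul_nonneg (abs_nonneg _) (by linarith [hb.one_le]))

theorem abs_add_abs_le (hb : p.LocalBounds δ G) (hκδ : κ ≤ δ) (hf : f.Near κ) (hg : g.Near κ)
    (hx : x ∈ Icc 0 p.L) (ht : t ∈ Ico 0 T) :
    |f.dρ g x t| + |f.dv g x t| ≤ recoverConst p G *
      (|f.dz g x t| + |f.dβ g x t| + ∫ y in (0 : ℝ)..p.L, (|f.dz g y t| + |f.dβ g y t|)) := by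
  have hG := hb.one_le
  have hδ : 0 ≤ δ := ((abs_nonneg _).trans (hf x hx t ht).1).trans hκδ
  refine recover_le p.L_pos.le hG (c := |p.gain| * G) (by positivity)
    (continuousOn_slice (f.contdρ g) ht) (continuousOn_slice (f.contdv g) ht)
    (continuousOn_slice (f.contdz g) ht) (continuousOn_slice (f.contdβ g) ht)
    (fun y hy => abs_dρ_le hb hκδ hf hg hy ht) (fun y hy => ?_) hx
  have h1 := abs_dβ_sub_le hb hδ f g hy t
  have h2 := abs_sub_abs_le_abs_sub (f.dv g y t) (f.dβ g y t)
  rw [abs_sub_comm] at h2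
  linarith

end Flow

end ARZModel

namespace ARZModel

variable {p : ARZModel} {Kw Kv : ℝ → ℝ → ℝ} {T : ℝ}

namespace Flow

variable {f g : p.Flow Kw Kv T} {δ G κ ε a₀ M x t : ℝ}

/-- The weighted difference of the first Riemann coordinates. -/
noncomputable def eP (f g : p.Flow Kw Kv T) (x t : ℝ) : ℝ := Real.exp (-x) * f.dz g x t

/-- The weighted difference of the transformed velocities. -/
noncomputable def eQ (f g : p.Flow Kw Kv T) (a₀ x t : ℝ) : ℝ :=
  a₀ * (Real.exp x * f.dβ g x t)

theorem contdeP (f g : p.Flow Kw Kv T) :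
    ContinuousOn (Function.uncurry (f.eP g)) (Icc 0 p.L ×ˢ Ico 0 T) :=
  ((Continuous.continuousOn (by fun_prop)) : ContinuousOn (fun z : ℝ × ℝ => Real.exp (-z.1)) _).mul
    (f.contdz g)

theorem contdeQ (f g : p.Flow Kw Kv T) (a₀ : ℝ) :
    ContinuousOn (Function.uncurry (f.eQ g a₀)) (Icc 0 p.L ×ˢ Ico 0 T) :=
  continuousOn_const.mul (((Continuous.continuousOn (by fun_prop)) :
    ContinuousOn (fun z : ℝ × ℝ => Real.exp z.1) _).mul (f.contdβ g))

theorem abs_dz_le_eP (f g : p.Flow Kw Kv T) (hx : x ∈ Icc 0 p.L) (t : ℝ) :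
    |f.dz g x t| ≤ Real.exp p.L * |f.eP g x t| := by
  rw [eP, abs_mul, Real.abs_exp, ← mul_assoc, ← Real.exp_add]
  exact le_mul_of_one_le_left (abs_nonneg _) (Real.one_le_exp (by linarith [hx.2]))

theorem abs_dβ_le_eQ (ha : 1 ≤ a₀) (f g : p.Flow Kw Kv T) (hx : x ∈ Icc 0 p.L) (t : ℝ) :
    |f.dβ g x t| ≤ Real.exp p.L * |f.eQ g a₀ x t| := by
  rw [eQ, abs_mul, abs_mul, Real.abs_exp, abs_of_pos (by linarith : 0 < a₀), ← mul_assoc, ← mul_assoc]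
  refine le_mul_of_one_le_left (abs_nonneg _) ?_
  have h1 := Real.one_le_exp p.L_pos.le
  have h2 := Real.one_le_exp hx.1
  have h3 := one_le_mul_of_one_le_of_one_le h1 ha
  exact one_le_mul_of_one_le_of_one_le h3 h2

/-- The size of a difference of solutions in terms of the weighted coordinates. -/
noncomputable def stateSize (f g : p.Flow Kw Kv T) (a₀ x t : ℝ) : ℝ :=
  |f.eP g x t| + |f.eQ g a₀ x t| + ∫ y in (0 : ℝ)..p.L, (|f.eP g y t| + |f.eQ g a₀ y t|)

theorem recoverConst_nonneg (hG : 1 ≤ G) : 0 ≤ recoverConst p G := by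
  have := p.L_pos
  unfold recoverConst
  positivity

theorem abs_add_abs_le_stateSize (hb : p.LocalBounds δ G) (hκδ : κ ≤ δ) (hf : f.Near κ)
    (hg : g.Near κ) (ha : 1 ≤ a₀) (hx : x ∈ Icc 0 p.L) (ht : t ∈ Ico 0 T) :
    |f.dρ g x t| + |f.dv g x t| ≤ recoverConst p G * Real.exp p.L * f.stateSize g a₀ x t := by
  have hL := p.L_pos.le
  refine (abs_add_abs_le hb hκδ hf hg hx ht).trans ?_
  rw [mul_assoc]
  refine mul_le_mul_of_nonneg_left ?_ (recoverConst_nonneg hb.one_le)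
  have c1 := continuousOn_slice (f.contdz g) ht
  have c2 := continuousOn_slice (f.contdβ g) ht
  have c3 := continuousOn_slice (f.contdeP g) ht
  have c4 := continuousOn_slice (f.contdeQ g a₀) ht
  have h1 : ∫ y in (0 : ℝ)..p.L, (|f.dz g y t| + |f.dβ g y t|)
      ≤ ∫ y in (0 : ℝ)..p.L, Real.exp p.L * (|f.eP g y t| + |f.eQ g a₀ y t|) := by
    refine intervalIntegral.integral_mono_on hL
      (ContinuousOn.intervalIntegrable_of_Icc hL (by fun_prop))
      (ContinuousOn.intervalIntegrable_of_Icc hL (by fun_prop)) fun y hy => ?_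
    rw [mul_add]
    exact add_le_add (abs_dz_le_eP f g hy t) (abs_dβ_le_eQ ha f g hy t)
  rw [intervalIntegral.integral_const_mul] at h1
  unfold stateSize
  rw [mul_add, mul_add]
  exact add_le_add (add_le_add (abs_dz_le_eP f g hx t) (abs_dβ_le_eQ ha f g hx t)) h1

/-- The sum of the constants in the source terms. -/
noncomputable def sourceConst (p : ARZModel) (G a₀ : ℝ) : ℝ :=
  (1 + G) * (recoverConst p G * Real.exp p.L)
    + a₀ * Real.exp p.L * (G / p.τ + (1 + G + G * G) + |p.gain| * G * (3 + G + G * G))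
      * (recoverConst p G * Real.exp p.L) + (1 + G + G * G)

/-- The constant in the outlet condition. -/
noncomputable def outletConst (p : ARZModel) (G a₀ : ℝ) : ℝ :=
  a₀ * Real.exp p.L * ((Real.exp (p.kap * p.L) * (1 + G) + 1)
    * (recoverConst p G * Real.exp p.L * (1 + p.L)))

theorem stateSize_nonneg (f g : p.Flow Kw Kv T) (a₀ x t : ℝ) : 0 ≤ f.stateSize g a₀ x t :=
  add_nonneg (add_nonneg (abs_nonneg _) (abs_nonneg _))
    (intervalIntegral.integral_nonneg p.L_pos.le fun _ _ => by positivity)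

theorem integral_abs_le (hb : p.LocalBounds δ G) (hκδ : κ ≤ δ) (hf : f.Near κ)
    (hg : g.Near κ) (ha : 1 ≤ a₀) (ht : t ∈ Ico 0 T) :
    ∫ y in (0 : ℝ)..p.L, (|f.dρ g y t| + |f.dv g y t|) ≤ recoverConst p G * Real.exp p.L
      * (1 + p.L) * ∫ y in (0 : ℝ)..p.L, (|f.eP g y t| + |f.eQ g a₀ y t|) := by
  have hL := p.L_pos.le
  have c1 := continuousOn_slice (f.contdρ g) ht
  have c2 := continuousOn_slice (f.contdv g) ht
  have c3 := continuousOn_slice (f.contdeP g) ht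
  have c4 := continuousOn_slice (f.contdeQ g a₀) ht
  have i3 : IntervalIntegrable (fun y => |f.eP g y t| + |f.eQ g a₀ y t|) volume 0 p.L :=
    ContinuousOn.intervalIntegrable_of_Icc hL (by fun_prop)
  have h1 : ∫ y in (0 : ℝ)..p.L, (|f.dρ g y t| + |f.dv g y t|)
      ≤ ∫ y in (0 : ℝ)..p.L, recoverConst p G * Real.exp p.L * f.stateSize g a₀ y t := by
    refine intervalIntegral.integral_mono_on hL
      (ContinuousOn.intervalIntegrable_of_Icc hL (by fun_prop))
      ((i3.add intervalIntegrable_const).const_mul _) fun y hy =>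
        abs_add_abs_le_stateSize hb hκδ hf hg ha hy ht
  have h2 : ∫ y in (0 : ℝ)..p.L, f.stateSize g a₀ y t
      = (1 + p.L) * ∫ y in (0 : ℝ)..p.L, (|f.eP g y t| + |f.eQ g a₀ y t|) := by
    unfold stateSize
    rw [intervalIntegral.integral_add i3 intervalIntegrable_const, intervalIntegral.integral_const,
      smul_eq_mul, sub_zero]
    ring
  rw [intervalIntegral.integral_const_mul, h2, ← mul_assoc] at h1
  exact h1

/-- By `dβ_outlet` the transformed velocity at `x = L` is the discrepancy alone, which is
proportional to the error `ε` of the gains. -/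
theorem abs_eQ_outlet_le (hb : p.LocalBounds δ G) (hκδ : κ ≤ δ) (hf : f.Near κ) (hg : g.Near κ)
    (hK : p.BoundedKernels Kw Kv M) (hε : p.GainsClose ε Kw Kv) (ha : 1 ≤ a₀)
    (ht : t ∈ Ico 0 T) : |f.eQ g a₀ p.L t| ≤ ε * outletConst p G a₀ *
      ∫ y in (0 : ℝ)..p.L, (|f.eP g y t| + |f.eQ g a₀ y t|) := by
  have hL := p.L_pos.le
  have hG := hb.one_le
  have hLL : p.L ∈ Icc 0 p.L := ⟨hL, le_rfl⟩
  have hδ : 0 ≤ δ := ((abs_nonneg _).trans (hf p.L hLL t ht).1).trans hκδ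
  have hε0 : 0 ≤ ε := (abs_nonneg _).trans (hε p.L hLL).1
  have c1 := continuousOn_slice (f.contdρ g) ht
  have c2 := continuousOn_slice (f.contdv g) ht
  have h1 := abs_discrepancy_le hK hε (w := fun x => Real.exp (p.kap * x)
      * (f.dv g x t - deriv p.V p.ρs * f.dρ g x t)) (v := fun x => f.dv g x t)
    (ContinuousOn.intervalIntegrable_of_Icc hL (by fun_prop))
    (ContinuousOn.intervalIntegrable_of_Icc hL (by fun_prop))
  rw [← f.dβ_outlet g hK ht] at h1
  set E := Real.exp (p.kap * p.L) with hE
  have hE0 : 0 < E := Real.exp_pos _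
  set I := ∫ y in (0 : ℝ)..p.L, (|f.dρ g y t| + |f.dv g y t|) with hI
  have h2 : ∫ x in (0 : ℝ)..p.L, |Real.exp (p.kap * x)
      * (f.dv g x t - deriv p.V p.ρs * f.dρ g x t)| ≤ E * (1 + G) * I := by
    rw [hI, ← intervalIntegral.integral_const_mul]
    refine intervalIntegral.integral_mono_on hL
      (ContinuousOn.intervalIntegrable_of_Icc hL (by fun_prop))
      (ContinuousOn.intervalIntegrable_of_Icc hL (by fun_prop)) fun y hy => ?_
    rw [abs_mul, Real.abs_exp, mul_assoc]
    refine mul_le_mul (Real.exp_le_exp.2 (mul_le_mul_of_nonneg_left hy.2 p.kap_pos.le)) ?_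
      (abs_nonneg _) hE0.le
    refine (abs_sub _ _).trans ?_
    rw [abs_mul]
    have h3 := mul_le_mul_of_nonneg_right (hb.deriv_le p.ρs (by simpa using hδ))
      (abs_nonneg (f.dρ g y t))
    have h4 := mul_nonneg (by linarith : 0 ≤ G) (abs_nonneg (f.dv g y t))
    have h5 := abs_nonneg (f.dρ g y t)
    linarith
  have h3 : ∫ x in (0 : ℝ)..p.L, |f.dv g x t| ≤ I := by
    refine intervalIntegral.integral_mono_on hL
      (ContinuousOn.intervalIntegrable_of_Icc hL (by fun_prop))
      (ContinuousOn.intervalIntegrable_of_Icc hL (by fun_prop)) fun y hy => ?_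
    exact le_add_of_nonneg_left (abs_nonneg _)
  have h4 := integral_abs_le hb hκδ hf hg ha ht
  rw [← hI] at h4
  rw [eQ, abs_mul, abs_mul, Real.abs_exp, abs_of_pos (by linarith : 0 < a₀)]
  set Φ := ∫ y in (0 : ℝ)..p.L, (|f.eP g y t| + |f.eQ g a₀ y t|)
  have hR := recoverConst_nonneg (p := p) hG
  calc a₀ * (Real.exp p.L * |f.dβ g p.L t|)
      ≤ a₀ * (Real.exp p.L * (ε * ((E * (1 + G) + 1) * I))) := by
        have : ε * ((E * (1 + G) + 1) * I) = ε * (E * (1 + G) * I + I) := by ring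
        rw [this]
        gcongr
        exact h1.trans (mul_le_mul_of_nonneg_left (add_le_add h2 h3) hε0)
    _ ≤ a₀ * (Real.exp p.L * (ε * ((E * (1 + G) + 1) *
          (recoverConst p G * Real.exp p.L * (1 + p.L) * Φ)))) := by gcongr
    _ = _ := by unfold outletConst; ring

/-- Equal inflows give `g.v * dρ = -(f.ρ * dv)` at `x = 0`. The velocity is bounded away from zero,
so `dρ` and hence `dz` are controlled there by `dv`, which is the value of `dβ` at `0`. -/
theorem inlet_le (hb : p.LocalBounds δ G) (hκδ : κ ≤ δ) (hf : f.Near κ) (hg : g.Near κ)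
    (ht : t ∈ Ico 0 T) : |f.dz g 0 t| ≤ (1 + G * G * G) * |f.dβ g 0 t| := by
  have hG := hb.one_le
  have h0 : (0 : ℝ) ∈ Icc 0 p.L := ⟨le_rfl, p.L_pos.le⟩
  rw [dβ_zero]
  have h1 := abs_dz_le hb hκδ hf hg h0 ht
  have hv := hb.inv_le _ ((hg 0 h0 t ht).2.1.trans hκδ)
  have hρ := hb.le _ ((hf 0 h0 t ht).1.trans hκδ)
  have hρ0 := hb.pos _ ((hf 0 h0 t ht).1.trans hκδ)
  have e : g.v 0 t * f.dρ g 0 t = -(f.ρ 0 t * f.dv g 0 t) := by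
    have e1 := f.inlet t ht
    have e2 := g.inlet t ht
    unfold dρ dv
    linear_combination e1 - e2
  have hGi : 0 < G⁻¹ := by positivity
  have h2 : G⁻¹ * |f.dρ g 0 t| ≤ G * |f.dv g 0 t| := by
    calc G⁻¹ * |f.dρ g 0 t| ≤ g.v 0 t * |f.dρ g 0 t| :=
          mul_le_mul_of_nonneg_right hv (abs_nonneg _)
      _ = |g.v 0 t * f.dρ g 0 t| := by rw [abs_mul, abs_of_pos (hGi.trans_le hv)]
      _ = f.ρ 0 t * |f.dv g 0 t| := by rw [e, abs_neg, abs_mul, abs_of_pos hρ0]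
      _ ≤ _ := mul_le_mul_of_nonneg_right hρ (abs_nonneg _)
  have h3 : |f.dρ g 0 t| ≤ G * (G * |f.dv g 0 t|) := by
    calc |f.dρ g 0 t| = G * (G⁻¹ * |f.dρ g 0 t|) := by field_simp
      _ ≤ _ := mul_le_mul_of_nonneg_left h2 (by linarith)
  have h4 := mul_le_mul_of_nonneg_left h3 (by linarith : 0 ≤ G)
  calc |f.dz g 0 t| ≤ |f.dv g 0 t| + G * (G * (G * |f.dv g 0 t|)) := by linarith
    _ = _ := by ring

/-- The weight `exp (-x)` on `dz` adds the damping `v` to the relaxation `1 / τ`; the weight `exp x`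
on `dβ` creates damping equal to the second speed, which is at least `λ₂ / 2`. A large `a₀` makes
the reflection at the inlet a contraction in the weighted variables. This costs nothing at the
outlet, where `dβ` is of order `ε`. -/
theorem dampedPair (hb : p.LocalBounds δ G) (hκδ : κ ≤ δ) (hf : f.Near κ) (hg : g.Near κ)
    (hK : p.BoundedKernels Kw Kv M) (hε : p.GainsClose ε Kw Kv) (ha : 1 ≤ a₀)
    (ha' : (1 + G * G * G) * (1 + 2 * G / p.lam2) ≤ a₀) :
    DampedPair p.L T (min (1 / p.τ) (p.lam2 / 2)) (κ * sourceConst p G a₀)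
      (ε * outletConst p G a₀) G (f.eP g) (f.eQ g a₀)
      (fun x t => Real.exp (-x) * (f.zx x t - g.zx x t - f.dz g x t))
      (fun x t => a₀ * (Real.exp x * (f.dβ g x t
        + (f.vx x t - g.vx x t - p.gain * deriv p.V p.ρs * f.dρ g x t))))
      (fun x t => Real.exp (-x) * (f.zt x t - g.zt x t))
      (fun x t => a₀ * (Real.exp x
        * (f.vt x t - g.vt x t + p.gain * deriv p.V p.ρs * f.dJ g x t)))
      f.v f.sp f.vx f.spx (fun x t => 1 / p.τ + f.v x t) f.sp := by
  have hL := p.L_pos.le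
  have hG := hb.one_le
  have hτ := p.τ_pos
  have hl2 := p.lam2_pos
  have hR := recoverConst_nonneg (p := p) hG
  have ha0 : 0 < a₀ := by linarith
  have hcE : ContinuousOn (Function.uncurry fun x _ : ℝ => Real.exp (-x)) (Icc 0 p.L ×ˢ Ico 0 T) :=
    Continuous.continuousOn (by unfold Function.uncurry; fun_prop)
  have hcE' : ContinuousOn (Function.uncurry fun x _ : ℝ => Real.exp x) (Icc 0 p.L ×ˢ Ico 0 T) :=
    Continuous.continuousOn (by unfold Function.uncurry; fun_prop)
  have hI : ∀ {t}, t ∈ Ioo 0 T → t ∈ Ico 0 T := fun ht => Ioo_subset_Ico_self ht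
  have nf := fun x hx t ht => hf x hx t (hI ht)
  have ng := fun x hx t ht => hg x hx t (hI ht)
  have hκ : ∀ {t}, t ∈ Ioo 0 T → 0 ≤ κ := fun ht =>
    (abs_nonneg _).trans (nf 0 ⟨le_rfl, hL⟩ _ ht).1
  have dex : ∀ x, HasDerivAt (fun y => Real.exp (-y)) (-Real.exp (-x)) x := fun x => by
    refine (hasDerivAt_neg x).exp.congr_deriv ?_
    ring
  set CE := G / p.τ + (1 + G + G * G) + |p.gain| * G * (3 + G + G * G) with hCE
  set K₂ := recoverConst p G * Real.exp p.L with hK₂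
  have hCE0 : 0 ≤ CE := by positivity
  have hK20 : 0 ≤ K₂ := by positivity
  have hsc : sourceConst p G a₀ = (1 + G) * K₂ + a₀ * Real.exp p.L * CE * K₂ + (1 + G + G * G) := rfl
  have s1 : (1 + G) * K₂ ≤ sourceConst p G a₀ := by
    have : 0 ≤ a₀ * Real.exp p.L * CE * K₂ := by positivity
    have : 0 ≤ G * G := by positivity
    linarith
  have s2 : a₀ * Real.exp p.L * CE * K₂ ≤ sourceConst p G a₀ := by
    have : 0 ≤ (1 + G) * K₂ := by positivity
    have : 0 ≤ G * G := by positivity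
    linarith
  have s3 : 1 + G + G * G ≤ sourceConst p G a₀ := by
    have : 0 ≤ (1 + G) * K₂ := by positivity
    have : 0 ≤ a₀ * Real.exp p.L * CE * K₂ := by positivity
    linarith
  have hspos : ∀ x ∈ Icc 0 p.L, ∀ t ∈ Ioo 0 T, p.lam2 / 2 ≤ f.sp x t := fun x hx t ht =>
    hb.le_speed _ _ ((nf x hx t ht).1.trans hκδ) ((nf x hx t ht).2.1.trans hκδ)
  have hvpos : ∀ x ∈ Icc 0 p.L, ∀ t ∈ Ioo 0 T, 0 ≤ f.v x t := fun x hx t ht => by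
    have h1 := hb.inv_le _ ((nf x hx t ht).2.1.trans hκδ)
    have h2 : 0 < G⁻¹ := by positivity
    linarith
  have hin : ∀ t ∈ Ioo 0 T, |f.eP g 0 t| ≤ (1 + G * G * G) * |f.dβ g 0 t| ∧
      |f.eQ g a₀ 0 t| = a₀ * |f.dβ g 0 t| := by
    intro t ht
    constructor
    · simpa [eP] using inlet_le hb hκδ hf hg (hI ht)
    · rw [eQ, Real.exp_zero, one_mul, abs_mul, abs_of_pos ha0]
  refine
    { contP := f.contdeP g
      contQ := f.contdeQ g a₀
      contPx := hcE.mul ((f.contzx.sub g.contzx).sub (f.contdz g))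
      contQx := continuousOn_const.mul (hcE'.mul ((f.contdβ g).add ((f.contvx.sub g.contvx).sub
        (continuousOn_const.mul (f.contdρ g)))))
      contPt := hcE.mul (f.contzt.sub g.contzt)
      contQt := continuousOn_const.mul (hcE'.mul ((f.contvt.sub g.contvt).add
        (continuousOn_const.mul (f.contdJ g))))
      conta := f.contv
      contb := f.contsp
      contax := f.contvx
      contbx := f.contspx
      derivPx := fun x hx t ht => ?_
      derivQx := fun x hx t ht => ?_
      derivPt := fun x hx t ht => ?_
      derivQt := fun x hx t ht => ?_
      derivax := fun x hx t ht => f.hasDerivAt_vx hx (hI ht)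
      derivbx := fun x hx t ht => f.hasDerivAt_spx hx (hI ht)
      le_p := fun x hx t ht => (min_le_left _ _).trans (le_add_of_nonneg_right (hvpos x hx t ht))
      le_q := fun x hx t ht => (min_le_right _ _).trans (hspos x hx t ht)
      ax_le := fun x hx t ht => ?_
      bx_le := fun x hx t ht => ?_
      eqP := fun x hx t ht => ?_
      eqQ := fun x hx t ht => ?_
      left := fun t ht => ?_
      left' := fun t ht => ?_
      b_nonneg := fun t ht => (half_pos hl2).le.trans (hspos 0 ⟨le_rfl, hL⟩ t ht)
      a_nonneg := fun t ht => hvpos p.L ⟨hL, le_rfl⟩ t ht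
      b_le := fun t ht => hb.speed_le _ _ ((nf p.L ⟨hL, le_rfl⟩ t ht).1.trans hκδ)
        ((nf p.L ⟨hL, le_rfl⟩ t ht).2.1.trans hκδ)
      right := fun t ht => abs_eQ_outlet_le hb hκδ hf hg hK hε ha (hI ht) }
  · refine ((dex x).mul ((f.hasDerivAt_zx hx (hI ht)).sub (g.hasDerivAt_zx hx (hI ht)))).congr_deriv
      ?_
    simp only [dz, Pi.sub_apply]
    ring
  · refine (((Real.hasDerivAt_exp x).mul (f.hasDerivAt_dβx g hx (hI ht))).const_mul a₀).congr_deriv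
      ?_
    ring
  · have hx' := Ioo_subset_Icc_self hx
    exact ((f.hasDerivAt_zt hx' ht).sub (g.hasDerivAt_zt hx' ht)).const_mul _
  · exact ((f.hasDerivAt_dβt g hx ht).const_mul _).const_mul _
  · refine ((nf x hx t ht).2.2.2).trans (le_mul_of_one_le_right (hκ ht) ?_)
    have : 0 ≤ G * G := by positivity
    linarith
  · obtain ⟨h1, h2, h3, h4⟩ := nf x hx t ht
    have k0 := hκ ht
    have hy := h1.trans hκδ
    have e1 : |f.ρx x t * deriv p.V (f.ρ x t)| ≤ κ * G := by
      rw [abs_mul]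
      exact mul_le_mul h3 (hb.deriv_le _ hy) (abs_nonneg _) k0
    have e2 : |f.ρ x t * (deriv (deriv p.V) (f.ρ x t) * f.ρx x t)| ≤ G * (G * κ) := by
      rw [abs_mul, abs_mul, abs_of_pos (hb.pos _ hy)]
      exact mul_le_mul (hb.le _ hy) (mul_le_mul (hb.deriv2_le _ hy) h3 (abs_nonneg _) (by linarith))
        (by positivity) (by linarith)
    have e3 := abs_add_three (f.vx x t) (f.ρx x t * deriv p.V (f.ρ x t))
      (f.ρ x t * (deriv (deriv p.V) (f.ρ x t) * f.ρx x t))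
    rw [spx, abs_neg, ← add_assoc]
    refine e3.trans ((?_ : _ ≤ κ * (1 + G + G * G)).trans (mul_le_mul_of_nonneg_left s3 k0))
    linarith
  · have e1 := f.z_equation hx (hI ht)
    have e2 := g.z_equation hx (hI ht)
    have k0 := hκ ht
    -- The coefficients are those of `f`; the difference of the two speeds leaves `dv * g.zx`, and
    -- `g.zx` is of order `κ` because `g` is near the equilibrium in `C¹`.
    have e3 : Real.exp (-x) * (f.zt x t - g.zt x t)
        + f.v x t * (Real.exp (-x) * (f.zx x t - g.zx x t - f.dz g x t))
        + (1 / p.τ + f.v x t) * f.eP g x t = -(Real.exp (-x) * (f.dv g x t * g.zx x t)) := by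
      unfold eP dz dv
      linear_combination Real.exp (-x) * (e1 - e2)
    obtain ⟨h1, h2, h3, h4⟩ := ng x hx t ht
    have e4 : |g.zx x t| ≤ κ * (1 + G) := by
      have e5 : |deriv p.V (g.ρ x t) * g.ρx x t| ≤ G * κ := by
        rw [abs_mul]
        exact mul_le_mul (hb.deriv_le _ (h1.trans hκδ)) h3 (abs_nonneg _) (by linarith)
      refine (abs_sub _ _).trans ?_
      linarith
    have e6 : |f.dv g x t| ≤ K₂ * f.stateSize g a₀ x t :=
      (le_add_of_nonneg_left (abs_nonneg _)).trans
        (abs_add_abs_le_stateSize hb hκδ hf hg ha hx (hI ht))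
    have h0 := stateSize_nonneg f g a₀ x t
    have hx1 : Real.exp (-x) ≤ 1 := Real.exp_le_one_iff.2 (neg_nonpos.2 hx.1)
    rw [e3, abs_neg, abs_mul, abs_mul, Real.abs_exp]
    calc Real.exp (-x) * (|f.dv g x t| * |g.zx x t|)
        ≤ 1 * ((K₂ * f.stateSize g a₀ x t) * (κ * (1 + G))) := by gcongr
      _ = κ * ((1 + G) * K₂) * f.stateSize g a₀ x t := by ring
      _ ≤ κ * sourceConst p G a₀ * f.stateSize g a₀ x t := by gcongr
  · have e1 := f.v_equation hx (hI ht)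
    have e2 := g.v_equation hx (hI ht)
    have k0 := hκ ht
    obtain ⟨h1, h2, h3, h4⟩ := nf x hx t ht
    obtain ⟨h5, h6, h7, h8⟩ := ng x hx t ht
    have key := hb.abs_source_le hκδ h1 h5 h2 h6 h8
    -- The right-hand side is the expression of `abs_source_le`, with `g.vx` in the role of `w`.
    have e3 : a₀ * (Real.exp x * (f.vt x t - g.vt x t + p.gain * deriv p.V p.ρs * f.dJ g x t))
        - f.sp x t * (a₀ * (Real.exp x * (f.dβ g x t
          + (f.vx x t - g.vx x t - p.gain * deriv p.V p.ρs * f.dρ g x t))))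
        + f.sp x t * f.eQ g a₀ x t
        = a₀ * (Real.exp x * (-((f.v x t - p.V (f.ρ x t)) - (g.v x t - p.V (g.ρ x t))) / p.τ
          + (p.speed (f.ρ x t) (f.v x t) - p.speed (g.ρ x t) (g.v x t)) * g.vx x t
          + p.gain * deriv p.V p.ρs * ((f.ρ x t * f.v x t - g.ρ x t * g.v x t)
            + p.speed (f.ρ x t) (f.v x t) * (f.ρ x t - g.ρ x t)))) := by
      unfold eQ dJ dρ
      unfold z sp at e1 e2
      unfold sp
      linear_combination a₀ * Real.exp x * (e1 - e2)
    have e6 : |f.ρ x t - g.ρ x t| + |f.v x t - g.v x t| ≤ K₂ * f.stateSize g a₀ x t :=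
      abs_add_abs_le_stateSize hb hκδ hf hg ha hx (hI ht)
    have h0 := stateSize_nonneg f g a₀ x t
    have hx1 : Real.exp x ≤ Real.exp p.L := Real.exp_le_exp.2 hx.2
    rw [e3, abs_mul, abs_mul, Real.abs_exp, abs_of_pos ha0]
    calc _ ≤ a₀ * (Real.exp p.L * (κ * CE * (K₂ * f.stateSize g a₀ x t))) := by
          gcongr
          exact key.trans (mul_le_mul_of_nonneg_left e6 (by positivity))
      _ = κ * (a₀ * Real.exp p.L * CE * K₂) * f.stateSize g a₀ x t := by ring
      _ ≤ κ * sourceConst p G a₀ * f.stateSize g a₀ x t := by gcongr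
  · obtain ⟨h1, h2⟩ := hin t ht
    rw [h2]
    refine h1.trans (mul_le_mul_of_nonneg_right (le_trans ?_ ha') (abs_nonneg _))
    have : 0 ≤ (1 + G * G * G) * (2 * G / p.lam2) := by positivity
    linarith
  · obtain ⟨h1, h2⟩ := hin t ht
    have h0 : (0 : ℝ) ∈ Icc 0 p.L := ⟨le_rfl, hL⟩
    have hvG := hb.le_v _ ((nf 0 h0 t ht).2.1.trans hκδ)
    have hsp := hspos 0 h0 t ht
    -- The term `2 G / λ₂` bounds the ratio of the two speeds at the inlet, which the second inlet
    -- condition of `DampedPair` compares.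
    have h3 : (1 + G * G * G) * (2 * G / p.lam2) ≤ a₀ := by
      have : 0 ≤ (1 + G * G * G) := by positivity
      linarith
    rw [h2]
    calc f.v 0 t * |f.eP g 0 t| ≤ G * ((1 + G * G * G) * |f.dβ g 0 t|) :=
          mul_le_mul hvG h1 (abs_nonneg _) (by linarith)
      _ = p.lam2 / 2 * (((1 + G * G * G) * (2 * G / p.lam2)) * |f.dβ g 0 t|) := by
          field_simp
      _ ≤ p.lam2 / 2 * (a₀ * |f.dβ g 0 t|) := by gcongr
      _ ≤ _ := mul_le_mul_of_nonneg_right hsp (by positivity)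

end Flow

end ARZModel

/-! ### Attraction between nearby classical solutions -/

namespace ARZModel

variable {p : ARZModel} {Kw Kv : ℝ → ℝ → ℝ} {T : ℝ}

namespace Flow

variable {f g : p.Flow Kw Kv T} {δ G κ ε a₀ M x t : ℝ}

theorem abs_eP_le (hb : p.LocalBounds δ G) (hκδ : κ ≤ δ) (hf : f.Near κ) (hg : g.Near κ)
    (hx : x ∈ Icc 0 p.L) (ht : t ∈ Ico 0 T) :
    |f.eP g x t| ≤ |f.dv g x t| + G * |f.dρ g x t| := by
  rw [eP, abs_mul, Real.abs_exp]
  exact (mul_le_of_le_one_left (abs_nonneg _) (Real.exp_le_one_iff.2 (neg_nonpos.2 hx.1))).trans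
    (abs_dz_le hb hκδ hf hg hx ht)

theorem abs_eQ_le (hb : p.LocalBounds δ G) (hδ : 0 ≤ δ) (ha : 1 ≤ a₀) (f g : p.Flow Kw Kv T)
    (hx : x ∈ Icc 0 p.L) (ht : t ∈ Ico 0 T) :
    |f.eQ g a₀ x t| ≤ a₀ * Real.exp p.L
      * (|f.dv g x t| + |p.gain| * G * ∫ y in (0 : ℝ)..p.L, |f.dρ g y t|) := by
  have hL := p.L_pos.le
  have hG := hb.one_le
  have c1 := (continuousOn_slice (f.contdρ g) ht).abs
  rw [eQ, abs_mul, abs_mul, Real.abs_exp, abs_of_pos (by linarith : 0 < a₀), ← mul_assoc]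
  refine mul_le_mul (mul_le_mul_of_nonneg_left (Real.exp_le_exp.2 hx.2) (by linarith)) ?_
    (abs_nonneg _) (by positivity)
  have h1 := abs_dβ_sub_le hb hδ f g hx t
  have h2 : ∫ y in (0 : ℝ)..x, |f.dρ g y t| ≤ ∫ y in (0 : ℝ)..p.L, |f.dρ g y t| :=
    intervalIntegral.integral_mono_interval le_rfl hx.1 hx.2
      (Filter.Eventually.of_forall fun _ => abs_nonneg _)
      (ContinuousOn.intervalIntegrable_of_Icc hL c1)
  have h3 := mul_le_mul_of_nonneg_left h2 (by positivity : 0 ≤ |p.gain| * G)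
  have h4 := abs_add_le (f.dβ g x t - f.dv g x t) (f.dv g x t)
  rw [sub_add_cancel] at h4
  linarith

/-- Together with `integral_state_sq_le` this makes the `L²` norms in the two sets of coordinates
comparable, so that the decay of the energy with exponent two passes back to the physical variables.
-/
theorem integral_sq_le_state (hb : p.LocalBounds δ G) (hκδ : κ ≤ δ) (hf : f.Near κ)
    (hg : g.Near κ) (ha : 1 ≤ a₀) (ht : t ∈ Ico 0 T) :
    ∫ x in (0 : ℝ)..p.L, (f.eP g x t ^ 2 + f.eQ g a₀ x t ^ 2)
      ≤ (2 * (1 + G ^ 2) + 2 * (a₀ * Real.exp p.L) ^ 2 * (1 + (|p.gain| * G * p.L) ^ 2))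
        * ∫ x in (0 : ℝ)..p.L, (f.dρ g x t ^ 2 + f.dv g x t ^ 2) := by
  have hL := p.L_pos.le
  have hδ : 0 ≤ δ := ((abs_nonneg _).trans (hf 0 ⟨le_rfl, hL⟩ t ht).1).trans hκδ
  have c1 := continuousOn_slice (f.contdρ g) ht
  have c2 := continuousOn_slice (f.contdv g) ht
  have c3 := continuousOn_slice (f.contdeP g) ht
  have c4 := continuousOn_slice (f.contdeQ g a₀) ht
  have i1 : IntervalIntegrable (fun x => f.dρ g x t ^ 2) volume 0 p.L :=
    ContinuousOn.intervalIntegrable_of_Icc hL (by fun_prop)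
  have i2 : IntervalIntegrable (fun x => f.dv g x t ^ 2) volume 0 p.L :=
    ContinuousOn.intervalIntegrable_of_Icc hL (by fun_prop)
  set J := ∫ y in (0 : ℝ)..p.L, |f.dρ g y t|
  set A := a₀ * Real.exp p.L
  set Γ := |p.gain| * G
  have hJ : J ^ 2 ≤ (p.L - 0) * ∫ x in (0 : ℝ)..p.L, f.dρ g x t ^ 2 :=
    sq_integral_abs_le hL (memLp_of_continuousOn c1)
  have h1 : ∫ x in (0 : ℝ)..p.L, (f.eP g x t ^ 2 + f.eQ g a₀ x t ^ 2)
      ≤ ∫ x in (0 : ℝ)..p.L, (((2 * (1 + G ^ 2) + 2 * A ^ 2)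
        * (f.dρ g x t ^ 2 + f.dv g x t ^ 2)) + 2 * A ^ 2 * (Γ * J) ^ 2) := by
    refine intervalIntegral.integral_mono_on hL
      (ContinuousOn.intervalIntegrable_of_Icc hL (by fun_prop))
      (ContinuousOn.intervalIntegrable_of_Icc hL (by fun_prop)) fun y hy => ?_
    have e1 := abs_eP_le hb hκδ hf hg hy ht
    have e2 := abs_eQ_le hb hδ ha f g hy ht
    have e3 := pow_le_pow_left₀ (abs_nonneg _) e1 2
    have e4 := pow_le_pow_left₀ (abs_nonneg _) e2 2
    rw [sq_abs] at e3 e4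
    have e5 := add_sq_le (a := |f.dv g y t|) (b := G * |f.dρ g y t|)
    have e6 := mul_le_mul_of_nonneg_left (add_sq_le (a := |f.dv g y t|) (b := Γ * J)) (sq_nonneg A)
    rw [mul_pow, sq_abs, sq_abs] at e5
    rw [sq_abs] at e6
    rw [mul_pow] at e4
    have e7 : 0 ≤ f.dρ g y t ^ 2 := sq_nonneg _
    have e8 : 0 ≤ G ^ 2 * f.dv g y t ^ 2 := by positivity
    have e9 : 0 ≤ A ^ 2 * f.dρ g y t ^ 2 := by positivity
    linarith
  refine h1.trans ?_
  rw [intervalIntegral.integral_add ((i1.add i2).const_mul _) intervalIntegrable_const,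
    intervalIntegral.integral_const_mul, intervalIntegral.integral_const, smul_eq_mul, sub_zero,
    intervalIntegral.integral_add i1 i2]
  rw [sub_zero] at hJ
  have h2 := mul_le_mul_of_nonneg_left hJ (by positivity : 0 ≤ p.L * (2 * A ^ 2 * Γ ^ 2))
  have h3 : 0 ≤ ∫ x in (0 : ℝ)..p.L, f.dv g x t ^ 2 :=
    intervalIntegral.integral_nonneg hL fun _ _ => sq_nonneg _
  have h4 := mul_nonneg (by positivity : 0 ≤ 2 * A ^ 2 * (Γ * p.L) ^ 2) h3
  linarith

theorem integral_state_sq_le (hb : p.LocalBounds δ G) (hκδ : κ ≤ δ) (hf : f.Near κ)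
    (hg : g.Near κ) (ha : 1 ≤ a₀) (ht : t ∈ Ico 0 T) :
    ∫ x in (0 : ℝ)..p.L, (f.dρ g x t ^ 2 + f.dv g x t ^ 2)
      ≤ (recoverConst p G * Real.exp p.L) ^ 2 * (4 + 4 * p.L ^ 2)
        * ∫ x in (0 : ℝ)..p.L, (f.eP g x t ^ 2 + f.eQ g a₀ x t ^ 2) := by
  have hL := p.L_pos.le
  have c1 := continuousOn_slice (f.contdρ g) ht
  have c2 := continuousOn_slice (f.contdv g) ht
  have c3 := continuousOn_slice (f.contdeP g) ht
  have c4 := continuousOn_slice (f.contdeQ g a₀) ht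
  have i1 : IntervalIntegrable (fun x => f.eP g x t ^ 2) volume 0 p.L :=
    ContinuousOn.intervalIntegrable_of_Icc hL (by fun_prop)
  have i2 : IntervalIntegrable (fun x => f.eQ g a₀ x t ^ 2) volume 0 p.L :=
    ContinuousOn.intervalIntegrable_of_Icc hL (by fun_prop)
  set R := recoverConst p G * Real.exp p.L
  set J := ∫ y in (0 : ℝ)..p.L, (|f.eP g y t| + |f.eQ g a₀ y t|) with hJdef
  have c5 : ContinuousOn (fun y => |f.eP g y t| + |f.eQ g a₀ y t|) (Icc 0 p.L) := by fun_prop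
  have sq2 : ∀ y, (|f.eP g y t| + |f.eQ g a₀ y t|) ^ 2
      ≤ 2 * (f.eP g y t ^ 2 + f.eQ g a₀ y t ^ 2) := fun y => by
    have := add_sq_le (a := |f.eP g y t|) (b := |f.eQ g a₀ y t|)
    rwa [sq_abs, sq_abs] at this
  set W := ∫ x in (0 : ℝ)..p.L, (f.eP g x t ^ 2 + f.eQ g a₀ x t ^ 2)
  have hJ : J ^ 2 ≤ 2 * p.L * W := by
    have h1 := sq_integral_abs_le hL (memLp_of_continuousOn c5)
    have h2 : ∫ x in (0 : ℝ)..p.L, |(|f.eP g x t| + |f.eQ g a₀ x t|)| = J :=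
      intervalIntegral.integral_congr fun x _ => abs_of_nonneg (by positivity)
    have h3 : ∫ x in (0 : ℝ)..p.L, (|f.eP g x t| + |f.eQ g a₀ x t|) ^ 2
        ≤ ∫ x in (0 : ℝ)..p.L, 2 * (f.eP g x t ^ 2 + f.eQ g a₀ x t ^ 2) :=
      intervalIntegral.integral_mono_on hL
        (ContinuousOn.intervalIntegrable_of_Icc hL (by fun_prop))
        (ContinuousOn.intervalIntegrable_of_Icc hL (by fun_prop)) fun y _ => sq2 y
    rw [intervalIntegral.integral_const_mul] at h3
    rw [h2, sub_zero] at h1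
    have h4 := mul_le_mul_of_nonneg_left h3 hL
    linarith
  have h1 : ∫ x in (0 : ℝ)..p.L, (f.dρ g x t ^ 2 + f.dv g x t ^ 2)
      ≤ ∫ x in (0 : ℝ)..p.L, (R ^ 2 * 4 * (f.eP g x t ^ 2 + f.eQ g a₀ x t ^ 2)
        + R ^ 2 * 2 * J ^ 2) := by
    refine intervalIntegral.integral_mono_on hL
      (ContinuousOn.intervalIntegrable_of_Icc hL (by fun_prop))
      (ContinuousOn.intervalIntegrable_of_Icc hL (by fun_prop)) fun y hy => ?_
    have e1 := pow_le_pow_left₀ (by positivity)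
      (abs_add_abs_le_stateSize hb hκδ hf hg ha hy ht) 2
    have e2 : f.dρ g y t ^ 2 + f.dv g y t ^ 2 ≤ (|f.dρ g y t| + |f.dv g y t|) ^ 2 := by
      have : 0 ≤ 2 * |f.dρ g y t| * |f.dv g y t| := by positivity
      rw [add_sq, sq_abs, sq_abs]
      linarith
    have e3 : f.stateSize g a₀ y t ^ 2
        ≤ 4 * (f.eP g y t ^ 2 + f.eQ g a₀ y t ^ 2) + 2 * J ^ 2 := by
      have e4 := add_sq_le (a := |f.eP g y t| + |f.eQ g a₀ y t|) (b := J)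
      have e5 := sq2 y
      unfold stateSize
      rw [← hJdef]
      linarith
    rw [mul_pow] at e1
    have e6 := mul_le_mul_of_nonneg_left e3 (sq_nonneg R)
    linarith
  refine h1.trans ?_
  rw [intervalIntegral.integral_add ((i1.add i2).const_mul _) intervalIntegrable_const,
    intervalIntegral.integral_const_mul, intervalIntegral.integral_const, smul_eq_mul, sub_zero]
  have h2 := mul_le_mul_of_nonneg_left hJ (by positivity : 0 ≤ p.L * (2 * R ^ 2))
  have h3 : p.L * (R ^ 2 * 2 * J ^ 2) = p.L * (2 * R ^ 2) * J ^ 2 := by ring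
  have h4 : p.L * (2 * R ^ 2) * (2 * p.L * W) = R ^ 2 * (4 * p.L ^ 2) * W := by ring
  have h5 : R ^ 2 * (4 + 4 * p.L ^ 2) * W = R ^ 2 * 4 * W + R ^ 2 * (4 * p.L ^ 2) * W := by ring
  linarith

end Flow

/-- Nearby solutions of the closed loop attract each other exponentially, in the sup norm and in
the `L²` norm, with constants that only depend on the model. -/
structure Attraction (p : ARZModel) (κ ε₁ C σ : ℝ) : Prop where
  sup : ∀ {Kw Kv : ℝ → ℝ → ℝ} {M ε T N : ℝ}, p.BoundedKernels Kw Kv M → p.GainsClose ε Kw Kv →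
    ε ≤ ε₁ → ∀ {f g : p.Flow Kw Kv T}, f.Near κ → g.Near κ →
    (∀ x ∈ Icc 0 p.L, |f.dρ g x 0| ≤ N ∧ |f.dv g x 0| ≤ N) → ∀ t ∈ Ico 0 T, ∀ x ∈ Icc 0 p.L,
      |f.dρ g x t| ≤ C * Real.exp (-σ * t) * N ∧ |f.dv g x t| ≤ C * Real.exp (-σ * t) * N
  l2 : ∀ {Kw Kv : ℝ → ℝ → ℝ} {M ε T : ℝ}, p.BoundedKernels Kw Kv M → p.GainsClose ε Kw Kv →
    ε ≤ ε₁ → ∀ {f g : p.Flow Kw Kv T}, f.Near κ → g.Near κ → ∀ t ∈ Ico 0 T,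
      ∫ x in (0 : ℝ)..p.L, (f.dρ g x t ^ 2 + f.dv g x t ^ 2)
        ≤ C * Real.exp (-σ * t) * ∫ x in (0 : ℝ)..p.L, (f.dρ g x 0 ^ 2 + f.dv g x 0 ^ 2)

/-- All constants of `dampedPair` depend on the model and on `G` only. Hence `κ` and `ε₁` can be
fixed before kernels and solutions are given, so that the smallness conditions of the energy
estimate hold. -/
theorem exists_attraction {δ G : ℝ} (hδ : 0 < δ) (hb : p.LocalBounds δ G) :
    ∃ κ > 0, κ ≤ δ ∧ ∃ ε₁ > 0, ∃ C > 0, ∃ σ > 0, p.Attraction κ ε₁ C σ := by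
  have hG := hb.one_le
  have hL := p.L_pos
  have hτ := p.τ_pos
  have hl2 := p.lam2_pos
  obtain ⟨a₀, ha, ha'⟩ : ∃ a₀ : ℝ, 1 ≤ a₀ ∧ (1 + G * G * G) * (1 + 2 * G / p.lam2) ≤ a₀ :=
    ⟨_, le_max_left _ _, le_max_right _ _⟩
  have hR := Flow.recoverConst_nonneg (p := p) hG
  have hS : 0 < Flow.sourceConst p G a₀ := by
    unfold Flow.sourceConst
    positivity
  have hO : 0 ≤ Flow.outletConst p G a₀ := by
    unfold Flow.outletConst
    positivity
  set S := Flow.sourceConst p G a₀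
  set O := Flow.outletConst p G a₀
  set s := min (1 / p.τ) (p.lam2 / 2)
  have hs : 0 < s := lt_min (by positivity) (by positivity)
  set R := Flow.recoverConst p G * Real.exp p.L with hRdef
  set C₁ := (1 + G) + a₀ * Real.exp p.L * (1 + |p.gain| * G * p.L) with hC₁
  set C₂ := 2 * (1 + G ^ 2) + 2 * (a₀ * Real.exp p.L) ^ 2 * (1 + (|p.gain| * G * p.L) ^ 2) with hC₂
  set C₃ := R ^ 2 * (4 + 4 * p.L ^ 2) with hC₃
  have hRnn : 0 ≤ R := by positivity
  have hC₁0 : 0 ≤ C₁ := by positivity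
  have hC₂0 : 0 ≤ C₂ := by positivity
  have hC₃0 : 0 ≤ C₃ := by positivity
  -- The admissible loss `s / 2` is shared equally: `s / 4` for the sources of order `κ` and `s / 4`
  -- for the outlet error of order `ε`. In `ε₁` the summands `+ 1` keep the denominators positive,
  -- and the second bound ensures `2 L θ ≤ 1`.
  set κ := min δ (s / 4 / (S * (4 + 4 * p.L))) with hκdef
  set ε₁ := min (s / 4 / (G * O + 1)) (1 / (2 * p.L * O + 1)) with hε₁
  have hκ : 0 < κ := lt_min hδ (by positivity)
  have hκS : κ * S * (4 + 4 * p.L) ≤ s / 4 := by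
    have h1 : κ ≤ s / 4 / (S * (4 + 4 * p.L)) := min_le_right _ _
    rw [le_div_iff₀ (by positivity)] at h1
    linarith
  have hε₁0 : 0 < ε₁ := lt_min (by positivity) (by positivity)
  have hεG : G * (ε₁ * O) ≤ s / 4 := by
    have h1 : ε₁ ≤ s / 4 / (G * O + 1) := min_le_left _ _
    rw [le_div_iff₀ (by positivity)] at h1
    linarith
  have hεL : 2 * p.L * (ε₁ * O) ≤ 1 := by
    have h1 : ε₁ ≤ 1 / (2 * p.L * O + 1) := min_le_right _ _
    rw [le_div_iff₀ (by positivity)] at h1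
    linarith
  have hGε : ∀ {ε}, ε ≤ ε₁ → κ * S * (4 + 4 * p.L) + G * (ε * O) ≤ s / 2 := fun h => by
    have : G * (_ * O) ≤ G * (ε₁ * O) :=
      mul_le_mul_of_nonneg_left (mul_le_mul_of_nonneg_right h hO) (by linarith)
    linarith
  have hLε : ∀ {ε}, ε ≤ ε₁ → 2 * p.L * (ε * O) ≤ 1 := fun h =>
    (mul_le_mul_of_nonneg_left (mul_le_mul_of_nonneg_right h hO) (by positivity)).trans hεL
  refine ⟨κ, hκ, min_le_left _ _, ε₁, hε₁0, R * (2 + 2 * p.L) * C₁ + C₃ * C₂ + 1, by positivity,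
    s / 2, half_pos hs, ?_, ?_⟩
  · intro Kw Kv M ε T N hK hε hεε f g hf hg hN t ht x hx
    have h0 : (0 : ℝ) ∈ Ico 0 T := ⟨le_rfl, ht.1.trans_lt ht.2⟩
    have hε0 : 0 ≤ ε := (abs_nonneg _).trans (hε 0 ⟨le_rfl, hL.le⟩).1
    have hN0 : 0 ≤ N := (abs_nonneg _).trans (hN x hx).1
    have hd := Flow.dampedPair hb (min_le_left _ _) hf hg hK hε ha ha'
    have hP : ∀ y ∈ Icc 0 p.L, |f.eP g y 0| ≤ C₁ * N := fun y hy => by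
      have h1 := Flow.abs_eP_le hb (min_le_left _ _) hf hg hy h0
      have h2 := mul_le_mul_of_nonneg_left (hN y hy).1 (by linarith : 0 ≤ G)
      have h3 : 0 ≤ a₀ * Real.exp p.L * (1 + |p.gain| * G * p.L) * N := by positivity
      rw [hC₁, add_mul]
      linarith [(hN y hy).2]
    have hQ : ∀ y ∈ Icc 0 p.L, |f.eQ g a₀ y 0| ≤ C₁ * N := fun y hy => by
      have h1 := Flow.abs_eQ_le hb hδ.le ha f g hy h0
      have c1 := (continuousOn_slice (f.contdρ g) h0).abs
      have h2 : ∫ y in (0 : ℝ)..p.L, |f.dρ g y 0| ≤ ∫ y in (0 : ℝ)..p.L, N :=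
        intervalIntegral.integral_mono_on hL.le (ContinuousOn.intervalIntegrable_of_Icc hL.le c1)
          intervalIntegrable_const fun z hz => (hN z hz).1
      rw [intervalIntegral.integral_const, smul_eq_mul, sub_zero] at h2
      have h3 : 0 ≤ (1 + G) * N := by positivity
      have h4 : a₀ * Real.exp p.L * (|f.dv g y 0| + |p.gain| * G * ∫ y in (0 : ℝ)..p.L, |f.dρ g y 0|)
          ≤ a₀ * Real.exp p.L * (N + |p.gain| * G * (p.L * N)) := by
        have := (hN y hy).2
        gcongr
      have h5 : a₀ * Real.exp p.L * (N + |p.gain| * G * (p.L * N))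
          = a₀ * Real.exp p.L * (1 + |p.gain| * G * p.L) * N := by ring
      rw [hC₁, add_mul]
      linarith
    have key := fun {y} (hy : y ∈ Icc 0 p.L) => hd.abs_le hL (by positivity) (by positivity)
      (by linarith) (hLε hεε) (hGε hεε) hP hQ ht hy
    have h1 := Flow.abs_add_abs_le_stateSize hb (min_le_left _ _) hf hg ha hx ht
    set e := Real.exp (-(s / 2) * t)
    have he : 0 < e := Real.exp_pos _
    have h2 : f.stateSize g a₀ x t ≤ (2 + 2 * p.L) * (e * (C₁ * N)) := by
      have c3 := continuousOn_slice (f.contdeP g) ht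
      have c4 := continuousOn_slice (f.contdeQ g a₀) ht
      have h3 : ∫ y in (0 : ℝ)..p.L, (|f.eP g y t| + |f.eQ g a₀ y t|)
          ≤ ∫ y in (0 : ℝ)..p.L, (2 * (e * (C₁ * N))) :=
        intervalIntegral.integral_mono_on hL.le
          (ContinuousOn.intervalIntegrable_of_Icc hL.le (by fun_prop)) intervalIntegrable_const
          fun z hz => by linarith [(key hz).1, (key hz).2]
      rw [intervalIntegral.integral_const, smul_eq_mul, sub_zero] at h3
      unfold Flow.stateSize
      linarith [(key hx).1, (key hx).2]
    have h3 : |f.dρ g x t| + |f.dv g x t|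
        ≤ (R * (2 + 2 * p.L) * C₁ + C₃ * C₂ + 1) * e * N := by
      have h4 := mul_le_mul_of_nonneg_left h2 hRnn
      have h5 : 0 ≤ (C₃ * C₂ + 1) * (e * N) := by positivity
      have h6 : (R * (2 + 2 * p.L) * C₁ + C₃ * C₂ + 1) * e * N
          = R * ((2 + 2 * p.L) * (e * (C₁ * N))) + (C₃ * C₂ + 1) * (e * N) := by ring
      rw [h6]
      linarith
    constructor <;> linarith [abs_nonneg (f.dρ g x t), abs_nonneg (f.dv g x t)]
  · intro Kw Kv M ε T hK hε hεε f g hf hg t ht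
    have h0 : (0 : ℝ) ∈ Ico 0 T := ⟨le_rfl, ht.1.trans_lt ht.2⟩
    have hε0 : 0 ≤ ε := (abs_nonneg _).trans (hε 0 ⟨le_rfl, hL.le⟩).1
    have hd := Flow.dampedPair hb (min_le_left _ _) hf hg hK hε ha ha'
    -- The exponent two, `k = 0`, suffices for the `L²` estimate.
    have h1 := hd.integral_pow_le hL (by positivity) (by positivity)
      (by linarith) (hLε hεε) (hGε hεε) 0 ht
    have h2 := Flow.integral_sq_le_state hb (min_le_left _ _) hf hg ha h0
    have h3 := Flow.integral_state_sq_le hb (min_le_left _ _) hf hg ha ht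
    simp only [Nat.cast_zero, mul_zero, zero_add] at h1
    set e := Real.exp (-(s / 2) * t)
    have he : Real.exp (-(2 * (s / 2)) * t) ≤ e := Real.exp_le_exp.2 (by
      have := mul_nonneg hs.le ht.1
      linarith)
    set W := ∫ x in (0 : ℝ)..p.L, (f.eP g x 0 ^ 2 + f.eQ g a₀ x 0 ^ 2)
    set I := ∫ x in (0 : ℝ)..p.L, (f.dρ g x 0 ^ 2 + f.dv g x 0 ^ 2)
    have hW : 0 ≤ W := intervalIntegral.integral_nonneg hL.le fun _ _ => by positivity
    have hI : 0 ≤ I := intervalIntegral.integral_nonneg hL.le fun _ _ => by positivity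
    have he0 : 0 < e := Real.exp_pos _
    have h4 : Real.exp (-(2 * (s / 2)) * t) * W ≤ e * (C₂ * I) := mul_le_mul he h2 hW he0.le
    have h5 := mul_le_mul_of_nonneg_left (h1.trans h4) hC₃0
    have h6 : 0 ≤ (R * (2 + 2 * p.L) * C₁ + 1) * (e * I) := by positivity
    have h7 : (R * (2 + 2 * p.L) * C₁ + C₃ * C₂ + 1) * e * I
        = C₃ * (e * (C₂ * I)) + (R * (2 + 2 * p.L) * C₁ + 1) * (e * I) := by ring
    rw [h7]
    linarith

end ARZModel

/-! ### Decay in `C¹` and continuation -/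

-- The tube lemma: a strict bound on a compact slice persists on neighbouring slices.
open Filter Topology in
theorem eventually_forall_Icc_lt {F : ℝ → ℝ → ℝ} {L T N t₀ : ℝ}
    (hF : ContinuousOn (Function.uncurry F) (Icc 0 L ×ˢ Ico 0 T)) (ht : t₀ ∈ Ico 0 T)
    (h : ∀ x ∈ Icc 0 L, F x t₀ < N) :
    ∀ᶠ s in 𝓝 t₀, s ∈ Ico 0 T → ∀ x ∈ Icc 0 L, F x s < N := by
  have h1 := (isCompact_Icc (a := (0 : ℝ)) (b := L)).eventually_forall_of_forall_eventually
    (x₀ := t₀) (P := fun s x => x ∈ Icc 0 L → s ∈ Ico 0 T → F x s < N) fun x hx => by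
      have h2 := eventually_nhdsWithin_iff.1 ((hF (x, t₀) ⟨hx, ht⟩).eventually_lt
        continuousWithinAt_const (h x hx))
      have h3 : Tendsto (fun z : ℝ × ℝ => (z.2, z.1)) (𝓝 (t₀, x)) (𝓝 (x, t₀)) :=
        continuous_swap.tendsto (t₀, x)
      exact (h3.eventually h2).mono fun z hz hx hs => hz ⟨hx, hs⟩
  exact h1.mono fun s hs hsT x hx => hs x hx hx hsT

open Filter Topology in
/-- A bound on small forward increments bounds the derivative. -/
theorem abs_le_of_abs_increment_le {u : ℝ → ℝ} {u' t T h₀ B : ℝ} (ht : t ∈ Ico 0 T)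
    (hu : HasDerivWithinAt u u' (Ico 0 T) t) (hh₀ : 0 < h₀)
    (h : ∀ h, 0 < h → h < h₀ → t + h < T → |u (t + h) - u t| ≤ B * h) : |u'| ≤ B := by
  have h1 : HasDerivWithinAt u u' (Ioo t (min T (t + h₀))) t := hu.mono fun s hs =>
    ⟨ht.1.trans hs.1.le, hs.2.trans_le (min_le_left _ _)⟩
  have hlt : t < min T (t + h₀) := lt_min ht.2 (by linarith)
  have h2 := ((hasDerivWithinAt_iff_tendsto_slope' (fun h => lt_irrefl _ h.1)).1 h1).abs
  rw [nhdsWithin_Ioo_eq_nhdsGT hlt] at h2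
  refine le_of_tendsto h2 ?_
  filter_upwards [Ioo_mem_nhdsGT hlt] with s hs
  have hs0 : 0 < s - t := sub_pos.2 hs.1
  have h3 := h (s - t) hs0 (by linarith [hs.2.trans_le (min_le_right T (t + h₀))])
    (by linarith [hs.2.trans_le (min_le_left T (t + h₀))])
  rw [add_sub_cancel] at h3
  rw [slope_def_field, abs_div, abs_of_pos hs0, div_le_iff₀ hs0]
  exact h3

namespace ARZModel

variable {p : ARZModel} {Kw Kv : ℝ → ℝ → ℝ} {T : ℝ}

namespace Flow

variable {f : p.Flow Kw Kv T} {δ G κ ε ε₁ C σ M N d x t : ℝ}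

/-- The time derivatives of a solution decay. -/
theorem abs_time_deriv_le (hA : p.Attraction κ ε₁ C σ) (hC : 0 < C) (hK : p.BoundedKernels Kw Kv M)
    (hε : p.GainsClose ε Kw Kv) (hεε : ε ≤ ε₁) (hf : f.Near κ)
    (hN : ∀ x ∈ Icc 0 p.L, |f.ρt x 0| ≤ N ∧ |f.vt x 0| ≤ N) (ht : t ∈ Ico 0 T)
    (hx : x ∈ Icc 0 p.L) :
    |f.ρt x t| ≤ C * Real.exp (-σ * t) * N ∧ |f.vt x t| ≤ C * Real.exp (-σ * t) * N := by
  have h0 : (0 : ℝ) ∈ Ico 0 T := ⟨le_rfl, ht.1.trans_lt ht.2⟩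
  set c := C * Real.exp (-σ * t) with hc
  have hc0 : 0 < c := mul_pos hC (Real.exp_pos _)
  -- A bound on the time derivatives at time zero extends to short times only with a slightly larger
  -- constant `N'`, by continuity.
  suffices key : ∀ N', N < N' → |f.ρt x t| ≤ c * N' ∧ |f.vt x t| ≤ c * N' by
    have e : ∀ η > 0, c * N + η = c * (N + η / c) := fun η _ => by field_simp
    constructor
    · refine le_of_forall_pos_le_add fun η hη => ?_
      rw [e η hη]
      exact (key _ (lt_add_of_pos_right _ (div_pos hη hc0))).1
    · refine le_of_forall_pos_le_add fun η hη => ?_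
      rw [e η hη]
      exact (key _ (lt_add_of_pos_right _ (div_pos hη hc0))).2
  intro N' hN'
  have e1 := eventually_forall_Icc_lt (F := fun x t => |f.ρt x t|) f.contρt.abs h0
    fun x hx => (hN x hx).1.trans_lt hN'
  have e2 := eventually_forall_Icc_lt (F := fun x t => |f.vt x t|) f.contvt.abs h0
    fun x hx => (hN x hx).2.trans_lt hN'
  obtain ⟨h₀, hh₀, hball⟩ := Metric.eventually_nhds_iff.1 (e1.and e2)
  have inc : ∀ h, 0 < h → h < h₀ → t + h < T →
      |f.ρ x (t + h) - f.ρ x t| ≤ c * N' * h ∧ |f.v x (t + h) - f.v x t| ≤ c * N' * h := by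
    intro h hh hlt hT
    have hsub : Icc 0 h ⊆ Ico 0 T := fun s hs => ⟨hs.1, by linarith [hs.2, ht.1]⟩
    have hb : ∀ s ∈ Icc 0 h, ∀ y ∈ Icc 0 p.L, |f.ρt y s| ≤ N' ∧ |f.vt y s| ≤ N' := by
      intro s hs y hy
      have hd : dist s 0 < h₀ := by
        rw [Real.dist_0_eq_abs, abs_of_nonneg hs.1]
        exact hs.2.trans_lt hlt
      exact ⟨((hball hd).1 (hsub hs) y hy).le, ((hball hd).2 (hsub hs) y hy).le⟩
    have hhI : h ∈ Icc 0 h := ⟨hh.le, le_rfl⟩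
    have h0I : (0 : ℝ) ∈ Icc 0 h := ⟨le_rfl, hh.le⟩
    have hinit : ∀ y ∈ Icc 0 p.L, |f.ρ y (0 + h) - f.ρ y 0| ≤ N' * h ∧
        |f.v y (0 + h) - f.v y 0| ≤ N' * h := by
      intro y hy
      have m1 := (convex_Icc (0 : ℝ) h).norm_image_sub_le_of_norm_hasDerivWithin_le
        (fun s hs => (f.derivρt y hy s (hsub hs)).mono hsub) (fun s hs => (hb s hs y hy).1) h0I hhI
      have m2 := (convex_Icc (0 : ℝ) h).norm_image_sub_le_of_norm_hasDerivWithin_le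
        (fun s hs => (f.derivvt y hy s (hsub hs)).mono hsub) (fun s hs => (hb s hs y hy).2) h0I hhI
      rw [Real.norm_eq_abs, Real.norm_eq_abs, sub_zero, abs_of_pos hh] at m1 m2
      rw [zero_add]
      exact ⟨m1, m2⟩
    -- The solution is compared with its own shift by `h`. Initially they differ by at most `N' h`;
    -- dividing by `h` and letting `h → 0` bounds the time derivatives, and no second derivatives
    -- are needed.
    have key := hA.sup hK hε hεε (f := f.shift hh.le) (g := f.restrict (by linarith : T - h ≤ T))
      (fun y hy s hs => hf y hy (s + h) ⟨by linarith [hs.1], by linarith [hs.2]⟩)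
      (fun y hy s hs => hf y hy s ⟨hs.1, by linarith [hs.2]⟩) hinit t ⟨ht.1, by linarith⟩ x hx
    rw [mul_assoc c]
    exact key
  exact ⟨abs_le_of_abs_increment_le ht (f.derivρt x hx t ht) hh₀ fun h a b c => (inc h a b c).1,
    abs_le_of_abs_increment_le ht (f.derivvt x hx t ht) hh₀ fun h a b c => (inc h a b c).2⟩

/-- The `C¹` deviation of the profile at time `t` from the equilibrium is at most `d`. -/
def DeviationLE (f : p.Flow Kw Kv T) (t d : ℝ) : Prop :=
  ∀ x ∈ Icc 0 p.L,
    |f.ρ x t - p.ρs| ≤ d ∧ |f.v x t - p.vs| ≤ d ∧ |f.ρx x t| ≤ d ∧ |f.vx x t| ≤ d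

theorem c1DeviationLE_iff (f : p.Flow Kw Kv T) (ht : t ∈ Ico 0 T) (d : ℝ) :
    p.C1DeviationLE (fun x => f.ρ x t) (fun x => f.v x t) d ↔ f.DeviationLE t d := by
  refine forall₂_congr fun x hx => ?_
  have hu := uniqueDiffOn_Icc p.L_pos x hx
  rw [(f.derivρx x hx t ht).derivWithin hu, (f.derivvx x hx t ht).derivWithin hu]

theorem abs_z_le (hb : p.LocalBounds δ G) (hρ : |f.ρ x t - p.ρs| ≤ N) (hv : |f.v x t - p.vs| ≤ N)
    (hN : |f.ρ x t - p.ρs| ≤ δ) : |f.z x t| ≤ (1 + G) * N := by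
  have hδ : 0 ≤ δ := (abs_nonneg _).trans hN
  have h1 := hb.abs_V_sub_le hN (by simpa using hδ : |p.ρs - p.ρs| ≤ δ)
  have e : f.z x t = (f.v x t - p.vs) - (p.V (f.ρ x t) - p.V p.ρs) := by
    unfold z vs
    ring
  rw [e]
  have h2 := mul_le_mul_of_nonneg_left hρ (by linarith [hb.one_le] : 0 ≤ G)
  linarith [abs_sub (f.v x t - p.vs) (p.V (f.ρ x t) - p.V p.ρs)]

/-- The constant that bounds the time derivatives by the `C¹` deviation. -/
noncomputable def timeConst (p : ARZModel) (G : ℝ) : ℝ := 2 * G + ((1 + G) / p.τ + G)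

theorem abs_time_deriv_le_of_deviationLE (hb : p.LocalBounds δ G) (hd : f.DeviationLE t d)
    (hdδ : d ≤ δ) (ht : t ∈ Ico 0 T) (hx : x ∈ Icc 0 p.L) :
    |f.ρt x t| ≤ timeConst p G * d ∧ |f.vt x t| ≤ timeConst p G * d := by
  obtain ⟨h1, h2, h3, h4⟩ := hd x hx
  have hG := hb.one_le
  have hτ := p.τ_pos
  have hd0 : 0 ≤ d := (abs_nonneg _).trans h1
  have hv := hb.le_v _ (h2.trans hdδ)
  have hv0 : 0 < f.v x t :=
    (inv_pos.2 (by linarith : 0 < G)).trans_le (hb.inv_le _ (h2.trans hdδ))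
  have hρ := hb.le _ (h1.trans hdδ)
  have hρ0 := hb.pos _ (h1.trans hdδ)
  have hs := hb.speed_le _ _ (h1.trans hdδ) (h2.trans hdδ)
  have hs0 := (half_pos p.lam2_pos).trans_le (hb.le_speed _ _ (h1.trans hdδ) (h2.trans hdδ))
  have hz := abs_z_le hb h1 h2 (h1.trans hdδ)
  have e1 : f.ρt x t = -(f.ρx x t * f.v x t + f.ρ x t * f.vx x t) := by
    linear_combination f.mass x hx t ht
  have e2 := f.v_equation hx ht
  have n1 : 0 ≤ ((1 + G) / p.τ + G) * d := by positivity
  have n2 : 0 ≤ 2 * G * d := by positivity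
  unfold timeConst
  rw [add_mul]
  constructor
  · have b1 : |f.ρx x t * f.v x t| ≤ d * G := by
      rw [abs_mul, abs_of_pos hv0]
      exact mul_le_mul h3 hv hv0.le hd0
    have b2 : |f.ρ x t * f.vx x t| ≤ G * d := by
      rw [abs_mul, abs_of_pos hρ0]
      exact mul_le_mul hρ h4 (abs_nonneg _) (by linarith)
    rw [e1, abs_neg]
    linarith [abs_add_le (f.ρx x t * f.v x t) (f.ρ x t * f.vx x t)]
  · have b1 : |-(f.z x t) / p.τ| ≤ (1 + G) / p.τ * d := by
      rw [abs_div, abs_neg, abs_of_pos hτ, div_mul_eq_mul_div]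
      exact div_le_div_of_nonneg_right hz hτ.le
    have b2 : |f.sp x t * f.vx x t| ≤ G * d := by
      rw [abs_mul, sp, abs_of_pos hs0]
      exact mul_le_mul hs h4 (abs_nonneg _) (by linarith)
    rw [e2]
    linarith [abs_add_le (-(f.z x t) / p.τ) (f.sp x t * f.vx x t)]

/-- The constants that bound the space derivatives. -/
noncomputable def spaceConst (p : ARZModel) (G : ℝ) : ℝ :=
  2 / p.lam2 * (timeConst p G + (1 + G) / p.τ)

/-- Both characteristic speeds are bounded away from zero, so the velocity equation can be solved
for `vx`, and then the mass equation for `ρx`. -/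
theorem abs_space_deriv_le (hb : p.LocalBounds δ G) (hδρ : |f.ρ x t - p.ρs| ≤ δ)
    (hδv : |f.v x t - p.vs| ≤ δ) (hρ : |f.ρ x t - p.ρs| ≤ d) (hv : |f.v x t - p.vs| ≤ d)
    (hρt : |f.ρt x t| ≤ timeConst p G * d) (hvt : |f.vt x t| ≤ timeConst p G * d)
    (ht : t ∈ Ico 0 T) (hx : x ∈ Icc 0 p.L) :
    |f.vx x t| ≤ spaceConst p G * d ∧
      |f.ρx x t| ≤ G * (timeConst p G + G * spaceConst p G) * d := by
  have hG := hb.one_le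
  have hτ := p.τ_pos
  have hl := p.lam2_pos
  have hvi := hb.inv_le _ hδv
  have hv0 : 0 < f.v x t := (inv_pos.2 (by linarith : 0 < G)).trans_le hvi
  have hρG := hb.le _ hδρ
  have hρ0 := hb.pos _ hδρ
  have hs := hb.le_speed _ _ hδρ hδv
  have hs0 := (half_pos hl).trans_le hs
  have hz := abs_z_le hb hρ hv hδρ
  have e2 := f.v_equation hx ht
  have b1 : |f.vx x t| ≤ spaceConst p G * d := by
    have e3 : f.sp x t * f.vx x t = f.vt x t + f.z x t / p.τ := by
      rw [e2]
      ring
    have b2 : |f.z x t / p.τ| ≤ (1 + G) / p.τ * d := by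
      rw [abs_div, abs_of_pos hτ, div_mul_eq_mul_div]
      exact div_le_div_of_nonneg_right hz hτ.le
    have b3 : p.lam2 / 2 * |f.vx x t| ≤ timeConst p G * d + (1 + G) / p.τ * d :=
      calc p.lam2 / 2 * |f.vx x t| ≤ f.sp x t * |f.vx x t| :=
            mul_le_mul_of_nonneg_right hs (abs_nonneg _)
        _ = |f.vt x t + f.z x t / p.τ| := by
            rw [← e3, abs_mul, sp, abs_of_pos hs0]
        _ ≤ _ := (abs_add_le _ _).trans (add_le_add hvt b2)
    calc |f.vx x t| = 2 / p.lam2 * (p.lam2 / 2 * |f.vx x t|) := by field_simp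
      _ ≤ 2 / p.lam2 * (timeConst p G * d + (1 + G) / p.τ * d) :=
          mul_le_mul_of_nonneg_left b3 (by positivity)
      _ = _ := by unfold spaceConst; ring
  refine ⟨b1, ?_⟩
  have e4 : f.v x t * f.ρx x t = -(f.ρt x t + f.ρ x t * f.vx x t) := by
    linear_combination f.mass x hx t ht
  have b4 : |f.ρ x t * f.vx x t| ≤ G * (spaceConst p G * d) := by
    rw [abs_mul, abs_of_pos hρ0]
    exact mul_le_mul hρG b1 (abs_nonneg _) (by linarith)
  have b5 : G⁻¹ * |f.ρx x t| ≤ timeConst p G * d + G * (spaceConst p G * d) :=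
    calc G⁻¹ * |f.ρx x t| ≤ f.v x t * |f.ρx x t| := mul_le_mul_of_nonneg_right hvi (abs_nonneg _)
      _ = |f.ρt x t + f.ρ x t * f.vx x t| := by
          rw [← abs_neg (f.ρt x t + _), ← e4, abs_mul, abs_of_pos hv0]
      _ ≤ _ := (abs_add_le _ _).trans (add_le_add hρt b4)
  calc |f.ρx x t| = G * (G⁻¹ * |f.ρx x t|) := by field_simp
    _ ≤ G * (timeConst p G * d + G * (spaceConst p G * d)) :=
        mul_le_mul_of_nonneg_left b5 (by linarith)
    _ = _ := by ring

/-- The constant in the decay of the `C¹` deviation. -/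
noncomputable def decayConst (p : ARZModel) (G C : ℝ) : ℝ :=
  C * (1 + spaceConst p G + G * (timeConst p G + G * spaceConst p G))

/-- Values decay by comparison with the constant solution and time derivatives by comparison with
the time shift; the equations convert time derivatives into space derivatives. -/
theorem deviationLE_of_near (hb : p.LocalBounds δ G) (hκδ : κ ≤ δ) (hA : p.Attraction κ ε₁ C σ)
    (hC : 0 < C) (hK : p.BoundedKernels Kw Kv M) (hε : p.GainsClose ε Kw Kv) (hεε : ε ≤ ε₁)
    (hf : f.Near κ) (hd : f.DeviationLE 0 d) (hdδ : d ≤ δ) (ht : t ∈ Ico 0 T) :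
    f.DeviationLE t (decayConst p G C * Real.exp (-σ * t) * d) := by
  intro x hx
  have h0 : (0 : ℝ) ∈ Ico 0 T := ⟨le_rfl, ht.1.trans_lt ht.2⟩
  have hG := hb.one_le
  have hτ := p.τ_pos
  have hl := p.lam2_pos
  have hκ : 0 ≤ κ := (abs_nonneg _).trans (hf x hx t ht).1
  have hd0 : 0 ≤ d := (abs_nonneg _).trans (hd x hx).1
  have hg : (equilibriumFlow p Kw Kv T).Near κ := fun _ _ _ _ => by simp [equilibriumFlow, hκ]
  have k1 : |f.ρ x t - p.ρs| ≤ _ ∧ |f.v x t - p.vs| ≤ _ := hA.sup hK hε hεε hf hg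
    (fun y hy => ⟨(hd y hy).1, (hd y hy).2.1⟩) t ht x hx
  have k2 := abs_time_deriv_le hA hC hK hε hεε hf
    (fun y hy => abs_time_deriv_le_of_deviationLE hb hd hdδ h0 hy) ht hx
  set e := C * Real.exp (-σ * t) with he
  have he0 : 0 < e := mul_pos hC (Real.exp_pos _)
  have e1 : e * (timeConst p G * d) = timeConst p G * (e * d) := by ring
  rw [e1] at k2
  have k3 := abs_space_deriv_le hb ((hf x hx t ht).1.trans hκδ) ((hf x hx t ht).2.1.trans hκδ)
    k1.1 k1.2 k2.1 k2.2 ht hx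
  have e2 : decayConst p G C * Real.exp (-σ * t) * d = e * d + spaceConst p G * (e * d)
      + G * (timeConst p G + G * spaceConst p G) * (e * d) := by
    rw [he]
    unfold decayConst
    ring
  have n0 : 0 ≤ e * d := by positivity
  have t0 : 0 ≤ timeConst p G := by unfold timeConst; positivity
  have s0 : 0 ≤ spaceConst p G := by unfold spaceConst; positivity
  have n1 : 0 ≤ spaceConst p G * (e * d) := by positivity
  have n2 : 0 ≤ G * (timeConst p G + G * spaceConst p G) * (e * d) := by positivity
  rw [e2]
  exact ⟨by linarith [k1.1], by linarith [k1.2], by linarith [k3.2], by linarith [k3.1]⟩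

open Filter Topology in
/-- A solution that starts near enough to the equilibrium stays near it. -/
theorem near_of_deviationLE (hb : p.LocalBounds δ G) (hκδ : κ ≤ δ) (hA : p.Attraction κ ε₁ C σ)
    (hC : 0 < C) (hσ : 0 < σ) (hK : p.BoundedKernels Kw Kv M) (hε : p.GainsClose ε Kw Kv)
    (hεε : ε ≤ ε₁) (hd : f.DeviationLE 0 d) (hdκ : d < κ) (hCd : decayConst p G C * d < κ) :
    f.Near κ := by
  have hL := p.L_pos.le
  have hG := hb.one_le
  have hτ := p.τ_pos
  have hl := p.lam2_pos
  have hd0 : 0 ≤ d := (abs_nonneg _).trans (hd 0 ⟨le_rfl, hL⟩).1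
  have hD : 0 ≤ decayConst p G C := by
    unfold decayConst spaceConst timeConst
    positivity
  let φ : ℝ → ℝ → ℝ := fun x t =>
    max (max |f.ρ x t - p.ρs| |f.v x t - p.vs|) (max |f.ρx x t| |f.vx x t|)
  have hφ : ∀ {x t N}, φ x t ≤ N ↔
      |f.ρ x t - p.ρs| ≤ N ∧ |f.v x t - p.vs| ≤ N ∧ |f.ρx x t| ≤ N ∧ |f.vx x t| ≤ N := by
    intro x t N
    simp only [φ, max_le_iff, and_assoc]
  have hcont : ContinuousOn (Function.uncurry φ) (Icc 0 p.L ×ˢ Ico 0 T) :=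
    (((f.contρ.sub continuousOn_const).abs).sup ((f.contv.sub continuousOn_const).abs)).sup
      (f.contρx.abs.sup f.contvx.abs)
  by_contra hbad
  -- The times at which the solution is not `κ`-near. Up to their infimum `s` it is near, so the
  -- decay estimate is available there.
  let B : Set ℝ := {t | t ∈ Ico 0 T ∧ ∃ x ∈ Icc 0 p.L, κ < φ x t}
  obtain ⟨t₁, ht₁⟩ : B.Nonempty := by
    unfold Near at hbad
    push Not at hbad
    obtain ⟨x, hx, t, ht, h⟩ := hbad
    refine ⟨t, ht, x, hx, ?_⟩
    by_contra! hle
    obtain ⟨h1, h2, h3, h4⟩ := hφ.1 hle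
    exact absurd h4 (not_le.2 (h h1 h2 h3))
  have hbdd : BddBelow B := ⟨0, fun t ht => ht.1.1⟩
  set s := sInf B with hs
  have hs0 : 0 ≤ s := le_csInf ⟨t₁, ht₁⟩ fun t ht => ht.1.1
  have hsT : s ∈ Ico 0 T := ⟨hs0, (csInf_le hbdd ht₁).trans_lt ht₁.1.2⟩
  have hnear : (f.restrict hsT.2.le).Near κ := fun x hx t ht => by
    refine hφ.1 (not_lt.1 fun hlt => ?_)
    exact absurd (csInf_le hbdd (⟨⟨ht.1, ht.2.trans hsT.2⟩, x, hx, hlt⟩ : t ∈ B)) (not_le.2 ht.2)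
  -- At `s = 0` this is the smallness of the data. Otherwise the decay estimate on `[0, s)` passes
  -- to `s` by continuity, and its bound `decayConst * d` is strictly below `κ`.
  have hlt : ∀ x ∈ Icc 0 p.L, φ x s < κ := by
    intro x hx
    rcases hs0.eq_or_lt with h | h
    · rw [← h]
      exact (hφ.2 (hd x hx)).trans_lt hdκ
    · refine lt_of_le_of_lt ?_ hCd
      have hcl : s ∈ closure (Ico 0 s) := by
        rw [closure_Ico h.ne]
        exact ⟨hs0, le_rfl⟩
      have hc : ContinuousWithinAt (φ x) (Ico 0 s) s :=
        (hcont.comp (f := fun t : ℝ => (x, t)) (Continuous.continuousOn (by fun_prop))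
          (fun _ ht => ⟨hx, ht⟩) s hsT).mono (Ico_subset_Ico_right hsT.2.le)
      refine ContinuousWithinAt.closure_le hcl hc continuousWithinAt_const fun t ht => ?_
      have h1 := deviationLE_of_near hb hκδ hA hC hK hε hεε hnear hd (hdκ.le.trans hκδ) ht x hx
      refine (hφ.2 h1).trans (mul_le_mul_of_nonneg_right (mul_le_of_le_one_right hD ?_) hd0)
      exact Real.exp_le_one_iff.2 (by nlinarith [ht.1])
  -- The strict bound persists for a short time after `s`, which contradicts the choice of `s` as
  -- the infimum of the bad times.
  obtain ⟨r, hr, hball⟩ := Metric.eventually_nhds_iff.1 (eventually_forall_Icc_lt hcont hsT hlt)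
  obtain ⟨t, ht, hts⟩ := exists_lt_of_csInf_lt ⟨t₁, ht₁⟩ (by linarith : sInf B < s + r)
  obtain ⟨htT, x, hx, hκx⟩ := ht
  have hst : s ≤ t := csInf_le hbdd ⟨htT, x, hx, hκx⟩
  have hdist : dist t s < r := by
    rw [Real.dist_eq, abs_of_nonneg (sub_nonneg.2 hst)]
    linarith
  exact lt_asymm hκx (hball hdist htT x hx)

end Flow

theorem exists_locallyExponentiallyStable (p : ARZModel) : ∃ ε₁ > 0, ∀ Kw Kv : ℝ → ℝ → ℝ,
    ∀ M ε : ℝ, ε ≤ ε₁ → p.BoundedKernels Kw Kv M → p.GainsClose ε Kw Kv →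
      p.LocallyExponentiallyStable Kw Kv := by
  obtain ⟨δ, hδ, G, hb⟩ := p.exists_localBounds
  obtain ⟨κ, hκ, hκδ, ε₁, hε₁, C, hC, σ, hσ, hA⟩ := exists_attraction hδ hb
  refine ⟨ε₁, hε₁, fun Kw Kv M ε hεε hK hε => ?_⟩
  have hG := hb.one_le
  have hτ := p.τ_pos
  have hl := p.lam2_pos
  set D := Flow.decayConst p G C with hDdef
  have hD : 0 ≤ D := by
    unfold D Flow.decayConst Flow.spaceConst Flow.timeConst
    positivity
  -- For `d` below this threshold both `d < κ` and `D * d < κ` hold; `D + C` serves for the `C¹` and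
  -- for the `L²` estimate.
  refine ⟨κ / (2 * (D + 1)), by positivity, D + C, by positivity, σ, hσ, ?_⟩
  intro T hT ρ v hsol d hd hdev t ht
  obtain ⟨f, rfl, rfl⟩ := hsol.exists_flow
  have h0 : (0 : ℝ) ∈ Ico 0 T := ⟨le_rfl, hT⟩
  have hd0' := (f.c1DeviationLE_iff h0 d).1 hdev
  have hd0 : 0 ≤ d := (abs_nonneg _).trans (hd0' 0 ⟨le_rfl, p.L_pos.le⟩).1
  rw [le_div_iff₀ (by positivity)] at hd
  have hDd : 0 ≤ D * d := mul_nonneg hD hd0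
  have hnear := Flow.near_of_deviationLE hb hκδ hA hC hσ hK hε hεε hd0' (by linarith) (by linarith)
  have hg : (equilibriumFlow p Kw Kv T).Near κ := fun _ _ _ _ => by simp [equilibriumFlow, hκ.le]
  have he : 0 < Real.exp (-σ * t) := Real.exp_pos _
  refine ⟨(f.c1DeviationLE_iff ht _).2 fun x hx => ?_, ?_⟩
  · obtain ⟨h1, h2, h3, h4⟩ := Flow.deviationLE_of_near hb hκδ hA hC hK hε hεε hnear hd0'
      (by linarith) ht x hx
    have hle : D * Real.exp (-σ * t) * d ≤ (D + C) * Real.exp (-σ * t) * d := by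
      gcongr
      linarith
    exact ⟨h1.trans hle, h2.trans hle, h3.trans hle, h4.trans hle⟩
  · have h1 : p.l2DeviationSq (fun x => f.ρ x t) (fun x => f.v x t) ≤ C * Real.exp (-σ * t)
        * p.l2DeviationSq (fun x => f.ρ x 0) (fun x => f.v x 0) := hA.l2 hK hε hεε hnear hg t ht
    have h2 : 0 ≤ p.l2DeviationSq (fun x => f.ρ x 0) (fun x => f.v x 0) :=
      intervalIntegral.integral_nonneg p.L_pos.le fun _ _ => by positivity
    refine h1.trans (mul_le_mul_of_nonneg_right (mul_le_mul_of_nonneg_right ?_ he.le) h2)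
    linarith

end ARZModel

/-! ### From accurate kernels to the theorem -/

namespace ARZModel

variable {p : ARZModel} {Kw Kv Khw Khv : ℝ → ℝ → ℝ} {ε : ℝ}

theorem IsApproxKernel.abs_sub_le {K Kh : ℝ → ℝ → ℝ} (h : p.IsApproxKernel ε K Kh) {x ξ : ℝ}
    (hx : (x, ξ) ∈ p.triangle) : |Kh x ξ - K x ξ| ≤ ε := by
  have h1 := h.close x ξ hx
  have h2 := abs_nonneg (p.dX (fun y η => Kh y η - K y η) x ξ)
  have h3 := abs_nonneg (p.dXi (fun y η => Kh y η - K y η) x ξ)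
  linarith

theorem IsKernelPair.gainsClose (hK : p.IsKernelPair Kw Kv) (hw : p.IsApproxKernel ε Kw Khw)
    (hv : p.IsApproxKernel ε Kv Khv) : p.GainsClose ε Khw Khv := fun ξ hξ => by
  have hx : (p.L, ξ) ∈ p.triangle := ⟨hξ.1, hξ.2, le_rfl⟩
  obtain ⟨e1, e2⟩ := hK.eq_explicit hx
  have h1 := hw.abs_sub_le hx
  have h2 := hv.abs_sub_le hx
  rw [e1] at h1
  rw [e2] at h2
  exact ⟨h1, h2⟩

theorem IsKernelPair.boundedKernels (hK : p.IsKernelPair Kw Kv) (hw : p.IsApproxKernel ε Kw Khw)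
    (hv : p.IsApproxKernel ε Kv Khv) (hε : ε ≤ 1) : p.BoundedKernels Khw Khv (|p.gain| + 1) := by
  have hX := p.boundedKernels_exact
  refine ⟨by positivity, hw.contDiffOn.continuousOn, hv.contDiffOn.continuousOn,
    fun x ξ hx => ?_, fun x ξ hx => ?_⟩
  · have h1 := hX.boundW x ξ hx
    rw [exactW, ← (hK.eq_explicit hx).1] at h1
    have h2 := abs_add_le (Kw x ξ) (Khw x ξ - Kw x ξ)
    rw [add_sub_cancel] at h2
    linarith [hw.abs_sub_le hx]
  · have h1 : |Kv x ξ| = |p.gain| := by rw [(hK.eq_explicit hx).2]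
    have h2 := abs_add_le (Kv x ξ) (Khv x ξ - Kv x ξ)
    rw [add_sub_cancel] at h2
    linarith [hv.abs_sub_le hx]

end ARZModel

theorem mainTheorem1 (p : ARZModel) :
    (∃ Kw Kv : ℝ → ℝ → ℝ, p.IsKernelPair Kw Kv) ∧
    ∀ Kw Kv : ℝ → ℝ → ℝ, p.IsKernelPair Kw Kv →
    ∀ ν : ℝ, 0 < ν → ∀ a : ℝ, p.r ^ 2 < a →
    ∃ m₁ > 0, ∃ m₂ > 0,
      (∃ ε₀ > 0, ∀ ε : ℝ, 0 < ε → ε < ε₀ →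
        0 < p.rate ν a m₁ ε ∧ p.r ^ 2 - a + 2 * a * p.L * ε < 0) ∧
      ∀ ε : ℝ, 0 < ε → 0 < p.rate ν a m₁ ε → p.r ^ 2 - a + 2 * a * p.L * ε < 0 →
      ∀ Khw Khv : ℝ → ℝ → ℝ, p.IsApproxKernel ε Kw Khw → p.IsApproxKernel ε Kv Khv →
        (∀ w v : p.StateL2,
          m₁ * (‖w‖ ^ 2 + ‖v‖ ^ 2) ≤ p.lyapunov ν a Khw Khv w v ∧
          p.lyapunov ν a Khw Khv w v ≤ m₂ * (‖w‖ ^ 2 + ‖v‖ ^ 2)) ∧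
        (∀ w₀ v₀ : p.StateL2,
          (∃ w v : ℝ → p.StateL2, p.IsL2Solution Khw Khv w₀ v₀ w v) ∧
          ∀ w v : ℝ → p.StateL2, p.IsL2Solution Khw Khv w₀ v₀ w v →
            ∀ t : ℝ, 0 ≤ t →
              ‖w t‖ ^ 2 + ‖v t‖ ^ 2
                ≤ Real.exp (-(p.rate ν a m₁ ε) * t) * (m₂ / m₁) * (‖w₀‖ ^ 2 + ‖v₀‖ ^ 2)) ∧
        p.LocallyExponentiallyStable Khw Khv := by
  refine ⟨⟨_, _, p.exists_isKernelPair⟩, fun Kw Kv hK ν hν a ha => ?_⟩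
  have hL := p.L_pos
  have h1 := p.lam1_pos
  have h2 := p.lam2_pos
  have ha0 : 0 < a := (sq_nonneg _).trans_lt ha
  obtain ⟨k, hk, k', hk', hlyap⟩ := p.exists_lyapunov_bounds (M := |p.gain| + 1) hν ha0
  obtain ⟨C, hC, j, hj, hlin⟩ := p.exists_linear_decay hν
  obtain ⟨ε₁, hε₁, hnl⟩ := p.exists_locallyExponentiallyStable
  set B := 2 * a * (1 + p.L) * (2 * p.lam2 + p.lam1) / p.lam2 with hBdef
  have hB : 0 < B := by positivity
  -- The lower constant may be decreased freely, and a smaller `m₁` lowers the claimed rate `ν - (B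
  -- / m₁) ε`. The second bound makes positivity of the rate imply `ε < min 1 ε₁`; the third gives
  -- `j ≤ B / m₁`, which puts the rate below the proved one.
  obtain ⟨m₁, hm₁, hm₁k, hm₁ε, hm₁j⟩ :
      ∃ m₁ > 0, m₁ ≤ k ∧ ν * m₁ ≤ B * min 1 ε₁ ∧ j * m₁ ≤ B := by
    refine ⟨min k (min (B * min 1 ε₁ / ν) (B / j)), by positivity, min_le_left _ _, ?_, ?_⟩
    · rw [mul_comm, ← le_div_iff₀ hν]
      exact (min_le_right _ _).trans (min_le_left _ _)
    · rw [mul_comm, ← le_div_iff₀ hj]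
      exact (min_le_right _ _).trans (min_le_right _ _)
  have hrate : ∀ ε, p.rate ν a m₁ ε = ν - B / m₁ * ε := fun ε => by
    rw [ARZModel.rate, hBdef]
    field_simp
  -- The second entry ensures that `m₂ / m₁` is at least the constant `C` of the proved decay.
  refine ⟨m₁, hm₁, max k' (C * m₁), lt_max_of_lt_left hk', ?_, ?_⟩
  · refine ⟨min (ν * m₁ / B) ((a - p.r ^ 2) / (2 * a * p.L)),
      lt_min (by positivity) (div_pos (sub_pos.2 ha) (by positivity)), fun ε _ hlt => ⟨?_, ?_⟩⟩
    · have h3 := hlt.trans_le (min_le_left _ _)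
      rw [lt_div_iff₀ hB] at h3
      rw [hrate, sub_pos, div_mul_eq_mul_div, div_lt_iff₀ hm₁]
      linarith
    · have h3 := hlt.trans_le (min_le_right _ _)
      rw [lt_div_iff₀ (by positivity)] at h3
      linarith
  intro ε hε hpos _ Khw Khv hKw hKv
  have hεm : ε < min 1 ε₁ := by
    rw [hrate, sub_pos, div_mul_eq_mul_div, div_lt_iff₀ hm₁] at hpos
    exact lt_of_mul_lt_mul_left (hpos.trans_le hm₁ε) hB.le
  have hε1 : ε ≤ 1 := hεm.le.trans (min_le_left _ _)
  have hBK := hK.boundedKernels hKw hKv hε1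
  have hGC := hK.gainsClose hKw hKv
  refine ⟨fun w v => ?_, fun w₀ v₀ => ⟨ARZModel.exists_isL2Solution hBK w₀ v₀, ?_⟩,
    hnl Khw Khv _ ε (hεm.le.trans (min_le_right _ _)) hBK hGC⟩
  · obtain ⟨b1, b2⟩ := hlyap Khw Khv hBK w v
    have hn : 0 ≤ ‖w‖ ^ 2 + ‖v‖ ^ 2 := by positivity
    exact ⟨(mul_le_mul_of_nonneg_right hm₁k hn).trans b1,
      b2.trans (mul_le_mul_of_nonneg_right (le_max_left _ _) hn)⟩
  · intro w v hs t ht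
    refine (hlin ε _ Khw Khv hBK hGC w₀ v₀ w v hs t ht).trans ?_
    rw [← mul_assoc]
    refine mul_le_mul_of_nonneg_right ?_ (by positivity)
    rw [mul_comm]
    refine mul_le_mul (Real.exp_le_exp.2 (mul_le_mul_of_nonneg_right ?_ ht)) ?_ hC.le
      (Real.exp_pos _).le
    -- The proved loss `j ε²` is at most the allowed loss `(B / m₁) ε`, since `ε ≤ 1`.
    · rw [hrate, neg_le_neg_iff]
      refine sub_le_sub_left ?_ ν
      have h3 : ε ^ 2 ≤ ε := by
        rw [sq]
        exact mul_le_of_le_one_left hε.le hε1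
      exact mul_le_mul ((le_div_iff₀ hm₁).2 hm₁j) h3 (sq_nonneg _) (by positivity)
    · rw [le_div_iff₀ hm₁]
      exact le_max_right _ _
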